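/- **Setting.** Let $(X,\tau)$ be a Polish space with a $\sigma$-finite Borel measure $m$ of full support. Write $L^p=L^p(X,m)$, $p'$ for the conjugate exponent, $\|f\|_{L^p\cap L^q}=\max\{\|f\|_p,\|f\|_q\}$ and $\|f\|_{L^p+L^q}=\inf\{\|g\|_p+\|h\|_q: f=g+h\}$. Let $\mathcal E$ be a densely defined, symmetric, strongly local Dirichlet form on $L^2$ with domain $\mathbb V$, normed by $\|f\|_{\mathbb V}^2=\|f\|_2^2+\mathcal E(f)$, which has a carré du champ, i.e. a positive, symmetric, continuous bilinear map $\Gamma:\mathbb V\times\mathbb V\to L^1$ with $\int\varphi\,\Gamma(f,f)\,dm=\mathcal E(f,f\varphi)-\tfrac12\mathcal E(f^2,\varphi)$ for $f,\varphi\in\mathbb V\cap L^\infty$ (so that $\mathcal E(f)=\int\Gamma(f)\,dm$, where $\Gamma(f)=\Gamma(f,f)$). Let $\Delta$ be its Laplacian, $\mathcal E(f,g)=-\int g\,\Delta f\,dm$ for all $g\in\mathbb V$, and $(\mathsf P_t)$ its heat semigroup on $L^2$. Put $\mathbb V_p=\{f\in\mathbb V\cap L^p:\ \sqrt{\Gamma(f)}\in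 L^p\}$ with norm $\|f\|_{\mathbb V}+\|f\|_p+\|\sqrt{\Gamma(f)}\|_p$. Let $\mathscr A\subset\mathbb V$ be an algebra contained in $L^p$ for all $p\in[1,\infty]$, stable under $(f_1,\dots,f_n)\mapsto\Phi(f_1,\dots,f_n)$ for all $n$ and all $\Phi\in C^1(\mathbb R^n)$ with $\Phi(0)=0$, and contained and dense in $\mathbb V_p$ for all $p\in[1,2]$. For $p\in(1,\infty)$ the $L^p$-$\Gamma$ inequality with constant $c_p>0$ is: $\|\sqrt{\Gamma(\mathsf P_tf)}\|_p\le c_p t^{-1/2}\|f\|_p$ for all $f\in L^2\cap L^p$, $t\in(0,1)$. A constant $c_p^\Delta>0$ is called admissible if $\|\Delta\mathsf P_tf\|_p\le c^\Delta_p t^{-1}\|f\|_p$ for all $f\in L^2\cap L^p$, $t\in(0,1)$. A derivation is a linear map $b:\mathscr A\to L^0$, $f\mapsto df(b)$, with $d(fg)(b)=f\,dg(b)+g\,df(b)$ and $|df(b)|\le g\sqrt{\Gamma(f)}$ $m$-a.e. for some $g\in L^0$ independent of $f$; it is in $L^q+L^\infty$ if $g$ can be chosen in $L^q+L^\infty$.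 Its divergence is in $L^q+L^\infty$ if there is $\operatorname{div}b\in L^q+L^\infty$ with $\int df(b)\,dm=-\int f\operatorname{div}b\,dm$ for all $f\in\mathscr A$. Let $r,s\in(1,\infty)$ and $q\in(1,\infty]$ with $q^{-1}+r^{-1}+s^{-1}=1$. If $b$ is in $L^q+L^\infty$ and $\mathscr A$ is contained and dense in $\mathbb V_r$ and $\mathbb V_s$, then $f\mapsto df(b)$ extends uniquely to continuous operators $\mathbb V_r\to L^{s'}+L^2$ and $\mathbb V_s\to L^{r'}+L^2$. The deformation of $b$ is of type $(r,s)$ if there is $c\ge0$ such that $$\Bigl|-\tfrac12\int\bigl[df(b)\,\Delta g+dg(b)\,\Delta f-(\operatorname{div}b)\,\Gamma(f,g)\bigr]dm\Bigr|\le c\,\|\sqrt{\Gamma(f)}\|_r\|\sqrt{\Gamma(g)}\|_s$$ for all $f\in\mathbb V_r$ with $\Delta f\in L^r\cap L^2$ and all $g\in\mathbb V_s$ with $\Delta g\in L^s\cap L^2$; the smallest such $c$ is denoted $\|D^{sym}b\|_{r,s}$. For $u\in L^r\cap L^2$ and $\alpha\in(0,1)$, the commutator $\mathscr C^\alpha(u,b)=\operatorname{div}((\mathsf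 P_\alpha u)b)-\mathsf P_\alpha(\operatorname{div}(ub))$ is the linear functional on $\mathscr A$ $$\mathscr A\ni f\mapsto-\int(\mathsf P_\alpha u)\,df(b)\,dm+\int u\,d(\mathsf P_\alpha f)(b)\,dm .$$ **Lemma (Commutator estimate).** There is a function $C:\mathbb R^4\to\mathbb R$ (not depending on any of the data) such that the following holds in every such setting. Let $r,s\in(1,\infty)$, $q\in(1,\infty]$ with $q^{-1}+r^{-1}+s^{-1}=1$. Assume that, for $p\in\{r,s\}$, $\mathscr A$ is contained and dense in $\mathbb V_p$ and the $L^p$-$\Gamma$ inequality holds with some constant. Let $b$ be a derivation in $L^q+L^\infty$ with $\operatorname{div}b\in L^q+L^\infty$ whose deformation is of type $(r,s)$. Then admissible constants $c_r^\Delta$ and $c_s^\Delta$ exist. For every $u\in L^r\cap L^2$ and $\alpha\in(0,1)$ the commutator $\mathscr C^\alpha(u,b)$ is induced by a function in $L^{s'}+L^2$, and $$\|\mathscr C^\alpha(u,b)\|_{L^{s'}+L^2}\le C(c_r,c_s,c_r^\Delta,c_s^\Delta)\,\|u\|_{L^r\cap L^2}\bigl(\|D^{sym}b\|_{r,s}+\|\operatorname{div}b\|_{L^q+L^\infty}\bigr)$$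 whenever $c_r,c_s$ are constants for which the $L^r$-$\Gamma$ and $L^s$-$\Gamma$ inequalities hold and $c_r^\Delta,c_s^\Delta$ are admissible. Moreover, for every $u\in L^r\cap L^2$, $\mathscr C^\alpha(u,b)\to0$ in $L^{s'}+L^2$ as $\alpha\downarrow0$. -/

import Mathlib

open MeasureTheory Filter Topology Set
open scoped ENNReal

noncomputable section

namespace DirichletCalculus

/-! ### Sums and intersections of Lebesgue spaces -/

/-- `f ∈ L^p + L^q`. -/
def MemSum {X : Type*} [MeasurableSpace X] (f : X → ℝ) (p q : ℝ≥0∞) (m : Measure X) : Prop :=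
  ∃ g h : X → ℝ, MemLp g p m ∧ MemLp h q m ∧ f =ᵐ[m] g + h

/-- The norm of `L^p + L^q`: the infimum of `‖g‖_p + ‖h‖_q` over all decompositions `f = g + h`
(it is infinite exactly when there is no decomposition with `g ∈ L^p`, `h ∈ L^q`). -/
def sumNorm {X : Type*} [MeasurableSpace X] (f : X → ℝ) (p q : ℝ≥0∞) (m : Measure X) : ℝ≥0∞ :=
  ⨅ (g : X → ℝ) (h : X → ℝ) (_ : AEStronglyMeasurable g m) (_ : AEStronglyMeasurable h m)
    (_ : f =ᵐ[m] g + h), eLpNorm g p m + eLpNorm h q m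

/-- The norm of `L^p ∩ L^q`. -/
def interNorm {X : Type*} [MeasurableSpace X] (f : X → ℝ) (p q : ℝ≥0∞) (m : Measure X) : ℝ≥0∞ :=
  max (eLpNorm f p m) (eLpNorm f q m)

/-! ### Dirichlet forms, carré du champ, Laplacian, heat semigroup -/

/-- A densely defined, strongly local, symmetric Dirichlet form on `L²(X, m)`, with domain
`dom` (the space `𝕍`) and associated bilinear form `form`. -/
structure DirichletForm {X : Type*} [MeasurableSpace X] (m : Measure X) where
  dom : Submodule ℝ (Lp ℝ 2 m)
  form : dom →ₗ[ℝ] dom →ₗ[ℝ] ℝ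
  dense_dom : Dense (dom : Set (Lp ℝ 2 m))
  symm : ∀ f g : dom, form f g = form g f
  nonneg : ∀ f : dom, 0 ≤ form f f
  /-- lower semicontinuity on `L²` of the quadratic form, which is `+∞` outside its domain -/
  lsc : by
    classical
    exact LowerSemicontinuous (fun f : Lp ℝ 2 m =>
      if h : f ∈ dom then ENNReal.ofReal (form ⟨f, h⟩ ⟨f, h⟩) else ⊤)
  /-- Markov property, for every normal contraction `η` -/
  markov : ∀ η : ℝ → ℝ, LipschitzWith 1 η → η 0 = 0 → ∀ f : dom, ∃ g : dom,
    (∀ᵐ x ∂m, (g : Lp ℝ 2 m) x = η ((f : Lp ℝ 2 m) x)) ∧ form g g ≤ form f f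
  strongly_local : ∀ (f g : dom) (a : ℝ),
    (∀ᵐ x ∂m, ((f : Lp ℝ 2 m) x + a) * (g : Lp ℝ 2 m) x = 0) → form f g = 0

variable {X : Type*} [MeasurableSpace X] {m : Measure X}

/-- The norm of `𝕍`: `‖f‖² = ‖f‖_2² + ℰ(f)`. -/
def DirichletForm.normV (E : DirichletForm m) (f : E.dom) : ℝ :=
  √(‖(f : Lp ℝ 2 m)‖ ^ 2 + E.form f f)

/-- `f ∈ D(Δ)` and `Δ f = h`: `f ∈ 𝕍` and `ℰ(f, g) = -∫ g h dm` for all `g ∈ 𝕍`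
(`h` is unique because `𝕍` is dense in `L²`). -/
def DirichletForm.IsLaplacian (E : DirichletForm m) (f h : Lp ℝ 2 m) : Prop :=
  ∃ hf : f ∈ E.dom, ∀ g : E.dom, E.form ⟨f, hf⟩ g = -∫ x, (g : Lp ℝ 2 m) x * h x ∂m

/-- The carré du champ of `ℰ`: the positive, symmetric, continuous bilinear map
`Γ : 𝕍 × 𝕍 → L¹` such that `∫ φ Γ(f,f) dm = ℰ(f, f φ) - ½ ℰ(f², φ)` for `f, φ ∈ 𝕍 ∩ L^∞`
(products of functions in `𝕍 ∩ L^∞` are in `𝕍`). -/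
structure CarreDuChamp (E : DirichletForm m) where
  Γ : E.dom →ₗ[ℝ] E.dom →ₗ[ℝ] Lp ℝ 1 m
  symm : ∀ f g : E.dom, Γ f g = Γ g f
  nonneg : ∀ f : E.dom, ∀ᵐ x ∂m, 0 ≤ Γ f f x
  continuous : ∃ K : ℝ, ∀ f g : E.dom, ‖Γ f g‖ ≤ K * E.normV f * E.normV g
  represents : ∀ f φ fφ ff : E.dom,
    MemLp (f : Lp ℝ 2 m) ⊤ m → MemLp (φ : Lp ℝ 2 m) ⊤ m →
    (∀ᵐ x ∂m, (fφ : Lp ℝ 2 m) x = (f : Lp ℝ 2 m) x * (φ : Lp ℝ 2 m) x) →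
    (∀ᵐ x ∂m, (ff : Lp ℝ 2 m) x = (f : Lp ℝ 2 m) x * (f : Lp ℝ 2 m) x) →
    ∫ x, (φ : Lp ℝ 2 m) x * Γ f f x ∂m = E.form f fφ - 1 / 2 * E.form ff φ

/-- The heat semigroup generated by `ℰ`: for every `f ∈ L²`, the curve `t ↦ P_t f` is the
(unique) solution of class `C¹((0,∞); L²)`, with values in `D(Δ)`, of `d/dt f_t = Δ f_t` with
`f_t → f` in `L²` as `t ↓ 0`. -/
structure HeatSemigroup (E : DirichletForm m) where
  P : ℝ → Lp ℝ 2 m →L[ℝ] Lp ℝ 2 m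
  contDiffOn : ∀ f : Lp ℝ 2 m, ContDiffOn ℝ 1 (fun t => P t f) (Ioi 0)
  heat_equation : ∀ (f : Lp ℝ 2 m) (t : ℝ), 0 < t →
    ∃ h : Lp ℝ 2 m, E.IsLaplacian (P t f) h ∧ HasDerivAt (fun t => P t f) h t
  tendsto_zero : ∀ f : Lp ℝ 2 m, Tendsto (fun t => P t f) (𝓝[>] 0) (𝓝 f)

variable {E : DirichletForm m}

/-- `√Γ(f)`. -/
def CarreDuChamp.sqrtΓ (G : CarreDuChamp E) (f : E.dom) : X → ℝ := fun x => √(G.Γ f f x)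

/-- The norm of `𝕍_p`: `‖f‖_𝕍 + ‖f‖_p + ‖√Γ(f)‖_p`, finite exactly on `𝕍_p`. -/
def CarreDuChamp.normVp (G : CarreDuChamp E) (p : ℝ≥0∞) (f : E.dom) : ℝ≥0∞ :=
  ENNReal.ofReal (E.normV f) + eLpNorm (f : Lp ℝ 2 m) p m + eLpNorm (G.sqrtΓ f) p m

/-- `f ∈ 𝕍_p`. -/
def CarreDuChamp.MemVp (G : CarreDuChamp E) (p : ℝ≥0∞) (f : E.dom) : Prop :=
  MemLp (f : Lp ℝ 2 m) p m ∧ MemLp (G.sqrtΓ f) p m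

/-- `S ⊆ 𝕍_p` and `S` is dense in `𝕍_p`. -/
def CarreDuChamp.DenseInVp (G : CarreDuChamp E) (p : ℝ≥0∞) (S : Set E.dom) : Prop :=
  (∀ f ∈ S, G.MemVp p f) ∧
    ∀ f : E.dom, G.MemVp p f → ∀ ε : ℝ≥0∞, 0 < ε → ∃ a ∈ S, G.normVp p (f - a) < ε

/-- The `L^p`-`Γ` inequality with constant `c`. -/
def GammaInequality (G : CarreDuChamp E) (H : HeatSemigroup E) (p : ℝ≥0∞) (c : ℝ) : Prop :=
  0 < c ∧ ∀ f : Lp ℝ 2 m, MemLp f p m → ∀ t ∈ Ioo (0 : ℝ) 1,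
    ∃ hf : H.P t f ∈ E.dom,
      eLpNorm (G.sqrtΓ ⟨H.P t f, hf⟩) p m ≤ ENNReal.ofReal (c / √t) * eLpNorm f p m

/-- The inequality `‖Δ P_t f‖_p ≤ (c / t) ‖f‖_p` for `f ∈ L^p ∩ L²` and `t ∈ (0,1)`. -/
def DeltaInequality (H : HeatSemigroup E) (p : ℝ≥0∞) (c : ℝ) : Prop :=
  0 < c ∧ ∀ f : Lp ℝ 2 m, MemLp f p m → ∀ t ∈ Ioo (0 : ℝ) 1,
    ∃ h : Lp ℝ 2 m, E.IsLaplacian (H.P t f) h ∧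
      eLpNorm h p m ≤ ENNReal.ofReal (c / t) * eLpNorm f p m

/-! ### The algebra of test functions and derivations -/

/-- The prescribed algebra `𝒜 ⊆ 𝕍` of test functions: contained in every `L^p`, stable under
composition with `C¹` functions vanishing at the origin (in particular under products), and
contained and dense in `𝕍_p` for every `p ∈ [1,2]` (for `p = 2` this is density in `𝕍`). -/
structure TestAlgebra (G : CarreDuChamp E) where
  carrier : Submodule ℝ E.dom
  memLp : ∀ f ∈ carrier, ∀ p : ℝ≥0∞, 1 ≤ p → MemLp (f : Lp ℝ 2 m) p m
  comp_mem : ∀ (n : ℕ) (Φ : (Fin n → ℝ) → ℝ), ContDiff ℝ 1 Φ → Φ 0 = 0 →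
    ∀ f : Fin n → carrier, ∃ g : carrier,
      ∀ᵐ x ∂m, ((g : E.dom) : Lp ℝ 2 m) x = Φ (fun i => ((f i : E.dom) : Lp ℝ 2 m) x)
  dense : ∀ p : ℝ≥0∞, 1 ≤ p → p ≤ 2 → G.DenseInVp p carrier

variable {G : CarreDuChamp E}

/-- A derivation `b : 𝒜 → L⁰`, `f ↦ df(b)`. -/
structure TestDerivation (A : TestAlgebra G) where
  d : A.carrier →ₗ[ℝ] (X →ₘ[m] ℝ)
  leibniz : ∀ f g fg : A.carrier,
    (∀ᵐ x ∂m, ((fg : E.dom) : Lp ℝ 2 m) x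
      = ((f : E.dom) : Lp ℝ 2 m) x * ((g : E.dom) : Lp ℝ 2 m) x) →
    ∀ᵐ x ∂m, d fg x = ((f : E.dom) : Lp ℝ 2 m) x * d g x + ((g : E.dom) : Lp ℝ 2 m) x * d f x
  bound : ∃ g : X →ₘ[m] ℝ, ∀ f : A.carrier, ∀ᵐ x ∂m, |d f x| ≤ g x * G.sqrtΓ f x

variable {A : TestAlgebra G}

namespace TestDerivation

/-- `b` is a derivation in `L^p + L^q`: some function `g ∈ L^p + L^q` satisfies
`|df(b)| ≤ g √Γ(f)` for all `f`; as `L^p + L^q` is solid, this says that the smallest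
nonnegative such function `|b|` is in `L^p + L^q`. -/
def InSum (b : TestDerivation A) (p q : ℝ≥0∞) : Prop :=
  ∃ g : X →ₘ[m] ℝ, MemSum g p q m ∧
    ∀ f : A.carrier, ∀ᵐ x ∂m, |b.d f x| ≤ g x * G.sqrtΓ f x

/-- The distributional divergence of `b` is induced by the function `D`. -/
def HasDivergence (b : TestDerivation A) (D : X →ₘ[m] ℝ) : Prop :=
  ∀ f : A.carrier, ∫ x, b.d f x ∂m = -∫ x, ((f : E.dom) : Lp ℝ 2 m) x * D x ∂m

/-- `w = df(b)` for the continuous extension of `b` from `𝒜` to `𝕍_p`, with values in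
`L^t + L²`: `w` is the limit of `da_n(b)` in `L^t + L²`, where `a_n ∈ 𝒜`, `a_n → f` in `𝕍_p`. -/
def IsExtension (b : TestDerivation A) (p t : ℝ≥0∞) (f : E.dom) (w : X →ₘ[m] ℝ) : Prop :=
  ∃ a : ℕ → A.carrier,
    Tendsto (fun n => G.normVp p (f - a n)) atTop (𝓝 0) ∧
    Tendsto (fun n => sumNorm (fun x => w x - b.d (a n) x) t 2 m) atTop (𝓝 0)

open Classical in
/-- `df(b)` for `f ∈ 𝕍_p`, where `b` is extended to a continuous operator `𝕍_p → L^t + L²`. -/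
def ext (b : TestDerivation A) (p t : ℝ≥0∞) (f : E.dom) : X →ₘ[m] ℝ :=
  if h : ∃ w, b.IsExtension p t f w then h.choose else 0

/-- `∫ D^sym b(f,g) dm`, for `f ∈ 𝕍_r`, `g ∈ 𝕍_s`, `Δ f = Lf`, `Δ g = Lg`, `div b = D`. -/
def symDeformation (b : TestDerivation A) (D : X →ₘ[m] ℝ) (r s : ℝ≥0∞)
    (f g : E.dom) (Lf Lg : Lp ℝ 2 m) : ℝ :=
  -(1 / 2) * ∫ x, (b.ext r s.conjExponent f x * Lg x + b.ext s r.conjExponent g x * Lf x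
    - D x * G.Γ f g x) ∂m

/-- The set of constants `c ≥ 0` such that `|∫ D^sym b(f,g) dm| ≤ c ‖√Γ(f)‖_r ‖√Γ(g)‖_s` for all
`f ∈ 𝕍_r` with `Δ f ∈ L^r ∩ L²` and all `g ∈ 𝕍_s` with `Δ g ∈ L^s ∩ L²`. -/
def deformationBounds (b : TestDerivation A) (D : X →ₘ[m] ℝ) (r s : ℝ≥0∞) : Set ℝ :=
  {c | 0 ≤ c ∧ ∀ (f g : E.dom) (Lf Lg : Lp ℝ 2 m),
    G.MemVp r f → E.IsLaplacian f Lf → MemLp Lf r m →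
    G.MemVp s g → E.IsLaplacian g Lg → MemLp Lg s m →
    |b.symDeformation D r s f g Lf Lg|
      ≤ c * (eLpNorm (G.sqrtΓ f) r m).toReal * (eLpNorm (G.sqrtΓ g) s m).toReal}

/-- The deformation of `b` is of type `(r,s)`. -/
def HasDeformation (b : TestDerivation A) (D : X →ₘ[m] ℝ) (r s : ℝ≥0∞) : Prop :=
  (b.deformationBounds D r s).Nonempty

/-- `‖D^sym b‖_{r,s}`, the smallest admissible constant. -/
def deformationNorm (b : TestDerivation A) (D : X →ₘ[m] ℝ) (r s : ℝ≥0∞) : ℝ :=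
  sInf (b.deformationBounds D r s)

/-- The distribution `div(v b)` on `𝒜`: `f ↦ -∫ v df(b) dm`. -/
def divMul (b : TestDerivation A) (v : Lp ℝ 2 m) (f : A.carrier) : ℝ :=
  -∫ x, v x * b.d f x ∂m

/-- The distribution `div(v b)` tested on `f ∈ 𝕍_p`, through the extension of `b`. -/
def divMulExt (b : TestDerivation A) (p t : ℝ≥0∞) (v : Lp ℝ 2 m) (f : E.dom) : ℝ :=
  -∫ x, v x * b.ext p t f x ∂m

open Classical in
/-- The distribution `P_α (div(u b))` on `𝒜`, given by duality through the symmetry of `P_α`: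
`f ↦ ⟨div(u b), P_α f⟩`; here `P_α f ∈ 𝕍_p`. -/
def semigroupDivMul (b : TestDerivation A) (H : HeatSemigroup E) (p t : ℝ≥0∞) (α : ℝ)
    (u : Lp ℝ 2 m) (f : A.carrier) : ℝ :=
  if h : H.P α ((f : E.dom) : Lp ℝ 2 m) ∈ E.dom then b.divMulExt p t u ⟨_, h⟩ else 0

/-- The commutator `C^α(u,b) = div((P_α u) b) - P_α (div(u b))`, as a distribution on `𝒜`, for
`u ∈ L^r ∩ L²`; the extension of `b` used in the second term is `𝕍_s → L^{r'} + L²`. -/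
def commutator (b : TestDerivation A) (H : HeatSemigroup E) (r s : ℝ≥0∞) (α : ℝ)
    (u : Lp ℝ 2 m) (f : A.carrier) : ℝ :=
  b.divMul (H.P α u) f - b.semigroupDivMul H s r.conjExponent α u f

end TestDerivation

end DirichletCalculus

end

/-! The estimate comes from interpolating between the two terms of the commutator along the heat
flow. For a test function `f` put Φ(t) = ∫ P_t u d(P_{α-t} f)(b) dm, so that the commutator tested
on `f` is Φ(0) - Φ(α). Differentiating produces ∫ ΔP_t u d(P_{α-t} f)(b) - ∫ P_t u d(ΔP_{α-t} f)(b).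
The Leibniz rule combined with the divergence, `leibnizDefect_eq_zero`, moves the derivation off
ΔP_{α-t} f, and what remains (`interpolation_deriv_eq`) is -2 times the deformation paired with P_t
u and P_{α-t} f, plus ∫ div b Γ(P_t u, P_{α-t} f), plus ∫ div b P_t u ΔP_{α-t} f.

By the Γ inequalities the first two terms are of order 1/(√t √(α-t)), whose integral over (0, α)
does not depend on α. The last is of order 1/(α-t) and not integrable at t = α. The interpolation is
therefore used on (0, α/2] only. On the other half the roles of (u, r) and (f, s) are exchanged:
with Ψ(t) = ∫ P_t f d(P_{α-t} u)(b) dm the Leibniz rule says that Φ(t) + Ψ(α-t) is an integral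
against div b, so the commutator equals (Φ(0) - Φ(α/2)) + (Ψ(0) - Ψ(α/2)) up to two harmless
divergence terms. Adding the bounds gives `abs_commutator_le`, an estimate by the L^s ∩ L² norm of
`f`. Hahn–Banach and the Riesz theorem for L^p, combined in `exists_representative`, turn this
functional into a function in L^{s'} + L².

Convergence to zero is a density argument. The uniform estimate allows `u` to be replaced by v = P_δ
u at a small cost. For such v, the commutator is, up to terms controlled by P_α u - u, the
functional g ↦ ∫ g dv(b) + ∫ g v div b evaluated at f - P_α f. That functional is close to an L²
pairing with some ψ, and ⟨f - P_α f, ψ⟩ = ⟨f, ψ - P_α ψ⟩ tends to zero uniformly for bounded `f`.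
This is `eventually_abs_commutator_P_le`.

All facts on the heat semigroup are derived from its definition by the heat equation: the semigroup
law, symmetry, energy decay, and the sub-Markov property. The admissible constants for Δ
(`exists_eLpNorm_lap_le`) express analyticity on L^p and come from Stein interpolation. For a
symmetric sub-Markovian contraction S the operators exp(-z(1 - S)) are contractions on L² for Re z ≥
0 and sub-Markovian for z ≥ 0. The three lines theorem interpolates these to L^p contractions on a
sector (`norm_pairing_le_of_arg`), and Cauchy's estimate bounds the derivative with a constant
independent of S. Applied to S = P_ε at time t/ε, the bounds survive the limit ε ↓ 0.

The L² parts of the sum spaces need a Γ inequality in L² as well. It rests on ∫ Γ(f) ≤ ℰ(f), proved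
in `integral_Γ_le` from the representation formula with weights increasing to 1 in the limit sense.
-/

noncomputable section

namespace DirichletCalculus

/-! ### The heat semigroup on L²: uniqueness, semigroup law, symmetry, energy bounds. -/

section

variable {X : Type*} [MeasurableSpace X] {m : Measure X} {E : DirichletForm m}

theorem integral_mul_eq_inner (f g : Lp ℝ 2 m) : ∫ x, f x * g x ∂m = inner ℝ f g := by
  rw [L2.inner_def]
  refine integral_congr_ae (.of_forall fun x => ?_)
  simp [mul_comm]

theorem DirichletForm.IsLaplacian.unique {f h h' : Lp ℝ 2 m} (H1 : E.IsLaplacian f h)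
    (H2 : E.IsLaplacian f h') : h = h' := by
  obtain ⟨hf, e1⟩ := H1
  obtain ⟨hf', e2⟩ := H2
  have : ∀ g ∈ (E.dom : Set (Lp ℝ 2 m)), inner ℝ g (h - h') = 0 := by
    intro g hg
    have := (e1 ⟨g, hg⟩).symm.trans (e2 ⟨g, hg⟩)
    simp only [integral_mul_eq_inner] at this
    rw [inner_sub_right]; linarith
  exact sub_eq_zero.1 (E.dense_dom.eq_zero_of_inner_right (𝕜 := ℝ) (fun g hg => this g hg))

theorem DirichletForm.IsLaplacian.form_eq {f h : Lp ℝ 2 m} (H : E.IsLaplacian f h)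
    (hf : f ∈ E.dom) (g : E.dom) : E.form ⟨f, hf⟩ g = -inner ℝ (g : Lp ℝ 2 m) h := by
  obtain ⟨_, e⟩ := H
  rw [e g, integral_mul_eq_inner]

theorem DirichletForm.IsLaplacian.inner_comm {f h g k : Lp ℝ 2 m} (H1 : E.IsLaplacian f h)
    (H2 : E.IsLaplacian g k) : inner ℝ h g = inner ℝ f k := by
  have a := H1.form_eq H1.1 ⟨g, H2.1⟩
  have b := H2.form_eq H2.1 ⟨f, H1.1⟩
  rw [E.symm] at b
  simp only at a b
  rw [real_inner_comm]
  linarith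

theorem DirichletForm.IsLaplacian.inner_nonpos {f h : Lp ℝ 2 m} (H1 : E.IsLaplacian f h) :
    inner ℝ f h ≤ 0 := by
  have a := H1.form_eq H1.1 ⟨f, H1.1⟩
  have := E.nonneg ⟨f, H1.1⟩
  simp only at a
  linarith

theorem DirichletForm.IsLaplacian.sub {f h g k : Lp ℝ 2 m} (H1 : E.IsLaplacian f h)
    (H2 : E.IsLaplacian g k) : E.IsLaplacian (f - g) (h - k) := by
  refine ⟨E.dom.sub_mem H1.1 H2.1, fun φ => ?_⟩
  have a := H1.form_eq H1.1 φ
  have b := H2.form_eq H2.1 φ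
  rw [integral_mul_eq_inner, inner_sub_right]
  have : (⟨f - g, E.dom.sub_mem H1.1 H2.1⟩ : E.dom) = ⟨f, H1.1⟩ - ⟨g, H2.1⟩ := rfl
  rw [this, map_sub, LinearMap.sub_apply, a, b]; ring

/-- Uniqueness for the heat equation. -/
theorem norm_le_of_heat_equation {u v : ℝ → Lp ℝ 2 m} {f : Lp ℝ 2 m}
    (h : ∀ t, 0 < t → E.IsLaplacian (u t) (v t) ∧ HasDerivAt u (v t) t)
    (h0 : Tendsto u (𝓝[>] 0) (𝓝 f)) {t : ℝ} (ht : 0 < t) : ‖u t‖ ≤ ‖f‖ := by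
  have hd : ∀ t, 0 < t → HasDerivAt (fun t => ‖u t‖ ^ 2) (2 * inner ℝ (u t) (v t)) t :=
    fun t ht => (h t ht).2.norm_sq
  have anti : AntitoneOn (fun t => ‖u t‖ ^ 2) (Ioi 0) := by
    apply antitoneOn_of_deriv_nonpos (convex_Ioi 0)
    · exact fun t ht => (hd t ht).continuousAt.continuousWithinAt
    · rw [interior_Ioi]
      exact fun t ht => (hd t ht).differentiableAt.differentiableWithinAt
    · rw [interior_Ioi]
      intro t ht
      rw [(hd t ht).deriv]
      have := (h t ht).1.inner_nonpos
      linarith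
  have lim : Tendsto (fun t => ‖u t‖ ^ 2) (𝓝[>] 0) (𝓝 (‖f‖ ^ 2)) := (h0.norm).pow 2
  have : ‖u t‖ ^ 2 ≤ ‖f‖ ^ 2 := by
    refine ge_of_tendsto lim ?_
    filter_upwards [Ioo_mem_nhdsGT ht] with s hs
    exact anti hs.1 ht hs.2.le
  exact (sq_le_sq₀ (norm_nonneg _) (norm_nonneg _)).1 this

/-- The difference of two solutions solves the heat equation with initial value zero, and the L²
norm of a solution never exceeds that of its initial value. -/
theorem eq_of_heat_equation {u v u' v' : ℝ → Lp ℝ 2 m} {f : Lp ℝ 2 m}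
    (h : ∀ t, 0 < t → E.IsLaplacian (u t) (v t) ∧ HasDerivAt u (v t) t)
    (h' : ∀ t, 0 < t → E.IsLaplacian (u' t) (v' t) ∧ HasDerivAt u' (v' t) t)
    (h0 : Tendsto u (𝓝[>] 0) (𝓝 f)) (h0' : Tendsto u' (𝓝[>] 0) (𝓝 f)) {t : ℝ} (ht : 0 < t) :
    u t = u' t := by
  have := norm_le_of_heat_equation (E := E) (u := u - u') (v := v - v') (f := f - f)
    (fun t ht => ⟨(h t ht).1.sub (h' t ht).1, (h t ht).2.sub (h' t ht).2⟩) (h0.sub h0') ht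
  rw [sub_self, norm_zero] at this
  exact sub_eq_zero.1 (norm_le_zero_iff.1 this)

namespace HeatSemigroup

variable (H : HeatSemigroup E)

/-- `Δ P_t f`. -/
def lap (t : ℝ) (f : Lp ℝ 2 m) : Lp ℝ 2 m := deriv (fun t => H.P t f) t

variable {t s : ℝ} (f g : Lp ℝ 2 m)

theorem isLaplacian (ht : 0 < t) : E.IsLaplacian (H.P t f) (H.lap t f) := by
  obtain ⟨h, h1, h2⟩ := H.heat_equation f t ht
  rwa [lap, h2.deriv]

theorem hasDerivAt (ht : 0 < t) : HasDerivAt (fun t => H.P t f) (H.lap t f) t := by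
  obtain ⟨h, h1, h2⟩ := H.heat_equation f t ht
  rwa [lap, h2.deriv]

theorem mem_dom (ht : 0 < t) : H.P t f ∈ E.dom := (H.isLaplacian f ht).1

theorem norm_P_le (ht : 0 < t) : ‖H.P t f‖ ≤ ‖f‖ :=
  norm_le_of_heat_equation (E := E) (u := fun t => H.P t f) (v := fun t => H.lap t f)
    (fun _ ht => ⟨H.isLaplacian f ht, H.hasDerivAt f ht⟩) (H.tendsto_zero f) ht

/-- As functions of `s`, both sides solve the heat equation with initial value P_t f; uniqueness
identifies them. -/
theorem P_add (hs : 0 < s) (ht : 0 < t) : H.P (s + t) f = H.P s (H.P t f) := by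
  refine eq_of_heat_equation (E := E) (u := fun s => H.P (s + t) f) (f := H.P t f)
    (u' := fun s => H.P s (H.P t f))
    (v := fun s => H.lap (s + t) f) (v' := fun s => H.lap s (H.P t f))
    (fun s hs => ⟨H.isLaplacian f (by positivity), ?_⟩)
    (fun s hs => ⟨H.isLaplacian _ hs, H.hasDerivAt _ hs⟩) ?_ (H.tendsto_zero _) hs
  · exact (H.hasDerivAt f (t := s + t) (by positivity)).comp_add_const s t
  · have h1 : Tendsto (fun s => H.P s f) (𝓝 t) (𝓝 (H.P t f)) := (H.hasDerivAt f ht).continuousAt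
    have : Tendsto (fun s : ℝ => s + t) (𝓝[>] 0) (𝓝 t) := by
      have : Tendsto (fun s : ℝ => s + t) (𝓝 0) (𝓝 (0 + t)) := (continuous_add_const t).tendsto 0
      rw [zero_add] at this
      exact this.mono_left nhdsWithin_le_nhds
    exact h1.comp this

theorem P_comm (hs : 0 < s) (ht : 0 < t) : H.P s (H.P t f) = H.P t (H.P s f) := by
  rw [← H.P_add f hs ht, ← H.P_add f ht hs, add_comm]

/-- Differentiation of the semigroup law in `t`. It lets ΔP_t f be treated as a heat flow started
from another L² function, hence as an element of the domain. -/
theorem lap_add (hs : 0 < s) (ht : 0 < t) : H.lap (s + t) f = H.P s (H.lap t f) := by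
  have h1 : HasDerivAt (fun t => H.P s (H.P t f)) (H.P s (H.lap t f)) t :=
    (H.P s).hasFDerivAt.comp_hasDerivAt t (H.hasDerivAt f ht)
  have h2 : HasDerivAt (fun t => H.P (s + t) f) (H.lap (s + t) f) t :=
    (H.hasDerivAt f (t := s + t) (by positivity)).comp_const_add s t
  refine h2.unique (h1.congr_of_eventuallyEq ?_)
  filter_upwards [lt_mem_nhds ht] with r hr using H.P_add f hs hr

/-- The function s ↦ ⟨P_s f, P_{t-s} g⟩ has derivative zero because the Laplacian is symmetric. Its
limits at the two ends of (0, t) are the two sides. -/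
theorem P_symm (ht : 0 < t) : inner ℝ (H.P t f) g = inner ℝ f (H.P t g) := by
  have hd : ∀ s ∈ Ioo 0 t, HasDerivAt (fun s => inner ℝ (H.P s f) (H.P (t - s) g)) (0 : ℝ) s := by
    intro s hs
    have h1 := H.hasDerivAt f hs.1
    have h2 : HasDerivAt (fun s => H.P (t - s) g) (-(H.lap (t - s) g)) s :=
      (H.hasDerivAt g (sub_pos.2 hs.2)).comp_const_sub t s
    have := h1.inner ℝ h2
    rwa [inner_neg_right, (H.isLaplacian f hs.1).inner_comm (H.isLaplacian g (sub_pos.2 hs.2)),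
      neg_add_cancel] at this
  obtain ⟨c, hc⟩ : ∃ c : ℝ, ∀ s ∈ Ioo 0 t, inner ℝ (H.P s f) (H.P (t - s) g) = c := by
    refine ⟨inner ℝ (H.P (t / 2) f) (H.P (t - t / 2) g), fun s hs => ?_⟩
    refine (convex_Ioo 0 t).is_const_of_fderivWithin_eq_zero (𝕜 := ℝ)
      (fun s hs => (hd s hs).differentiableAt.differentiableWithinAt) (fun s hs => ?_) hs
      ⟨by positivity, by linarith⟩
    rw [(hd s hs).hasFDerivAt.hasFDerivWithinAt.fderivWithin (isOpen_Ioo.uniqueDiffWithinAt hs)]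
    ext; simp
  have l1 : Tendsto (fun s => inner ℝ (H.P s f) (H.P (t - s) g)) (𝓝[>] 0)
      (𝓝 (inner ℝ f (H.P t g))) := by
    refine (H.tendsto_zero f).inner ?_
    have h1 : Tendsto (fun s => H.P s g) (𝓝 t) (𝓝 (H.P t g)) := (H.hasDerivAt g ht).continuousAt
    have : Tendsto (fun s : ℝ => t - s) (𝓝 0) (𝓝 (t - 0)) := (continuous_const.sub continuous_id).tendsto 0
    rw [sub_zero] at this
    exact (h1.comp this).mono_left nhdsWithin_le_nhds
  have l2 : Tendsto (fun s => inner ℝ (H.P s f) (H.P (t - s) g)) (𝓝[<] t)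
      (𝓝 (inner ℝ (H.P t f) g)) := by
    refine (((H.hasDerivAt f ht).continuousAt).tendsto.mono_left nhdsWithin_le_nhds).inner ?_
    refine (H.tendsto_zero g).comp ?_
    refine tendsto_nhdsWithin_iff.2 ⟨?_, ?_⟩
    · have : Tendsto (fun s : ℝ => t - s) (𝓝 t) (𝓝 (t - t)) := (continuous_const.sub continuous_id).tendsto t
      rw [sub_self] at this
      exact this.mono_left nhdsWithin_le_nhds
    · filter_upwards [self_mem_nhdsWithin] with s (hs : s < t) using sub_pos.2 hs
  have e1 : inner ℝ f (H.P t g) = c := by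
    refine tendsto_nhds_unique l1 (tendsto_const_nhds.congr' ?_)
    filter_upwards [Ioo_mem_nhdsGT ht] with s hs using (hc s hs).symm
  have e2 : inner ℝ (H.P t f) g = c := by
    refine tendsto_nhds_unique l2 (tendsto_const_nhds.congr' ?_)
    filter_upwards [Ioo_mem_nhdsLT ht] with s hs using (hc s hs).symm
  rw [e1, e2]

theorem form_P (ht : 0 < t) (g : E.dom) :
    E.form ⟨H.P t f, H.mem_dom f ht⟩ g = -inner ℝ (g : Lp ℝ 2 m) (H.lap t f) :=
  (H.isLaplacian f ht).form_eq _ _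

/-- `E(P_t f) = -⟨Δ P_t f, P_t f⟩`. -/
theorem energy_eq (ht : 0 < t) : E.form ⟨H.P t f, H.mem_dom f ht⟩ ⟨H.P t f, H.mem_dom f ht⟩
    = -inner ℝ (H.lap (2 * t) f) f := by
  rw [H.form_P f ht, two_mul, H.lap_add f ht ht, H.P_symm _ _ ht, real_inner_comm]

/-- The derivative of ⟨ΔP_t f, f⟩ is ‖ΔP_{t/2} f‖² ≥ 0. Through `energy_eq` this says that the
energy decreases along the flow. -/
theorem energy_antitone (hs : 0 < s) (hst : s ≤ t) :
    inner ℝ (H.lap s f) f ≤ inner ℝ (H.lap t f) f := by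
  have hd : ∀ t ∈ Ioi s, HasDerivAt (fun t => inner ℝ (H.lap t f) f)
      (‖H.lap (t / 2) f‖ ^ 2) t := by
    intro t ht
    have ht' : s < t := ht
    have ht0 : 0 < t := hs.trans ht
    -- Splitting off a fixed time t/2 leaves a single derivative of the flow to compute, so no
    -- second time derivative is needed.
    have key : ∀ r, t / 2 < r → inner ℝ (H.lap r f) f = inner ℝ (H.lap (t / 2) f) (H.P (r - t/2) f) := by
      intro r hr
      rw [← H.P_symm _ _ (sub_pos.2 hr), ← H.lap_add f (sub_pos.2 hr) (by positivity)]
      simp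
    have h1 := (hasDerivAt_const t (H.lap (t / 2) f)).inner ℝ
      ((H.hasDerivAt f (t := t - t/2) (by linarith)).comp_sub_const t (t/2))
    simp only [inner_zero_left, add_zero] at h1
    rw [show t - t/2 = t/2 by ring, real_inner_self_eq_norm_sq] at h1
    refine h1.congr_of_eventuallyEq ?_
    filter_upwards [lt_mem_nhds (show t/2 < t by linarith)] with r hr using key r hr
  have hc : ContinuousOn (fun t => inner ℝ (H.lap t f) f) (Ici s) := by
    have : ∀ r ∈ Ici s, ContinuousWithinAt (fun t => inner ℝ (H.lap t f) f) (Ici s) r := by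
      intro r hr
      have hr : s ≤ r := hr
      have : ContinuousAt (fun t => inner ℝ (H.lap (s/2) f) (H.P (t - s/2) f)) r :=
        continuousAt_const.inner ((H.hasDerivAt f (t := r - s/2) (by linarith)).comp_sub_const r (s/2)).continuousAt
      refine this.continuousWithinAt.congr_of_eventuallyEq ?_ ?_
      · filter_upwards [self_mem_nhdsWithin] with t ht
        have ht : s ≤ t := ht
        rw [← H.P_symm _ _ (by linarith), ← H.lap_add f (by linarith) (by positivity)]
        simp
      · rw [← H.P_symm _ _ (by linarith), ← H.lap_add f (by linarith) (by positivity)]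
        simp
    exact this
  have := monotoneOn_of_deriv_nonneg (convex_Ici s) hc
    (by rw [interior_Ici]; exact fun t ht => (hd t ht).differentiableAt.differentiableWithinAt)
    (by rw [interior_Ici]; intro t ht; rw [(hd t ht).deriv]; positivity)
  exact this self_mem_Ici hst hst

/-- ℰ(P_t f) = -⟨ΔP_{2t} f, f⟩, and by monotonicity this is at most the value of -⟨ΔP_c f, f⟩ at an
intermediate time c ∈ (t, 2t). The mean value theorem identifies that value with (⟨P_t f, f⟩ -
⟨P_{2t} f, f⟩)/t. -/
theorem energy_le (ht : 0 < t) : E.form ⟨H.P t f, H.mem_dom f ht⟩ ⟨H.P t f, H.mem_dom f ht⟩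
    ≤ 1 / t * ‖f‖ ^ 2 := by
  rw [H.energy_eq f ht]
  obtain ⟨c, hc, e⟩ := exists_hasDerivAt_eq_slope (fun r => inner ℝ (H.P r f) f)
    (fun r => inner ℝ (H.lap r f) f) (show t < 2 * t by linarith)
    (fun r hr => (((H.hasDerivAt f (t := r) (ht.trans_le hr.1)).inner ℝ
      (hasDerivAt_const r f)).continuousAt.continuousWithinAt))
    (fun r hr => by
      have := ((H.hasDerivAt f (t := r) (ht.trans hr.1)).inner ℝ (hasDerivAt_const r f))
      simpa using this)
  have h1 : inner ℝ (H.P (2 * t) f) f = ‖H.P t f‖ ^ 2 := by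
    rw [two_mul, H.P_add f ht ht, H.P_symm _ _ ht, real_inner_self_eq_norm_sq]
  have h2 : inner ℝ (H.P t f) f ≤ ‖f‖ ^ 2 := by
    refine (real_inner_le_norm _ _).trans ?_
    rw [sq]; gcongr; exact H.norm_P_le f ht
  have h3 := H.energy_antitone f (s := c) (t := 2 * t) (ht.trans hc.1) hc.2.le
  rw [e, h1, show 2 * t - t = t by ring, div_le_iff₀ ht] at h3
  rw [div_mul_eq_mul_div, le_div_iff₀ ht, one_mul]
  nlinarith [sq_nonneg ‖H.P t f‖]

theorem form_le (f g : E.dom) : |E.form f g| ≤ √(E.form f f) * √(E.form g g) := by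
  rw [← Real.sqrt_mul (E.nonneg f)]
  refine Real.abs_le_sqrt ?_
  have h : ∀ x : ℝ, 0 ≤ E.form g g * (x * x) + 2 * E.form f g * x + E.form f f := by
    intro x
    have := E.nonneg (f + x • g)
    simp only [map_add, LinearMap.add_apply, map_smul, LinearMap.smul_apply, smul_eq_mul] at this
    rw [E.symm g f] at this
    linarith
  have := discrim_le_zero h
  unfold discrim at this
  nlinarith

/-- Duality: ⟨ΔP_t f, g⟩ = -ℰ(P_{t/2} f, P_{t/2} g), and each factor has energy at most (2/t) times
the squared L² norm. -/
theorem norm_lap_le (ht : 0 < t) : ‖H.lap t f‖ ≤ 2 / t * ‖f‖ := by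
  have h2 : 0 < t / 2 := by positivity
  have key : ∀ g, |inner ℝ (H.lap t f) g| ≤ 2 / t * ‖f‖ * ‖g‖ := by
    intro g
    have e : inner ℝ (H.lap t f) g = - E.form ⟨H.P (t/2) f, H.mem_dom f h2⟩ ⟨H.P (t/2) g, H.mem_dom g h2⟩ := by
      rw [H.form_P f h2, neg_neg]
      simp only
      rw [H.P_symm _ _ h2, ← H.lap_add f h2 h2, add_halves, real_inner_comm]
    have b : ∀ f, √(E.form ⟨H.P (t/2) f, H.mem_dom f h2⟩ ⟨H.P (t/2) f, H.mem_dom f h2⟩) ≤ √(2 / t) * ‖f‖ := by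
      intro f
      rw [← Real.sqrt_sq (norm_nonneg f), ← Real.sqrt_mul (by positivity)]
      refine Real.sqrt_le_sqrt ?_
      have := H.energy_le f h2
      rwa [one_div_div] at this
    rw [e, abs_neg]
    refine (form_le _ _).trans ?_
    calc _ ≤ (√(2 / t) * ‖f‖) * (√(2 / t) * ‖g‖) := by
          gcongr <;> apply b
      _ = (√(2/t) * √(2/t)) * ‖f‖ * ‖g‖ := by ring
      _ = _ := by rw [Real.mul_self_sqrt (by positivity)]
  have := key (H.lap t f)
  rw [real_inner_self_eq_norm_sq, abs_of_nonneg (by positivity)] at this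
  by_cases h : ‖H.lap t f‖ = 0
  · rw [h]; positivity
  · have h' : 0 < ‖H.lap t f‖ := lt_of_le_of_ne (norm_nonneg _) (Ne.symm h)
    rw [sq] at this
    exact le_of_mul_le_mul_right this h'

end HeatSemigroup

end

/-! ### The sub-Markov property of the heat semigroup. -/

section

variable {X : Type*} [MeasurableSpace X] {m : Measure X} {E : DirichletForm m}

/-- The positive part of `f - a`, for `0 ≤ a`. -/
def excess (a : ℝ) (x : ℝ) : ℝ := x - min x (max a 0)

theorem excess_eq (a x : ℝ) : excess a x = max (x - max a 0) 0 := by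
  unfold excess
  rcases le_total x (max a 0) with h | h
  · rw [min_eq_left h, max_eq_right (by linarith), sub_self]
  · rw [min_eq_right h, max_eq_left (sub_nonneg.2 h)]

theorem lipschitzWith_excess (a : ℝ) : LipschitzWith 1 (excess a) := by
  have : excess a = fun x => max (x - max a 0) 0 := funext (excess_eq a)
  rw [this]
  exact ((LipschitzWith.id.sub (LipschitzWith.const (max a 0))).weaken (by simp)).max_const 0

theorem excess_zero (a : ℝ) : excess a 0 = 0 := by
  rw [excess_eq]; simp

/-- The excess `(f - a)₊` of an `L²` function. -/
def excessLp (a : ℝ) (f : Lp ℝ 2 m) : Lp ℝ 2 m := (lipschitzWith_excess a).compLp (excess_zero a) f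

theorem excessLp_coe (a : ℝ) (f : Lp ℝ 2 m) : ∀ᵐ x ∂m, excessLp a f x = excess a (f x) :=
  (lipschitzWith_excess a).coeFn_compLp (excess_zero a) f

theorem excessLp_eq_zero {a : ℝ} (ha : 0 ≤ a) (f : Lp ℝ 2 m) :
    excessLp a f = 0 ↔ ∀ᵐ x ∂m, f x ≤ a := by
  rw [Lp.ext_iff]
  constructor
  · intro h
    filter_upwards [h, excessLp_coe a f, Lp.coeFn_zero ℝ 2 m] with x h1 h2 h3
    rw [h2, excess_eq, max_eq_left ha, h3] at h1
    have : f x - a ≤ 0 := by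
      by_contra hh
      rw [max_eq_left (by linarith)] at h1
      simp only [Pi.zero_apply] at h1
      linarith
    linarith
  · intro h
    filter_upwards [h, excessLp_coe a f, Lp.coeFn_zero ℝ 2 m] with x h1 h2 h3
    rw [h2, excess_eq, max_eq_left ha, h3, max_eq_right (by linarith)]
    rfl

theorem isClosed_setOf_le {a : ℝ} (ha : 0 ≤ a) : IsClosed {f : Lp ℝ 2 m | ∀ᵐ x ∂m, f x ≤ a} := by
  have : {f : Lp ℝ 2 m | ∀ᵐ x ∂m, f x ≤ a} = (excessLp a) ⁻¹' {0} := by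
    ext f; simp [excessLp_eq_zero ha]
  rw [this]
  exact isClosed_singleton.preimage
    ((lipschitzWith_excess a).continuous_compLp (excess_zero a))

/-- The first order expansion of `½‖(u - a)₊‖²`. -/
theorem excess_expansion (a : ℝ) (u h : Lp ℝ 2 m) :
    |1 / 2 * ‖excessLp a (u + h)‖ ^ 2 - 1 / 2 * ‖excessLp a u‖ ^ 2 - inner ℝ (excessLp a u) h|
      ≤ 1 / 2 * ‖h‖ ^ 2 := by
  have I : ∀ u v : Lp ℝ 2 m, Integrable (fun x => inner ℝ (u x) (v x)) m :=
    fun u v => L2.integrable_inner u v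
  simp only [← real_inner_self_eq_norm_sq, L2.inner_def]
  rw [← integral_const_mul, ← integral_const_mul, ← integral_const_mul, ← integral_sub, ← integral_sub]
  rotate_left
  · exact ((I _ _).const_mul _).sub ((I _ _).const_mul _)
  · exact I _ _
  · exact (I _ _).const_mul _
  · exact (I _ _).const_mul _
  · rw [← Real.norm_eq_abs]
    refine norm_integral_le_of_norm_le ((I h h).const_mul _) ?_
    filter_upwards [excessLp_coe a u, excessLp_coe a (u + h), Lp.coeFn_add u h] with x h1 h2 h3
    rw [h1, h2, h3, excess_eq, excess_eq]
    simp only [RCLike.inner_apply, conj_trivial, Pi.add_apply, Real.norm_eq_abs]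
    generalize max a 0 = c
    generalize h x = y
    generalize u x = z
    rw [abs_le]
    rcases le_total (z - c) 0 with k1 | k1 <;> rcases le_total (z + y - c) 0 with k2 | k2
    · rw [max_eq_right k1, max_eq_right k2]
      constructor <;> nlinarith [sq_nonneg y]
    · rw [max_eq_right k1, max_eq_left k2]
      constructor <;> nlinarith [sq_nonneg y]
    · rw [max_eq_left k1, max_eq_right k2]
      constructor <;> nlinarith [sq_nonneg y, sq_nonneg (z - c), sq_nonneg (z + y - c)]
    · rw [max_eq_left k1, max_eq_left k2]
      constructor <;> nlinarith [sq_nonneg y]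

/-- The remainder in `excess_expansion` is quadratic in the L² norm, so the squared excess is
differentiable even though the positive part is not smooth. -/
theorem hasFDerivAt_excess (a : ℝ) (u : Lp ℝ 2 m) :
    HasFDerivAt (fun u : Lp ℝ 2 m => 1 / 2 * ‖excessLp a u‖ ^ 2) (innerSL ℝ (excessLp a u)) u := by
  rw [hasFDerivAt_iff_isLittleO_nhds_zero]
  have : (fun h : Lp ℝ 2 m => 1 / 2 * ‖excessLp a (u + h)‖ ^ 2 - 1 / 2 * ‖excessLp a u‖ ^ 2
      - (innerSL ℝ (excessLp a u)) h) =O[𝓝 0] fun h => ‖h‖ ^ 2 := by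
    refine Asymptotics.IsBigO.of_bound (1 / 2) (.of_forall fun h => ?_)
    rw [Real.norm_of_nonneg (by positivity : (0:ℝ) ≤ ‖h‖ ^ 2)]
    exact excess_expansion a u h
  refine this.trans_isLittleO ?_
  exact Asymptotics.isLittleO_norm_pow_id one_lt_two

/-- `(f - a)₊ ∈ 𝕍` and `ℰ(f, (f - a)₊) ≥ 0`. -/
theorem DirichletForm.excess_mem (E : DirichletForm m) (a : ℝ) (f : E.dom) :
    ∃ h : excessLp a (f : Lp ℝ 2 m) ∈ E.dom, 0 ≤ E.form f ⟨_, h⟩ := by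
  have lip : LipschitzWith 1 (fun x : ℝ => min x (max a 0)) := LipschitzWith.id.min_const _
  obtain ⟨g, hg, hE⟩ := E.markov _ lip (by simp) f
  have e : excessLp a (f : Lp ℝ 2 m) = ((f - g : E.dom) : Lp ℝ 2 m) := by
    apply Lp.ext
    filter_upwards [excessLp_coe a (f : Lp ℝ 2 m), hg, Lp.coeFn_sub (f : Lp ℝ 2 m) g] with x h1 h2 h3
    rw [h1, AddSubgroupClass.coe_sub, h3, Pi.sub_apply, h2, excess]
  refine ⟨e ▸ (f - g).2, ?_⟩
  have : (⟨excessLp a (f : Lp ℝ 2 m), e ▸ (f - g).2⟩ : E.dom) = f - g := Subtype.ext e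
  rw [this]
  -- Here g is f truncated at a. Nonnegativity of ℰ(f - g) gives 2ℰ(f, g) ≤ ℰ(f) + ℰ(g) ≤ 2ℰ(f),
  -- that is, ℰ(f, f - g) ≥ 0.
  have h1 := E.nonneg (f - g)
  simp only [map_sub, LinearMap.sub_apply] at h1 ⊢
  rw [E.symm g f] at h1
  linarith

/-- A bounded operator on `L²` is sub-Markovian if it preserves upper bounds by nonnegative
constants. -/
def IsSubMarkov (S : Lp ℝ 2 m →L[ℝ] Lp ℝ 2 m) : Prop :=
  ∀ a : ℝ, 0 ≤ a → ∀ f : Lp ℝ 2 m, (∀ᵐ x ∂m, f x ≤ a) → ∀ᵐ x ∂m, S f x ≤ a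

/-- The quantity ½‖(P_t f - a)₊‖² has derivative -ℰ(P_t f, (P_t f - a)₊) ≤ 0 and tends to ½‖(f -
a)₊‖² = 0 as t ↓ 0, so it vanishes for all times. -/
theorem HeatSemigroup.isSubMarkov (H : HeatSemigroup E) {t : ℝ} (ht : 0 < t) :
    IsSubMarkov (H.P t) := by
  intro a ha f hf
  have hd : ∀ t, 0 < t → HasDerivAt (fun t => 1 / 2 * ‖excessLp a (H.P t f)‖ ^ 2)
      (inner ℝ (excessLp a (H.P t f)) (H.lap t f)) t := fun t ht =>
    HasFDerivAt.comp_hasDerivAt (f := fun t => H.P t f) t (hasFDerivAt_excess a (H.P t f))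
      (H.hasDerivAt f ht)
  have hn : ∀ t, 0 < t → inner ℝ (excessLp a (H.P t f)) (H.lap t f) ≤ 0 := by
    intro t ht
    obtain ⟨h1, h2⟩ := E.excess_mem a ⟨H.P t f, H.mem_dom f ht⟩
    rw [H.form_P f ht] at h2
    linarith
  have anti : AntitoneOn (fun t => 1 / 2 * ‖excessLp a (H.P t f)‖ ^ 2) (Ioi 0) := by
    apply antitoneOn_of_deriv_nonpos (convex_Ioi 0)
    · exact fun t ht => (hd t ht).continuousAt.continuousWithinAt
    · rw [interior_Ioi]
      exact fun t ht => (hd t ht).differentiableAt.differentiableWithinAt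
    · rw [interior_Ioi]
      intro t ht
      rw [(hd t ht).deriv]
      exact hn t ht
  have c : Continuous (excessLp a : Lp ℝ 2 m → Lp ℝ 2 m) :=
    (lipschitzWith_excess a).continuous_compLp (excess_zero a)
  have lim : Tendsto (fun t => 1 / 2 * ‖excessLp a (H.P t f)‖ ^ 2) (𝓝[>] 0)
      (𝓝 (1 / 2 * ‖excessLp a f‖ ^ 2)) :=
    ((((c.tendsto f).comp (H.tendsto_zero f)).norm).pow 2).const_mul _
  rw [(excessLp_eq_zero ha f).2 hf] at lim
  have : 1 / 2 * ‖excessLp a (H.P t f)‖ ^ 2 ≤ 1 / 2 * ‖(0 : Lp ℝ 2 m)‖ ^ 2 := by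
    refine ge_of_tendsto lim ?_
    filter_upwards [Ioo_mem_nhdsGT ht] with s hs
    exact anti hs.1 ht hs.2.le
  rw [norm_zero] at this
  rw [← excessLp_eq_zero ha, ← norm_eq_zero]
  nlinarith [norm_nonneg (excessLp a (H.P t f))]

namespace IsSubMarkov

variable {S T : Lp ℝ 2 m →L[ℝ] Lp ℝ 2 m}

theorem nonneg (hS : IsSubMarkov S) {f : Lp ℝ 2 m} (hf : ∀ᵐ x ∂m, 0 ≤ f x) :
    ∀ᵐ x ∂m, 0 ≤ S f x := by
  have := hS 0 le_rfl (-f) (by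
    filter_upwards [hf, Lp.coeFn_neg f] with x h1 h2
    rw [h2, Pi.neg_apply]; linarith)
  filter_upwards [this, Lp.coeFn_neg (S f)] with x h1 h2
  rw [map_neg, h2, Pi.neg_apply] at h1
  linarith

theorem one : IsSubMarkov (1 : Lp ℝ 2 m →L[ℝ] Lp ℝ 2 m) := fun _ _ _ hf => hf

theorem mul (hS : IsSubMarkov S) (hT : IsSubMarkov T) : IsSubMarkov (S * T) :=
  fun a ha f hf => hS a ha _ (hT a ha f hf)

theorem pow (hS : IsSubMarkov S) (n : ℕ) : IsSubMarkov (S ^ n) := by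
  induction n with
  | zero => simpa using one
  | succ n ih => rw [pow_succ]; exact ih.mul hS

end IsSubMarkov

end

/-! ### L^p norms by duality. -/

section

/-- The function `sign(f) |f|^(p-1)`, which norms `f` in `L^p`. -/
def dualTest {X : Type*} (p : ℝ) (f : X → ℝ) (x : X) : ℝ := SignType.sign (f x) * |f x| ^ (p - 1)

theorem mul_dualTest {X : Type*} {p : ℝ} (hp : 1 < p) (f : X → ℝ) (x : X) :
    f x * dualTest p f x = |f x| ^ p := by
  unfold dualTest
  rw [← mul_assoc, self_mul_sign]
  rcases eq_or_ne (f x) 0 with h | h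
  · rw [h]; simp; rw [Real.zero_rpow (by linarith)]
  · rw [mul_comm, ← Real.rpow_add_one (by positivity)]; simp

theorem enorm_dualTest {X : Type*} {p : ℝ} (hp : 1 < p) (f : X → ℝ) (x : X) :
    ‖dualTest p f x‖ₑ = ‖f x‖ₑ ^ (p - 1) := by
  unfold dualTest
  rcases eq_or_ne (f x) 0 with h | h
  · rw [h]; simp [ENNReal.zero_rpow_of_pos (sub_pos.2 hp)]
  · rw [enorm_mul]
    have : ‖((SignType.sign (f x) : SignType) : ℝ)‖ₑ = 1 := by
      rcases lt_or_gt_of_ne h with h | h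
      · rw [sign_neg h]; simp
      · rw [sign_pos h]; simp
    rw [this, one_mul, Real.enorm_rpow_of_nonneg (abs_nonneg _) (by linarith), ← Real.norm_eq_abs, enorm_norm]

variable {X : Type*} [MeasurableSpace X] {m : Measure X}

theorem tendsto_eLpNorm_sub_of_dominated {p : ℝ≥0∞} (hp0 : p ≠ 0) (hp : p ≠ ⊤) {f : ℕ → X → ℝ}
    {g G : X → ℝ} (hf : ∀ n, AEStronglyMeasurable (f n) m) (hg : AEStronglyMeasurable g m)
    (hG : MemLp G p m) (hb : ∀ n, ∀ᵐ x ∂m, |f n x - g x| ≤ G x)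
    (hl : ∀ᵐ x ∂m, Tendsto (fun n => f n x) atTop (𝓝 (g x))) :
    Tendsto (fun n => eLpNorm (f n - g) p m) atTop (𝓝 0) := by
  have hp' : 0 < p.toReal := ENNReal.toReal_pos hp0 hp
  have key : Tendsto (fun n => ∫⁻ x, ‖(f n - g) x‖ₑ ^ p.toReal ∂m) atTop (𝓝 (∫⁻ _, 0 ∂m)) := by
    refine tendsto_lintegral_of_dominated_convergence' (fun x => ‖G x‖ₑ ^ p.toReal) ?_ ?_ ?_ ?_
    · intro n
      exact ((hf n).sub hg).enorm.pow_const _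
    · intro n
      filter_upwards [hb n] with x hx
      gcongr
      rw [enorm_le_iff_norm_le]
      rw [Real.norm_eq_abs, Real.norm_eq_abs]
      exact hx.trans (le_abs_self _)
    · have := hG.eLpNorm_lt_top
      rw [eLpNorm_lt_top_iff_lintegral_rpow_enorm_lt_top hp0 hp] at this
      exact this.ne
    · filter_upwards [hl] with x hx
      have h1 : Tendsto (fun n => ‖(f n - g) x‖ₑ) atTop (𝓝 0) := by
        have := (hx.sub_const (g x)).enorm
        simpa using this
      have := h1.ennrpow_const p.toReal
      rwa [ENNReal.zero_rpow_of_pos hp'] at this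
  simp only [lintegral_zero] at key
  have := key.ennrpow_const (1 / p.toReal)
  rw [ENNReal.zero_rpow_of_pos (by positivity)] at this
  refine this.congr fun n => ?_
  rw [eLpNorm_eq_lintegral_rpow_enorm_toReal hp0 hp]

theorem enorm_integral_mul_le {p p' : ℝ≥0∞} [p.HolderConjugate p'] {f g : X → ℝ}
    (hf : AEStronglyMeasurable f m) (hg : AEStronglyMeasurable g m) :
    ‖∫ x, f x * g x ∂m‖ₑ ≤ eLpNorm f p m * eLpNorm g p' m := by
  refine (enorm_integral_le_lintegral_enorm _).trans ?_
  have h : eLpNorm (f • g) 1 m ≤ eLpNorm f p m * eLpNorm g p' m := eLpNorm_smul_le_mul_eLpNorm hg hf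
  rwa [eLpNorm_one_eq_lintegral_enorm] at h

theorem integrable_mul_of_conj {p p' : ℝ≥0∞} [p.HolderConjugate p'] {f g : X → ℝ}
    (hf : MemLp f p m) (hg : MemLp g p' m) : Integrable (fun x => f x * g x) m :=
  hf.integrable_mul hg

theorem measurable_dualTest (p : ℝ) {f : X → ℝ} (hf : Measurable f) : Measurable (dualTest p f) := by
  have : Measurable (fun y : ℝ => ((SignType.sign y : SignType) : ℝ) * |y| ^ (p - 1)) := by
    refine Measurable.mul ?_ (by fun_prop)
    have : (fun y : ℝ => ((SignType.sign y : SignType) : ℝ))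
        = fun y => if 0 < y then 1 else if y < 0 then -1 else 0 := by
      ext y
      rw [sign_apply]; split_ifs <;> simp
    rw [this]
    exact Measurable.ite measurableSet_Ioi measurable_const
      (Measurable.ite measurableSet_Iio measurable_const measurable_const)
  exact this.comp hf

theorem aestronglyMeasurable_dualTest (p : ℝ) {f : X → ℝ} (hf : AEStronglyMeasurable f m) :
    AEStronglyMeasurable (dualTest p f) m :=
  ((measurable_dualTest p measurable_id).comp_aemeasurable hf.aemeasurable).aestronglyMeasurable

/-- Norm bound from testing against truncations of the norming function. -/
theorem eLpNorm_le_of_dualTest {p p' : ℝ≥0∞} [p.HolderConjugate p'] (hp1 : 1 < p) (hp : p ≠ ⊤)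
    {f : X → ℝ} (hf : AEStronglyMeasurable f m) {K : ℝ≥0∞} (B : ℕ → Set X)
    (hB : ∀ n, MeasurableSet (B n)) (hlim : ∀ x, ∀ᶠ n in atTop, x ∈ B n)
    (hmem : ∀ n, MemLp ((B n).indicator f) p m)
    (htest : ∀ n, ‖∫ x, f x * (B n).indicator (dualTest p.toReal f) x ∂m‖ₑ
      ≤ K * eLpNorm ((B n).indicator (dualTest p.toReal f)) p' m) :
    eLpNorm f p m ≤ K := by
  have hp0 : p ≠ 0 := (zero_lt_one.trans hp1).ne'
  have hr1 : 1 < p.toReal := by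
    rw [← ENNReal.toReal_one]; exact (ENNReal.toReal_lt_toReal ENNReal.one_ne_top hp).2 hp1
  have hp'1 : 1 < p' := (ENNReal.HolderConjugate.lt_top_iff_one_lt p p').1 hp.lt_top
  have hp' : p' ≠ ⊤ := ((ENNReal.HolderConjugate.lt_top_iff_one_lt p' p).2 hp1).ne
  have hconj : p.toReal.HolderConjugate p'.toReal :=
    ENNReal.HolderConjugate.toReal_of_ne_top hp hp'
  have key : ∀ n, eLpNorm ((B n).indicator f) p m ≤ K := by
    intro n
    set I := ∫⁻ x, ‖(B n).indicator f x‖ₑ ^ p.toReal ∂m with hI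
    have hIfin : I ≠ ⊤ := by
      have := (hmem n).eLpNorm_lt_top
      rw [eLpNorm_lt_top_iff_lintegral_rpow_enorm_lt_top hp0 hp] at this
      exact this.ne
    have e1 : eLpNorm ((B n).indicator f) p m = I ^ (1 / p.toReal) :=
      eLpNorm_eq_lintegral_rpow_enorm_toReal hp0 hp
    have e2 : eLpNorm ((B n).indicator (dualTest p.toReal f)) p' m = I ^ (1 / p'.toReal) := by
      rw [eLpNorm_eq_lintegral_rpow_enorm_toReal (zero_lt_one.trans hp'1).ne' hp']
      congr 1
      refine lintegral_congr fun x => ?_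
      by_cases hx : x ∈ B n
      · rw [indicator_of_mem hx, indicator_of_mem hx, enorm_dualTest hr1, ← ENNReal.rpow_mul,
          hconj.sub_one_mul_conj]
      · rw [indicator_of_notMem hx, indicator_of_notMem hx, enorm_zero,
          ENNReal.zero_rpow_of_pos hconj.symm.pos, ENNReal.zero_rpow_of_pos hconj.pos]
    have e3 : ‖∫ x, f x * (B n).indicator (dualTest p.toReal f) x ∂m‖ₑ = I := by
      have : ∀ x, f x * (B n).indicator (dualTest p.toReal f) x = |(B n).indicator f x| ^ p.toReal := by
        intro x
        by_cases hx : x ∈ B n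
        · rw [indicator_of_mem hx, indicator_of_mem hx, mul_dualTest hr1]
        · rw [indicator_of_notMem hx, indicator_of_notMem hx, mul_zero, abs_zero, Real.zero_rpow hconj.ne_zero]
      simp_rw [this]
      have h0 : 0 ≤ ∫ x, |(B n).indicator f x| ^ p.toReal ∂m := integral_nonneg fun x => by positivity
      rw [Real.enorm_of_nonneg h0, ofReal_integral_eq_lintegral_ofReal]
      · refine lintegral_congr fun x => ?_
        rw [← Real.norm_eq_abs, ← ENNReal.ofReal_rpow_of_nonneg (norm_nonneg _) hconj.nonneg, ofReal_norm]
      · exact (hmem n).integrable_norm_rpow hp0 hp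
      · exact .of_forall fun x => by simp only [Pi.zero_apply]; positivity
    -- With I the p-th power integral of the truncated function, the test inequality reads I ≤ K
    -- I^{1/p'}. Since I is finite, dividing gives I^{1/p} ≤ K.
    have h := htest n
    rw [e3, e2] at h
    rw [e1]
    by_cases hI0 : I = 0
    · rw [hI0, ENNReal.zero_rpow_of_pos (by have := hconj.pos; positivity)]; exact zero_le
    have hsum : 1 / p.toReal = 1 - 1 / p'.toReal := by
      have := hconj.inv_add_inv_eq_one
      simp only [one_div]; linarith
    rw [hsum, ENNReal.rpow_sub _ _ hI0 hIfin, ENNReal.rpow_one]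
    refine ENNReal.div_le_of_le_mul h
  refine Lp.eLpNorm_le_of_ae_tendsto (u := atTop) (.of_forall key) (fun n => hf.indicator (hB n)) ?_
  refine .of_forall fun x => ?_
  refine tendsto_const_nhds.congr' ?_
  filter_upwards [hlim x] with n hn
  rw [indicator_of_mem hn]

/-- A pairing bound against integrable simple functions extends to bounded functions. -/
theorem pairing_le_of_simpleFunc {p' : ℝ≥0∞} (hp'1 : 1 ≤ p') (hp' : p' ≠ ⊤)
    {f : X → ℝ} (hf : MemLp f 2 m) {K : ℝ≥0∞} (hK : K ≠ ⊤)
    (h : ∀ g : SimpleFunc X ℝ, MemLp g 2 m → MemLp g p' m →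
      ‖∫ x, f x * g x ∂m‖ₑ ≤ K * eLpNorm g p' m)
    {g : X → ℝ} (hg2 : MemLp g 2 m) (hg : MemLp g p' m) :
    ‖∫ x, f x * g x ∂m‖ₑ ≤ K * eLpNorm g p' m := by
  wlog hgm : StronglyMeasurable g generalizing g
  · have hg' := hg.aestronglyMeasurable
    have := this (hg2.ae_eq hg'.ae_eq_mk) (hg.ae_eq hg'.ae_eq_mk) hg'.stronglyMeasurable_mk
    rw [← eLpNorm_congr_ae hg'.ae_eq_mk] at this
    rwa [integral_congr_ae (g := fun x => f x * hg'.mk g x)]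
    filter_upwards [hg'.ae_eq_mk] with x hx
    rw [hx]
  have hgm' := hgm.measurable
  set φ : ℕ → SimpleFunc X ℝ := fun n => SimpleFunc.approxOn g hgm' univ 0 (mem_univ _) n
  have h1 : Tendsto (fun n => eLpNorm (⇑(φ n) - g) 2 m) atTop (𝓝 0) :=
    SimpleFunc.tendsto_approxOn_Lp_eLpNorm hgm' (mem_univ _) (by simp) (by simp) (by simpa using hg2.2)
  have h2 : Tendsto (fun n => eLpNorm (⇑(φ n) - g) p' m) atTop (𝓝 0) :=
    SimpleFunc.tendsto_approxOn_Lp_eLpNorm hgm' (mem_univ _) hp' (by simp) (by simpa using hg.2)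
  have m1 : ∀ n, MemLp (φ n) 2 m := fun n =>
    SimpleFunc.memLp_approxOn hgm' hg2 (mem_univ _) (by simp) n
  have m2 : ∀ n, MemLp (φ n) p' m := fun n =>
    SimpleFunc.memLp_approxOn hgm' hg (mem_univ _) (by simp) n
  have bound : ∀ n, ‖∫ x, f x * g x ∂m‖ₑ ≤ (K * (eLpNorm g p' m + eLpNorm (⇑(φ n) - g) p' m))
      + eLpNorm f 2 m * eLpNorm (⇑(φ n) - g) 2 m := by
    intro n
    have e : ∫ x, f x * g x ∂m = ∫ x, f x * φ n x ∂m - ∫ x, f x * (⇑(φ n) - g) x ∂m := by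
      rw [← integral_sub (integrable_mul_of_conj hf (m1 n))
        (integrable_mul_of_conj hf ((m1 n).sub hg2))]
      congr 1; ext x; simp; ring
    rw [e]
    refine enorm_sub_le.trans (add_le_add ((h _ (m1 n) (m2 n)).trans ?_)
      (enorm_integral_mul_le hf.1 ((m1 n).sub hg2).1))
    gcongr
    calc eLpNorm (φ n) p' m = eLpNorm (g + (⇑(φ n) - g)) p' m := by congr 1; ext x; simp
      _ ≤ _ := eLpNorm_add_le hg.1 ((m2 n).sub hg).1 hp'1
  have lim : Tendsto (fun n => (K * (eLpNorm g p' m + eLpNorm (⇑(φ n) - g) p' m))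
      + eLpNorm f 2 m * eLpNorm (⇑(φ n) - g) 2 m) atTop
      (𝓝 (K * (eLpNorm g p' m + 0) + eLpNorm f 2 m * 0)) := by
    refine (ENNReal.Tendsto.const_mul (tendsto_const_nhds.add h2) (Or.inr hK)).add
      (ENNReal.Tendsto.const_mul h1 (Or.inr hf.eLpNorm_ne_top))
  rw [add_zero, mul_zero, add_zero] at lim
  exact ge_of_tendsto' lim bound

/-- `L^p` norm by duality, for `f ∈ L²`. -/
theorem eLpNorm_le_of_simpleFunc {p p' : ℝ≥0∞} [p.HolderConjugate p'] (hp1 : 1 < p) (hp : p ≠ ⊤)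
    {f : X → ℝ} (hf : MemLp f 2 m) {K : ℝ≥0∞} (hK : K ≠ ⊤)
    (h : ∀ g : SimpleFunc X ℝ, MemLp g 2 m → MemLp g p' m →
      ‖∫ x, f x * g x ∂m‖ₑ ≤ K * eLpNorm g p' m) :
    eLpNorm f p m ≤ K := by
  wlog hfm : StronglyMeasurable f generalizing f
  · have := this (hf.ae_eq hf.1.ae_eq_mk) (fun g h1 h2 => ?_) hf.1.stronglyMeasurable_mk
    · rwa [eLpNorm_congr_ae hf.1.ae_eq_mk]
    · rw [integral_congr_ae (g := fun x => f x * g x)]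
      · exact h g h1 h2
      · filter_upwards [hf.1.ae_eq_mk] with x hx
        rw [hx]
  have hp'1 : 1 < p' := (ENNReal.HolderConjugate.lt_top_iff_one_lt p p').1 hp.lt_top
  have hp' : p' ≠ ⊤ := ((ENNReal.HolderConjugate.lt_top_iff_one_lt p' p).2 hp1).ne
  have hr1 : 1 < p.toReal := by
    rw [← ENNReal.toReal_one]; exact (ENNReal.toReal_lt_toReal ENNReal.one_ne_top hp).2 hp1
  -- Away from the zero set, `B n` lies in {|f| ≥ 1/(n+1)}, which has finite measure by Chebyshev
  -- since f ∈ L². There f is also bounded, so truncations of powers of |f| lie in every L^q.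
  -- Keeping the zero set makes the `B n` exhaust the whole space.
  set B : ℕ → Set X := fun n => {x | f x = 0 ∨ (1 / (n + 1 : ℝ) ≤ |f x| ∧ |f x| ≤ n)} with hB
  have hBm : ∀ n, MeasurableSet (B n) := fun n => by
    have := hfm.measurable
    exact (measurableSet_eq_fun this measurable_const).union
      ((measurableSet_le measurable_const this.abs).inter (measurableSet_le this.abs measurable_const))
  have bdd : ∀ n (q : ℝ≥0∞) (r : ℝ) (k : X → ℝ), 0 ≤ r → AEStronglyMeasurable k m →
      (∀ x, f x = 0 → k x = 0) → (∀ x, ‖k x‖ ≤ |f x| ^ r) → MemLp ((B n).indicator k) q m := by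
    intro n q r k hr hk hk0 hkb
    set T := {x | 1 / (n + 1 : ℝ) ≤ |f x|} with hT
    have hTm : MeasurableSet T := measurableSet_le measurable_const hfm.measurable.abs
    have fin : m T ≠ ⊤ := by
      have := meas_ge_le_mul_pow_eLpNorm_enorm m (p := 2) (by simp) (by simp) hf.1 (ε := ENNReal.ofReal (1 / (n+1 : ℝ)))
        (by simp; positivity) (by simp)
      have hs : T ⊆ {x | ENNReal.ofReal (1 / (n+1 : ℝ)) ≤ ‖f x‖ₑ} := by
        intro x hx
        show ENNReal.ofReal (1 / (n+1 : ℝ)) ≤ ‖f x‖ₑ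
        rw [← ofReal_norm, Real.norm_eq_abs]
        exact ENNReal.ofReal_le_ofReal hx
      refine ((measure_mono hs).trans this).trans_lt ?_ |>.ne
      refine ENNReal.mul_lt_top ?_ ?_
      · rw [lt_top_iff_ne_top]
        simp
        positivity
      · simpa using hf.2
    have e : (B n).indicator k = T.indicator ((B n).indicator k) := by
      ext x
      by_cases hx : x ∈ T
      · rw [indicator_of_mem hx]
      · rw [indicator_of_notMem hx]
        by_cases hx' : x ∈ B n
        · rw [indicator_of_mem hx']
          rcases hx' with h0 | h0
          · exact hk0 x h0
          · exact absurd h0.1 hx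
        · rw [indicator_of_notMem hx']
    rw [e]
    have : IsFiniteMeasure (m.restrict T) := ⟨by simpa using fin.lt_top⟩
    rw [memLp_indicator_iff_restrict hTm]
    refine MemLp.of_bound (hk.indicator (hBm n)).restrict ((n:ℝ) ^ r) (.of_forall fun x => ?_)
    by_cases hx' : x ∈ B n
    · rw [indicator_of_mem hx']
      refine (hkb x).trans ?_
      rcases hx' with h0 | h0
      · rw [h0, abs_zero]; gcongr; positivity
      · gcongr; exact h0.2
    · rw [indicator_of_notMem hx', norm_zero]; positivity
  refine eLpNorm_le_of_dualTest (p' := p') hp1 hp hf.1 B hBm ?_ ?_ ?_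
  · intro x
    by_cases h0 : f x = 0
    · exact .of_forall fun n => Or.inl h0
    · have h1 : Tendsto (fun n : ℕ => 1 / (n + 1 : ℝ)) atTop (𝓝 0) := tendsto_one_div_add_atTop_nhds_zero_nat
      filter_upwards [h1.eventually_le_const (abs_pos.2 h0), eventually_ge_atTop ⌈|f x|⌉₊] with n h2 h3
      exact Or.inr ⟨h2, (Nat.le_ceil _).trans (by exact_mod_cast h3)⟩
  · intro n
    exact bdd n p 1 f zero_le_one hf.1 (fun x h => h) (fun x => by simp)
  · intro n
    have hd : ∀ q, MemLp ((B n).indicator (dualTest p.toReal f)) q m := fun q => by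
      refine bdd n q (p.toReal - 1) _ (by linarith) (aestronglyMeasurable_dualTest _ hf.1) (fun x hx => ?_) (fun x => ?_)
      · simp [dualTest, hx]
      · have := enorm_dualTest hr1 f x
        rw [← ofReal_norm, ← ofReal_norm, ENNReal.ofReal_rpow_of_nonneg (norm_nonneg _) (by linarith),
          ENNReal.ofReal_eq_ofReal_iff (norm_nonneg _) (by positivity)] at this
        rw [this, Real.norm_eq_abs]
    exact pairing_le_of_simpleFunc hp'1.le hp' hf hK h (hd 2) (hd p')

end

/-! ### Riesz representation of functionals on L^p. -/

section

variable {X : Type*} [MeasurableSpace X] {m : Measure X}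

section Dual

variable {p : ℝ≥0∞} [Fact (1 ≤ p)]

/-- The value of a functional on `L^p` at a function, and `0` outside `L^p`. -/
def onFun (Λ : Lp ℝ p m →L[ℝ] ℝ) (f : X → ℝ) : ℝ := by
  classical exact if h : MemLp f p m then Λ h.toLp else 0

theorem onFun_of_memLp (Λ : Lp ℝ p m →L[ℝ] ℝ) {f : X → ℝ} (h : MemLp f p m) :
    onFun Λ f = Λ h.toLp := by
  unfold onFun; rw [dif_pos h]

theorem onFun_add (Λ : Lp ℝ p m →L[ℝ] ℝ) {f g : X → ℝ} (hf : MemLp f p m) (hg : MemLp g p m) :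
    onFun Λ (f + g) = onFun Λ f + onFun Λ g := by
  rw [onFun_of_memLp Λ hf, onFun_of_memLp Λ hg, onFun_of_memLp Λ (hf.add hg), ← map_add]; rfl

theorem onFun_sub (Λ : Lp ℝ p m →L[ℝ] ℝ) {f g : X → ℝ} (hf : MemLp f p m) (hg : MemLp g p m) :
    onFun Λ (f - g) = onFun Λ f - onFun Λ g := by
  rw [onFun_of_memLp Λ hf, onFun_of_memLp Λ hg, onFun_of_memLp Λ (hf.sub hg), ← map_sub]; rfl

theorem onFun_const_mul (Λ : Lp ℝ p m →L[ℝ] ℝ) (c : ℝ) {f : X → ℝ} (hf : MemLp f p m) :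
    onFun Λ (c • f) = c * onFun Λ f := by
  rw [onFun_of_memLp Λ hf, onFun_of_memLp Λ (hf.const_smul c), MemLp.toLp_const_smul, map_smul, smul_eq_mul]

theorem onFun_le (Λ : Lp ℝ p m →L[ℝ] ℝ) {f : X → ℝ} (hf : MemLp f p m) :
    ‖onFun Λ f‖ₑ ≤ ‖Λ‖ₑ * eLpNorm f p m := by
  rw [onFun_of_memLp Λ hf]
  refine (Λ.le_opENorm _).trans ?_
  rw [Lp.enorm_toLp]

theorem onFun_congr (Λ : Lp ℝ p m →L[ℝ] ℝ) {f g : X → ℝ} (h : f =ᵐ[m] g) :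
    onFun Λ f = onFun Λ g := by
  by_cases hf : MemLp f p m
  · rw [onFun_of_memLp Λ hf, onFun_of_memLp Λ (hf.ae_eq h), MemLp.toLp_congr _ _ h]
  · have hg : ¬ MemLp g p m := fun hg => hf (hg.ae_eq h.symm)
    simp [onFun, hf, hg]

theorem onFun_tendsto (Λ : Lp ℝ p m →L[ℝ] ℝ) (hp : p ≠ ⊤) {f : ℕ → X → ℝ}
    {g G : X → ℝ} (hf : ∀ n, MemLp (f n) p m) (hg : MemLp g p m)
    (hG : MemLp G p m) (hb : ∀ n, ∀ᵐ x ∂m, |f n x - g x| ≤ G x)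
    (hl : ∀ᵐ x ∂m, Tendsto (fun n => f n x) atTop (𝓝 (g x))) :
    Tendsto (fun n => onFun Λ (f n)) atTop (𝓝 (onFun Λ g)) := by
  have hp0 : p ≠ 0 := (zero_lt_one.trans_le (Fact.out : 1 ≤ p)).ne'
  have h := tendsto_eLpNorm_sub_of_dominated hp0 hp (fun n => (hf n).1) hg.1 hG hb hl
  rw [tendsto_iff_edist_tendsto_0]
  have h2 : Tendsto (fun n => ‖Λ‖ₑ * eLpNorm (f n - g) p m) atTop (𝓝 (‖Λ‖ₑ * 0)) :=
    ENNReal.Tendsto.const_mul h (Or.inr (by simp))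
  rw [mul_zero] at h2
  refine tendsto_of_tendsto_of_tendsto_of_le_of_le tendsto_const_nhds h2 (fun _ => zero_le) (fun n => ?_)
  rw [edist_eq_enorm_sub, ← onFun_sub Λ (hf n) hg]
  exact onFun_le Λ ((hf n).sub hg)

/-- The signed measure `A ↦ Λ(ρ 1_A)`. -/
def weightedMeasure (Λ : Lp ℝ p m →L[ℝ] ℝ) (hp : p ≠ ⊤) {ρ : X → ℝ} (hρ : MemLp ρ p m) :
    SignedMeasure X := by
  classical
  refine
  { measureOf' := fun A => if MeasurableSet A then onFun Λ (A.indicator ρ) else 0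
    empty' := ?_
    not_measurable' := fun A hA => if_neg hA
    m_iUnion' := ?_ }
  · simp only [MeasurableSet.empty, if_true, indicator_empty]
    have := onFun_const_mul Λ 0 hρ
    rw [zero_smul, zero_mul] at this
    exact this
  · intro A hA hdisj
    have hp0 : p ≠ 0 := (zero_lt_one.trans_le (Fact.out : 1 ≤ p)).ne'
    have hmem : ∀ B, MeasurableSet B → MemLp (B.indicator ρ) p m := fun B hB => hρ.indicator hB
    simp only [hA, MeasurableSet.iUnion hA, if_true]
    -- The L^p norm of ρ restricted to B is μ(B)^{1/p} for this finite measure. Continuity of Λ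
    -- therefore bounds the tail of the series of values by a power of the tail of a convergent
    -- series.
    set μ := m.withDensity (fun x => ‖ρ x‖ₑ ^ p.toReal) with hμ
    have hfin : IsFiniteMeasure μ := by
      refine isFiniteMeasure_withDensity ?_
      have := hρ.eLpNorm_lt_top
      rw [eLpNorm_lt_top_iff_lintegral_rpow_enorm_lt_top hp0 hp] at this
      exact this.ne
    have hnorm : ∀ B, MeasurableSet B → eLpNorm (B.indicator ρ) p m = (μ B) ^ (1 / p.toReal) := by
      intro B hB
      rw [eLpNorm_eq_lintegral_rpow_enorm_toReal hp0 hp, hμ, withDensity_apply _ hB, ← lintegral_indicator hB]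
      congr 1
      refine lintegral_congr fun x => ?_
      by_cases hx : x ∈ B
      · rw [indicator_of_mem hx, indicator_of_mem hx]
      · rw [indicator_of_notMem hx, indicator_of_notMem hx, enorm_zero,
          ENNReal.zero_rpow_of_pos (ENNReal.toReal_pos hp0 hp)]
    have hpart : ∀ s : Finset ℕ, ∑ i ∈ s, onFun Λ ((A i).indicator ρ) =
        onFun Λ ((⋃ i ∈ s, A i).indicator ρ) := by
      intro s
      induction s using Finset.induction_on with
      | empty =>
        simp only [Finset.sum_empty, Finset.notMem_empty, iUnion_of_empty, iUnion_empty, indicator_empty]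
        have := onFun_const_mul Λ 0 hρ
        rw [zero_smul, zero_mul] at this
        exact this.symm
      | insert a s ha ih =>
        rw [Finset.sum_insert ha, ih, Finset.set_biUnion_insert, indicator_union_of_disjoint,
          ← onFun_add Λ (hmem _ (hA a)) (hmem _ (Finset.measurableSet_biUnion s fun i _ => hA i))]
        · rfl
        · rw [disjoint_iUnion₂_right]
          intro i hi
          exact hdisj (fun h => ha (h ▸ hi))
    have htail : ∀ s : Finset ℕ, edist (∑ i ∈ s, onFun Λ ((A i).indicator ρ)) (onFun Λ ((⋃ i, A i).indicator ρ))
        ≤ ‖Λ‖ₑ * (∑' i : {i // i ∉ s}, μ (A i)) ^ (1 / p.toReal) := by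
      intro s
      have hU : (⋃ i, A i) = (⋃ i ∈ s, A i) ∪ (⋃ i : {i // i ∉ s}, A i) := by
        ext x
        simp only [mem_iUnion, mem_union, Subtype.exists, exists_prop]
        constructor
        · rintro ⟨i, hi⟩
          by_cases h : i ∈ s
          · exact Or.inl ⟨i, h, hi⟩
          · exact Or.inr ⟨i, h, hi⟩
        · rintro (⟨i, _, hi⟩ | ⟨i, _, hi⟩) <;> exact ⟨i, hi⟩
      have hmeas2 : MeasurableSet (⋃ i : {i // i ∉ s}, A i) := MeasurableSet.iUnion fun i => hA i
      rw [hpart, hU, indicator_union_of_disjoint, edist_comm, edist_eq_enorm_sub]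
      · have := onFun_add Λ (hmem _ (Finset.measurableSet_biUnion s fun i _ => hA i)) (hmem _ hmeas2)
        change ‖onFun Λ (_ + _) - _‖ₑ ≤ _
        rw [this, add_sub_cancel_left]
        refine (onFun_le Λ (hmem _ hmeas2)).trans ?_
        rw [hnorm _ hmeas2]
        gcongr
        exact measure_iUnion_le _
      · rw [disjoint_iUnion₂_left]
        intro i hi
        rw [disjoint_iUnion_right]
        intro j
        exact hdisj (fun h => j.2 (h ▸ hi))
    have hsum : ∑' i, μ (A i) ≠ ⊤ := by
      rw [← measure_iUnion hdisj hA]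
      exact measure_ne_top _ _
    have h1 := ((ENNReal.tendsto_tsum_compl_atTop_zero hsum).ennrpow_const (1 / p.toReal))
    rw [ENNReal.zero_rpow_of_pos (by have := ENNReal.toReal_pos hp0 hp; positivity)] at h1
    have h2 := ENNReal.Tendsto.const_mul (a := ‖Λ‖ₑ) h1 (Or.inr (by simp))
    rw [mul_zero] at h2
    rw [HasSum, SummationFilter.unconditional_filter, tendsto_iff_edist_tendsto_0]
    exact tendsto_of_tendsto_of_tendsto_of_le_of_le tendsto_const_nhds h2 (fun _ => zero_le) htail

/-- The Radon–Nikodym theorem for `weightedMeasure`. The weight ρ ∈ L^p makes every measurable set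
admissible, including sets of infinite `m`-measure. -/
theorem exists_density (Λ : Lp ℝ p m →L[ℝ] ℝ) [SigmaFinite m] (hp : p ≠ ⊤) {ρ : X → ℝ} (hρ : MemLp ρ p m) :
    ∃ h : X → ℝ, StronglyMeasurable h ∧ Integrable h m ∧
      ∀ A, MeasurableSet A → onFun Λ (A.indicator ρ) = ∫ x in A, h x ∂m := by
  classical
  set ν := weightedMeasure Λ hp hρ
  have hν : ∀ A, MeasurableSet A → ν A = onFun Λ (A.indicator ρ) := fun A hA => if_pos hA
  have hac : ν ≪ᵥ m.toENNRealVectorMeasure := by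
    refine VectorMeasure.AbsolutelyContinuous.mk fun A hA h0 => ?_
    rw [Measure.toENNRealVectorMeasure_apply_measurable hA] at h0
    rw [hν A hA, onFun_congr Λ (g := (0 : ℝ) • ρ)]
    · rw [onFun_const_mul Λ 0 hρ, zero_mul]
    · rw [zero_smul]
      exact indicator_meas_zero h0
  have := (SignedMeasure.absolutelyContinuous_iff_withDensityᵥ_rnDeriv_eq ν m).1 hac
  refine ⟨ν.rnDeriv m, (SignedMeasure.measurable_rnDeriv ν m).stronglyMeasurable,
    SignedMeasure.integrable_rnDeriv ν m, fun A hA => ?_⟩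
  rw [← hν A hA, ← withDensityᵥ_apply (SignedMeasure.integrable_rnDeriv ν m) hA, this]

/-- Linearity extends the identity from indicators to simple functions. Dominated convergence, in
L^p on one side and in L¹ on the other, extends it to bounded measurable multipliers. -/
theorem onFun_mul_bounded (Λ : Lp ℝ p m →L[ℝ] ℝ) (hp : p ≠ ⊤) {ρ h : X → ℝ}
    (hρ : MemLp ρ p m) (hh : Integrable h m)
    (H : ∀ A, MeasurableSet A → onFun Λ (A.indicator ρ) = ∫ x in A, h x ∂m)
    {ψ : X → ℝ} (hψ : Measurable ψ) {C : ℝ} (hC : ∀ x, |ψ x| ≤ C) :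
    onFun Λ (fun x => ρ x * ψ x) = ∫ x, h x * ψ x ∂m := by
  have hmemb : ∀ (ψ : X → ℝ), Measurable ψ → ∀ C, (∀ x, |ψ x| ≤ C) → MemLp (fun x => ρ x * ψ x) p m := by
    intro ψ hψ C hC
    have : MemLp (fun x => ψ x * ρ x) p m :=
      hρ.mul (memLp_top_of_bound hψ.aestronglyMeasurable C (.of_forall fun x => hC x))
    simpa only [mul_comm] using this
  have hsimp : ∀ φ : SimpleFunc X ℝ, onFun Λ (fun x => ρ x * φ x) = ∫ x, h x * φ x ∂m := by
    intro φ
    obtain ⟨C, hC⟩ := φ.exists_forall_norm_le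
    clear hC C
    induction φ using SimpleFunc.induction with
    | const c hs =>
      rename_i s
      have e1 : (fun x => ρ x * (SimpleFunc.piecewise s hs (SimpleFunc.const X c) (SimpleFunc.const X 0)) x)
          = c • s.indicator ρ := by
        ext x
        by_cases hx : x ∈ s <;> simp [hx, mul_comm]
      have e2 : (fun x => h x * (SimpleFunc.piecewise s hs (SimpleFunc.const X c) (SimpleFunc.const X 0)) x)
          = fun x => c * s.indicator h x := by
        ext x
        by_cases hx : x ∈ s <;> simp [hx, mul_comm]
      rw [e1, e2, onFun_const_mul Λ c (hρ.indicator hs), H s hs, integral_const_mul, integral_indicator hs]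
    | add hd hf hg =>
      rename_i f g
      obtain ⟨C, hC⟩ := f.exists_forall_norm_le
      obtain ⟨C', hC'⟩ := g.exists_forall_norm_le
      have e1 : (fun x => ρ x * (f + g) x) = (fun x => ρ x * f x) + (fun x => ρ x * g x) := by
        ext x; simp [mul_add]
      have e2 : (fun x => h x * (f + g) x) = (fun x => h x * f x + h x * g x) := by
        ext x; simp [mul_add]
      rw [e1, e2, onFun_add Λ (hmemb f f.measurable C hC) (hmemb g g.measurable C' hC'), hf, hg, integral_add]
      · exact hh.mul_bdd (c := C) f.aestronglyMeasurable (.of_forall hC)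
      · exact hh.mul_bdd (c := C') g.aestronglyMeasurable (.of_forall hC')
  set φ : ℕ → SimpleFunc X ℝ := fun n => SimpleFunc.approxOn ψ hψ univ 0 (mem_univ _) n
  have hφ : ∀ n x, ‖φ n x‖ ≤ C + C := fun n x =>
    (SimpleFunc.norm_approxOn_zero_le hψ (mem_univ _) x n).trans (add_le_add (hC x) (hC x))
  have hlim : ∀ x, Tendsto (fun n => φ n x) atTop (𝓝 (ψ x)) := fun x =>
    SimpleFunc.tendsto_approxOn hψ (mem_univ _) (by simp)
  have l1 : Tendsto (fun n => onFun Λ (fun x => ρ x * φ n x)) atTop (𝓝 (onFun Λ (fun x => ρ x * ψ x))) := by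
    refine onFun_tendsto Λ hp (G := fun x => (3 * C) * |ρ x|) (fun n => hmemb _ (φ n).measurable _ (hφ n)) (hmemb _ hψ _ hC)
      (hρ.abs.const_mul _) (fun n => .of_forall fun x => ?_) (.of_forall fun x => (hlim x).const_mul _)
    rw [← mul_sub, abs_mul, mul_comm]
    gcongr
    have := hφ n x
    rw [Real.norm_eq_abs] at this
    have h2 := hC x
    have := abs_sub (φ n x) (ψ x)
    linarith
  have l2 : Tendsto (fun n => ∫ x, h x * φ n x ∂m) atTop (𝓝 (∫ x, h x * ψ x ∂m)) := by
    refine tendsto_integral_of_dominated_convergence (fun x => |h x| * (C + C)) ?_ ?_ ?_ ?_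
    · exact fun n => hh.1.mul (φ n).aestronglyMeasurable
    · exact hh.abs.mul_const _
    · refine fun n => .of_forall fun x => ?_
      rw [norm_mul, Real.norm_eq_abs]
      gcongr
      exact hφ n x
    · exact .of_forall fun x => (hlim x).const_mul _
  simp_rw [hsimp] at l1
  exact tendsto_nhds_unique l1 l2

/-- Riesz representation of the dual of `L^p`, `1 < p < ∞`. -/
theorem exists_dual_representative [SigmaFinite m] {p' : ℝ≥0∞} [p.HolderConjugate p']
    (hp1 : 1 < p) (hp : p ≠ ⊤) (Λ : Lp ℝ p m →L[ℝ] ℝ) :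
    ∃ w : X → ℝ, MemLp w p' m ∧ eLpNorm w p' m ≤ ‖Λ‖ₑ ∧ ∀ f : Lp ℝ p m, Λ f = ∫ x, w x * f x ∂m := by
  have hp0 : p ≠ 0 := (zero_lt_one.trans hp1).ne'
  have hp'1 : 1 < p' := (ENNReal.HolderConjugate.lt_top_iff_one_lt p p').1 hp.lt_top
  have hp' : p' ≠ ⊤ := ((ENNReal.HolderConjugate.lt_top_iff_one_lt p' p).2 hp1).ne
  have hr1 : 1 < p'.toReal := by
    rw [← ENNReal.toReal_one]; exact (ENNReal.toReal_lt_toReal ENNReal.one_ne_top hp').2 hp'1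
  have hpr := ENNReal.toReal_pos hp0 hp
  -- A σ-finite measure has a strictly positive integrable function; its power 1/p is a strictly
  -- positive ρ ∈ L^p. Dividing the density of A ↦ Λ(ρ 1_A) by ρ produces the representing function.
  obtain ⟨g0, g0pos, g0m, g0int⟩ := exists_pos_lintegral_lt_of_sigmaFinite m (one_ne_zero (α := ℝ≥0∞))
  set ρ : X → ℝ := fun x => (g0 x : ℝ) ^ (1 / p.toReal) with hρdef
  have ρpos : ∀ x, 0 < ρ x := fun x => Real.rpow_pos_of_pos (g0pos x) _
  have ρm : Measurable ρ := by
    have : Measurable fun x => (g0 x : ℝ) := g0m.coe_nnreal_real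
    exact this.pow_const _
  have hρ : MemLp ρ p m := by
    refine ⟨ρm.aestronglyMeasurable, ?_⟩
    rw [eLpNorm_lt_top_iff_lintegral_rpow_enorm_lt_top hp0 hp]
    refine lt_of_eq_of_lt (lintegral_congr fun x => ?_) (g0int.trans ENNReal.one_lt_top)
    rw [hρdef, Real.enorm_rpow_of_nonneg (NNReal.coe_nonneg _) (by positivity), ← ENNReal.rpow_mul,
      one_div_mul_cancel hpr.ne', ENNReal.rpow_one]
    simp [enorm, NNReal.nnnorm_eq]
  obtain ⟨h, hm, hint, H⟩ := exists_density Λ hp hρ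
  set w : X → ℝ := fun x => h x / ρ x with hw
  have wm : Measurable w := hm.measurable.div ρm
  have hwρ : ∀ x, w x * ρ x = h x := fun x => div_mul_cancel₀ _ (ρpos x).ne'
  have hnorm : eLpNorm w p' m ≤ ‖Λ‖ₑ := by
    -- On `B n` the norming function is ρ times a function bounded by n, which is the class where Λ
    -- is already known as an integral. As ρ > 0, every point lies in `B n` for large n.
    set B : ℕ → Set X := fun n => {x | |dualTest p'.toReal w x| ≤ n * ρ x}
    have dm : Measurable (dualTest p'.toReal w) := measurable_dualTest _ wm
    have hB : ∀ n, MeasurableSet (B n) := fun n =>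
      measurableSet_le dm.abs (ρm.const_mul _)
    have ψb : ∀ n x, |(B n).indicator (dualTest p'.toReal w) x / ρ x| ≤ n := by
      intro n x
      rw [abs_div, abs_of_pos (ρpos x), div_le_iff₀ (ρpos x)]
      by_cases hx : x ∈ B n
      · rw [indicator_of_mem hx]; exact hx
      · rw [indicator_of_notMem hx, abs_zero]; have := ρpos x; positivity
    have ψm : ∀ n, Measurable (fun x => (B n).indicator (dualTest p'.toReal w) x / ρ x) := fun n =>
      (dm.indicator (hB n)).div ρm
    have e : ∀ n, (fun x => ρ x * ((B n).indicator (dualTest p'.toReal w) x / ρ x)) = (B n).indicator (dualTest p'.toReal w) := by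
      intro n; ext x
      rw [mul_div_cancel₀ _ (ρpos x).ne']
    have e' : ∀ n x, h x * ((B n).indicator (dualTest p'.toReal w) x / ρ x) = w x * (B n).indicator (dualTest p'.toReal w) x := by
      intro n x
      rw [hw]; ring
    have memd : ∀ n, MemLp ((B n).indicator (dualTest p'.toReal w)) p m := by
      intro n
      rw [← e n]
      have : MemLp (fun x => ((B n).indicator (dualTest p'.toReal w) x / ρ x) * ρ x) p m :=
        hρ.mul (memLp_top_of_bound (ψm n).aestronglyMeasurable n (.of_forall fun x => ψb n x))
      simpa only [mul_comm] using this
    refine eLpNorm_le_of_dualTest (p' := p) hp'1 hp' wm.aestronglyMeasurable B hB ?_ ?_ ?_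
    · intro x
      obtain ⟨n, hn⟩ := exists_nat_ge (|dualTest p'.toReal w x| / ρ x)
      filter_upwards [eventually_ge_atTop n] with k hk
      have : |dualTest p'.toReal w x| / ρ x ≤ k := hn.trans (by exact_mod_cast hk)
      exact (div_le_iff₀ (ρpos x)).1 this
    · intro n
      refine ⟨(wm.indicator (hB n)).aestronglyMeasurable, ?_⟩
      rw [eLpNorm_lt_top_iff_lintegral_rpow_enorm_lt_top (zero_lt_one.trans hp'1).ne' hp']
      have i1 : Integrable (fun x => h x * ((B n).indicator (dualTest p'.toReal w) x / ρ x)) m :=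
        hint.mul_bdd (c := n) (ψm n).aestronglyMeasurable (.of_forall fun x => ψb n x)
      refine lt_of_eq_of_lt (lintegral_congr fun x => ?_) i1.2
      simp only [e']
      by_cases hx : x ∈ B n
      · rw [indicator_of_mem hx, indicator_of_mem hx, mul_dualTest hr1,
          Real.enorm_rpow_of_nonneg (abs_nonneg _) (by linarith), ← Real.norm_eq_abs, enorm_norm]
      · rw [indicator_of_notMem hx, indicator_of_notMem hx, mul_zero, enorm_zero,
          ENNReal.zero_rpow_of_pos (by linarith)]
    · intro n
      have := onFun_mul_bounded Λ hp hρ hint H (ψm n) (ψb n)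
      rw [e] at this
      simp_rw [e'] at this
      rw [← this]
      exact onFun_le Λ (memd n)
  have hwmem : MemLp w p' m := ⟨wm.aestronglyMeasurable, hnorm.trans_lt (by simp)⟩
  refine ⟨w, hwmem, hnorm, fun f => ?_⟩
  have fm := (Lp.stronglyMeasurable f).measurable
  -- The same truncation relative to ρ, now applied to `f`, removes the boundedness assumption by
  -- dominated convergence.
  set T : ℕ → Set X := fun n => {x | |f x| ≤ n * ρ x}
  have hT : ∀ n, MeasurableSet (T n) := fun n => measurableSet_le fm.abs (ρm.const_mul _)
  have ψb : ∀ n x, |(T n).indicator f x / ρ x| ≤ n := by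
    intro n x
    rw [abs_div, abs_of_pos (ρpos x), div_le_iff₀ (ρpos x)]
    by_cases hx : x ∈ T n
    · rw [indicator_of_mem hx]; exact hx
    · rw [indicator_of_notMem hx, abs_zero]; have := ρpos x; positivity
  have hlim : ∀ x, Tendsto (fun n => (T n).indicator f x) atTop (𝓝 (f x)) := by
    intro x
    refine tendsto_const_nhds.congr' ?_
    obtain ⟨n, hn⟩ := exists_nat_ge (|f x| / ρ x)
    filter_upwards [eventually_ge_atTop n] with k hk
    have : |f x| / ρ x ≤ k := hn.trans (by exact_mod_cast hk)
    rw [indicator_of_mem]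
    exact (div_le_iff₀ (ρpos x)).1 this
  have key : ∀ n, onFun Λ ((T n).indicator f) = ∫ x, w x * (T n).indicator f x ∂m := by
    intro n
    have := onFun_mul_bounded Λ hp hρ hint H (ψ := fun x => (T n).indicator f x / ρ x)
      ((fm.indicator (hT n)).div ρm) (ψb n)
    rw [show (fun x => ρ x * ((T n).indicator f x / ρ x)) = (T n).indicator f from by
      ext x; rw [mul_div_cancel₀ _ (ρpos x).ne']] at this
    rw [this]
    congr 1; ext x
    rw [hw]; ring
  have fmem := Lp.memLp f
  have l1 := onFun_tendsto Λ hp (f := fun n => (T n).indicator f) (g := f) (G := fun x => |f x|)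
    (fun n => fmem.indicator (hT n)) fmem fmem.abs (fun n => .of_forall fun x => by
      by_cases hx : x ∈ T n
      · rw [indicator_of_mem hx, sub_self, abs_zero]; positivity
      · rw [indicator_of_notMem hx, zero_sub, abs_neg]) (.of_forall hlim)
  have l2 : Tendsto (fun n => ∫ x, w x * (T n).indicator f x ∂m) atTop (𝓝 (∫ x, w x * f x ∂m)) := by
    refine tendsto_integral_of_dominated_convergence (fun x => |w x * f x|) ?_ ?_ ?_ ?_
    · exact fun n => wm.aestronglyMeasurable.mul (fm.indicator (hT n)).aestronglyMeasurable
    · have := ENNReal.HolderConjugate.symm (p := p) (q := p')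
      exact (integrable_mul_of_conj hwmem fmem).abs
    · refine fun n => .of_forall fun x => ?_
      by_cases hx : x ∈ T n
      · rw [indicator_of_mem hx]; rfl
      · rw [indicator_of_notMem hx, mul_zero, norm_zero]; positivity
    · exact .of_forall fun x => (hlim x).const_mul _
  simp_rw [key] at l1
  have := tendsto_nhds_unique l1 l2
  rw [← this, onFun_of_memLp Λ fmem, Lp.toLp_coeFn]

end Dual

end

section

variable {X : Type*} [MeasurableSpace X] {m : Measure X}

/-! ### Complexification of `L²` -/

/-- The embedding of real into complex `L²`. -/
def ofRealLp (m : Measure X) : Lp ℝ 2 m →L[ℝ] Lp ℂ 2 m := Complex.ofRealCLM.compLpL 2 m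

/-- Real part on `L²`. -/
def reLp (m : Measure X) : Lp ℂ 2 m →L[ℝ] Lp ℝ 2 m := Complex.reCLM.compLpL 2 m

/-- Imaginary part on `L²`. -/
def imLp (m : Measure X) : Lp ℂ 2 m →L[ℝ] Lp ℝ 2 m := Complex.imCLM.compLpL 2 m

theorem ofRealLp_coe (f : Lp ℝ 2 m) : ∀ᵐ x ∂m, ofRealLp m f x = (f x : ℂ) :=
  Complex.ofRealCLM.coeFn_compLpL f

theorem reLp_coe (f : Lp ℂ 2 m) : ∀ᵐ x ∂m, reLp m f x = (f x).re :=
  Complex.reCLM.coeFn_compLpL f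

theorem imLp_coe (f : Lp ℂ 2 m) : ∀ᵐ x ∂m, imLp m f x = (f x).im :=
  Complex.imCLM.coeFn_compLpL f

theorem re_add_im_Lp (f : Lp ℂ 2 m) :
    ofRealLp m (reLp m f) + Complex.I • ofRealLp m (imLp m f) = f := by
  apply Lp.ext
  filter_upwards [Lp.coeFn_add (ofRealLp m (reLp m f)) (Complex.I • ofRealLp m (imLp m f)),
    Lp.coeFn_smul Complex.I (ofRealLp m (imLp m f)), ofRealLp_coe (reLp m f), ofRealLp_coe (imLp m f),
    reLp_coe f, imLp_coe f] with x h1 h2 h3 h4 h5 h6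
  rw [h1, Pi.add_apply, h2, Pi.smul_apply, h3, h4, h5, h6, smul_eq_mul, mul_comm]
  exact Complex.re_add_im _

theorem reLp_smul_eq (c : ℂ) (f : Lp ℂ 2 m) :
    reLp m (c • f) = c.re • reLp m f - c.im • imLp m f := by
  apply Lp.ext
  filter_upwards [reLp_coe (c • f), Lp.coeFn_smul c f, reLp_coe f, imLp_coe f,
    Lp.coeFn_sub (c.re • reLp m f) (c.im • imLp m f), Lp.coeFn_smul c.re (reLp m f),
    Lp.coeFn_smul c.im (imLp m f)] with x h1 h2 h3 h4 h5 h6 h7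
  rw [h1, h2, h5, Pi.sub_apply, h6, h7, Pi.smul_apply, Pi.smul_apply, Pi.smul_apply, h3, h4]
  simp

theorem imLp_smul_eq (c : ℂ) (f : Lp ℂ 2 m) :
    imLp m (c • f) = c.re • imLp m f + c.im • reLp m f := by
  apply Lp.ext
  filter_upwards [imLp_coe (c • f), Lp.coeFn_smul c f, reLp_coe f, imLp_coe f,
    Lp.coeFn_add (c.re • imLp m f) (c.im • reLp m f), Lp.coeFn_smul c.re (imLp m f),
    Lp.coeFn_smul c.im (reLp m f)] with x h1 h2 h3 h4 h5 h6 h7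
  rw [h1, h2, h5, Pi.add_apply, h6, h7, Pi.smul_apply, Pi.smul_apply, Pi.smul_apply, h3, h4]
  simp

theorem reLp_ofReal (f : Lp ℝ 2 m) : reLp m (ofRealLp m f) = f := by
  apply Lp.ext
  filter_upwards [reLp_coe (ofRealLp m f), ofRealLp_coe f] with x h1 h2
  rw [h1, h2, Complex.ofReal_re]

theorem imLp_ofReal (f : Lp ℝ 2 m) : imLp m (ofRealLp m f) = 0 := by
  apply Lp.ext
  filter_upwards [imLp_coe (ofRealLp m f), ofRealLp_coe f, Lp.coeFn_zero ℝ 2 m] with x h1 h2 h3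
  rw [h1, h2, Complex.ofReal_im, h3]; rfl

theorem inner_ofRealLp (f g : Lp ℝ 2 m) :
    inner ℂ (ofRealLp m f) (ofRealLp m g) = ((inner ℝ f g : ℝ) : ℂ) := by
  rw [L2.inner_def, L2.inner_def, ← integral_complex_ofReal]
  refine integral_congr_ae ?_
  filter_upwards [ofRealLp_coe f, ofRealLp_coe g] with x h1 h2
  rw [h1, h2]
  simp

theorem norm_ofRealLp (f : Lp ℝ 2 m) : ‖ofRealLp m f‖ = ‖f‖ := by
  have h' : ‖ofRealLp m f‖ ^ 2 = ‖f‖ ^ 2 := by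
    rw [← inner_self_eq_norm_sq (𝕜 := ℂ), inner_ofRealLp, real_inner_self_eq_norm_sq]
    exact Complex.ofReal_re _
  exact (sq_eq_sq₀ (norm_nonneg _) (norm_nonneg _)).1 h'

theorem ofRealLp_smul (c : ℝ) (f : Lp ℝ 2 m) : (c : ℂ) • ofRealLp m f = ofRealLp m (c • f) := by
  rw [map_smul]; rfl

/-- The complexification of an operator on real `L²`. -/
def complexify (S : Lp ℝ 2 m →L[ℝ] Lp ℝ 2 m) : Lp ℂ 2 m →L[ℂ] Lp ℂ 2 m where
  toFun f := ofRealLp m (S (reLp m f)) + Complex.I • ofRealLp m (S (imLp m f))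
  map_add' f g := by simp only [map_add, smul_add]; abel
  map_smul' c f := by
    simp only [reLp_smul_eq, imLp_smul_eq, map_sub, map_add, ← ofRealLp_smul, map_smul S,
      RingHom.id_apply]
    have hc := Complex.re_add_im c
    conv_rhs => rw [← hc]
    match_scalars
    · ring
    · linear_combination (-(c.im : ℂ)) * Complex.I_mul_I
  cont := by fun_prop

variable {S : Lp ℝ 2 m →L[ℝ] Lp ℝ 2 m}

theorem complexify_ofReal (f : Lp ℝ 2 m) : complexify S (ofRealLp m f) = ofRealLp m (S f) := by
  change ofRealLp m (S (reLp m _)) + Complex.I • ofRealLp m (S (imLp m _)) = _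
  rw [reLp_ofReal, imLp_ofReal]; simp

theorem complexify_pow_ofReal (n : ℕ) (f : Lp ℝ 2 m) :
    (complexify S ^ n) (ofRealLp m f) = ofRealLp m ((S ^ n) f) := by
  induction n with
  | zero => simp
  | succ n ih => rw [pow_succ', pow_succ', mul_apply_eq_comp, ih, complexify_ofReal]; rfl

theorem complexify_symm (hS : ∀ f g, inner ℝ (S f) g = inner ℝ f (S g)) (f g : Lp ℂ 2 m) :
    inner ℂ (complexify S f) g = inner ℂ f (complexify S g) := by
  conv_lhs => rw [← re_add_im_Lp f, ← re_add_im_Lp g]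
  conv_rhs => rw [← re_add_im_Lp f, ← re_add_im_Lp g]
  simp only [map_add, map_smul, complexify_ofReal, inner_add_left, inner_add_right, inner_smul_left,
    inner_smul_right, inner_ofRealLp, hS]

theorem norm_sq_Lp_complex (f : Lp ℂ 2 m) : ‖f‖ ^ 2 = ‖reLp m f‖ ^ 2 + ‖imLp m f‖ ^ 2 := by
  have h : ((‖f‖ ^ 2 : ℝ) : ℂ) = ((‖reLp m f‖ ^ 2 + ‖imLp m f‖ ^ 2 : ℝ) : ℂ) := by
    have := inner_self_eq_norm_sq_to_K (𝕜 := ℂ) f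
    have e : ((‖f‖ ^ 2 : ℝ) : ℂ) = inner ℂ f f := by rw [this]; simp
    rw [e]
    conv_lhs => rw [← re_add_im_Lp f]
    simp only [inner_add_left, inner_add_right, inner_smul_left, inner_smul_right, inner_ofRealLp,
      ← real_inner_self_eq_norm_sq, real_inner_comm (reLp m f) (imLp m f)]
    simp only [Complex.conj_I, Complex.ofReal_add]
    linear_combination (-(inner ℝ (imLp m f) (imLp m f) : ℝ) : ℂ) * Complex.I_mul_I
  exact_mod_cast h

theorem norm_complexify_le (hS : ‖S‖ ≤ 1) (f : Lp ℂ 2 m) : ‖complexify S f‖ ≤ ‖f‖ := by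
  have h : ‖complexify S f‖ ^ 2 ≤ ‖f‖ ^ 2 := by
    rw [norm_sq_Lp_complex, norm_sq_Lp_complex f]
    have e : complexify S f = ofRealLp m (S (reLp m f)) + Complex.I • ofRealLp m (S (imLp m f)) := rfl
    rw [e, map_add, map_add, reLp_smul_eq, imLp_smul_eq, reLp_ofReal, imLp_ofReal, reLp_ofReal, imLp_ofReal]
    simp only [Complex.I_re, Complex.I_im, zero_smul, one_smul, sub_zero, add_zero, zero_add, smul_zero]
    have b : ∀ g, ‖S g‖ ≤ ‖g‖ := fun g => (S.le_of_opNorm_le hS g).trans (by rw [one_mul])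
    gcongr <;> exact b _
  exact (sq_le_sq₀ (norm_nonneg _) (norm_nonneg _)).1 h

/-! ### The semigroup generated by `S - 1` -/

/-- `exp(-t(1 - S))`. -/
def expSemi (S : Lp ℝ 2 m →L[ℝ] Lp ℝ 2 m) (t : ℝ) : Lp ℝ 2 m →L[ℝ] Lp ℝ 2 m :=
  Real.exp (-t) • NormedSpace.exp (t • S)

/-- `exp(-z(1 - S))` for complex times. -/
def expSemiC (S : Lp ℝ 2 m →L[ℝ] Lp ℝ 2 m) (z : ℂ) : Lp ℂ 2 m →L[ℂ] Lp ℂ 2 m :=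
  Complex.exp (-z) • NormedSpace.exp (z • complexify S)

theorem hasDerivAt_expSemi (S : Lp ℝ 2 m →L[ℝ] Lp ℝ 2 m) (t : ℝ) :
    HasDerivAt (expSemi S) (S * expSemi S t - expSemi S t) t := by
  have h1 : HasDerivAt (fun t : ℝ => Real.exp (-t)) (-Real.exp (-t)) t := by
    simpa using (hasDerivAt_neg t).exp
  have h2 := hasDerivAt_exp_smul_const' (𝕂 := ℝ) S t
  refine (h1.smul h2).congr_deriv ?_
  unfold expSemi
  rw [mul_smul_comm, neg_smul, sub_eq_add_neg]

theorem hasDerivAt_expSemiC (S : Lp ℝ 2 m →L[ℝ] Lp ℝ 2 m) (z : ℂ) :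
    HasDerivAt (expSemiC S) (complexify S * expSemiC S z - expSemiC S z) z := by
  have h1 : HasDerivAt (fun t : ℂ => Complex.exp (-t)) (-Complex.exp (-z)) z := by
    simpa using (hasDerivAt_neg z).cexp
  have h2 := hasDerivAt_exp_smul_const' (𝕂 := ℂ) (complexify S) z
  refine (h1.smul h2).congr_deriv ?_
  unfold expSemiC
  rw [mul_smul_comm, neg_smul, sub_eq_add_neg]

theorem expSemi_zero : expSemi S 0 = 1 := by
  simp [expSemi, NormedSpace.exp_zero]

theorem expSemiC_zero : expSemiC S 0 = 1 := by
  simp [expSemiC, NormedSpace.exp_zero]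

/-- Along the ray s ↦ sz the squared norm has derivative 2 Re(z ⟨v, (S - 1)v⟩). Symmetry makes ⟨v,
Sv⟩ real, so this is 2 Re z (⟨v, Sv⟩ - ‖v‖²), which is nonpositive for a contraction S in the closed
right half plane. -/
theorem norm_expSemiC_le (hsym : ∀ f g, inner ℝ (S f) g = inner ℝ f (S g)) (hS : ‖S‖ ≤ 1)
    {z : ℂ} (hz : 0 ≤ z.re) (f : Lp ℂ 2 m) : ‖expSemiC S z f‖ ≤ ‖f‖ := by
  have hd : ∀ s : ℝ, HasDerivAt (fun s : ℝ => expSemiC S (s * z) f)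
      (z • (complexify S (expSemiC S (s * z) f) - expSemiC S (s * z) f)) s := by
    intro s
    have h1 : HasDerivAt (fun s : ℝ => (s : ℂ) * z) z s := by
      simpa using (Complex.ofRealCLM.hasDerivAt (x := s)).mul_const z
    have h2 := (hasDerivAt_expSemiC S (s * z)).scomp s h1
    have h3 := (ContinuousLinearMap.apply ℂ (Lp ℂ 2 m) f).restrictScalars ℝ |>.hasFDerivAt.comp_hasDerivAt s h2
    exact h3
  have hn : ∀ s : ℝ, HasDerivAt (fun s : ℝ => ‖expSemiC S (s * z) f‖ ^ 2)
      (2 * RCLike.re (inner ℂ (expSemiC S (s * z) f) (z • (complexify S (expSemiC S (s * z) f) - expSemiC S (s * z) f)))) s := by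
    intro s
    have h := (hd s).inner ℂ (hd s)
    have h2 := Complex.reCLM.hasFDerivAt.comp_hasDerivAt s h
    have e : (fun s : ℝ => ‖expSemiC S (s * z) f‖ ^ 2) = fun s : ℝ => Complex.reCLM (inner ℂ (expSemiC S (s * z) f) (expSemiC S (s * z) f)) := by
      ext s
      have := inner_self_eq_norm_sq (𝕜 := ℂ) (expSemiC S (s * z) f)
      rw [← this]; rfl
    rw [e]
    refine h2.congr_deriv ?_
    rw [map_add, two_mul]
    congr 1
    exact inner_re_symm (𝕜 := ℂ) _ _
  have hneg : ∀ v : Lp ℂ 2 m, RCLike.re (inner ℂ v (z • (complexify S v - v))) ≤ 0 := by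
    intro v
    rw [inner_smul_right, inner_sub_right]
    have him : (inner ℂ v (complexify S v)).im = 0 := by
      have h1 := complexify_symm hsym v v
      have h2 := inner_conj_symm (𝕜 := ℂ) v (complexify S v)
      rw [h1] at h2
      exact Complex.conj_eq_iff_im.1 h2
    have him2 : (inner ℂ v v).im = 0 := inner_self_im (𝕜 := ℂ) v
    have hre : (inner ℂ v (complexify S v)).re ≤ (inner ℂ v v).re := by
      have h3 : (inner ℂ v v).re = ‖v‖ ^ 2 := inner_self_eq_norm_sq (𝕜 := ℂ) v
      rw [h3]
      refine (Complex.re_le_norm _).trans ((norm_inner_le_norm _ _).trans ?_)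
      rw [sq]; gcongr; exact norm_complexify_le hS v
    simp only [RCLike.re_to_complex, Complex.mul_re, Complex.sub_re, Complex.sub_im, him, him2]
    nlinarith
  have anti : Antitone (fun s : ℝ => ‖expSemiC S (s * z) f‖ ^ 2) := by
    apply antitone_of_deriv_nonpos (fun s => (hn s).differentiableAt)
    intro s
    rw [(hn s).deriv]
    have := hneg (expSemiC S (s * z) f)
    linarith
  have := anti (zero_le_one (α := ℝ))
  simp only [Complex.ofReal_one, one_mul, Complex.ofReal_zero, zero_mul, expSemiC_zero] at this
  exact (sq_le_sq₀ (norm_nonneg _) (norm_nonneg _)).1 this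

theorem hasSum_expSemi (t : ℝ) (f : Lp ℝ 2 m) :
    HasSum (fun n : ℕ => (Real.exp (-t) * ((n.factorial : ℝ)⁻¹ * t ^ n)) • (S ^ n) f) (expSemi S t f) := by
  have h := NormedSpace.exp_series_hasSum_exp' (𝕂 := ℝ) (t • S)
  have h2 := h.mapL (ContinuousLinearMap.apply ℝ (Lp ℝ 2 m) f)
  have h3 := h2.const_smul (Real.exp (-t))
  refine h3.congr_fun ?_ |> fun h => h
  intro n
  simp [smul_pow, mul_smul]

theorem expSemiC_ofReal (t : ℝ) (f : Lp ℝ 2 m) :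
    expSemiC S t (ofRealLp m f) = ofRealLp m (expSemi S t f) := by
  have h := NormedSpace.exp_series_hasSum_exp' (𝕂 := ℂ) ((t : ℂ) • complexify S)
  have h2 := h.mapL (ContinuousLinearMap.apply ℂ (Lp ℂ 2 m) (ofRealLp m f))
  have h3 := h2.const_smul (Complex.exp (-t))
  have h4 := (hasSum_expSemi (S := S) t f).mapL (ofRealLp m)
  refine h3.unique ?_
  refine h4.congr_fun ?_ |> fun h => h
  intro n
  simp only [smul_pow, ContinuousLinearMap.apply_apply, smul_apply, complexify_pow_ofReal, smul_smul]
  rw [← ofRealLp_smul]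
  congr 1
  push_cast
  ring

/-- The partial sums of the exponential series combine powers of S with nonnegative weights e^{-t}
tⁿ/n! of total at most 1. Since a ≥ 0 they keep the bound a, and the set of functions below a is
closed in L². -/
theorem IsSubMarkov.expSemi (hS : IsSubMarkov S) {t : ℝ} (ht : 0 ≤ t) : IsSubMarkov (expSemi S t) := by
  intro a ha f hf
  have hcl : IsClosed {f : Lp ℝ 2 m | ∀ᵐ x ∂m, f x ≤ a} := isClosed_setOf_le ha
  refine hcl.mem_of_tendsto (hasSum_expSemi (S := S) t f).tendsto_sum_nat (.of_forall fun N => ?_)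
  have hsum : Real.exp (-t) * ∑ n ∈ Finset.range N, ((n.factorial : ℝ)⁻¹ * t ^ n) ≤ 1 := by
    have := Real.sum_le_exp_of_nonneg ht N
    rw [Real.exp_neg, inv_mul_le_iff₀ (Real.exp_pos _), mul_one]
    refine le_trans (le_of_eq ?_) this
    refine Finset.sum_congr rfl fun n _ => ?_
    rw [div_eq_inv_mul]
  have hpart : ∀ N, ∀ᵐ x ∂m, (∑ n ∈ Finset.range N, (Real.exp (-t) * ((n.factorial : ℝ)⁻¹ * t ^ n)) • (S ^ n) f : Lp ℝ 2 m) x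
      ≤ (Real.exp (-t) * ∑ n ∈ Finset.range N, ((n.factorial : ℝ)⁻¹ * t ^ n)) * a := by
    intro N
    induction N with
    | zero =>
      filter_upwards [Lp.coeFn_zero ℝ 2 m] with x hx
      simp only [Finset.range_zero, Finset.sum_empty, mul_zero, zero_mul]
      rw [hx]; rfl
    | succ N ih =>
      rw [Finset.sum_range_succ, Finset.sum_range_succ]
      filter_upwards [ih, hS.pow N a ha f hf,
        Lp.coeFn_add (∑ n ∈ Finset.range N, (Real.exp (-t) * ((n.factorial : ℝ)⁻¹ * t ^ n)) • (S ^ n) f)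
          ((Real.exp (-t) * ((N.factorial : ℝ)⁻¹ * t ^ N)) • (S ^ N) f),
        Lp.coeFn_smul (Real.exp (-t) * ((N.factorial : ℝ)⁻¹ * t ^ N)) ((S ^ N) f)] with x h1 h2 h3 h4
      rw [h3, Pi.add_apply, h4, Pi.smul_apply, mul_add, add_mul, smul_eq_mul]
      gcongr
  filter_upwards [hpart N] with x hx
  refine hx.trans ?_
  calc _ ≤ 1 * a := by gcongr
    _ = a := one_mul a

theorem expSemi_symm (hsym : ∀ f g, inner ℝ (S f) g = inner ℝ f (S g)) (t : ℝ) (f g : Lp ℝ 2 m) :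
    inner ℝ (expSemi S t f) g = inner ℝ f (expSemi S t g) := by
  have hp : ∀ n : ℕ, ∀ f g, inner ℝ ((S ^ n) f) g = inner ℝ f ((S ^ n) g) := by
    intro n
    induction n with
    | zero => intro f g; simp
    | succ n ih =>
      intro f g
      rw [pow_succ, mul_apply_eq_comp, ih, hsym, ← mul_apply_eq_comp, ← pow_succ']
      rw [pow_succ]
  have h1 := (hasSum_expSemi (S := S) t f).mapL (innerSL ℝ g)
  have h2 := (hasSum_expSemi (S := S) t g).mapL (innerSL ℝ f)
  have h3 : inner ℝ g (expSemi S t f) = inner ℝ f (expSemi S t g) := by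
    refine h1.unique ?_
    refine h2.congr_fun ?_ |> fun h => h
    intro n
    simp only [innerSL_apply_apply, inner_smul_right]
    rw [← hp, real_inner_comm]
  rw [← h3, real_inner_comm]

/-- The case of a real time in the complex contraction bound, pulled back through the isometric
embedding of real into complex L². -/
theorem norm_expSemi_le (hsym : ∀ f g, inner ℝ (S f) g = inner ℝ f (S g)) (hS : ‖S‖ ≤ 1)
    {t : ℝ} (ht : 0 ≤ t) (f : Lp ℝ 2 m) : ‖expSemi S t f‖ ≤ ‖f‖ := by
  rw [← norm_ofRealLp, ← norm_ofRealLp f, ← expSemiC_ofReal]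
  exact norm_expSemiC_le hsym hS (by simpa using ht) _

end

/-! ### Stein interpolation on a sector. -/

section

variable {X : Type*} [MeasurableSpace X] {m : Measure X} {S : Lp ℝ 2 m →L[ℝ] Lp ℝ 2 m}

/-- The indicator of the level set `{f = a}` of a simple function, as an element of `L²` if it is
square integrable. -/
def levelSet (m : Measure X) (f : SimpleFunc X ℝ) (a : ℝ) : Lp ℝ 2 m := by
  classical exact if h : m (f ⁻¹' {a}) ≠ ⊤ then
    indicatorConstLp 2 (f.measurableSet_preimage {a}) h (1 : ℝ) else 0

theorem levelSet_coe {f : SimpleFunc X ℝ} (hf : MemLp f 2 m) {a : ℝ} (ha : a ≠ 0) :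
    ∀ᵐ x ∂m, levelSet m f a x = (f ⁻¹' {a}).indicator (fun _ => 1) x := by
  have h : m (f ⁻¹' {a}) ≠ ⊤ :=
    (SimpleFunc.measure_preimage_lt_top_of_memLp (by simp) (by simp) f hf a ha).ne
  rw [levelSet, dif_pos h]
  exact indicatorConstLp_coeFn

/-- The nonzero values of a simple function. -/
def nonzeroRange (f : SimpleFunc X ℝ) : Finset ℝ := f.range.erase 0

/-- Composition of a simple function with an arbitrary `c` as a finite combination of level sets.
The level zero may have infinite measure, which is why it is left out and c 0 = 0 is required. -/
theorem sum_levelSet_coe {f : SimpleFunc X ℝ} (hf : MemLp f 2 m) (c : ℝ → ℝ) (hc : c 0 = 0) :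
    ∀ᵐ x ∂m, (∑ a ∈ nonzeroRange f, c a • levelSet m f a : Lp ℝ 2 m) x = c (f x) := by
  have h1 : ∀ᵐ x ∂m, ∀ a ∈ nonzeroRange f, levelSet m f a x = (f ⁻¹' {a}).indicator (fun _ => 1) x := by
    rw [Filter.eventually_all_finset]
    intro a ha
    exact levelSet_coe hf (Finset.ne_of_mem_erase ha)
  have h2 : ∀ s : Finset ℝ, ∀ᵐ x ∂m, (∑ a ∈ s, c a • levelSet m f a : Lp ℝ 2 m) x = ∑ a ∈ s, c a * levelSet m f a x := by
    intro s
    induction s using Finset.induction_on with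
    | empty =>
      filter_upwards [Lp.coeFn_zero ℝ 2 m] with x hx
      simp only [Finset.sum_empty]; rw [hx]; rfl
    | insert a s ha ih =>
      rw [Finset.sum_insert ha]
      filter_upwards [ih, Lp.coeFn_add (c a • levelSet m f a) (∑ a ∈ s, c a • levelSet m f a),
        Lp.coeFn_smul (c a) (levelSet m f a)] with x h1 h2 h3
      rw [h2, Pi.add_apply, h3, h1, Finset.sum_insert ha]; rfl
  filter_upwards [h1, h2 (nonzeroRange f)] with x h1 h2
  rw [h2, Finset.sum_congr rfl fun a ha => by rw [h1 a ha]]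
  by_cases hx : f x = 0
  · rw [hx, hc]
    refine Finset.sum_eq_zero fun a ha => ?_
    rw [indicator_of_notMem, mul_zero]
    intro h
    exact Finset.ne_of_mem_erase ha (by rw [← hx]; exact h.symm)
  · rw [Finset.sum_eq_single (f x)]
    · simp
    · intro a _ hne
      rw [indicator_of_notMem, mul_zero]
      exact fun h => hne h.symm
    · intro h
      exact absurd (Finset.mem_erase.2 ⟨hx, f.mem_range_self x⟩) h

theorem sum_levelSet_complex_norm {f : SimpleFunc X ℝ} (hf : MemLp f 2 m) (c : ℝ → ℂ) (hc : c 0 = 0) :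
    ‖∑ a ∈ nonzeroRange f, c a • ofRealLp m (levelSet m f a)‖ ^ 2 = ∫ x, ‖c (f x)‖ ^ 2 ∂m := by
  have e1 : reLp m (∑ a ∈ nonzeroRange f, c a • ofRealLp m (levelSet m f a)) =
      ∑ a ∈ nonzeroRange f, (c a).re • levelSet m f a := by
    rw [map_sum]; refine Finset.sum_congr rfl fun a _ => ?_
    rw [reLp_smul_eq, reLp_ofReal, imLp_ofReal, smul_zero, sub_zero]
  have e2 : imLp m (∑ a ∈ nonzeroRange f, c a • ofRealLp m (levelSet m f a)) =
      ∑ a ∈ nonzeroRange f, (c a).im • levelSet m f a := by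
    rw [map_sum]; refine Finset.sum_congr rfl fun a _ => ?_
    rw [imLp_smul_eq, reLp_ofReal, imLp_ofReal, smul_zero, zero_add]
  rw [norm_sq_Lp_complex, e1, e2, ← real_inner_self_eq_norm_sq, ← real_inner_self_eq_norm_sq,
    L2.inner_def, L2.inner_def, ← integral_add (L2.integrable_inner (𝕜 := ℝ) _ _) (L2.integrable_inner (𝕜 := ℝ) _ _)]
  refine integral_congr_ae ?_
  filter_upwards [sum_levelSet_coe hf (fun a => (c a).re) (by simp [hc]),
    sum_levelSet_coe hf (fun a => (c a).im) (by simp [hc])] with x h1 h2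
  rw [h1, h2, Complex.sq_norm, Complex.normSq_apply]
  simp
  ring

theorem toLp_eq_sum_levelSet {f : SimpleFunc X ℝ} (hf : MemLp f 2 m) :
    hf.toLp = ∑ a ∈ nonzeroRange f, a • levelSet m f a := by
  apply Lp.ext
  filter_upwards [hf.coeFn_toLp, sum_levelSet_coe hf (fun a => a) rfl] with x h1 h2
  rw [h1, h2]

/-- Analytic families of powers, `sign(y) |y|^(k)` with complex exponent. -/
def cpower (y : ℝ) (k : ℂ) : ℂ := ((SignType.sign y : SignType) : ℝ) * Complex.exp (Real.log |y| * k)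

theorem cpower_zero (k : ℂ) : cpower 0 k = 0 := by simp [cpower]

theorem cpower_one (y : ℝ) : cpower y 1 = y := by
  unfold cpower
  rcases eq_or_ne y 0 with h | h
  · simp [h]
  · rw [mul_one, ← Complex.ofReal_exp, Real.exp_log (by positivity), ← Complex.ofReal_mul, sign_mul_abs]

theorem norm_cpower {y : ℝ} (hy : y ≠ 0) (k : ℂ) : ‖cpower y k‖ = |y| ^ k.re := by
  unfold cpower
  rw [norm_mul, Complex.norm_exp]
  have : ‖(((SignType.sign y : SignType) : ℝ) : ℂ)‖ = 1 := by
    rcases lt_or_gt_of_ne hy with h | h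
    · rw [sign_neg h]; simp
    · rw [sign_pos h]; simp
  rw [this, one_mul, Real.rpow_def_of_pos (by positivity)]
  congr 1
  rw [Complex.re_ofReal_mul]

theorem differentiable_cpower (y : ℝ) {k : ℂ → ℂ} (hk : Differentiable ℂ k) :
    Differentiable ℂ fun z => cpower y (k z) := by
  unfold cpower
  fun_prop

theorem differentiable_pairing (S : Lp ℝ 2 m →L[ℝ] Lp ℝ 2 m) (f g : Lp ℂ 2 m) :
    Differentiable ℂ fun z => inner ℂ g (expSemiC S z f) := by
  intro z
  have h3 := (ContinuousLinearMap.apply ℂ (Lp ℂ 2 m) f).hasFDerivAt.comp_hasDerivAt z (hasDerivAt_expSemiC S z)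
  have h4 := (innerSL ℂ g).hasFDerivAt.comp_hasDerivAt z h3
  exact h4.differentiableAt

/-- The contraction property on `L^p`, `1 < p < 2`, for complex times, by Stein interpolation. -/
theorem norm_pairing_le_of_arg (hS : IsSubMarkov S) (hsym : ∀ f g, inner ℝ (S f) g = inner ℝ f (S g))
    (hS1 : ‖S‖ ≤ 1) {p p' : ℝ} (hpp : p.HolderConjugate p') (hp2 : p < 2)
    {f g : SimpleFunc X ℝ} (hf : MemLp f 2 m) (hg : MemLp g 2 m)
    {z : ℂ} (hz0 : z ≠ 0) (hz : |z.arg| ≤ Real.pi / 2 * (2 / p')) :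
    ‖inner ℂ (ofRealLp m hg.toLp) (expSemiC S z (ofRealLp m hf.toLp))‖
      ≤ (∫ x, |f x| ^ p ∂m) ^ (1 / p) * (∫ x, |g x| ^ p' ∂m) ^ (1 / p') := by
  have hp0 := hpp.pos
  have hp'0 := hpp.symm.pos
  have hp1 := hpp.lt
  -- The parameter with 1/p = (1 - θ)/1 + θ/2: L^p lies at θ between L¹ and L². It is strictly
  -- between 0 and 1 because 1 < p < 2.
  set θ : ℝ := 2 / p' with hθ
  have hsum := hpp.inv_add_inv_eq_one
  have hp'2 : 2 < p' := by
    by_contra h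
    push Not at h
    have h1 : (1:ℝ) / 2 < p⁻¹ := by rw [one_div]; exact inv_strictAnti₀ hp0 hp2
    have h2 : (1:ℝ) / 2 ≤ p'⁻¹ := by rw [one_div]; exact inv_anti₀ hp'0 h
    linarith
  have hθ0 : 0 < θ := by positivity
  have hθ1 : θ < 1 := by rw [hθ, div_lt_one hp'0]; exact hp'2
  set φ : ℝ := z.arg / θ with hφ
  have hφb : |φ| ≤ Real.pi / 2 := by
    rw [hφ, abs_div, abs_of_pos hθ0, div_le_iff₀ hθ0]; exact hz
  -- The complex time varies with ζ. It is a positive real number on the line Re ζ = 0, equals z at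
  -- ζ = θ, and has argument φ Re ζ, so it stays in the closed right half plane on the strip because
  -- |φ| ≤ π/2.
  set Z : ℂ → ℂ := fun ζ => ‖z‖ * Complex.exp (Complex.I * φ * ζ) with hZ
  have hZre : ∀ ζ : ℂ, ζ ∈ Complex.HadamardThreeLines.verticalClosedStrip 0 1 → 0 ≤ (Z ζ).re := by
    intro ζ hζ
    have h01 : ζ.re ∈ Icc (0:ℝ) 1 := hζ
    rw [hZ, Complex.re_ofReal_mul, Complex.exp_re]
    have him : (Complex.I * φ * ζ).im = φ * ζ.re := by simp [mul_assoc]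
    rw [him]
    have : |φ * ζ.re| ≤ Real.pi / 2 := by
      rw [abs_mul, abs_of_nonneg h01.1]
      calc _ ≤ Real.pi / 2 * 1 := mul_le_mul hφb h01.2 h01.1 (by positivity)
        _ = _ := mul_one _
    have hc := Real.cos_nonneg_of_mem_Icc (abs_le.1 this |> fun h => ⟨by linarith [h.1], h.2⟩)
    positivity
  set R := nonzeroRange f
  set Q := nonzeroRange g
  -- Both exponents equal 1 at ζ = θ, where `f` and `g` are recovered. On Re ζ = 0 the moduli are
  -- |f|^p and the indicator of {g ≠ 0}; on Re ζ = 1 they are |f|^{p/2} and |g|^{p'/2}, which are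
  -- controlled in L².
  set u : ℂ → ℝ → ℂ := fun ζ a => cpower a (p * (1 - ζ / 2)) with hu
  set v : ℂ → ℝ → ℂ := fun ζ b => cpower b (p' * (ζ / 2)) with hv
  set h : ℝ → ℝ → ℂ → ℂ := fun a b w => inner ℂ (ofRealLp m (levelSet m g b)) (expSemiC S w (ofRealLp m (levelSet m f a))) with hh
  set F : ℂ → ℂ := fun ζ => ∑ a ∈ R, ∑ b ∈ Q, u ζ a * v ζ b * h a b (Z ζ) with hF
  have hFinner : ∀ ζ, F ζ = inner ℂ (∑ b ∈ Q, (starRingEnd ℂ) (v ζ b) • ofRealLp m (levelSet m g b))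
      (expSemiC S (Z ζ) (∑ a ∈ R, u ζ a • ofRealLp m (levelSet m f a))) := by
    intro ζ
    simp only [hF, map_sum, inner_sum, sum_inner, map_smul, inner_smul_left, inner_smul_right,
      Complex.conj_conj, hh]
    refine Finset.sum_congr rfl fun a _ => ?_
    rw [Finset.mul_sum]
    refine Finset.sum_congr rfl fun b _ => ?_
    ring
  have hdiff : Differentiable ℂ F := by
    have hZd : Differentiable ℂ Z := by rw [hZ]; fun_prop
    rw [hF]
    refine Differentiable.fun_sum fun a _ => Differentiable.fun_sum fun b _ => ?_
    refine ((differentiable_cpower a (by fun_prop)).mul (differentiable_cpower b (by fun_prop))).mul ?_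
    exact (differentiable_pairing S _ _).comp hZd
  have hRne : ∀ a ∈ R, a ≠ 0 := fun a ha => Finset.ne_of_mem_erase ha
  have hQne : ∀ a ∈ Q, a ≠ 0 := fun a ha => Finset.ne_of_mem_erase ha
  set Nf := ∫ x, |f x| ^ p ∂m with hNf
  set Ng := ∫ x, |g x| ^ p' ∂m with hNg
  have hNf0 : 0 ≤ Nf := integral_nonneg fun x => by positivity
  have hNg0 : 0 ≤ Ng := integral_nonneg fun x => by positivity
  have ure : ∀ ζ : ℂ, ((p : ℂ) * (1 - ζ / 2)).re = p * (1 - ζ.re / 2) := by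
    intro ζ
    rw [Complex.re_ofReal_mul]; simp
  have vre : ∀ ζ : ℂ, ((p' : ℂ) * (ζ / 2)).re = p' * (ζ.re / 2) := by
    intro ζ
    rw [Complex.re_ofReal_mul]; simp
  have hbdd : BddAbove ((norm ∘ F) '' Complex.HadamardThreeLines.verticalClosedStrip 0 1) := by
    refine ⟨∑ a ∈ R, ∑ b ∈ Q, max (|a| ^ p) 1 * max (|b| ^ p') 1 * (‖ofRealLp m (levelSet m g b)‖ * ‖ofRealLp m (levelSet m f a)‖), ?_⟩
    rintro _ ⟨ζ, hζ, rfl⟩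
    have h01 : ζ.re ∈ Icc (0:ℝ) 1 := hζ
    have pow_le : ∀ (y e e' : ℝ), 0 ≤ y → 0 ≤ e → e ≤ e' → y ^ e ≤ max (y ^ e') 1 := by
      intro y e e' hy he hee
      rcases le_total y 1 with h | h
      · exact (Real.rpow_le_one hy h he).trans (le_max_right _ _)
      · exact (Real.rpow_le_rpow_of_exponent_le h hee).trans (le_max_left _ _)
    simp only [Function.comp, hF]
    refine (norm_sum_le _ _).trans (Finset.sum_le_sum fun a ha => ?_)
    refine (norm_sum_le _ _).trans (Finset.sum_le_sum fun b hb => ?_)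
    rw [norm_mul, norm_mul]
    have e1 : ‖u ζ a‖ ≤ max (|a| ^ p) 1 := by
      rw [hu, norm_cpower (hRne a ha), ure]
      refine pow_le _ _ _ (abs_nonneg _) ?_ ?_
      · have := h01.2; have := h01.1; have : 0 ≤ 1 - ζ.re / 2 := by linarith
        positivity
      · have := h01.1; nlinarith
    have e2 : ‖v ζ b‖ ≤ max (|b| ^ p') 1 := by
      rw [hv, norm_cpower (hQne b hb), vre]
      refine pow_le _ _ _ (abs_nonneg _) ?_ ?_
      · have := h01.1; positivity
      · have := h01.2; nlinarith
    have e3 : ‖h a b (Z ζ)‖ ≤ ‖ofRealLp m (levelSet m g b)‖ * ‖ofRealLp m (levelSet m f a)‖ := by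
      refine (norm_inner_le_norm _ _).trans ?_
      gcongr
      exact norm_expSemiC_le hsym hS1 (hZre ζ hζ) _
    gcongr
  -- bound on the line `Re ζ = 0`
  have hleft : ∀ ζ ∈ Complex.re ⁻¹' {0}, ‖F ζ‖ ≤ Nf := by
    intro ζ hζ
    have hζ0 : ζ.re = 0 := hζ
    set τ : ℝ := ‖z‖ * Real.exp (-(φ * ζ.im)) with hτ
    have hτ0 : 0 ≤ τ := by positivity
    have hZτ : Z ζ = τ := by
      have : Complex.I * φ * ζ = ((-(φ * ζ.im) : ℝ) : ℂ) := by
        conv_lhs => rw [← Complex.re_add_im ζ, hζ0]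
        push_cast
        linear_combination (φ : ℂ) * ζ.im * Complex.I_mul_I
      simp only [hZ]
      rw [this, hτ]; push_cast; rfl
    -- At a real time the operator preserves positivity, so its matrix entries between indicators
    -- are nonnegative and absolute values can be taken term by term.
    have hpos : ∀ a ∈ R, ∀ b ∈ Q, 0 ≤ inner ℝ (levelSet m g b) (expSemi S τ (levelSet m f a)) := by
      intro a ha b hb
      rw [L2.inner_def]
      refine integral_nonneg_of_ae ?_
      have h1 := (hS.expSemi hτ0).nonneg (f := levelSet m f a) (by
        filter_upwards [levelSet_coe hf (hRne a ha)] with x hx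
        rw [hx]; exact indicator_nonneg (fun _ _ => zero_le_one) x)
      filter_upwards [h1, levelSet_coe hg (hQne b hb)] with x h1 h2
      rw [h2]
      simp only [RCLike.inner_apply, conj_trivial, Pi.zero_apply]
      exact mul_nonneg h1 (indicator_nonneg (fun _ _ => zero_le_one) x)
    have step1 : ‖F ζ‖ ≤ ∑ a ∈ R, ∑ b ∈ Q, |a| ^ p * inner ℝ (levelSet m g b) (expSemi S τ (levelSet m f a)) := by
      simp only [hF]
      refine (norm_sum_le _ _).trans (Finset.sum_le_sum fun a ha => ?_)
      refine (norm_sum_le _ _).trans (Finset.sum_le_sum fun b hb => ?_)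
      rw [norm_mul, norm_mul, hu, hv]
      simp only
      rw [norm_cpower (hRne a ha), norm_cpower (hQne b hb), ure, vre, hζ0, hh]
      simp only
      rw [hZτ, expSemiC_ofReal, inner_ofRealLp, Complex.norm_real, Real.norm_of_nonneg (hpos a ha b hb)]
      simp
    have step2 : ∑ a ∈ R, ∑ b ∈ Q, |a| ^ p * inner ℝ (levelSet m g b) (expSemi S τ (levelSet m f a))
        = inner ℝ (∑ a ∈ R, |a| ^ p • levelSet m f a) (expSemi S τ (∑ b ∈ Q, (1:ℝ) • levelSet m g b)) := by
      simp only [map_sum, inner_sum, sum_inner, map_smul, inner_smul_left, inner_smul_right, one_mul]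
      rw [Finset.sum_comm]
      refine Finset.sum_congr rfl fun b _ => Finset.sum_congr rfl fun a _ => ?_
      rw [← expSemi_symm hsym, real_inner_comm]
      simp
    refine step1.trans ?_
    rw [step2, L2.inner_def]
    have hcoeF := sum_levelSet_coe hf (fun a => |a| ^ p) (by simp [Real.zero_rpow hp0.ne'])
    have hcoeG := sum_levelSet_coe hg (fun a => if a = 0 then 0 else 1) (by simp)
    have hG1 : (∑ b ∈ Q, (1:ℝ) • levelSet m g b) = ∑ b ∈ Q, (if b = 0 then (0:ℝ) else 1) • levelSet m g b :=
      Finset.sum_congr rfl fun b hb => by rw [if_neg (hQne b hb)]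
    -- Moving the operator to the other side by symmetry, it acts on the indicator of {g ≠ 0} and
    -- the result is at most 1. This is the L¹–L^∞ endpoint.
    have hle1 : ∀ᵐ x ∂m, expSemi S τ (∑ b ∈ Q, (1:ℝ) • levelSet m g b) x ≤ 1 := by
      refine hS.expSemi hτ0 1 zero_le_one _ ?_
      rw [hG1]
      filter_upwards [hcoeG] with x hx
      rw [hx]; split_ifs <;> norm_num
    have hint : Integrable (fun x => |f x| ^ p) m := by
      have : MemLp f (ENNReal.ofReal p) m := by
        rw [SimpleFunc.memLp_iff (by simpa using hp0) (by simp)]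
        exact (SimpleFunc.memLp_iff (by simp) (by simp)).1 hf
      have := this.integrable_norm_rpow (by simpa using hp0) (by simp)
      simpa [ENNReal.toReal_ofReal hp0.le] using this
    refine integral_mono_ae (L2.integrable_inner (𝕜 := ℝ) _ _) hint ?_
    filter_upwards [hcoeF, hle1] with x h1 h2
    simp only [RCLike.inner_apply, conj_trivial]
    rw [h1]
    have : 0 ≤ |f x| ^ p := by positivity
    nlinarith
  -- bound on the line `Re ζ = 1`
  have hright : ∀ ζ ∈ Complex.re ⁻¹' {1}, ‖F ζ‖ ≤ √Nf * √Ng := by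
    intro ζ hζ
    have hζ1 : ζ.re = 1 := hζ
    rw [hFinner]
    refine (norm_inner_le_norm _ _).trans ?_
    rw [mul_comm]
    have hstrip : ζ ∈ Complex.HadamardThreeLines.verticalClosedStrip 0 1 := by
      show ζ.re ∈ Icc (0:ℝ) 1
      rw [hζ1]; simp
    have sqp : ∀ (y e : ℝ), 0 ≤ y → (y ^ (e * (1/2))) ^ 2 = y ^ e := by
      intro y e hy
      rw [← Real.rpow_natCast, ← Real.rpow_mul hy]; congr 1; push_cast; ring
    gcongr
    · refine (norm_expSemiC_le hsym hS1 (hZre ζ hstrip) _).trans ?_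
      refine Real.le_sqrt_of_sq_le ?_
      rw [sum_levelSet_complex_norm hf (u ζ) (cpower_zero _)]
      refine le_of_eq (integral_congr_ae (.of_forall fun x => ?_))
      simp only [hu]
      by_cases hx : f x = 0
      · rw [hx, cpower_zero, abs_zero, Real.zero_rpow hp0.ne']; simp
      · rw [norm_cpower hx, ure, hζ1, show (1:ℝ) - 1/2 = 1/2 by norm_num, sqp _ _ (abs_nonneg _)]
    · refine Real.le_sqrt_of_sq_le ?_
      rw [sum_levelSet_complex_norm hg (fun b => (starRingEnd ℂ) (v ζ b)) (by simp [hv, cpower_zero])]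
      refine le_of_eq (integral_congr_ae (.of_forall fun x => ?_))
      simp only [hv, RCLike.norm_conj]
      by_cases hx : g x = 0
      · rw [hx, cpower_zero, abs_zero, Real.zero_rpow hp'0.ne']; simp
      · rw [norm_cpower hx, vre, hζ1, sqp _ _ (abs_nonneg _)]
  have hstripθ : (θ : ℂ) ∈ Complex.HadamardThreeLines.verticalClosedStrip 0 1 := by
    show (θ : ℂ).re ∈ Icc (0:ℝ) 1
    rw [Complex.ofReal_re]; exact ⟨hθ0.le, hθ1.le⟩
  have main := Complex.HadamardThreeLines.norm_le_interp_of_mem_verticalClosedStrip₀₁' F hstripθ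
    hdiff.diffContOnCl hbdd hleft hright
  have hZθ : Z θ = z := by
    simp only [hZ]
    have : Complex.I * φ * θ = z.arg * Complex.I := by
      rw [hφ]; push_cast
      have : (θ : ℂ) ≠ 0 := by exact_mod_cast hθ0.ne'
      field_simp
    rw [this]; exact Complex.norm_mul_exp_arg_mul_I z
  have hp'inv : p' * (θ / 2) = 1 := by rw [hθ]; field_simp
  have hpinv : p * (1 - θ / 2) = 1 := by
    have h1 : θ / 2 = p'⁻¹ := by rw [hθ]; field_simp
    rw [h1, show 1 - p'⁻¹ = p⁻¹ by linarith]; exact mul_inv_cancel₀ hp0.ne'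
  have hFθ : F θ = inner ℂ (ofRealLp m hg.toLp) (expSemiC S z (ofRealLp m hf.toLp)) := by
    rw [hFinner, hZθ, toLp_eq_sum_levelSet hf, toLp_eq_sum_levelSet hg]
    have e1 : ∀ a, u θ a = a := fun a => by
      simp only [hu]
      rw [show (p : ℂ) * (1 - θ / 2) = 1 by exact_mod_cast hpinv, cpower_one]
    have e2 : ∀ a, v θ a = a := fun a => by
      simp only [hv]
      rw [show (p' : ℂ) * (θ / 2) = 1 by exact_mod_cast hp'inv, cpower_one]
    simp only [e1, e2, Complex.conj_ofReal, ofRealLp_smul, ← map_sum, R, Q]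
  rw [← hFθ]
  refine main.trans (le_of_eq ?_)
  rw [Complex.ofReal_re, Real.sqrt_eq_rpow, Real.sqrt_eq_rpow, Real.mul_rpow (by positivity) (by positivity),
    ← Real.rpow_mul hNf0, ← Real.rpow_mul hNg0, ← mul_assoc]
  have e1 : 1 / p = (1 - θ) + 1 / 2 * θ := by
    have h1 : θ / 2 = p'⁻¹ := by rw [hθ]; field_simp
    rw [one_div]; linarith
  have e2 : 1 / p' = 1 / 2 * θ := by rw [hθ]; field_simp
  rw [e1, e2, Real.rpow_add_of_nonneg hNf0 (by linarith) (by positivity)]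

end

/-! ### Analyticity on L^p and passage from bounded generators to the heat semigroup. -/

section

variable {X : Type*} [MeasurableSpace X] {m : Measure X} {S : Lp ℝ 2 m →L[ℝ] Lp ℝ 2 m}

/-- `T` satisfies `|⟨T f, g⟩| ≤ K ‖f‖_p ‖g‖_p'` on simple functions. -/
def PairingBound (T : Lp ℝ 2 m →L[ℝ] Lp ℝ 2 m) (p p' : ℝ≥0∞) (K : ℝ) : Prop :=
  ∀ (f g : SimpleFunc X ℝ) (hf : MemLp f 2 m) (hg : MemLp g 2 m),
    |inner ℝ hg.toLp (T hf.toLp)| ≤ K * (eLpNorm f p m).toReal * (eLpNorm g p' m).toReal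

/-- A disk in the sector on which Cauchy's estimate can be applied, with radius proportional to t.
The factor ½ keeps |w| ≥ t/2, and then |Im w| ≤ (sin β) t/2 ≤ sin β |w|. -/
theorem arg_le_of_mem_closedBall {β t : ℝ} (hβ0 : 0 < β) (hβ : β < Real.pi / 2) (ht : 0 < t) {w : ℂ}
    (hw : ‖w - t‖ ≤ Real.sin β / 2 * t) : w ≠ 0 ∧ |w.arg| ≤ β := by
  have hs1 : Real.sin β ≤ 1 := Real.sin_le_one β
  have hs0 : 0 < Real.sin β := Real.sin_pos_of_pos_of_lt_pi hβ0 (by linarith [Real.pi_pos])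
  have hre : t / 2 ≤ w.re := by
    have h1 : |(w - t).re| ≤ ‖w - t‖ := Complex.abs_re_le_norm _
    have h2 : Real.sin β / 2 * t ≤ t / 2 := by nlinarith
    have := (abs_le.1 (h1.trans (hw.trans h2))).1
    simp at this; linarith
  have hw0 : w ≠ 0 := by
    rintro rfl
    simp at hre; linarith
  refine ⟨hw0, ?_⟩
  have hnorm : 0 < ‖w‖ := norm_pos_iff.2 hw0
  have hnre : t / 2 ≤ ‖w‖ := hre.trans (Complex.re_le_norm w)
  have him : |w.im| ≤ Real.sin β * ‖w‖ := by
    have h1 : |(w - t).im| ≤ ‖w - t‖ := Complex.abs_im_le_norm _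
    simp only [Complex.sub_im, Complex.ofReal_im, sub_zero] at h1
    nlinarith
  have harg : |w.arg| ≤ Real.pi / 2 := Complex.abs_arg_le_pi_div_two_iff.2 (by linarith)
  have hsin : Real.sin |w.arg| ≤ Real.sin β := by
    have : Real.sin |w.arg| = |Real.sin w.arg| := by
      rcases le_total 0 w.arg with h | h
      · rw [abs_of_nonneg h, abs_of_nonneg (Real.sin_nonneg_of_nonneg_of_le_pi h (Complex.arg_le_pi w))]
      · rw [abs_of_nonpos h, Real.sin_neg, abs_of_nonpos]
        exact Real.sin_nonpos_of_nonpos_of_neg_pi_le h (Complex.neg_pi_lt_arg w).le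
    rw [this, Complex.sin_arg, abs_div, abs_of_pos hnorm, div_le_iff₀ hnorm]
    exact him
  by_contra hcon
  push Not at hcon
  have := Real.strictMonoOn_sin ⟨by linarith, hβ.le⟩ ⟨by linarith [abs_nonneg w.arg], harg⟩ hcon
  linarith

theorem simpleFunc_lpNorm {p : ℝ} (hp : 0 < p) {f : SimpleFunc X ℝ} (hf : MemLp f 2 m) :
    (∫ x, |f x| ^ p ∂m) ^ (1 / p) = (eLpNorm f (ENNReal.ofReal p) m).toReal := by
  have hmem : MemLp f (ENNReal.ofReal p) m := by
    rw [SimpleFunc.memLp_iff (by simpa using hp) (by simp)]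
    exact (SimpleFunc.memLp_iff (by simp) (by simp)).1 hf
  rw [hmem.eLpNorm_eq_integral_rpow_norm (by simpa using hp) (by simp), ENNReal.toReal_ofReal hp.le,
    ENNReal.toReal_ofReal (by positivity), one_div]
  simp

/-- The derivative of t ↦ exp(tS) has two expressions, with S on the left and on the right;
uniqueness of the derivative equates them. -/
theorem expSemi_commute (S : Lp ℝ 2 m →L[ℝ] Lp ℝ 2 m) (t : ℝ) :
    S * expSemi S t = expSemi S t * S := by
  unfold expSemi
  rw [mul_smul_comm, smul_mul_assoc]
  congr 1
  have h1 := hasDerivAt_exp_smul_const' (𝕂 := ℝ) S t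
  have h2 := hasDerivAt_exp_smul_const (𝕂 := ℝ) S t
  exact h1.unique h2

/-- Analyticity of symmetric sub-Markovian semigroups on `L^p`, `1 < p < 2`, for bounded
generators. -/
theorem exists_pairingBound (X : Type*) [MeasurableSpace X] (m : Measure X) {p p' : ℝ}
    (hpp : p.HolderConjugate p') (hp2 : p < 2) :
    ∃ C : ℝ, 0 < C ∧ ∀ S : Lp ℝ 2 m →L[ℝ] Lp ℝ 2 m, IsSubMarkov S →
      (∀ f g, inner ℝ (S f) g = inner ℝ f (S g)) → ‖S‖ ≤ 1 → ∀ t, 0 < t →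
      PairingBound (expSemi S t) (ENNReal.ofReal p) (ENNReal.ofReal p') 1 ∧
      PairingBound (S * expSemi S t - expSemi S t) (ENNReal.ofReal p) (ENNReal.ofReal p') (C / t) := by
  have hp0 := hpp.pos
  have hp'0 := hpp.symm.pos
  have hsum := hpp.inv_add_inv_eq_one
  have hp'2 : 2 < p' := by
    by_contra h
    push Not at h
    have h1 : (1:ℝ) / 2 < p⁻¹ := by rw [one_div]; exact inv_strictAnti₀ hp0 hp2
    have h2 : (1:ℝ) / 2 ≤ p'⁻¹ := by rw [one_div]; exact inv_anti₀ hp'0 h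
    linarith
  set β := Real.pi / 2 * (2 / p') with hβ
  have hβ0 : 0 < β := by have := Real.pi_pos; positivity
  have hβ1 : β < Real.pi / 2 := by
    have : 2 / p' < 1 := by rw [div_lt_one hp'0]; exact hp'2
    have := Real.pi_pos
    nlinarith
  have hs0 : 0 < Real.sin β := Real.sin_pos_of_pos_of_lt_pi hβ0 (by linarith [Real.pi_pos])
  -- The constant is the reciprocal of the relative radius of the Cauchy disk. It depends on p
  -- alone, through β, and not on S or on the measure space.
  refine ⟨(Real.sin β / 2)⁻¹, by positivity, fun S hS hsym hS1 t ht => ⟨?_, ?_⟩⟩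
  · intro f g hf hg
    have := norm_pairing_le_of_arg hS hsym hS1 hpp hp2 hf hg (z := t) (by exact_mod_cast ht.ne')
      (by rw [Complex.arg_ofReal_of_nonneg ht.le, abs_zero]; exact hβ0.le)
    rw [expSemiC_ofReal, inner_ofRealLp, Complex.norm_real, simpleFunc_lpNorm hp0 hf,
      simpleFunc_lpNorm hp'0 hg] at this
    rwa [one_mul]
  · intro f g hf hg
    set F : ℂ → ℂ := fun z => inner ℂ (ofRealLp m hg.toLp) (expSemiC S z (ofRealLp m hf.toLp)) with hF
    have hd : HasDerivAt F (inner ℂ (ofRealLp m hg.toLp)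
        ((complexify S * expSemiC S t - expSemiC S t) (ofRealLp m hf.toLp))) t := by
      have h3 := (ContinuousLinearMap.apply ℂ (Lp ℂ 2 m) (ofRealLp m hf.toLp)).hasFDerivAt.comp_hasDerivAt
        (t : ℂ) (hasDerivAt_expSemiC S t)
      exact (innerSL ℂ (ofRealLp m hg.toLp)).hasFDerivAt.comp_hasDerivAt (t : ℂ) h3
    have hR : 0 < Real.sin β / 2 * t := by positivity
    have := Complex.norm_deriv_le_of_forall_mem_sphere_norm_le (c := t) hR
      (differentiable_pairing S (ofRealLp m hf.toLp) (ofRealLp m hg.toLp)).diffContOnCl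
      (C := (eLpNorm f (ENNReal.ofReal p) m).toReal * (eLpNorm g (ENNReal.ofReal p') m).toReal) (by
        intro z hz
        have hz' : ‖z - t‖ ≤ Real.sin β / 2 * t := (mem_sphere_iff_norm.1 hz).le
        obtain ⟨h1, h2⟩ := arg_le_of_mem_closedBall hβ0 hβ1 ht hz'
        have := norm_pairing_le_of_arg hS hsym hS1 hpp hp2 hf hg h1 h2
        rwa [simpleFunc_lpNorm hp0 hf, simpleFunc_lpNorm hp'0 hg] at this)
    have hd' := hd.deriv
    rw [hF] at hd'
    rw [hd'] at this
    have e : (complexify S * expSemiC S t - expSemiC S t) (ofRealLp m hf.toLp)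
        = ofRealLp m ((S * expSemi S t - expSemi S t) hf.toLp) := by
      rw [sub_apply, sub_apply, mul_apply_eq_comp, mul_apply_eq_comp, expSemiC_ofReal, complexify_ofReal, map_sub]
    rw [e, inner_ofRealLp, Complex.norm_real, Real.norm_eq_abs] at this
    refine this.trans (le_of_eq ?_)
    field_simp

theorem memLp_simpleFunc_of_two {f : SimpleFunc X ℝ} (hf : MemLp f 2 m) (p : ℝ≥0∞) : MemLp f p m := by
  rcases eq_or_ne p 0 with rfl | h0
  · exact f.memLp_zero m
  rcases eq_or_ne p ⊤ with rfl | h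
  · exact f.memLp_top m
  rw [SimpleFunc.memLp_iff h0 h]
  exact (SimpleFunc.memLp_iff (by simp) (by simp)).1 hf

theorem enorm_integral_eq_inner (f g : Lp ℝ 2 m) : ‖∫ x, f x * g x ∂m‖ₑ = ENNReal.ofReal |inner ℝ f g| := by
  rw [integral_mul_eq_inner, ← ofReal_norm, Real.norm_eq_abs]

/-- From a bound for the pairing on simple functions to operator bounds on `L² ∩ L^p`. -/
theorem PairingBound.eLpNorm_le {T : Lp ℝ 2 m →L[ℝ] Lp ℝ 2 m} {p p' : ℝ≥0∞} [p.HolderConjugate p'] {K : ℝ}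
    (hK : 0 ≤ K) (h : PairingBound T p p' K) (hT : ∀ f g, inner ℝ (T f) g = inner ℝ f (T g))
    (hp1 : 1 < p) (hp : p ≠ ⊤) {f : Lp ℝ 2 m} (hf : MemLp f p m) :
    eLpNorm (T f) p m ≤ ENNReal.ofReal K * eLpNorm f p m := by
  have hp'1 : 1 < p' := (ENNReal.HolderConjugate.lt_top_iff_one_lt p p').1 hp.lt_top
  have hp' : p' ≠ ⊤ := ((ENNReal.HolderConjugate.lt_top_iff_one_lt p' p).2 hp1).ne
  -- Duality is used twice: first to bound T on simple functions in L^{p'}, and then, through the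
  -- symmetry of T, to bound T f in L^p for general f.
  have step : ∀ g : SimpleFunc X ℝ, ∀ hg : MemLp g 2 m,
      eLpNorm (T hg.toLp) p' m ≤ ENNReal.ofReal K * eLpNorm g p' m := by
    intro g hg
    have := ENNReal.HolderConjugate.symm (p := p) (q := p')
    refine eLpNorm_le_of_simpleFunc (p' := p) hp'1 hp' (Lp.memLp _)
      (ENNReal.mul_ne_top (by simp) (memLp_simpleFunc_of_two hg p').eLpNorm_ne_top) ?_
    intro φ hφ _
    have e : ∫ x, T hg.toLp x * φ x ∂m = ∫ x, T hg.toLp x * (hφ.toLp φ : Lp ℝ 2 m) x ∂m := by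
      refine integral_congr_ae ?_
      filter_upwards [hφ.coeFn_toLp] with x hx
      rw [hx]
    rw [e, enorm_integral_eq_inner, hT]
    have := ENNReal.ofReal_le_ofReal (h φ g hφ hg)
    rw [ENNReal.ofReal_mul (by positivity), ENNReal.ofReal_mul hK,
      ENNReal.ofReal_toReal (memLp_simpleFunc_of_two hg p').eLpNorm_ne_top,
      ENNReal.ofReal_toReal (memLp_simpleFunc_of_two hφ p).eLpNorm_ne_top] at this
    refine this.trans (le_of_eq (by ring))
  refine eLpNorm_le_of_simpleFunc (p' := p') hp1 hp (Lp.memLp _)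
    (ENNReal.mul_ne_top (by simp) hf.eLpNorm_ne_top) ?_
  intro φ hφ _
  have e : ∫ x, T f x * φ x ∂m = ∫ x, f x * T hφ.toLp x ∂m := by
    rw [integral_mul_eq_inner, ← hT, ← integral_mul_eq_inner]
    refine integral_congr_ae ?_
    filter_upwards [hφ.coeFn_toLp] with x hx
    rw [hx]
  rw [e]
  refine (enorm_integral_mul_le (p := p) (p' := p') hf.1 (Lp.aestronglyMeasurable _)).trans ?_
  calc _ ≤ eLpNorm f p m * (ENNReal.ofReal K * eLpNorm φ p' m) := by gcongr; exact step φ hφ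
    _ = _ := by ring

theorem PairingBound.symm {T : Lp ℝ 2 m →L[ℝ] Lp ℝ 2 m} {p p' : ℝ≥0∞} {K : ℝ}
    (h : PairingBound T p p' K) (hT : ∀ f g, inner ℝ (T f) g = inner ℝ f (T g)) :
    PairingBound T p' p K := by
  intro f g hf hg
  rw [← hT, real_inner_comm]
  refine (h g f hg hf).trans (le_of_eq (by ring))

/-- Lower semicontinuity of the `L^p` norm under `L²` convergence. -/
theorem eLpNorm_le_of_tendsto {ι : Type*} {l : Filter ι} [l.NeBot] [l.IsCountablyGenerated]
    {f : ι → Lp ℝ 2 m} {g : Lp ℝ 2 m} (h : Tendsto f l (𝓝 g)) {p K : ℝ≥0∞}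
    (hb : ∀ᶠ i in l, eLpNorm (f i) p m ≤ K) : eLpNorm g p m ≤ K := by
  have h1 := tendstoInMeasure_of_tendsto_Lp h
  obtain ⟨ns, hns, hae⟩ := h1.exists_seq_tendsto_ae'
  exact Lp.eLpNorm_le_of_ae_tendsto (u := atTop) (hns.eventually hb)
    (fun n => Lp.aestronglyMeasurable _) hae

variable {E : DirichletForm m}

namespace HeatSemigroup

variable (H : HeatSemigroup E) {t : ℝ}

theorem opNorm_P_le (ht : 0 < t) : ‖H.P t‖ ≤ 1 :=
  ContinuousLinearMap.opNorm_le_bound _ zero_le_one fun f => by rw [one_mul]; exact H.norm_P_le f ht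

/-- The difference quotient `(P_ε - 1)/ε`. -/
def quot (ε : ℝ) (f : Lp ℝ 2 m) : Lp ℝ 2 m := ε⁻¹ • (H.P ε f - f)

theorem tendsto_quot {δ : ℝ} (hδ : 0 < δ) (f : Lp ℝ 2 m) :
    Tendsto (fun ε => H.quot ε (H.P δ f)) (𝓝[>] 0) (𝓝 (H.lap δ f)) := by
  have h := (H.hasDerivAt f hδ).tendsto_slope_zero_right
  refine h.congr' ?_
  filter_upwards [self_mem_nhdsWithin] with ε (hε : 0 < ε)
  rw [quot, ← H.P_add f hε hδ, add_comm]

/-- The curve s ↦ exp(-((t-s)/ε)(1 - P_ε)) P_{s+δ} f joins the two terms. Its derivative is the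
first operator applied to (Δ - (P_ε - 1)/ε) P_{s+δ} f, and since everything commutes with P_s it is
largest at s = 0. The preliminary flow by δ puts `f` in the domain of Δ. -/
theorem norm_expSemi_sub_le {ε δ : ℝ} (hε : 0 < ε) (hδ : 0 < δ) (ht : 0 < t) (f : Lp ℝ 2 m) :
    ‖expSemi (H.P ε) (t / ε) (H.P δ f) - H.P t (H.P δ f)‖ ≤ ‖H.quot ε (H.P δ f) - H.lap δ f‖ * t := by
  have hsym : ∀ f g, inner ℝ (H.P ε f) g = inner ℝ f (H.P ε g) := fun f g => H.P_symm f g hε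
  have hS1 := H.opNorm_P_le hε
  set φ : ℝ → Lp ℝ 2 m := fun s => expSemi (H.P ε) ((t - s) / ε) (H.P (s + δ) f) with hφ
  set φ' : ℝ → Lp ℝ 2 m := fun s => expSemi (H.P ε) ((t - s) / ε)
    (H.lap (s + δ) f - H.quot ε (H.P (s + δ) f)) with hφ'
  have hd : ∀ s ∈ Icc 0 t, HasDerivAt φ (φ' s) s := by
    intro s hs
    have h1 : HasDerivAt (fun s => (t - s) / ε) (-1 / ε) s := by
      have := ((hasDerivAt_id s).const_sub t).div_const ε
      simpa using this
    have h2 := HasDerivAt.scomp (g₁ := expSemi (H.P ε)) (h := fun s => (t - s) / ε) s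
      (hasDerivAt_expSemi (H.P ε) ((t - s) / ε)) h1
    change HasDerivAt (fun s => expSemi (H.P ε) ((t - s) / ε)) _ s at h2
    have h3 := (H.hasDerivAt f (t := s + δ) (by linarith [hs.1])).comp_add_const s δ
    refine (h2.clm_apply h3).congr_deriv ?_
    rw [hφ', expSemi_commute]
    simp only [quot, smul_apply, sub_apply, mul_apply_eq_comp, map_sub, map_smul]
    rw [neg_div, one_div]
    module
  have hb : ∀ s ∈ Ico 0 t, ‖φ' s‖ ≤ ‖H.quot ε (H.P δ f) - H.lap δ f‖ := by
    intro s hs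
    refine (norm_expSemi_le hsym hS1 (div_nonneg (by linarith [hs.2]) hε.le) _).trans ?_
    rw [norm_sub_rev]
    rcases eq_or_lt_of_le hs.1 with h0 | h0
    · rw [← h0, zero_add]
    · have e : H.quot ε (H.P (s + δ) f) - H.lap (s + δ) f = H.P s (H.quot ε (H.P δ f) - H.lap δ f) := by
        rw [map_sub, ← H.lap_add f h0 hδ, quot, quot, map_smul, map_sub, H.P_add f h0 hδ, H.P_comm _ h0 hε]
      rw [e]
      exact H.norm_P_le _ h0
  have := norm_image_sub_le_of_norm_deriv_le_segment' (f := φ) (f' := φ')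
    (fun s hs => (hd s hs).hasDerivWithinAt) hb t ⟨ht.le, le_rfl⟩
  simp only [hφ, sub_self, zero_div, expSemi_zero, sub_zero, zero_add] at this
  rw [norm_sub_rev, H.P_add f ht hδ] at this
  exact this

/-- On flowed functions P_δ f the convergence is the consistency of the difference quotient.
Contractivity of both families extends it to all of L², since P_δ f → f. -/
theorem tendsto_expSemi (ht : 0 < t) (f : Lp ℝ 2 m) :
    Tendsto (fun ε => expSemi (H.P ε) (t / ε) f) (𝓝[>] 0) (𝓝 (H.P t f)) := by
  rw [Metric.tendsto_nhds]
  intro η hη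
  have h1 : ∀ᶠ δ in 𝓝[>] (0:ℝ), ‖H.P δ f - f‖ < η / 4 ∧ 0 < δ := by
    have := (Metric.tendsto_nhds.1 (H.tendsto_zero f) (η / 4) (by positivity))
    filter_upwards [this, self_mem_nhdsWithin] with δ h1 h2
    exact ⟨by rwa [← dist_eq_norm], h2⟩
  obtain ⟨δ, hδ1, hδ⟩ := h1.exists
  have h2 : Tendsto (fun ε => ‖H.quot ε (H.P δ f) - H.lap δ f‖ * t) (𝓝[>] 0) (𝓝 0) := by
    have := ((tendsto_iff_norm_sub_tendsto_zero.1 (H.tendsto_quot hδ f)).mul_const t)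
    rwa [zero_mul] at this
  filter_upwards [h2.eventually_lt_const (show (0:ℝ) < η / 2 by positivity), self_mem_nhdsWithin] with ε h3 (hε : 0 < ε)
  have hsym : ∀ f g, inner ℝ (H.P ε f) g = inner ℝ f (H.P ε g) := fun f g => H.P_symm f g hε
  have a1 := H.norm_expSemi_sub_le hε hδ ht f
  have a2 := norm_expSemi_le hsym (H.opNorm_P_le hε) (t := t / ε) (by positivity) (f - H.P δ f)
  have a3 := H.norm_P_le (H.P δ f - f) ht
  rw [norm_sub_rev f] at a2
  rw [dist_eq_norm]
  have e : expSemi (H.P ε) (t / ε) f - H.P t f = expSemi (H.P ε) (t / ε) (f - H.P δ f)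
      + (expSemi (H.P ε) (t / ε) (H.P δ f) - H.P t (H.P δ f)) + H.P t (H.P δ f - f) := by
    simp only [map_sub]; abel
  rw [e]
  refine (norm_add₃_le).trans_lt ?_
  linarith

theorem ofReal_toReal_conj {p p' : ℝ≥0∞} [p.HolderConjugate p'] (hp1 : 1 < p) (hp : p ≠ ⊤) :
    p = ENNReal.ofReal p.toReal ∧ p' = ENNReal.ofReal p'.toReal ∧ p.toReal.HolderConjugate p'.toReal := by
  have hp' : p' ≠ ⊤ := ((ENNReal.HolderConjugate.lt_top_iff_one_lt p' p).2 hp1).ne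
  exact ⟨(ENNReal.ofReal_toReal hp).symm, (ENNReal.ofReal_toReal hp').symm,
    ENNReal.HolderConjugate.toReal_of_ne_top hp hp'⟩

/-- Uniform bounds on `L^p` for the approximating semigroups. -/
theorem exists_approx_bounds {p : ℝ≥0∞} (hp1 : 1 < p) (hp : p ≠ ⊤) (hp2 : p ≠ 2) :
    ∃ C : ℝ, 0 < C ∧ ∀ ε, 0 < ε → ∀ t, 0 < t → ∀ f : Lp ℝ 2 m, MemLp f p m →
      eLpNorm (expSemi (H.P ε) (t / ε) f) p m ≤ eLpNorm f p m ∧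
      eLpNorm (expSemi (H.P ε) (t / ε) (H.quot ε f)) p m ≤ ENNReal.ofReal (C / t) * eLpNorm f p m := by
  obtain ⟨p', hpp⟩ : ∃ p' : ℝ≥0∞, p.HolderConjugate p' := ⟨_, ENNReal.HolderConjugate.conjExponent hp1.le⟩
  have hpp' := ENNReal.HolderConjugate.symm (p := p) (q := p')
  obtain ⟨e1, e2, hr⟩ := ofReal_toReal_conj (p := p) (p' := p') hp1 hp
  -- Stein interpolation is available below 2. For p > 2 the conjugate exponent is below 2, and a
  -- pairing bound for a symmetric operator may be read with the two exponents exchanged.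
  have key : ∃ C : ℝ, 0 < C ∧ ∀ S : Lp ℝ 2 m →L[ℝ] Lp ℝ 2 m, IsSubMarkov S →
      (∀ f g, inner ℝ (S f) g = inner ℝ f (S g)) → ‖S‖ ≤ 1 → ∀ t, 0 < t →
      (PairingBound (expSemi S t) p p' 1 ∧
      PairingBound (S * expSemi S t - expSemi S t) p p' (C / t)) ∨
      (PairingBound (expSemi S t) p' p 1 ∧
      PairingBound (S * expSemi S t - expSemi S t) p' p (C / t)) := by
    rcases lt_or_gt_of_ne hp2 with h | h
    · obtain ⟨C, hC, hh⟩ := exists_pairingBound X m hr (by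
        have := (ENNReal.toReal_lt_toReal hp (by simp)).2 h
        simpa using this)
      rw [← e1, ← e2] at hh
      exact ⟨C, hC, fun S a b c t ht => Or.inl (hh S a b c t ht)⟩
    · have h2 : (2:ℝ) < p.toReal := by
        have := (ENNReal.toReal_lt_toReal (by simp) hp).2 h
        simpa using this
      obtain ⟨C, hC, hh⟩ := exists_pairingBound X m hr.symm (by
        by_contra hcon
        push Not at hcon
        have h0 := hr.inv_add_inv_eq_one
        have h1 : p.toReal⁻¹ < 1 / 2 := by rw [one_div]; exact inv_strictAnti₀ (by norm_num) h2
        have h3 : p'.toReal⁻¹ ≤ 1 / 2 := by rw [one_div]; exact inv_anti₀ (by norm_num) hcon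
        linarith)
      rw [← e1, ← e2] at hh
      exact ⟨C, hC, fun S a b c t ht => Or.inr (hh S a b c t ht)⟩
  obtain ⟨C, hC, hh⟩ := key
  refine ⟨C, hC, fun ε hε t ht f hf => ?_⟩
  have hsym : ∀ f g, inner ℝ (H.P ε f) g = inner ℝ f (H.P ε g) := fun f g => H.P_symm f g hε
  have sym1 := expSemi_symm hsym (t / ε)
  have sym2 : ∀ f g, inner ℝ ((H.P ε * expSemi (H.P ε) (t / ε) - expSemi (H.P ε) (t / ε)) f) g
      = inner ℝ f ((H.P ε * expSemi (H.P ε) (t / ε) - expSemi (H.P ε) (t / ε)) g) := by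
    intro f g
    rw [sub_apply, sub_apply, inner_sub_left, inner_sub_right, sym1, mul_apply_eq_comp, hsym, sym1,
      ← mul_apply_eq_comp, ← expSemi_commute]
  have h := hh (H.P ε) (H.isSubMarkov hε) hsym (H.opNorm_P_le hε) (t / ε) (by positivity)
  have h' : PairingBound (expSemi (H.P ε) (t / ε)) p p' 1 ∧
      PairingBound (H.P ε * expSemi (H.P ε) (t / ε) - expSemi (H.P ε) (t / ε)) p p' (C / (t / ε)) := by
    rcases h with h | h
    · exact h
    · exact ⟨h.1.symm sym1, h.2.symm sym2⟩
  constructor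
  · have := h'.1.eLpNorm_le zero_le_one sym1 hp1 hp hf
    simpa using this
  · have h3 := h'.2.eLpNorm_le (by positivity) sym2 hp1 hp hf
    -- The factor ε⁻¹ of the difference quotient compensates the time t/ε: C/(t/ε) · ε⁻¹ = C/t,
    -- uniformly in ε.
    have e : expSemi (H.P ε) (t / ε) (H.quot ε f)
        = ε⁻¹ • (H.P ε * expSemi (H.P ε) (t / ε) - expSemi (H.P ε) (t / ε)) f := by
      rw [quot, map_smul, map_sub, expSemi_commute]; rfl
    rw [e, eLpNorm_congr_ae (Lp.coeFn_smul _ _), eLpNorm_const_smul]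
    calc _ ≤ ‖ε⁻¹‖ₑ * (ENNReal.ofReal (C / (t / ε)) * eLpNorm f p m) := by gcongr
      _ = _ := by
        rw [← mul_assoc, Real.enorm_of_nonneg (by positivity), ← ENNReal.ofReal_mul (by positivity)]
        congr 2
        field_simp

/-- The heat semigroup is a contraction on `L^p`. -/
theorem eLpNorm_P_le {p : ℝ≥0∞} (hp1 : 1 < p) (hp : p ≠ ⊤) (ht : 0 < t) {f : Lp ℝ 2 m} (hf : MemLp f p m) :
    eLpNorm (H.P t f) p m ≤ eLpNorm f p m := by
  by_cases hp2 : p = 2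
  · subst hp2
    rw [← Lp.enorm_def, ← Lp.enorm_def, enorm_le_iff_norm_le]
    exact H.norm_P_le f ht
  obtain ⟨C, hC, h⟩ := H.exists_approx_bounds hp1 hp hp2
  refine eLpNorm_le_of_tendsto (H.tendsto_expSemi ht f) ?_
  filter_upwards [self_mem_nhdsWithin] with ε (hε : 0 < ε)
  exact (h ε hε t ht f hf).1

theorem memLp_P {p : ℝ≥0∞} (hp1 : 1 < p) (hp : p ≠ ⊤) (ht : 0 < t) {f : Lp ℝ 2 m} (hf : MemLp f p m) :
    MemLp (H.P t f) p m :=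
  ⟨Lp.aestronglyMeasurable _, (H.eLpNorm_P_le hp1 hp ht hf).trans_lt hf.2⟩

/-- Analyticity of the heat semigroup on `L^p`. -/
theorem exists_eLpNorm_lap_le {p : ℝ≥0∞} (hp1 : 1 < p) (hp : p ≠ ⊤) :
    ∃ C : ℝ, 0 < C ∧ ∀ t, 0 < t → ∀ f : Lp ℝ 2 m, MemLp f p m →
      eLpNorm (H.lap t f) p m ≤ ENNReal.ofReal (C / t) * eLpNorm f p m := by
  by_cases hp2 : p = 2
  · subst hp2
    refine ⟨2, two_pos, fun t ht f hf => ?_⟩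
    rw [← Lp.enorm_def, ← Lp.enorm_def, ← ofReal_norm, ← ofReal_norm, ← ENNReal.ofReal_mul (by positivity)]
    exact ENNReal.ofReal_le_ofReal (H.norm_lap_le f ht)
  obtain ⟨C, hC, h⟩ := H.exists_approx_bounds hp1 hp hp2
  refine ⟨2 * C, by positivity, fun t ht f hf => ?_⟩
  have h2 : 0 < t / 2 := by positivity
  -- The difference quotient converges only on smoothed functions. Half of the time is therefore
  -- spent on P_{t/2} f, the other half on the approximating semigroup, which provides the uniform
  -- L^p bound.
  have hlim : Tendsto (fun ε => expSemi (H.P ε) (t / 2 / ε) (H.quot ε (H.P (t / 2) f))) (𝓝[>] 0)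
      (𝓝 (H.lap t f)) := by
    have e : H.lap t f = H.P (t / 2) (H.lap (t / 2) f) + 0 := by
      rw [add_zero, ← H.lap_add f h2 h2, add_halves]
    rw [e]
    have l1 := H.tendsto_expSemi h2 (H.lap (t / 2) f)
    have l2 : Tendsto (fun ε => expSemi (H.P ε) (t / 2 / ε) (H.quot ε (H.P (t / 2) f) - H.lap (t / 2) f))
        (𝓝[>] 0) (𝓝 0) := by
      have := tendsto_iff_norm_sub_tendsto_zero.1 (H.tendsto_quot h2 f)
      refine squeeze_zero_norm' ?_ this
      filter_upwards [self_mem_nhdsWithin] with ε (hε : 0 < ε)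
      exact norm_expSemi_le (fun f g => H.P_symm f g hε) (H.opNorm_P_le hε) (by positivity) _
    refine (l1.add l2).congr fun ε => ?_
    rw [map_sub]; abel
  refine eLpNorm_le_of_tendsto hlim ?_
  filter_upwards [self_mem_nhdsWithin] with ε (hε : 0 < ε)
  refine (h ε hε (t / 2) h2 _ (H.memLp_P hp1 hp h2 hf)).2.trans ?_
  rw [show C / (t / 2) = 2 * C / t by field_simp]
  gcongr
  exact H.eLpNorm_P_le hp1 hp h2 hf

theorem exists_deltaInequality {p : ℝ≥0∞} (hp1 : 1 < p) (hp : p ≠ ⊤) : ∃ c, DeltaInequality H p c := by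
  obtain ⟨C, hC, h⟩ := H.exists_eLpNorm_lap_le hp1 hp
  exact ⟨C, hC, fun f hf t ht => ⟨H.lap t f, H.isLaplacian f ht.1, h t ht.1 f hf⟩⟩

end HeatSemigroup

end

section

variable {X : Type*} [MeasurableSpace X] {m : Measure X} {E : DirichletForm m}

/-! ### The heat semigroup on `L^p ∩ L²` -/

/-- Every exponent `p ∈ (1,∞)` lies between some other exponent in `(1,∞)` and `2`. -/
theorem exists_eLpNorm_interpolate {p : ℝ≥0∞} (hp1 : 1 < p) (hp : p ≠ ⊤) :
    ∃ p₀ : ℝ≥0∞, 1 < p₀ ∧ p₀ ≠ ⊤ ∧ ∃ a b : ℝ, 0 ≤ a ∧ 0 < b ∧ ∀ (m : Measure X) (g : X → ℝ),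
      AEStronglyMeasurable g m → eLpNorm g p m ≤ eLpNorm g p₀ m ^ a * eLpNorm g 2 m ^ b := by
  have hP1 : 1 < p.toReal := (ENNReal.toReal_lt_toReal (by simp) hp).2 hp1
  set P := p.toReal with hP
  -- P₀ is P pushed away from 2 by the fraction η. This choice keeps P₀ > 1, since P₀ - 1 = P(P -
  -- 1)/2, and P is the convex combination of P₀ and 2 with weight 1/(1 + η).
  set η := (P - 1) / 2 with hη
  have hη0 : 0 < η := by rw [hη]; linarith
  set P₀ := P + η * (P - 2) with hP0
  have hP01 : 1 < P₀ := by rw [hP0, hη]; nlinarith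
  set θ := 1 / (1 + η) with hθ
  have hθ0 : 0 < θ := by positivity
  have hθ1 : 0 < 1 - θ := by
    rw [hθ, sub_pos, div_lt_one (by linarith)]; linarith
  have hPe : P₀ * θ + 2 * (1 - θ) = P := by
    rw [hP0, hθ]; field_simp; ring
  refine ⟨ENNReal.ofReal P₀, by simpa using hP01, by simp, P₀ * θ / P, 2 * (1 - θ) / P, by positivity,
    by positivity, fun m g hg => ?_⟩
  have h0 : p ≠ 0 := (zero_lt_one.trans hp1).ne'
  rw [eLpNorm_eq_lintegral_rpow_enorm_toReal h0 hp,
    eLpNorm_eq_lintegral_rpow_enorm_toReal (p := ENNReal.ofReal P₀) (by simp; linarith) (by simp),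
    eLpNorm_eq_lintegral_rpow_enorm_toReal (p := 2) (by simp) (by simp),
    ENNReal.toReal_ofReal (by linarith), ENNReal.toReal_ofNat, ← hP,
    ← ENNReal.rpow_mul, ← ENNReal.rpow_mul]
  have key := ENNReal.lintegral_mul_norm_pow_le (μ := m) (f := fun x => ‖g x‖ₑ ^ P₀)
    (g := fun x => ‖g x‖ₑ ^ (2 : ℝ)) (hg.enorm.pow_const _) (hg.enorm.pow_const _) hθ0.le hθ1.le (by ring)
  have e : ∀ x, (‖g x‖ₑ ^ P₀) ^ θ * (‖g x‖ₑ ^ (2 : ℝ)) ^ (1 - θ) = ‖g x‖ₑ ^ P := by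
    intro x
    rw [← ENNReal.rpow_mul, ← ENNReal.rpow_mul, ← ENNReal.rpow_add_of_nonneg _ _ (by positivity) (by positivity), hPe]
  simp_rw [e] at key
  have := ENNReal.rpow_le_rpow key (show 0 ≤ 1 / P by positivity)
  refine this.trans (le_of_eq ?_)
  rw [ENNReal.mul_rpow_of_nonneg _ _ (by positivity), ← ENNReal.rpow_mul, ← ENNReal.rpow_mul]
  congr 2 <;> field_simp

/-- Mean value inequality in `L^p` for a curve that is differentiable in `L²`. -/
theorem eLpNorm_sub_le_of_hasDerivAt [SigmaFinite m] {p : ℝ≥0∞} (hp1 : 1 < p) (hp : p ≠ ⊤) {F F' : ℝ → Lp ℝ 2 m}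
    {s : Set ℝ} (hs : Convex ℝ s) (hF : ∀ t ∈ s, HasDerivAt F (F' t) t)
    {K : ℝ} (hb : ∀ t ∈ s, eLpNorm (F' t) p m ≤ ENNReal.ofReal K)
    {a b : ℝ} (ha : a ∈ s) (hbs : b ∈ s) :
    eLpNorm (F b - F a : Lp ℝ 2 m) p m ≤ ENNReal.ofReal (K * |b - a|) := by
  obtain ⟨p', hpp⟩ : ∃ p', p.HolderConjugate p' := ⟨_, ENNReal.HolderConjugate.conjExponent hp1.le⟩
  refine eLpNorm_le_of_simpleFunc (p' := p') hp1 hp (Lp.memLp _) (by simp) ?_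
  -- Differentiability is known only in L². Pairing with a simple function gives a scalar curve,
  -- whose derivative is controlled by the L^p bound and the dual norm of `g`.
  intro g hg hg'
  have e : ∀ f : Lp ℝ 2 m, ∫ x, f x * g x ∂m = inner ℝ f (hg.toLp g) := by
    intro f
    rw [← integral_mul_eq_inner]
    refine integral_congr_ae ?_
    filter_upwards [hg.coeFn_toLp] with x hx
    rw [hx]
  rw [e, inner_sub_left]
  have hd : ∀ t ∈ s, HasDerivWithinAt (fun t => inner ℝ (F t) (hg.toLp g)) (inner ℝ (F' t) (hg.toLp g)) s t := by
    intro t ht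
    have := (hF t ht).inner ℝ (hasDerivAt_const t (hg.toLp g))
    simpa using this.hasDerivWithinAt
  have hn : ∀ t ∈ s, ‖inner ℝ (F' t) (hg.toLp g)‖ ≤ (ENNReal.ofReal K * eLpNorm g p' m).toReal := by
    intro t ht
    rw [← toReal_enorm]
    refine ENNReal.toReal_mono (ENNReal.mul_ne_top (by simp) hg'.eLpNorm_ne_top) ?_
    rw [← e]
    refine (enorm_integral_mul_le (p := p) (p' := p') (Lp.aestronglyMeasurable _) hg.1).trans ?_
    gcongr
    exact hb t ht
  have := hs.norm_image_sub_le_of_norm_hasDerivWithin_le hd hn ha hbs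
  rw [← ofReal_norm]
  refine (ENNReal.ofReal_le_ofReal this).trans (le_of_eq ?_)
  rw [ENNReal.ofReal_mul (by positivity), ENNReal.ofReal_toReal (ENNReal.mul_ne_top (by simp) hg'.eLpNorm_ne_top),
    Real.norm_eq_abs, ENNReal.ofReal_mul' (abs_nonneg _)]
  ring

/-- `L^p ∩ L²`, as a subspace of `L^p × L²`. -/
def interLp (m : Measure X) (p : ℝ≥0∞) [Fact (1 ≤ p)] : Submodule ℝ (Lp ℝ p m × Lp ℝ 2 m) where
  carrier := {z | z.1 =ᵐ[m] z.2}
  zero_mem' := (Lp.coeFn_zero ..).trans (Lp.coeFn_zero ..).symm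
  add_mem' := fun {z w} hz hw => ((Lp.coeFn_add z.1 w.1).trans (EventuallyEq.add (f := z.1) (g := z.2) (f' := w.1) (g' := w.2) hz hw)).trans (Lp.coeFn_add z.2 w.2).symm
  smul_mem' := fun c z hz => ((Lp.coeFn_smul c z.1).trans (EventuallyEq.const_smul (show (z.1 : X → ℝ) =ᵐ[m] z.2 from hz) c)).trans (Lp.coeFn_smul c z.2).symm

section

variable {p : ℝ≥0∞} [Fact (1 ≤ p)]

theorem interLp.ae_eq (z : interLp m p) : z.1.1 =ᵐ[m] z.1.2 := z.2

theorem interLp.memLp (z : interLp m p) : MemLp z.1.2 p m := (Lp.memLp z.1.1).ae_eq (interLp.ae_eq z)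

theorem interLp.ext {z w : interLp m p} (h : z.1.2 = w.1.2) : z = w := by
  refine Subtype.ext (Prod.ext (Lp.ext ?_) h)
  exact ((interLp.ae_eq z).trans (by rw [h])).trans (interLp.ae_eq w).symm

theorem interLp.enorm_eq (z : interLp m p) : ‖z‖ₑ = interNorm z.1.2 p 2 m := by
  rw [interNorm, ← eLpNorm_congr_ae (interLp.ae_eq z), ← Lp.enorm_def, ← Lp.enorm_def]
  rw [← ofReal_norm, ← ofReal_norm, ← ofReal_norm, ← ENNReal.ofReal_max]
  rfl

open Classical in
/-- The element of `L^p ∩ L²` given by `f`, if `f ∈ L^p`. -/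
def toInterLp (p : ℝ≥0∞) [Fact (1 ≤ p)] (f : Lp ℝ 2 m) : interLp m p :=
  if h : MemLp f p m then ⟨(h.toLp f, f), h.coeFn_toLp⟩ else 0

theorem toInterLp_snd {f : Lp ℝ 2 m} (hf : MemLp f p m) : (toInterLp p f).1.2 = f := by
  rw [toInterLp, dif_pos hf]

theorem toInterLp_sub {f g : Lp ℝ 2 m} (hf : MemLp f p m) (hg : MemLp g p m) :
    toInterLp p (f - g) = toInterLp p f - toInterLp p g := by
  have h : MemLp (f - g : Lp ℝ 2 m) p m := (hf.sub hg).ae_eq (Lp.coeFn_sub f g).symm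
  apply interLp.ext
  rw [toInterLp_snd h]
  change f - g = (toInterLp p f).1.2 - (toInterLp p g).1.2
  rw [toInterLp_snd hf, toInterLp_snd hg]

theorem toInterLp_smul (c : ℝ) {f : Lp ℝ 2 m} (hf : MemLp f p m) :
    toInterLp p (c • f) = c • toInterLp p f := by
  have h : MemLp (c • f : Lp ℝ 2 m) p m := (hf.const_smul c).ae_eq (Lp.coeFn_smul c f).symm
  apply interLp.ext
  rw [toInterLp_snd h]
  change c • f = c • (toInterLp p f).1.2
  rw [toInterLp_snd hf]

theorem enorm_toInterLp {f : Lp ℝ 2 m} (hf : MemLp f p m) : ‖toInterLp p f‖ₑ = interNorm f p 2 m := by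
  rw [interLp.enorm_eq, toInterLp_snd hf]

end

theorem memLp_sub {p : ℝ≥0∞} {f g : Lp ℝ 2 m} (hf : MemLp f p m) (hg : MemLp g p m) :
    MemLp (f - g : Lp ℝ 2 m) p m := (hf.sub hg).ae_eq (Lp.coeFn_sub f g).symm

theorem memLp_smul {p : ℝ≥0∞} (c : ℝ) {f : Lp ℝ 2 m} (hf : MemLp f p m) :
    MemLp (c • f : Lp ℝ 2 m) p m := (hf.const_smul c).ae_eq (Lp.coeFn_smul c f).symm

theorem eLpNorm_sub_Lp_le {p : ℝ≥0∞} (hp : 1 ≤ p) (f g : Lp ℝ 2 m) :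
    eLpNorm (f - g : Lp ℝ 2 m) p m ≤ eLpNorm f p m + eLpNorm g p m := by
  rw [eLpNorm_congr_ae (Lp.coeFn_sub f g)]
  exact eLpNorm_sub_le (Lp.aestronglyMeasurable _) (Lp.aestronglyMeasurable _) hp

namespace HeatSemigroup

variable (H : HeatSemigroup E) {t : ℝ} {p : ℝ≥0∞}

theorem memLp_lap (hp1 : 1 < p) (hp : p ≠ ⊤) (ht : 0 < t) {f : Lp ℝ 2 m} (hf : MemLp f p m) :
    MemLp (H.lap t f) p m := by
  obtain ⟨C, hC, h⟩ := H.exists_eLpNorm_lap_le hp1 hp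
  exact ⟨Lp.aestronglyMeasurable _, (h t ht f hf).trans_lt (ENNReal.mul_lt_top (by simp) hf.2)⟩

/-- Strong continuity of the heat semigroup on `L^p`. -/
theorem tendsto_eLpNorm_P_sub (hp1 : 1 < p) (hp : p ≠ ⊤) {f : Lp ℝ 2 m} (hf : MemLp f p m) :
    Tendsto (fun t => eLpNorm (H.P t f - f : Lp ℝ 2 m) p m) (𝓝[>] 0) (𝓝 0) := by
  obtain ⟨p₀, hp01, hp0, a, b, ha, hb, h⟩ := exists_eLpNorm_interpolate (X := X) hp1 hp
  -- For such `g` the L^p norm of P_t g - g is at most a power of its L² norm, which tends to zero,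
  -- times a power of 2‖g‖_{p₀}. Simple functions are of this kind and are dense in L^p.
  have simple : ∀ g : Lp ℝ 2 m, MemLp g p₀ m →
      Tendsto (fun t => eLpNorm (H.P t g - g : Lp ℝ 2 m) p m) (𝓝[>] 0) (𝓝 0) := by
    intro g hg
    have l2 : Tendsto (fun t => (2 * eLpNorm g p₀ m) ^ a * ‖H.P t g - g‖ₑ ^ b) (𝓝[>] 0) (𝓝 0) := by
      have l1 : Tendsto (fun t => ‖H.P t g - g‖ₑ) (𝓝[>] 0) (𝓝 0) := by
        have := (tendsto_iff_norm_sub_tendsto_zero.1 (H.tendsto_zero g))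
        simpa [ofReal_norm] using ENNReal.tendsto_ofReal this
      have l3 := (ENNReal.continuous_rpow_const (y := b)).tendsto 0 |>.comp l1
      rw [ENNReal.zero_rpow_of_pos hb] at l3
      have := ENNReal.Tendsto.const_mul (a := (2 * eLpNorm g p₀ m) ^ a) l3
        (Or.inr (ENNReal.rpow_ne_top_of_nonneg ha (ENNReal.mul_ne_top (by simp) hg.eLpNorm_ne_top)))
      simpa using this
    refine tendsto_of_tendsto_of_tendsto_of_le_of_le' tendsto_const_nhds l2 (by simp) ?_
    filter_upwards [self_mem_nhdsWithin] with t (ht : 0 < t)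
    refine (h m _ (Lp.aestronglyMeasurable _)).trans ?_
    rw [Lp.enorm_def]
    gcongr
    refine (eLpNorm_sub_Lp_le hp01.le _ _).trans ?_
    rw [two_mul]
    gcongr
    exact H.eLpNorm_P_le hp01 hp0 ht hg
  rw [ENNReal.tendsto_nhds_zero]
  intro ε hε
  obtain ⟨φ, hφ, hφm⟩ := hf.exists_simpleFunc_eLpNorm_sub_lt hp (ε := ε / 3)
    (ENNReal.div_ne_zero.2 ⟨hε.ne', by simp⟩)
  have hφ2 : MemLp φ 2 m := by
    rw [SimpleFunc.memLp_iff (by simp) (by simp)]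
    exact (SimpleFunc.memLp_iff (zero_lt_one.trans hp1).ne' hp).1 hφm
  set g : Lp ℝ 2 m := hφ2.toLp φ with hg
  have hgφ : g =ᵐ[m] φ := hφ2.coeFn_toLp
  have hfg : eLpNorm (f - g : Lp ℝ 2 m) p m < ε / 3 := by
    rwa [eLpNorm_congr_ae ((Lp.coeFn_sub f g).trans (EventuallyEq.rfl.sub hgφ))]
  have hgp : ∀ p, MemLp g p m := fun p => (memLp_simpleFunc_of_two hφ2 p).ae_eq hgφ.symm
  have l := (ENNReal.tendsto_nhds_zero.1 (simple g (hgp p₀))) (ε / 3)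
    (ENNReal.div_pos hε.ne' (by simp))
  filter_upwards [l, self_mem_nhdsWithin] with t hl (ht : 0 < t)
  have e : H.P t f - f = H.P t (f - g) - (f - g) - (0 - (H.P t g - g)) := by rw [map_sub]; abel
  have hfgp : MemLp (f - g : Lp ℝ 2 m) p m := memLp_sub hf (hgp p)
  rw [e]
  refine (eLpNorm_sub_Lp_le hp1.le _ _).trans ?_
  have h1 := (eLpNorm_sub_Lp_le hp1.le (H.P t (f - g)) (f - g))
  have h2 := H.eLpNorm_P_le hp1 hp ht hfgp
  have h3 : eLpNorm (0 - (H.P t g - g) : Lp ℝ 2 m) p m ≤ ε / 3 := by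
    rw [zero_sub, eLpNorm_congr_ae (Lp.coeFn_neg _), eLpNorm_neg]
    exact hl
  calc _ ≤ (ε / 3 + ε / 3) + ε / 3 := by
        gcongr
        exact h1.trans (add_le_add (h2.trans hfg.le) hfg.le)
    _ = ε := ENNReal.add_thirds ε

theorem tendsto_toInterLp [Fact (1 ≤ p)] (hp1 : 1 < p) (hp : p ≠ ⊤) {f : Lp ℝ 2 m} (hf : MemLp f p m) :
    Tendsto (fun t => toInterLp p (H.P t f)) (𝓝[>] 0) (𝓝 (toInterLp p f)) := by
  rw [tendsto_iff_edist_tendsto_0]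
  have l1 := H.tendsto_eLpNorm_P_sub hp1 hp hf
  have l2 := H.tendsto_eLpNorm_P_sub (p := 2) (by simp) (by simp) (Lp.memLp f)
  have := l1.max l2
  rw [max_self] at this
  refine this.congr' ?_
  filter_upwards [self_mem_nhdsWithin] with t (ht : 0 < t)
  rw [edist_eq_enorm_sub, ← toInterLp_sub (H.memLp_P hp1 hp ht hf) hf,
    enorm_toInterLp (memLp_sub (H.memLp_P hp1 hp ht hf) hf), interNorm]

variable [SigmaFinite m]

/-- With δ = t/4, ΔP_τ f = P_{τ-δ}(ΔP_δ f) is itself a heat flow, at times τ - δ ≥ δ where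
analyticity bounds its derivative in L^p. This Lipschitz bound gives the quadratic remainder in the
differentiability of the flow. -/
theorem exists_eLpNorm_lap_sub_le (hp1 : 1 < p) (hp : p ≠ ⊤) (ht : 0 < t) {f : Lp ℝ 2 m} (hf : MemLp f p m) :
    ∃ M : ℝ, 0 ≤ M ∧ ∀ τ ∈ Ioi (t / 2), eLpNorm (H.lap τ f - H.lap t f : Lp ℝ 2 m) p m
      ≤ ENNReal.ofReal (M * |τ - t|) := by
  obtain ⟨C, hC, h⟩ := H.exists_eLpNorm_lap_le hp1 hp
  set δ := t / 4 with hδ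
  have hδ0 : 0 < δ := by positivity
  have hl := H.memLp_lap hp1 hp hδ0 hf
  refine ⟨C / δ * (eLpNorm (H.lap δ f) p m).toReal, by positivity, fun τ hτ => ?_⟩
  have hd : ∀ σ ∈ Ioi (t / 2), HasDerivAt (fun σ => H.P (σ - δ) (H.lap δ f)) (H.lap (σ - δ) (H.lap δ f)) σ := by
    intro σ hσ
    have : 0 < σ - δ := by have := mem_Ioi.1 hσ; rw [hδ]; linarith
    exact (H.hasDerivAt (H.lap δ f) this).comp_sub_const σ δ
  have e : ∀ σ ∈ Ioi (t / 2), H.lap σ f = H.P (σ - δ) (H.lap δ f) := by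
    intro σ hσ
    have : 0 < σ - δ := by have := mem_Ioi.1 hσ; rw [hδ]; linarith
    rw [← H.lap_add f this hδ0, sub_add_cancel]
  have htm : t ∈ Ioi (t / 2) := by rw [mem_Ioi]; linarith
  rw [e τ hτ, e t htm]
  refine eLpNorm_sub_le_of_hasDerivAt hp1 hp (convex_Ioi _) hd ?_ htm hτ
  · intro σ hσ
    have hσ' : δ ≤ σ - δ := by have := mem_Ioi.1 hσ; rw [hδ]; linarith
    refine (h _ (hδ0.trans_le hσ') _ hl).trans ?_
    rw [ENNReal.ofReal_mul (by positivity), ENNReal.ofReal_toReal hl.eLpNorm_ne_top]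
    gcongr

/-- Differentiability of the heat semigroup in `L^p ∩ L²`. -/
theorem hasDerivAt_toInterLp [Fact (1 ≤ p)] (hp1 : 1 < p) (hp : p ≠ ⊤) (ht : 0 < t) {f : Lp ℝ 2 m} (hf : MemLp f p m) :
    HasDerivAt (fun t => toInterLp p (H.P t f)) (toInterLp p (H.lap t f)) t := by
  have quad : ∀ q : ℝ≥0∞, 1 < q → q ≠ ⊤ → MemLp f q m → ∃ M : ℝ, 0 ≤ M ∧ ∀ h : ℝ, |h| < t / 2 →
      eLpNorm (H.P (t + h) f - H.P t f - h • H.lap t f : Lp ℝ 2 m) q m ≤ ENNReal.ofReal (M * h ^ 2) := by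
    intro q hq1 hq hfq
    obtain ⟨M, hM, hb⟩ := H.exists_eLpNorm_lap_sub_le hq1 hq ht hfq
    refine ⟨M, hM, fun h hh => ?_⟩
    have hh' := abs_lt.1 hh
    -- The mean value inequality is applied to the flow minus its linear part at t; the derivative
    -- of this difference is at most M|τ - t| ≤ M|h|.
    have key := eLpNorm_sub_le_of_hasDerivAt (p := q) hq1 hq (F := fun τ => H.P τ f - (τ - t) • H.lap t f)
      (F' := fun τ => H.lap τ f - H.lap t f) (s := uIcc t (t + h)) (K := M * |h|) (convex_uIcc _ _)
      (a := t) (b := t + h) ?_ ?_ left_mem_uIcc right_mem_uIcc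
    · have e : H.P (t + h) f - H.P t f - h • H.lap t f
          = (H.P (t + h) f - (t + h - t) • H.lap t f) - (H.P t f - (t - t) • H.lap t f) := by
        rw [add_sub_cancel_left, sub_self, zero_smul]; abel
      rw [e]
      refine key.trans (le_of_eq ?_)
      rw [add_sub_cancel_left, mul_assoc, ← sq, sq_abs]
    all_goals
      intro τ hτ
      have hτ2 : |τ - t| ≤ |h| := by
        have := abs_sub_left_of_mem_uIcc hτ
        rwa [add_sub_cancel_left] at this
      have hτ1 : t / 2 < τ := by have := abs_le.1 hτ2; linarith
      have hτ0 : 0 < τ := by linarith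
    · have h1 := (((hasDerivAt_id τ).sub_const t).smul_const (H.lap t f))
      rw [one_smul] at h1
      exact (H.hasDerivAt f hτ0).sub h1
    · refine (hb τ hτ1).trans (ENNReal.ofReal_le_ofReal ?_)
      gcongr
  obtain ⟨M, hM, hb⟩ := quad p hp1 hp hf
  obtain ⟨M₂, hM₂, hb₂⟩ := quad 2 (by simp) (by simp) (Lp.memLp f)
  rw [hasDerivAt_iff_isLittleO_nhds_zero]
  refine Asymptotics.IsBigO.trans_isLittleO (g := fun h : ℝ => h ^ 2) ?_ (Asymptotics.isLittleO_pow_id one_lt_two)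
  refine Asymptotics.IsBigO.of_bound (max M M₂) ?_
  filter_upwards [Metric.ball_mem_nhds (0 : ℝ) (half_pos ht)] with h hh
  rw [Metric.mem_ball, dist_zero_right, Real.norm_eq_abs] at hh
  have hth : 0 < t + h := by have := abs_lt.1 hh; linarith
  have m1 := H.memLp_P hp1 hp hth hf
  have m2 := H.memLp_P hp1 hp ht hf
  have m3 := H.memLp_lap hp1 hp ht hf
  rw [← toInterLp_sub m1 m2, ← toInterLp_smul h m3, ← toInterLp_sub (memLp_sub m1 m2) (memLp_smul h m3),
    ← toReal_enorm, enorm_toInterLp (memLp_sub (memLp_sub m1 m2) (memLp_smul h m3)),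
    Real.norm_of_nonneg (sq_nonneg h)]
  refine ENNReal.toReal_le_of_le_ofReal (by positivity) ?_
  rw [interNorm]
  refine max_le ((hb h hh).trans ?_) ((hb₂ h hh).trans ?_)
  all_goals
    refine ENNReal.ofReal_le_ofReal ?_
    gcongr
    simp

end HeatSemigroup

end

section

variable {X : Type*} [MeasurableSpace X] {m : Measure X} {E : DirichletForm m}

/-! ### Energy and the heat semigroup -/

namespace DirichletForm

theorem form_add_self (f g : E.dom) : E.form (f + g) (f + g) = E.form f f + 2 * E.form f g + E.form g g := by
  simp only [map_add, LinearMap.add_apply]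
  rw [E.symm g f]; ring

theorem form_sub_self (f g : E.dom) : E.form (f - g) (f - g) = E.form f f - 2 * E.form f g + E.form g g := by
  simp only [map_sub, LinearMap.sub_apply]
  rw [E.symm g f]; ring

theorem eventually_lt_form {ι : Type*} {l : Filter ι} {f : ι → E.dom} {g : E.dom}
    (h : Tendsto (fun i => (f i : Lp ℝ 2 m)) l (𝓝 (g : Lp ℝ 2 m))) {c : ℝ} (hc : c < E.form g g) :
    ∀ᶠ i in l, c < E.form (f i) (f i) := by
  rcases lt_or_ge c 0 with h0 | h0
  · exact Eventually.of_forall fun i => h0.trans_le (E.nonneg _)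
  have := E.lsc (g : Lp ℝ 2 m) (ENNReal.ofReal c) (by
    beta_reduce
    rw [gt_iff_lt, dif_pos g.2]
    exact (ENNReal.ofReal_lt_ofReal_iff_of_nonneg h0).2 hc)
  filter_upwards [h.eventually this] with i hi
  rw [gt_iff_lt, dif_pos (f i).2] at hi
  exact (ENNReal.ofReal_lt_ofReal_iff_of_nonneg h0).1 hi

/-- `L²` convergence without gain of energy is convergence in energy. -/
theorem tendsto_form_sub {ι : Type*} {l : Filter ι} {f : ι → E.dom} {g : E.dom}
    (h : Tendsto (fun i => (f i : Lp ℝ 2 m)) l (𝓝 (g : Lp ℝ 2 m)))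
    (hE : ∀ᶠ i in l, E.form (f i) (f i) ≤ E.form g g) :
    Tendsto (fun i => E.form (f i - g) (f i - g)) l (𝓝 0) := by
  -- Lower semicontinuity is used for f_i + g, whose limit has energy 4ℰ(g). The parallelogram
  -- identity then forces ℰ(f_i - g) → 0.
  have h2 : Tendsto (fun i => ((f i + g : E.dom) : Lp ℝ 2 m)) l (𝓝 ((g + g : E.dom) : Lp ℝ 2 m)) :=
    h.add_const _
  rw [Metric.tendsto_nhds]
  intro ε hε
  have e : E.form (g + g) (g + g) = 4 * E.form g g := by rw [form_add_self]; ring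
  filter_upwards [hE, eventually_lt_form h2 (c := 4 * E.form g g - ε) (by rw [e]; linarith)] with i h1 h3
  rw [form_add_self] at h3
  rw [Real.dist_eq, sub_zero, abs_of_nonneg (E.nonneg _), form_sub_self]
  linarith

end DirichletForm

namespace HeatSemigroup

variable (H : HeatSemigroup E) {t : ℝ}

/-- ℰ(P_t u) = ℰ(P_{2t} u, u) by symmetry. Cauchy–Schwarz together with ℰ(P_{2t} u) ≤ ℰ(P_t u)
bounds it by √ℰ(P_t u) √ℰ(u), and one square root cancels. -/
theorem form_P_self_le (u : E.dom) (ht : 0 < t) :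
    E.form ⟨H.P t u, H.mem_dom _ ht⟩ ⟨H.P t u, H.mem_dom _ ht⟩ ≤ E.form u u := by
  set Pu : E.dom := ⟨H.P t u, H.mem_dom _ ht⟩ with hPu
  set Qu : E.dom := ⟨H.P (t + t) u, H.mem_dom _ (by positivity)⟩ with hQu
  have h1 : E.form Pu Pu = E.form Qu u := by
    rw [hPu, hQu, H.form_P _ ht, H.form_P _ (by positivity), H.P_symm _ _ ht, ← H.lap_add _ ht ht]
  have h2 : E.form Qu Qu ≤ E.form Pu Pu := by
    rw [hPu, hQu, H.energy_eq _ ht, H.energy_eq _ (by positivity)]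
    exact neg_le_neg (H.energy_antitone u (by positivity) (by linarith))
  have h3 := form_le Qu u
  have h4 : E.form Pu Pu ≤ √(E.form Pu Pu) * √(E.form u u) := by
    rw [h1] at *
    refine (le_abs_self _).trans (h3.trans ?_)
    gcongr
  have h5 := Real.mul_self_sqrt (E.nonneg Pu)
  have h6 : √(E.form Pu Pu) ≤ √(E.form u u) := by
    rcases (Real.sqrt_nonneg (E.form Pu Pu)).eq_or_lt with h | h
    · rw [← h]; positivity
    · exact le_of_mul_le_mul_left (h5.trans_le h4) h
  exact (Real.sqrt_le_sqrt_iff (E.nonneg u)).1 h6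

/-- The pairing is -ℰ(P_t u, v). As the flow does not increase the energy and P_t u → u in L², the
convergence takes place in energy. -/
theorem tendsto_form_P (u v : E.dom) :
    Tendsto (fun t => inner ℝ (H.lap t u) (v : Lp ℝ 2 m)) (𝓝[>] 0) (𝓝 (-E.form u v)) := by
  classical
  set f : ℝ → E.dom := fun t => if h : 0 < t then ⟨H.P t u, H.mem_dom _ h⟩ else 0 with hf
  have hft : ∀ t, ∀ h : 0 < t, f t = ⟨H.P t u, H.mem_dom _ h⟩ := fun t h => by rw [hf]; exact dif_pos h
  have h1 : Tendsto (fun t => (f t : Lp ℝ 2 m)) (𝓝[>] 0) (𝓝 (u : Lp ℝ 2 m)) := by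
    refine (H.tendsto_zero u).congr' ?_
    filter_upwards [self_mem_nhdsWithin] with t ht
    rw [hft t ht]
  have h2 := DirichletForm.tendsto_form_sub h1 (by
    filter_upwards [self_mem_nhdsWithin] with t ht
    rw [hft t ht]
    exact H.form_P_self_le u ht)
  have h3 : Tendsto (fun t => √(E.form (f t - u) (f t - u)) * √(E.form v v)) (𝓝[>] 0) (𝓝 0) := by
    have := (h2.sqrt).mul_const (√(E.form v v))
    simpa using this
  rw [tendsto_iff_norm_sub_tendsto_zero]
  refine squeeze_zero' (by simp) ?_ h3
  filter_upwards [self_mem_nhdsWithin] with t ht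
  have e : inner ℝ (H.lap t u) (v : Lp ℝ 2 m) = - E.form (f t) v := by
    rw [hft t ht, H.form_P _ ht, real_inner_comm]; ring
  rw [e, show -E.form (f t) v - -E.form u v = -(E.form (f t - u) v) by
    simp only [map_sub, LinearMap.sub_apply]; ring, norm_neg]
  exact form_le _ _

/-- The form is the limit of the approximating forms `t⁻¹ ⟨u - P_t u, v⟩`. -/
theorem tendsto_approxForm (u v : E.dom) :
    Tendsto (fun t => t⁻¹ * inner ℝ ((u : Lp ℝ 2 m) - H.P t u) (v : Lp ℝ 2 m)) (𝓝[>] 0) (𝓝 (E.form u v)) := by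
  -- The value at 0 is replaced by the continuous extension, so that the one-sided derivative at 0
  -- is the limit of the derivatives at positive times.
  set φ : ℝ → ℝ := Function.update (fun t => inner ℝ (H.P t u) (v : Lp ℝ 2 m)) 0 (inner ℝ (u : Lp ℝ 2 m) v) with hφ
  have e : ∀ t : ℝ, 0 < t → φ t = inner ℝ (H.P t u) (v : Lp ℝ 2 m) := fun t ht => by
    rw [hφ, Function.update_of_ne ht.ne']
  have hd : ∀ t : ℝ, 0 < t → HasDerivAt φ (inner ℝ (H.lap t u) (v : Lp ℝ 2 m)) t := by
    intro t ht
    have := (H.hasDerivAt u ht).inner ℝ (hasDerivAt_const t (v : Lp ℝ 2 m))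
    simp only [inner_zero_right, zero_add] at this
    refine this.congr_of_eventuallyEq ?_
    filter_upwards [lt_mem_nhds ht] with s hs using e s hs
  have key := hasDerivWithinAt_Ici_of_tendsto_deriv (s := Ioi 0) (f := φ) (a := 0) (e := -E.form u v)
    (fun t ht => (hd t ht).differentiableAt.differentiableWithinAt) (by
      have : Tendsto φ (𝓝[>] 0) (𝓝 (inner ℝ (u : Lp ℝ 2 m) v)) := by
        refine ((H.tendsto_zero u).inner tendsto_const_nhds).congr' ?_
        filter_upwards [self_mem_nhdsWithin] with t ht using (e t ht).symm
      rw [ContinuousWithinAt, hφ, Function.update_self]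
      exact this) self_mem_nhdsWithin (by
      refine (H.tendsto_form_P u v).congr' ?_
      filter_upwards [self_mem_nhdsWithin] with t ht using (hd t ht).deriv.symm)
  have h1 := (hasDerivWithinAt_iff_tendsto_slope' (s := Ioi 0) (by simp)).1 (key.mono Ioi_subset_Ici_self)
  have h2 := h1.neg
  rw [neg_neg] at h2
  refine h2.congr' ?_
  filter_upwards [self_mem_nhdsWithin] with t ht
  rw [slope_def_field, e t ht, hφ, Function.update_self, inner_sub_left, sub_zero]
  field_simp
  ring

end HeatSemigroup

/-! ### Consequences of sub-Markovianity -/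

namespace IsSubMarkov

variable {S : Lp ℝ 2 m →L[ℝ] Lp ℝ 2 m}

/-- The Kadison–Schwarz inequality `(S f)² ≤ S f²`, in the form `2 c S f - c² ≤ S f²` for all `c`. -/
theorem two_mul_sub_sq_le (hS : IsSubMarkov S) {f F : Lp ℝ 2 m} (hF : ∀ᵐ x ∂m, F x = f x * f x) :
    ∀ᵐ x ∂m, ∀ c : ℝ, 2 * c * S f x - c ^ 2 ≤ S F x := by
  -- Pointwise 2cf - f² ≤ c², an upper bound by a nonnegative constant, which S preserves. Rational
  -- c keep the exceptional set null; continuity in c gives the rest.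
  have h : ∀ᵐ x ∂m, ∀ c : ℚ, 2 * (c : ℝ) * S f x - (c : ℝ) ^ 2 ≤ S F x := by
    rw [ae_all_iff]
    intro c
    have h1 := hS ((c : ℝ) ^ 2) (sq_nonneg _) ((2 * (c : ℝ)) • f - F) (by
      filter_upwards [hF, Lp.coeFn_sub ((2 * (c : ℝ)) • f) F, Lp.coeFn_smul (2 * (c : ℝ)) f] with x h1 h2 h3
      rw [h2, Pi.sub_apply, h3, Pi.smul_apply, h1, smul_eq_mul]
      nlinarith [sq_nonneg (f x - c)])
    filter_upwards [h1, Lp.coeFn_sub ((2 * (c : ℝ)) • S f) (S F), Lp.coeFn_smul (2 * (c : ℝ)) (S f)] with x h1 h2 h3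
    rw [map_sub, map_smul, h2, Pi.sub_apply, h3, Pi.smul_apply, smul_eq_mul] at h1
    linarith
  filter_upwards [h] with x hx c
  refine Rat.denseRange_cast.induction_on (p := fun c : ℝ => 2 * c * S f x - c ^ 2 ≤ S F x) c ?_ hx
  exact isClosed_le (by fun_prop) continuous_const

/-- For `0 ≤ φ ≤ 1` the symmetrized increment of `f` weighted by `φ` is at most the full one. -/
theorem integral_increment_le [SigmaFinite m] (hS : IsSubMarkov S) (hsym : ∀ f g, inner ℝ (S f) g = inner ℝ f (S g))
    {f F φ : Lp ℝ 2 m} (hF : ∀ᵐ x ∂m, F x = f x * f x) (hφ1 : ∀ᵐ x ∂m, φ x ≤ 1)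
    (hφf : MemLp (fun x => φ x * f x) 2 m) :
    ∫ x, φ x * F x - 2 * (φ x * f x * S f x) + φ x * S F x ∂m ≤ 2 * inner ℝ (f - S f) f := by
  -- The unweighted increment is nonnegative, by the previous inequality with c = f(x).
  -- Integrability of S F over the whole space is not available at this stage, so the integrals are
  -- first taken over sets of finite measure.
  set I : X → ℝ := fun x => F x - 2 * (f x * S f x) + S F x with hI
  have hI0 : ∀ᵐ x ∂m, 0 ≤ I x := by
    filter_upwards [hS.two_mul_sub_sq_le hF, hF] with x h1 h2
    have := h1 (f x)
    simp only [hI]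
    rw [h2]; nlinarith
  have hFint : Integrable F m := by
    refine ((Lp.memLp f).integrable_mul (Lp.memLp f)).congr ?_
    filter_upwards [hF] with x hx
    rw [hx]; rfl
  have hfS : Integrable (fun x => f x * S f x) m := (Lp.memLp f).integrable_mul (Lp.memLp (S f))
  have hb : ∀ n, ∫ x in spanningSets m n, I x ∂m
      ≤ (∫ x in spanningSets m n, F x - 2 * (f x * S f x) ∂m) + ∫ x, F x ∂m := by
    intro n
    have hms := measurableSet_spanningSets m n
    have hfin := (measure_spanningSets_lt_top m n).ne
    have hSF : IntegrableOn (S F) (spanningSets m n) m := by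
      have : IsFiniteMeasure (m.restrict (spanningSets m n)) := ⟨by
        rw [Measure.restrict_apply_univ]; exact hfin.lt_top⟩
      exact ((Lp.memLp (S F)).restrict _).integrable (by norm_num)
    have e : ∫ x in spanningSets m n, I x ∂m
        = (∫ x in spanningSets m n, F x - 2 * (f x * S f x) ∂m) + ∫ x in spanningSets m n, S F x ∂m :=
      integral_add (hFint.sub (hfS.const_mul 2)).integrableOn hSF
    rw [e]
    gcongr
    set χ : Lp ℝ 2 m := indicatorConstLp 2 hms hfin (1 : ℝ) with hχ
    have hχe : χ =ᵐ[m] (spanningSets m n).indicator (fun _ => (1 : ℝ)) := indicatorConstLp_coeFn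
    -- By symmetry S moves onto the indicator, where it is at most 1; hence the integral of S F is
    -- at most that of F on each of these sets.
    have e1 : ∫ x in spanningSets m n, S F x ∂m = ∫ x, F x * S χ x ∂m := by
      rw [integral_mul_eq_inner, ← hsym, ← integral_mul_eq_inner, ← integral_indicator hms]
      refine integral_congr_ae ?_
      filter_upwards [hχe] with x hx
      rw [hx]
      by_cases hxs : x ∈ spanningSets m n <;> simp [hxs]
    rw [e1]
    refine integral_mono_ae ((Lp.memLp F).integrable_mul (Lp.memLp (S χ))) hFint ?_
    have hχ1 := hS 1 zero_le_one χ (by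
      filter_upwards [hχe] with x hx
      rw [hx]
      by_cases hxs : x ∈ spanningSets m n <;> simp [hxs])
    filter_upwards [hF, hχ1] with x h1 h2
    have : 0 ≤ F x := by rw [h1]; exact mul_self_nonneg _
    simpa using mul_le_mul_of_nonneg_left h2 this
  have hφF : Integrable (fun x => φ x * F x) m := (Lp.memLp φ).integrable_mul (Lp.memLp F)
  have hφSF : Integrable (fun x => φ x * S F x) m := (Lp.memLp φ).integrable_mul (Lp.memLp (S F))
  have hφfS : Integrable (fun x => φ x * f x * S f x) m := hφf.integrable_mul (Lp.memLp (S f))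
  have hint : Integrable (fun x => φ x * F x - 2 * (φ x * f x * S f x) + φ x * S F x) m :=
    (hφF.sub (hφfS.const_mul 2)).add hφSF
  have l1 : Tendsto (fun n => ∫ x in spanningSets m n, φ x * F x - 2 * (φ x * f x * S f x) + φ x * S F x ∂m) atTop
      (𝓝 (∫ x, φ x * F x - 2 * (φ x * f x * S f x) + φ x * S F x ∂m)) := by
    have := tendsto_setIntegral_of_monotone (measurableSet_spanningSets m) (monotone_spanningSets m)
      (hint.integrableOn (s := ⋃ n, spanningSets m n))
    rwa [iUnion_spanningSets, setIntegral_univ] at this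
  have l2 : Tendsto (fun n => (∫ x in spanningSets m n, F x - 2 * (f x * S f x) ∂m) + ∫ x, F x ∂m) atTop
      (𝓝 ((∫ x, F x - 2 * (f x * S f x) ∂m) + ∫ x, F x ∂m)) := by
    have := tendsto_setIntegral_of_monotone (measurableSet_spanningSets m) (monotone_spanningSets m)
      ((hFint.sub (hfS.const_mul 2)).integrableOn (s := ⋃ n, spanningSets m n))
    rw [iUnion_spanningSets, setIntegral_univ] at this
    exact this.add_const _
  have e2 : (∫ x, F x - 2 * (f x * S f x) ∂m) + ∫ x, F x ∂m = 2 * inner ℝ (f - S f) f := by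
    have e3 : ∫ x, F x ∂m = inner ℝ f f := by
      rw [← integral_mul_eq_inner]
      exact integral_congr_ae hF
    rw [integral_sub hFint (hfS.const_mul 2), integral_const_mul, integral_mul_eq_inner, e3, inner_sub_left,
      hsym f f]
    ring
  rw [← e2]
  refine le_of_tendsto_of_tendsto' l1 l2 fun n => le_trans ?_ (hb n)
  have hIint : IntegrableOn I (spanningSets m n) m := by
    have : IsFiniteMeasure (m.restrict (spanningSets m n)) := ⟨by
      rw [Measure.restrict_apply_univ]; exact measure_spanningSets_lt_top m n⟩
    exact (hFint.sub (hfS.const_mul 2)).integrableOn.add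
      (((Lp.memLp (S F)).restrict _).integrable (by norm_num))
  refine integral_mono_ae hint.integrableOn hIint (ae_restrict_of_ae ?_)
  filter_upwards [hI0, hφ1] with x h1 h2
  have := mul_le_mul_of_nonneg_right h2 h1
  simp only [hI] at this ⊢
  linarith

end IsSubMarkov

end

section

variable {X : Type*} [MeasurableSpace X] {m : Measure X} {E : DirichletForm m}

/-! ### The carré du champ -/

namespace CarreDuChamp

variable (G : CarreDuChamp E)

theorem Γ_add_smul (f g : E.dom) (c : ℝ) :
    G.Γ (f + c • g) (f + c • g) = G.Γ f f + (2 * c) • G.Γ f g + (c ^ 2) • G.Γ g g := by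
  simp only [map_add, map_smul, LinearMap.add_apply, LinearMap.smul_apply]
  rw [G.symm g f]
  module

/-- The Cauchy–Schwarz inequality for the carré du champ. -/
theorem abs_Γ_le (f g : E.dom) : ∀ᵐ x ∂m, |G.Γ f g x| ≤ G.sqrtΓ f x * G.sqrtΓ g x := by
  have h : ∀ᵐ x ∂m, ∀ c : ℚ, 0 ≤ G.Γ g g x * ((c : ℝ) * c) + 2 * G.Γ f g x * (c : ℝ) + G.Γ f f x := by
    rw [ae_all_iff]
    intro c
    filter_upwards [G.nonneg (f + (c : ℝ) • g),
      Lp.coeFn_add (G.Γ f f + (2 * (c : ℝ)) • G.Γ f g) (((c : ℝ) ^ 2) • G.Γ g g),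
      Lp.coeFn_add (G.Γ f f) ((2 * (c : ℝ)) • G.Γ f g),
      Lp.coeFn_smul (2 * (c : ℝ)) (G.Γ f g), Lp.coeFn_smul ((c : ℝ) ^ 2) (G.Γ g g)] with x h1 h2 h3 h4 h5
    rw [Γ_add_smul, h2, Pi.add_apply, h3, Pi.add_apply, h4, h5, Pi.smul_apply, Pi.smul_apply,
      smul_eq_mul, smul_eq_mul] at h1
    linarith
  filter_upwards [h, G.nonneg f, G.nonneg g] with x hx hf hg
  have h' : ∀ c : ℝ, 0 ≤ G.Γ g g x * (c * c) + 2 * G.Γ f g x * c + G.Γ f f x := by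
    intro c
    refine Rat.denseRange_cast.induction_on
      (p := fun c : ℝ => 0 ≤ G.Γ g g x * (c * c) + 2 * G.Γ f g x * c + G.Γ f f x) c ?_ hx
    exact isClosed_le continuous_const (by fun_prop)
  have hd := discrim_le_zero h'
  rw [discrim] at hd
  rw [sqrtΓ, sqrtΓ, ← Real.sqrt_mul hf]
  apply Real.abs_le_sqrt
  nlinarith

theorem sqrtΓ_nonneg (f : E.dom) (x : X) : 0 ≤ G.sqrtΓ f x := Real.sqrt_nonneg _

theorem aestronglyMeasurable_sqrtΓ (f : E.dom) : AEStronglyMeasurable (G.sqrtΓ f) m :=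
  Real.continuous_sqrt.comp_aestronglyMeasurable (Lp.aestronglyMeasurable (G.Γ f f))

theorem sqrtΓ_sq (f : E.dom) : ∀ᵐ x ∂m, G.sqrtΓ f x ^ 2 = G.Γ f f x := by
  filter_upwards [G.nonneg f] with x hx
  exact Real.sq_sqrt hx

theorem sqrtΓ_add_le (f g : E.dom) : ∀ᵐ x ∂m, G.sqrtΓ (f + g) x ≤ G.sqrtΓ f x + G.sqrtΓ g x := by
  have e := G.Γ_add_smul f g 1
  rw [one_smul] at e
  filter_upwards [G.abs_Γ_le f g, G.sqrtΓ_sq f, G.sqrtΓ_sq g,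
      Lp.coeFn_add (G.Γ f f + (2 * (1 : ℝ)) • G.Γ f g) (((1 : ℝ) ^ 2) • G.Γ g g),
      Lp.coeFn_add (G.Γ f f) ((2 * (1 : ℝ)) • G.Γ f g),
      Lp.coeFn_smul (2 * (1 : ℝ)) (G.Γ f g), Lp.coeFn_smul ((1 : ℝ) ^ 2) (G.Γ g g)] with x h0 hf hg h2 h3 h4 h5
  have h1 : G.Γ (f + g) (f + g) x = G.Γ f f x + 2 * G.Γ f g x + G.Γ g g x := by
    rw [e, h2, Pi.add_apply, h3, Pi.add_apply, h4, h5, Pi.smul_apply, Pi.smul_apply,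
      smul_eq_mul, smul_eq_mul]; ring
  have h6 := (abs_le.1 h0).2
  have := G.sqrtΓ_nonneg f x
  have := G.sqrtΓ_nonneg g x
  change √(G.Γ (f + g) (f + g) x) ≤ _
  rw [h1]
  refine Real.sqrt_le_iff.2 ⟨by positivity, ?_⟩
  nlinarith

theorem sqrtΓ_smul (c : ℝ) (f : E.dom) : ∀ᵐ x ∂m, G.sqrtΓ (c • f) x = |c| * G.sqrtΓ f x := by
  have e : G.Γ (c • f) (c • f) = (c ^ 2) • G.Γ f f := by
    simp only [map_smul, LinearMap.smul_apply]; module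
  filter_upwards [Lp.coeFn_smul (c ^ 2) (G.Γ f f)] with x hx
  rw [sqrtΓ, e, hx, Pi.smul_apply, smul_eq_mul, Real.sqrt_mul (sq_nonneg c), Real.sqrt_sq_eq_abs, sqrtΓ]

theorem sqrtΓ_neg (f : E.dom) : ∀ᵐ x ∂m, G.sqrtΓ (-f) x = G.sqrtΓ f x := by
  have := G.sqrtΓ_smul (-1) f
  simpa using this

theorem sqrtΓ_sub_le (f g : E.dom) : ∀ᵐ x ∂m, G.sqrtΓ (f - g) x ≤ G.sqrtΓ f x + G.sqrtΓ g x := by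
  rw [sub_eq_add_neg]
  filter_upwards [G.sqrtΓ_add_le f (-g), G.sqrtΓ_neg g] with x h1 h2
  rwa [h2] at h1

theorem eLpNorm_sqrtΓ_add_le {p : ℝ≥0∞} (hp : 1 ≤ p) (f g : E.dom) :
    eLpNorm (G.sqrtΓ (f + g)) p m ≤ eLpNorm (G.sqrtΓ f) p m + eLpNorm (G.sqrtΓ g) p m := by
  have h1 : eLpNorm (G.sqrtΓ (f + g)) p m ≤ eLpNorm (G.sqrtΓ f + G.sqrtΓ g) p m := by
    refine eLpNorm_mono_ae_real ?_
    filter_upwards [G.sqrtΓ_add_le f g] with x h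
    rw [Real.norm_of_nonneg (G.sqrtΓ_nonneg _ x)]
    exact h
  exact h1.trans (eLpNorm_add_le (G.aestronglyMeasurable_sqrtΓ f) (G.aestronglyMeasurable_sqrtΓ g) hp)

theorem eLpNorm_sqrtΓ_sub_le {p : ℝ≥0∞} (hp : 1 ≤ p) (f g : E.dom) :
    eLpNorm (G.sqrtΓ (f - g)) p m ≤ eLpNorm (G.sqrtΓ f) p m + eLpNorm (G.sqrtΓ g) p m := by
  have := G.eLpNorm_sqrtΓ_add_le hp f (-g)
  rwa [← sub_eq_add_neg, eLpNorm_congr_ae (f := G.sqrtΓ (-g)) (G.sqrtΓ_neg g)] at this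

theorem eLpNorm_sqrtΓ_smul {p : ℝ≥0∞} (c : ℝ) (f : E.dom) :
    eLpNorm (G.sqrtΓ (c • f)) p m = ‖c‖ₑ * eLpNorm (G.sqrtΓ f) p m := by
  have e : G.sqrtΓ (c • f) =ᵐ[m] |c| • G.sqrtΓ f := G.sqrtΓ_smul c f
  rw [eLpNorm_congr_ae e, eLpNorm_const_smul, Real.enorm_abs]

theorem MemVp.sub {p : ℝ≥0∞} (hp : 1 ≤ p) {f g : E.dom} (hf : G.MemVp p f) (hg : G.MemVp p g) :
    G.MemVp p (f - g) :=
  ⟨memLp_sub hf.1 hg.1, G.aestronglyMeasurable_sqrtΓ _,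
    (G.eLpNorm_sqrtΓ_sub_le hp f g).trans_lt (ENNReal.add_lt_top.2 ⟨hf.2.2, hg.2.2⟩)⟩

theorem MemVp.add {p : ℝ≥0∞} (hp : 1 ≤ p) {f g : E.dom} (hf : G.MemVp p f) (hg : G.MemVp p g) :
    G.MemVp p (f + g) :=
  ⟨(hf.1.add hg.1).ae_eq (Lp.coeFn_add _ _).symm, G.aestronglyMeasurable_sqrtΓ _,
    (G.eLpNorm_sqrtΓ_add_le hp f g).trans_lt (ENNReal.add_lt_top.2 ⟨hf.2.2, hg.2.2⟩)⟩

theorem MemVp.smul {p : ℝ≥0∞} (c : ℝ) {f : E.dom} (hf : G.MemVp p f) : G.MemVp p (c • f) :=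
  ⟨memLp_smul c hf.1, G.aestronglyMeasurable_sqrtΓ _, by
    rw [eLpNorm_sqrtΓ_smul]; exact ENNReal.mul_lt_top (by simp) hf.2.2⟩

theorem memLp_sqrtΓ_two (f : E.dom) : MemLp (G.sqrtΓ f) 2 m := by
  rw [memLp_two_iff_integrable_sq (G.aestronglyMeasurable_sqrtΓ f)]
  exact (L1.integrable_coeFn (G.Γ f f)).congr ((G.sqrtΓ_sq f).mono fun x hx => hx.symm)

theorem integral_sqrtΓ_sq (f : E.dom) : ∫ x, G.sqrtΓ f x ^ 2 ∂m = ∫ x, G.Γ f f x ∂m :=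
  integral_congr_ae (G.sqrtΓ_sq f)

theorem ofReal_normV_le_normVp (p : ℝ≥0∞) (f : E.dom) : ENNReal.ofReal (E.normV f) ≤ G.normVp p f := by
  rw [normVp, add_assoc]
  exact le_self_add

theorem eLpNorm_le_normVp (p : ℝ≥0∞) (f : E.dom) : eLpNorm (f : Lp ℝ 2 m) p m ≤ G.normVp p f := by
  rw [normVp]
  exact le_add_self.trans le_self_add

theorem eLpNorm_sqrtΓ_le_normVp (p : ℝ≥0∞) (f : E.dom) : eLpNorm (G.sqrtΓ f) p m ≤ G.normVp p f := by
  rw [normVp]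
  exact le_add_self

theorem memVp_two (f : E.dom) : G.MemVp 2 f := ⟨Lp.memLp _, G.memLp_sqrtΓ_two f⟩

end CarreDuChamp

variable {G : CarreDuChamp E}

namespace TestAlgebra

variable (A : TestAlgebra G)

theorem exists_comp (η : ℝ → ℝ) (hη : ContDiff ℝ 1 η) (h0 : η 0 = 0) (f : A.carrier) :
    ∃ g : A.carrier, ∀ᵐ x ∂m, ((g : E.dom) : Lp ℝ 2 m) x = η (((f : E.dom) : Lp ℝ 2 m) x) :=
  A.comp_mem 1 (fun v => η (v 0)) (hη.comp (contDiff_apply ℝ ℝ 0)) h0 (fun _ => f)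

theorem exists_mul (f g : A.carrier) : ∃ fg : A.carrier, ∀ᵐ x ∂m,
    ((fg : E.dom) : Lp ℝ 2 m) x = ((f : E.dom) : Lp ℝ 2 m) x * ((g : E.dom) : Lp ℝ 2 m) x := by
  have := A.comp_mem 2 (fun v => v 0 * v 1) ((contDiff_apply ℝ ℝ 0).mul (contDiff_apply ℝ ℝ 1))
    (by simp) ![f, g]
  simpa using this

theorem exists_approx {p : ℝ≥0∞} (h : G.DenseInVp p A.carrier) {f : E.dom} (hf : G.MemVp p f) :
    ∃ a : ℕ → A.carrier, Tendsto (fun n => G.normVp p (f - a n)) atTop (𝓝 0) := by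
  have := fun n : ℕ => h.2 f hf (n + 1 : ℝ≥0∞)⁻¹ (by simp)
  choose a ha hlt using this
  refine ⟨fun n => ⟨a n, ha n⟩, ?_⟩
  refine tendsto_of_tendsto_of_tendsto_of_le_of_le tendsto_const_nhds ?_ (fun _ => zero_le) fun n => (hlt n).le
  have := (ENNReal.tendsto_inv_nat_nhds_zero).comp (tendsto_add_atTop_nat 1)
  refine this.congr fun n => ?_
  simp

theorem enorm_le_normV (f : E.dom) : ‖(f : Lp ℝ 2 m)‖ₑ ≤ ENNReal.ofReal (E.normV f) := by
  rw [← ofReal_norm]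
  refine ENNReal.ofReal_le_ofReal (Real.le_sqrt_of_sq_le ?_)
  linarith [E.nonneg f]

theorem enorm_le_normVp (p : ℝ≥0∞) (f : E.dom) : ‖(f : Lp ℝ 2 m)‖ₑ ≤ G.normVp p f :=
  (enorm_le_normV f).trans (G.ofReal_normV_le_normVp p f)

/-- Test functions are dense in `L²`. -/
theorem exists_norm_sub_lt (γ : Lp ℝ 2 m) {ε : ℝ} (hε : 0 < ε) :
    ∃ a : A.carrier, ‖γ - ((a : E.dom) : Lp ℝ 2 m)‖ < ε := by
  obtain ⟨v, hv, hvd⟩ := Metric.dense_iff.1 E.dense_dom γ _ (half_pos hε)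
  lift v to E.dom using hvd
  obtain ⟨a, ha, hlt⟩ := (A.dense 2 (by simp) le_rfl).2 v (G.memVp_two v)
    (ENNReal.ofReal (ε / 2)) (by simpa using hε)
  refine ⟨⟨a, ha⟩, ?_⟩
  have h1 : ‖(v : Lp ℝ 2 m) - (a : Lp ℝ 2 m)‖ < ε / 2 := by
    have h0 := (enorm_le_normVp (G := G) 2 (v - a)).trans_lt hlt
    rw [← ofReal_norm] at h0
    exact (ENNReal.ofReal_lt_ofReal_iff (half_pos hε)).1 h0
  rw [mem_ball_iff_norm'] at hv
  have h2 := norm_sub_le_norm_sub_add_norm_sub γ (v : Lp ℝ 2 m) (a : Lp ℝ 2 m)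
  exact h2.trans_lt (by linarith)

/-- Test functions with values in `[0,1]` converging to `1`. -/
theorem exists_tendsto_one [SigmaFinite m] : ∃ φ : ℕ → A.carrier,
    (∀ n, ∀ᵐ x ∂m, 0 ≤ ((φ n : E.dom) : Lp ℝ 2 m) x ∧ ((φ n : E.dom) : Lp ℝ 2 m) x ≤ 1) ∧
    ∀ᵐ x ∂m, Tendsto (fun n => ((φ n : E.dom) : Lp ℝ 2 m) x) atTop (𝓝 1) := by
  obtain ⟨g, hg0, hgm, hg⟩ := exists_pos_lintegral_lt_of_sigmaFinite m (ε := 1) one_ne_zero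
  have hg2 : MemLp (fun x => √(g x : ℝ)) 2 m := by
    rw [memLp_two_iff_integrable_sq (by fun_prop)]
    simp only [NNReal.zero_le_coe, Real.sq_sqrt]
    refine ⟨by fun_prop, ?_⟩
    rw [HasFiniteIntegral]
    simpa using hg.trans ENNReal.one_lt_top
  set γ : Lp ℝ 2 m := hg2.toLp _ with hγ
  have hγe : γ =ᵐ[m] fun x => √(g x : ℝ) := hg2.coeFn_toLp
  have hcl : ∀ n : ℕ, ∃ a : A.carrier, ‖γ - ((a : E.dom) : Lp ℝ 2 m)‖ < 1 / ((n : ℝ) + 1) :=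
    fun n => A.exists_norm_sub_lt γ (by positivity)
  choose a ha using hcl
  have hlim : Tendsto (fun n => ((a n : E.dom) : Lp ℝ 2 m)) atTop (𝓝 γ) := by
    rw [tendsto_iff_norm_sub_tendsto_zero]
    refine squeeze_zero (fun _ => norm_nonneg _) (fun n => ?_) tendsto_one_div_add_atTop_nhds_zero_nat
    rw [norm_sub_rev]; exact (ha n).le
  obtain ⟨ns, hns, hae⟩ := (tendstoInMeasure_of_tendsto_Lp hlim).exists_seq_tendsto_ae
  -- The approximants converge a.e. to a strictly positive function, so n times the n-th one tends
  -- to infinity. Composition with this smooth function, which vanishes at 0 and tends to 1 at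
  -- infinity, stays in the algebra.
  set η : ℝ → ℝ := fun x => x ^ 2 / (1 + x ^ 2) with hη
  have hηc : ContDiff ℝ 1 η := by
    refine ContDiff.div (by fun_prop) (by fun_prop) fun x => ?_
    positivity
  have hφ := fun n : ℕ => A.exists_comp η hηc (by simp [hη]) ((n : ℝ) • a (ns n))
  choose φ hφ using hφ
  refine ⟨φ, fun n => ?_, ?_⟩
  · filter_upwards [hφ n] with x hx
    rw [hx, hη]
    exact ⟨by positivity, (div_le_one (by positivity)).2 (by linarith)⟩
  · have hsm : ∀ᵐ x ∂m, ∀ n : ℕ, (((((n : ℝ) • a (ns n) : A.carrier) : E.dom) : Lp ℝ 2 m)) x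
        = n * ((a (ns n) : E.dom) : Lp ℝ 2 m) x := by
      rw [ae_all_iff]
      intro n
      exact Lp.coeFn_smul (n : ℝ) ((a (ns n) : E.dom) : Lp ℝ 2 m)
    filter_upwards [ae_all_iff.2 hφ, hsm, hae, hγe] with x h1 h2 h3 h4
    simp only [h1, h2]
    rw [h4] at h3
    have hpos : 0 < √(g x : ℝ) := Real.sqrt_pos.2 (by exact_mod_cast hg0 x)
    have h5 : Tendsto (fun n : ℕ => ((n : ℝ) * ((a (ns n) : E.dom) : Lp ℝ 2 m) x)) atTop atTop :=
      tendsto_natCast_atTop_atTop.atTop_mul_pos hpos h3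
    have h6 : Tendsto η atTop (𝓝 1) := by
      have : Tendsto (fun x : ℝ => 1 - (1 + x ^ 2)⁻¹) atTop (𝓝 (1 - 0)) := by
        refine tendsto_const_nhds.sub (tendsto_inv_atTop_zero.comp ?_)
        exact tendsto_atTop_add_const_left _ _ (tendsto_pow_atTop two_ne_zero)
      rw [sub_zero] at this
      refine this.congr fun x => ?_
      rw [hη]
      field_simp
      ring
    exact h6.comp h5

variable [SigmaFinite m]

/-- The carré du champ of a test function, weighted by a test function with values in `[0,1]`,
is controlled by the energy. -/
theorem integral_mul_Γ_le (H : HeatSemigroup E) (f φ : A.carrier)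
    (hφ1 : ∀ᵐ x ∂m, ((φ : E.dom) : Lp ℝ 2 m) x ≤ 1) :
    ∫ x, ((φ : E.dom) : Lp ℝ 2 m) x * G.Γ (f : E.dom) f x ∂m ≤ E.form (f : E.dom) f := by
  obtain ⟨F, hF⟩ := A.exists_mul f f
  obtain ⟨fφ, hfφ⟩ := A.exists_mul f φ
  -- Replacing each form by t⁻¹⟨u - P_t u, v⟩ turns ℰ(f, fφ) - ½ℰ(f², φ) into 1/(2t) times the
  -- increment of `f` weighted by φ. `integral_increment_le` compares it with the approximation
  -- t⁻¹⟨f - P_t f, f⟩ of ℰ(f).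
  rw [G.represents f φ fφ F (A.memLp f f.2 ⊤ le_top) (A.memLp φ φ.2 ⊤ le_top) hfφ hF]
  have l1 := (H.tendsto_approxForm (f : E.dom) (fφ : E.dom)).sub
    ((H.tendsto_approxForm (F : E.dom) (φ : E.dom)).const_mul (1 / 2))
  have l2 := H.tendsto_approxForm (f : E.dom) (f : E.dom)
  refine le_of_tendsto_of_tendsto l1 l2 ?_
  filter_upwards [self_mem_nhdsWithin] with t (ht : 0 < t)
  have hφf : MemLp (fun x => ((φ : E.dom) : Lp ℝ 2 m) x * ((f : E.dom) : Lp ℝ 2 m) x) 2 m := by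
    refine (Lp.memLp ((fφ : E.dom) : Lp ℝ 2 m)).ae_eq ?_
    filter_upwards [hfφ] with x hx
    rw [hx, mul_comm]
  have key := (H.isSubMarkov ht).integral_increment_le (fun f g => H.P_symm f g ht) hF hφ1 hφf
  set f' : Lp ℝ 2 m := ((f : E.dom) : Lp ℝ 2 m)
  set φ' : Lp ℝ 2 m := ((φ : E.dom) : Lp ℝ 2 m)
  set F' : Lp ℝ 2 m := ((F : E.dom) : Lp ℝ 2 m)
  set fφ' : Lp ℝ 2 m := ((fφ : E.dom) : Lp ℝ 2 m)
  have i1 : Integrable (fun x => φ' x * F' x) m := (Lp.memLp φ').integrable_mul (Lp.memLp F')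
  have i2 : Integrable (fun x => φ' x * H.P t F' x) m := (Lp.memLp φ').integrable_mul (Lp.memLp (H.P t F'))
  have i3 : Integrable (fun x => φ' x * f' x * H.P t f' x) m := hφf.integrable_mul (Lp.memLp (H.P t f'))
  have i12 : Integrable (fun x => φ' x * F' x - 2 * (φ' x * f' x * H.P t f' x)) m := i1.sub (i3.const_mul 2)
  rw [integral_add i12 i2, integral_sub i1 (i3.const_mul 2), integral_const_mul,
    integral_mul_eq_inner, integral_mul_eq_inner] at key
  have e1 : ∫ x, φ' x * f' x * H.P t f' x ∂m = inner ℝ fφ' (H.P t f') := by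
    rw [← integral_mul_eq_inner]
    refine integral_congr_ae ?_
    filter_upwards [hfφ] with x hx
    rw [hx]; ring
  have e2 : inner ℝ fφ' f' = inner ℝ φ' F' := by
    rw [← integral_mul_eq_inner, ← integral_mul_eq_inner]
    refine integral_congr_ae ?_
    filter_upwards [hfφ, hF] with x h1 h2
    rw [h1, h2]; ring
  rw [e1] at key
  have h2 := mul_le_mul_of_nonneg_left key (show 0 ≤ t⁻¹ / 2 by positivity)
  rw [inner_sub_left, inner_sub_left, inner_sub_left, real_inner_comm, e2, real_inner_comm fφ', real_inner_comm φ',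
    real_inner_comm φ']
  rw [inner_sub_left] at h2
  linarith

/-- The carré du champ is controlled by the energy. -/
theorem integral_Γ_le (A : TestAlgebra G) (H : HeatSemigroup E) (f : E.dom) : ∫ x, G.Γ f f x ∂m ≤ E.form f f := by
  have test : ∀ f : A.carrier, ∫ x, G.Γ (f : E.dom) f x ∂m ≤ E.form (f : E.dom) f := by
    intro f
    obtain ⟨φ, h01, hlim⟩ := A.exists_tendsto_one
    have l : Tendsto (fun n => ∫ x, ((φ n : E.dom) : Lp ℝ 2 m) x * G.Γ (f : E.dom) f x ∂m) atTop
        (𝓝 (∫ x, G.Γ (f : E.dom) f x ∂m)) := by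
      refine tendsto_integral_of_dominated_convergence (fun x => G.Γ (f : E.dom) f x)
        (fun n => (Lp.aestronglyMeasurable _).mul (Lp.aestronglyMeasurable _)) (L1.integrable_coeFn _) ?_ ?_
      · intro n
        filter_upwards [h01 n, G.nonneg f] with x h1 h2
        rw [norm_mul, Real.norm_of_nonneg h1.1, Real.norm_of_nonneg h2]
        exact mul_le_of_le_one_left h2 h1.2
      · filter_upwards [hlim] with x hx
        simpa using hx.mul_const (G.Γ (f : E.dom) f x)
    exact le_of_tendsto' l fun n => A.integral_mul_Γ_le H f (φ n) ((h01 n).mono fun x hx => hx.2)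
  -- Both sides are continuous for the norm of 𝕍, the left one by the continuity of Γ into L¹, and
  -- test functions are dense there.
  obtain ⟨a, ha⟩ := A.exists_approx (A.dense 2 (by simp) le_rfl) (G.memVp_two f)
  obtain ⟨K, hK⟩ := G.continuous
  have hV : Tendsto (fun n => E.normV (f - a n)) atTop (𝓝 0) := by
    have h1 : Tendsto (fun n => ENNReal.ofReal (E.normV (f - a n))) atTop (𝓝 0) :=
      tendsto_of_tendsto_of_tendsto_of_le_of_le tendsto_const_nhds ha (fun _ => zero_le)
        fun n => G.ofReal_normV_le_normVp 2 _
    have h2 := (ENNReal.continuousAt_toReal (ENNReal.zero_ne_top)).tendsto.comp h1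
    refine h2.congr fun n => ?_
    exact ENNReal.toReal_ofReal (Real.sqrt_nonneg _)
  have hE : Tendsto (fun n => E.form (f - a n) (f - a n)) atTop (𝓝 0) := by
    have h1 := hV.pow 2
    rw [zero_pow two_ne_zero] at h1
    refine squeeze_zero (fun _ => E.nonneg _) (fun n => ?_) h1
    rw [DirichletForm.normV, Real.sq_sqrt (add_nonneg (sq_nonneg _) (E.nonneg _))]
    linarith [sq_nonneg ‖((f - a n : E.dom) : Lp ℝ 2 m)‖]
  have hE1 : Tendsto (fun n => E.form f (f - a n)) atTop (𝓝 0) := by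
    have h1 := (hE.sqrt).const_mul (√(E.form f f))
    rw [Real.sqrt_zero, mul_zero] at h1
    exact squeeze_zero_norm (fun n => HeatSemigroup.form_le _ _) h1
  have lE : Tendsto (fun n => E.form (a n : E.dom) (a n)) atTop (𝓝 (E.form f f)) := by
    have h1 := ((tendsto_const_nhds (x := E.form f f)).sub (hE1.const_mul 2)).add hE
    rw [mul_zero, sub_zero, add_zero] at h1
    refine h1.congr fun n => ?_
    simp only [map_sub, LinearMap.sub_apply]
    rw [E.symm (a n) f]; ring
  have lΓ : Tendsto (fun n => G.Γ (a n : E.dom) (a n)) atTop (𝓝 (G.Γ f f)) := by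
    have h1 : Tendsto (fun n => G.Γ f (f - a n)) atTop (𝓝 0) := by
      have := hV.const_mul (K * E.normV f)
      rw [mul_zero] at this
      exact squeeze_zero_norm (fun n => hK _ _) this
    have h2 : Tendsto (fun n => G.Γ (f - a n) (f - a n)) atTop (𝓝 0) := by
      have := (hV.const_mul K).mul hV
      rw [mul_zero] at this
      exact squeeze_zero_norm (fun n => hK _ _) this
    have h3 := ((tendsto_const_nhds (x := G.Γ f f)).sub (h1.const_smul (2 : ℝ))).add h2
    rw [smul_zero, sub_zero, add_zero] at h3
    refine h3.congr fun n => ?_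
    simp only [map_sub, LinearMap.sub_apply]
    rw [G.symm (a n) f]; module
  have lI : Tendsto (fun n => ∫ x, G.Γ (a n : E.dom) (a n) x ∂m) atTop (𝓝 (∫ x, G.Γ f f x ∂m)) := by
    have h := (L1.continuous_integral (μ := m) (E := ℝ)).tendsto (G.Γ f f) |>.comp lΓ
    simpa only [Function.comp_def, L1.integral_eq_integral] using h
  exact le_of_tendsto_of_tendsto' lI lE fun n => test (a n)

theorem eLpNorm_sqrtΓ_two_le (A : TestAlgebra G) (H : HeatSemigroup E) (f : E.dom) :
    eLpNorm (G.sqrtΓ f) 2 m ≤ ENNReal.ofReal (√(E.form f f)) := by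
  have h := G.memLp_sqrtΓ_two f
  rw [h.eLpNorm_eq_integral_rpow_norm (by simp) (by simp)]
  refine ENNReal.ofReal_le_ofReal ?_
  simp only [ENNReal.toReal_ofNat, Real.rpow_ofNat, Real.norm_eq_abs, sq_abs]
  rw [G.integral_sqrtΓ_sq, ← one_div, ← Real.sqrt_eq_rpow]
  exact Real.sqrt_le_sqrt (A.integral_Γ_le H f)

theorem eLpNorm_sqrtΓ_two_le_normVp (A : TestAlgebra G) (H : HeatSemigroup E) (p : ℝ≥0∞) (f : E.dom) :
    eLpNorm (G.sqrtΓ f) 2 m ≤ G.normVp p f := by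
  refine (A.eLpNorm_sqrtΓ_two_le H f).trans ((ENNReal.ofReal_le_ofReal ?_).trans (G.ofReal_normV_le_normVp p f))
  refine Real.sqrt_le_sqrt ?_
  linarith [sq_nonneg ‖(f : Lp ℝ 2 m)‖]

/-- The L²-Γ inequality with constant 1, valid for all positive times. It handles the L² and L^∞
parts of the sum spaces. -/
theorem eLpNorm_sqrtΓ_P_le (A : TestAlgebra G) (H : HeatSemigroup E) (f : Lp ℝ 2 m) {t : ℝ} (ht : 0 < t) :
    eLpNorm (G.sqrtΓ ⟨H.P t f, H.mem_dom f ht⟩) 2 m ≤ ENNReal.ofReal (1 / √t) * eLpNorm f 2 m := by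
  refine (A.eLpNorm_sqrtΓ_two_le H _).trans ?_
  rw [← Lp.enorm_def, ← ofReal_norm, ← ENNReal.ofReal_mul (by positivity)]
  refine ENNReal.ofReal_le_ofReal ?_
  refine (Real.sqrt_le_sqrt (H.energy_le f ht)).trans (le_of_eq ?_)
  rw [Real.sqrt_mul (by positivity), Real.sqrt_sq (norm_nonneg _), Real.sqrt_div zero_le_one, Real.sqrt_one]

end TestAlgebra

end

section

variable {X : Type*} [MeasurableSpace X] {m : Measure X} {E : DirichletForm m}

/-! ### Hölder inequalities in sums of Lebesgue spaces -/

theorem sumNorm_le {f g h : X → ℝ} {p q : ℝ≥0∞} (hg : AEStronglyMeasurable g m) (hh : AEStronglyMeasurable h m)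
    (he : f =ᵐ[m] g + h) : sumNorm f p q m ≤ eLpNorm g p m + eLpNorm h q m := by
  unfold sumNorm
  exact iInf_le_of_le g <| iInf_le_of_le h <| iInf_le_of_le hg <| iInf_le_of_le hh <| iInf_le_of_le he le_rfl

theorem exists_seq_tendsto_ae_zero {u : ℕ → X → ℝ} {p : ℝ≥0∞} (hp : p ≠ 0)
    (hu : ∀ n, AEStronglyMeasurable (u n) m) (h : Tendsto (fun n => eLpNorm (u n) p m) atTop (𝓝 0)) :
    ∃ ns : ℕ → ℕ, StrictMono ns ∧ ∀ᵐ x ∂m, Tendsto (fun n => u (ns n) x) atTop (𝓝 0) :=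
  (tendstoInMeasure_of_tendsto_eLpNorm (g := 0) hp hu aestronglyMeasurable_zero
    (by simpa using h)).exists_seq_tendsto_ae

/-- Near-optimal decompositions have both summands tending to zero in norm. A subsequence for the
first summand, and a further one for the second, converge a.e. -/
theorem exists_seq_tendsto_ae_zero_of_sumNorm {u : ℕ → X → ℝ} {p q : ℝ≥0∞} (hp : p ≠ 0) (hq : q ≠ 0)
    (h : Tendsto (fun n => sumNorm (u n) p q m) atTop (𝓝 0)) :
    ∃ ns : ℕ → ℕ, StrictMono ns ∧ ∀ᵐ x ∂m, Tendsto (fun n => u (ns n) x) atTop (𝓝 0) := by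
  -- The slack 1/n is needed because the infimum in the sum norm need not be attained; at n = 0 it
  -- is infinite, which does no harm.
  have l : Tendsto (fun n => sumNorm (u n) p q m + (n : ℝ≥0∞)⁻¹) atTop (𝓝 0) := by
    simpa using h.add ENNReal.tendsto_inv_nat_nhds_zero
  have ex : ∀ n : ℕ, ∃ g k : X → ℝ, AEStronglyMeasurable g m ∧ AEStronglyMeasurable k m ∧ u n =ᵐ[m] g + k ∧
      eLpNorm g p m + eLpNorm k q m ≤ sumNorm (u n) p q m + (n : ℝ≥0∞)⁻¹ ∨ sumNorm (u n) p q m = ⊤ := by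
    intro n
    by_cases ht : sumNorm (u n) p q m = ⊤
    · exact ⟨0, 0, Or.inr ht⟩
    have : sumNorm (u n) p q m < sumNorm (u n) p q m + (n : ℝ≥0∞)⁻¹ :=
      ENNReal.lt_add_right ht (by simp)
    conv_lhs at this => rw [sumNorm]
    simp only [iInf_lt_iff] at this
    obtain ⟨g, k, hg, hk, he, hlt⟩ := this
    exact ⟨g, k, Or.inl ⟨hg, hk, he, hlt.le⟩⟩
  have hfin : ∀ᶠ n in atTop, sumNorm (u n) p q m ≠ ⊤ := by
    filter_upwards [h.eventually_lt_const ENNReal.zero_lt_top] with n hn using hn.ne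
  obtain ⟨N, hN⟩ := eventually_atTop.1 hfin
  have ex' : ∀ n : ℕ, ∃ g k : X → ℝ, AEStronglyMeasurable g m ∧ AEStronglyMeasurable k m ∧ u (n + N) =ᵐ[m] g + k ∧
      eLpNorm g p m + eLpNorm k q m ≤ sumNorm (u (n + N)) p q m + ((n + N : ℕ) : ℝ≥0∞)⁻¹ := by
    intro n
    obtain ⟨g, k, hgk | hgk⟩ := ex (n + N)
    · exact ⟨g, k, hgk⟩
    · exact absurd hgk (hN _ (by omega))
  choose g k hg hk he hle using ex'
  have l' := l.comp (tendsto_add_atTop_nat N)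
  have lg : Tendsto (fun n => eLpNorm (g n) p m) atTop (𝓝 0) :=
    tendsto_of_tendsto_of_tendsto_of_le_of_le tendsto_const_nhds l' (fun _ => zero_le)
      fun n => le_self_add.trans (hle n)
  have lk : Tendsto (fun n => eLpNorm (k n) q m) atTop (𝓝 0) :=
    tendsto_of_tendsto_of_tendsto_of_le_of_le tendsto_const_nhds l' (fun _ => zero_le)
      fun n => le_add_self.trans (hle n)
  obtain ⟨n₁, hn₁, h₁⟩ := exists_seq_tendsto_ae_zero hp hg lg
  obtain ⟨n₂, hn₂, h₂⟩ := exists_seq_tendsto_ae_zero hq (fun n => hk (n₁ n)) (lk.comp hn₁.tendsto_atTop)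
  refine ⟨fun n => n₁ (n₂ n) + N, fun a b hab => by have := hn₁ (hn₂ hab); simpa using this, ?_⟩
  filter_upwards [h₁, h₂, ae_all_iff.2 he] with x hx1 hx2 hx3
  have := (hx1.comp hn₂.tendsto_atTop).add hx2
  rw [add_zero] at this
  refine this.congr fun n => ?_
  rw [hx3]; rfl

theorem eLpNorm_mul_le {p q r : ℝ≥0∞} [ENNReal.HolderTriple p q r] {f g : X → ℝ}
    (hf : AEStronglyMeasurable f m) (hg : AEStronglyMeasurable g m) :
    eLpNorm (fun x => f x * g x) r m ≤ eLpNorm f p m * eLpNorm g q m := by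
  have h := eLpNorm_smul_le_mul_eLpNorm (p := p) (q := q) (r := r) hg hf
  rwa [smul_eq_mul] at h

/-- A function dominated by `(k₁ + k₂) y` splits accordingly. -/
theorem exists_decomposition {w k₁ k₂ y : X → ℝ} (hw : AEStronglyMeasurable w m) (hk1 : AEStronglyMeasurable k₁ m)
    (hy : AEStronglyMeasurable y m) (h1 : ∀ x, 0 ≤ k₁ x) (h2 : ∀ x, 0 ≤ k₂ x) (h0 : ∀ x, 0 ≤ y x)
    (hle : ∀ᵐ x ∂m, |w x| ≤ (k₁ x + k₂ x) * y x) :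
    ∃ w₁ w₂ : X → ℝ, AEStronglyMeasurable w₁ m ∧ AEStronglyMeasurable w₂ m ∧ w = w₁ + w₂ ∧
      (∀ᵐ x ∂m, |w₁ x| ≤ k₁ x * y x) ∧ ∀ᵐ x ∂m, |w₂ x| ≤ k₂ x * y x := by
  -- The first part is `w` clamped to [-k₁y, k₁y]. The excess is then at most k₂y in modulus.
  set w₁ : X → ℝ := fun x => max (-(k₁ x * y x)) (min (w x) (k₁ x * y x)) with hw1
  have m1 : AEStronglyMeasurable w₁ m := ((hk1.mul hy).neg).sup (hw.inf (hk1.mul hy))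
  refine ⟨w₁, w - w₁, m1, hw.sub m1, by abel, Eventually.of_forall fun x => ?_, ?_⟩
  · have := mul_nonneg (h1 x) (h0 x)
    rw [abs_le]
    exact ⟨le_max_left _ _, max_le (by linarith) (min_le_right _ _)⟩
  · filter_upwards [hle] with x hx
    have a1 := mul_nonneg (h1 x) (h0 x)
    have a2 := mul_nonneg (h2 x) (h0 x)
    rw [add_mul, abs_le] at hx
    rw [Pi.sub_apply, hw1, abs_le]
    dsimp only
    rcases le_total (w x) (k₁ x * y x) with c | c
    · rw [min_eq_left c]
      rcases le_total (-(k₁ x * y x)) (w x) with d | d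
      · rw [max_eq_right d]; constructor <;> linarith
      · rw [max_eq_left d]; constructor <;> linarith [hx.1, hx.2]
    · rw [min_eq_right c, max_eq_right (by linarith)]; constructor <;> linarith [hx.1, hx.2]

section

variable {q p t : ℝ≥0∞} [ENNReal.HolderTriple q p t] {w k₁ k₂ y : X → ℝ}

theorem exists_decomposition_eLpNorm_le (hw : AEStronglyMeasurable w m) (hk1 : AEStronglyMeasurable k₁ m)
    (hk2 : AEStronglyMeasurable k₂ m)
    (hy : AEStronglyMeasurable y m) (h1 : ∀ x, 0 ≤ k₁ x) (h2 : ∀ x, 0 ≤ k₂ x) (h0 : ∀ x, 0 ≤ y x)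
    (hle : ∀ᵐ x ∂m, |w x| ≤ (k₁ x + k₂ x) * y x) :
    ∃ w₁ w₂ : X → ℝ, AEStronglyMeasurable w₁ m ∧ AEStronglyMeasurable w₂ m ∧ w = w₁ + w₂ ∧
      eLpNorm w₁ t m ≤ eLpNorm k₁ q m * eLpNorm y p m ∧ eLpNorm w₂ 2 m ≤ eLpNorm k₂ ⊤ m * eLpNorm y 2 m := by
  obtain ⟨w₁, w₂, m1, m2, e, b1, b2⟩ := exists_decomposition hw hk1 hy h1 h2 h0 hle
  exact ⟨w₁, w₂, m1, m2, e, (eLpNorm_mono_ae_real b1).trans (eLpNorm_mul_le hk1 hy),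
    (eLpNorm_mono_ae_real b2).trans (eLpNorm_mul_le hk2 hy)⟩

theorem sumNorm_le_of_abs_le (hw : AEStronglyMeasurable w m) (hk1 : AEStronglyMeasurable k₁ m)
    (hk2 : AEStronglyMeasurable k₂ m)
    (hy : AEStronglyMeasurable y m) (h1 : ∀ x, 0 ≤ k₁ x) (h2 : ∀ x, 0 ≤ k₂ x) (h0 : ∀ x, 0 ≤ y x)
    (hle : ∀ᵐ x ∂m, |w x| ≤ (k₁ x + k₂ x) * y x) :
    sumNorm w t 2 m ≤ eLpNorm k₁ q m * eLpNorm y p m + eLpNorm k₂ ⊤ m * eLpNorm y 2 m := by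
  obtain ⟨w₁, w₂, m1, m2, e, b1, b2⟩ := exists_decomposition_eLpNorm_le hw hk1 hk2 hy h1 h2 h0 hle (q := q) (p := p) (t := t)
  exact (sumNorm_le m1 m2 (by rw [e])).trans (add_le_add b1 b2)

end

/-- The bound for `∫ |k₁ + k₂| |y| |z|` by Hölder's inequality. -/
def holderBound (m : Measure X) (q r s : ℝ≥0∞) (k₁ k₂ y z : X → ℝ) : ℝ≥0∞ :=
  eLpNorm k₁ q m * eLpNorm y r m * eLpNorm z s m + eLpNorm k₂ ⊤ m * eLpNorm y 2 m * eLpNorm z 2 m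

theorem eLpNorm_one_mul_mul_le {q r s : ℝ≥0∞} (h : q⁻¹ + r⁻¹ + s⁻¹ = 1) {k y z : X → ℝ}
    (hk : AEStronglyMeasurable k m) (hy : AEStronglyMeasurable y m) (hz : AEStronglyMeasurable z m) :
    eLpNorm (fun x => k x * y x * z x) 1 m ≤ eLpNorm k q m * eLpNorm y r m * eLpNorm z s m := by
  have h1 : ENNReal.HolderTriple q r (q⁻¹ + r⁻¹)⁻¹ := ⟨by rw [inv_inv]⟩
  have h2 : ENNReal.HolderTriple (q⁻¹ + r⁻¹)⁻¹ s 1 := ⟨by rw [inv_inv, inv_one, h]⟩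
  refine (eLpNorm_mul_le (p := (q⁻¹ + r⁻¹)⁻¹) (q := s) (hk.mul hy) hz).trans ?_
  gcongr
  exact eLpNorm_mul_le hk hy

section

variable {q r s : ℝ≥0∞} {F k₁ k₂ y z : X → ℝ}

theorem eLpNorm_one_le_holderBound (h : q⁻¹ + r⁻¹ + s⁻¹ = 1) (hk1 : AEStronglyMeasurable k₁ m)
    (hk2 : AEStronglyMeasurable k₂ m) (hy : AEStronglyMeasurable y m) (hz : AEStronglyMeasurable z m)
    (hle : ∀ᵐ x ∂m, |F x| ≤ |k₁ x + k₂ x| * |y x| * |z x|) :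
    eLpNorm F 1 m ≤ holderBound m q r s k₁ k₂ y z := by
  have h2 : (⊤ : ℝ≥0∞)⁻¹ + 2⁻¹ + 2⁻¹ = 1 := by simp [ENNReal.inv_two_add_inv_two]
  have b : eLpNorm F 1 m ≤ eLpNorm ((fun x => k₁ x * y x * z x) + fun x => k₂ x * y x * z x) 1 m := by
    refine eLpNorm_mono_ae ?_
    filter_upwards [hle] with x hx
    rw [Pi.add_apply, ← add_mul, ← add_mul, norm_mul, norm_mul]
    exact hx
  refine b.trans ((eLpNorm_add_le ((hk1.mul hy).mul hz) ((hk2.mul hy).mul hz) le_rfl).trans ?_)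
  exact add_le_add (eLpNorm_one_mul_mul_le h hk1 hy hz) (eLpNorm_one_mul_mul_le h2 hk2 hy hz)

theorem holderBound_lt_top (hk1 : MemLp k₁ q m) (hk2 : MemLp k₂ ⊤ m) (hy : MemLp y r m) (hy2 : MemLp y 2 m)
    (hz : MemLp z s m) (hz2 : MemLp z 2 m) : holderBound m q r s k₁ k₂ y z < ⊤ :=
  ENNReal.add_lt_top.2 ⟨ENNReal.mul_lt_top (ENNReal.mul_lt_top hk1.2 hy.2) hz.2,
    ENNReal.mul_lt_top (ENNReal.mul_lt_top hk2.2 hy2.2) hz2.2⟩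

theorem integrable_of_abs_le_mul (h : q⁻¹ + r⁻¹ + s⁻¹ = 1) (hF : AEStronglyMeasurable F m)
    (hk1 : MemLp k₁ q m) (hk2 : MemLp k₂ ⊤ m) (hy : MemLp y r m) (hy2 : MemLp y 2 m)
    (hz : MemLp z s m) (hz2 : MemLp z 2 m) (hle : ∀ᵐ x ∂m, |F x| ≤ |k₁ x + k₂ x| * |y x| * |z x|) :
    Integrable F m :=
  memLp_one_iff_integrable.1 ⟨hF, (eLpNorm_one_le_holderBound h hk1.1 hk2.1 hy.1 hz.1 hle).trans_lt
    (holderBound_lt_top hk1 hk2 hy hy2 hz hz2)⟩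

theorem enorm_integral_le_holderBound (h : q⁻¹ + r⁻¹ + s⁻¹ = 1) (hk1 : AEStronglyMeasurable k₁ m)
    (hk2 : AEStronglyMeasurable k₂ m) (hy : AEStronglyMeasurable y m) (hz : AEStronglyMeasurable z m)
    (hle : ∀ᵐ x ∂m, |F x| ≤ |k₁ x + k₂ x| * |y x| * |z x|) :
    ‖∫ x, F x ∂m‖ₑ ≤ holderBound m q r s k₁ k₂ y z := by
  refine (enorm_integral_le_lintegral_enorm F).trans ?_
  rw [← eLpNorm_one_eq_lintegral_enorm]
  exact eLpNorm_one_le_holderBound h hk1 hk2 hy hz hle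

end

/-! ### Extension of derivations -/

variable {G : CarreDuChamp E} {A : TestAlgebra G}

/-- The a.e. convergence of √Γ(f - a_n) along a subsequence converts norm approximation into
pointwise statements about derivations, which are controlled pointwise by √Γ. -/
theorem TestAlgebra.exists_approx_ae (A : TestAlgebra G) {p : ℝ≥0∞} (H : HeatSemigroup E) [SigmaFinite m]
    {f : E.dom} {a : ℕ → A.carrier} (ha : Tendsto (fun n => G.normVp p (f - a n)) atTop (𝓝 0)) :
    Tendsto (fun n => eLpNorm (G.sqrtΓ (f - a n)) p m) atTop (𝓝 0) ∧
    Tendsto (fun n => eLpNorm (G.sqrtΓ (f - a n)) 2 m) atTop (𝓝 0) ∧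
    ∃ ns : ℕ → ℕ, StrictMono ns ∧ ∀ᵐ x ∂m, Tendsto (fun n => G.sqrtΓ (f - a (ns n)) x) atTop (𝓝 0) := by
  have h1 : Tendsto (fun n => eLpNorm (G.sqrtΓ (f - a n)) p m) atTop (𝓝 0) :=
    tendsto_of_tendsto_of_tendsto_of_le_of_le tendsto_const_nhds ha (fun _ => zero_le)
      fun n => G.eLpNorm_sqrtΓ_le_normVp p _
  have h2 : Tendsto (fun n => eLpNorm (G.sqrtΓ (f - a n)) 2 m) atTop (𝓝 0) :=
    tendsto_of_tendsto_of_tendsto_of_le_of_le tendsto_const_nhds ha (fun _ => zero_le)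
      fun n => A.eLpNorm_sqrtΓ_two_le_normVp H p _
  obtain ⟨ns, hns, h⟩ := exists_seq_tendsto_ae_zero (u := fun n => G.sqrtΓ (f - a n)) two_ne_zero
    (fun n => G.aestronglyMeasurable_sqrtΓ _) h2
  exact ⟨h1, h2, ns, hns, h⟩

namespace TestDerivation

variable {b : TestDerivation A} {q p t : ℝ≥0∞} {k₁ k₂ : X → ℝ}

/-- `|df(b)| ≤ (k₁ + k₂) √Γ(f)` with `k₁ ∈ L^q` and `k₂ ∈ L^∞` nonnegative. -/
structure Control (b : TestDerivation A) (q : ℝ≥0∞) (k₁ k₂ : X → ℝ) : Prop where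
  nonneg₁ : ∀ x, 0 ≤ k₁ x
  nonneg₂ : ∀ x, 0 ≤ k₂ x
  memLp₁ : MemLp k₁ q m
  memLp₂ : MemLp k₂ ⊤ m
  le : ∀ f : A.carrier, ∀ᵐ x ∂m, |b.d f x| ≤ (k₁ x + k₂ x) * G.sqrtΓ f x

theorem InSum.exists_control (h : b.InSum q ⊤) : ∃ k₁ k₂, b.Control q k₁ k₂ := by
  obtain ⟨g, ⟨k₁, k₂, h1, h2, e⟩, hle⟩ := h
  refine ⟨fun x => |k₁ x|, fun x => |k₂ x|, fun x => abs_nonneg _, fun x => abs_nonneg _, h1.abs, h2.abs, fun f => ?_⟩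
  filter_upwards [hle f, e] with x hx he
  refine hx.trans (mul_le_mul_of_nonneg_right ?_ (G.sqrtΓ_nonneg _ x))
  rw [he, Pi.add_apply]
  exact add_le_add (le_abs_self _) (le_abs_self _)

namespace Control

theorem nonneg (hb : b.Control q k₁ k₂) (x : X) : 0 ≤ k₁ x + k₂ x := add_nonneg (hb.nonneg₁ x) (hb.nonneg₂ x)

end Control

end TestDerivation

end

/-! ### Existence, pointwise bounds and linearity of the extended derivation. -/

section

variable {X : Type*} [MeasurableSpace X] {m : Measure X} {E : DirichletForm m}
  {G : CarreDuChamp E} {A : TestAlgebra G}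

theorem CarreDuChamp.sqrtΓ_zero (G : CarreDuChamp E) : ∀ᵐ x ∂m, G.sqrtΓ 0 x = 0 := by
  filter_upwards [Lp.coeFn_zero ℝ 1 m] with x hx
  rw [sqrtΓ, map_zero, hx, Pi.zero_apply, Real.sqrt_zero]

namespace TestDerivation.Control

variable {b : TestDerivation A} {q p t : ℝ≥0∞} {k₁ k₂ : X → ℝ}

theorem abs_d_sub_le (hb : b.Control q k₁ k₂) (f : E.dom) (a c : A.carrier) :
    ∀ᵐ x ∂m, |b.d a x - b.d c x| ≤ (k₁ x + k₂ x) * (G.sqrtΓ (f - c) x + G.sqrtΓ (f - a) x) := by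
  filter_upwards [hb.le (a - c), AEEqFun.coeFn_sub (b.d a) (b.d c), G.sqrtΓ_sub_le (f - c) (f - a)] with x h1 h2 h3
  rw [map_sub, h2, Pi.sub_apply] at h1
  refine h1.trans (mul_le_mul_of_nonneg_left ?_ (hb.nonneg x))
  rw [show (f - (c : E.dom)) - (f - (a : E.dom)) = ((a - c : A.carrier) : E.dom) by
    rw [Submodule.coe_sub]; abel] at h3
  exact h3

variable [SigmaFinite m]

/-- Along a common subsequence da_n(b) → w and √Γ(f - a_n) → 0 a.e., so the bound for da_n(b) -
dc(b) passes to the limit. It holds for every admissible `w`, so the arbitrary choice made in `ext`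
is harmless. -/
theorem abs_sub_le_of_isExtension (hb : b.Control q k₁ k₂) (H : HeatSemigroup E) (ht : t ≠ 0)
    {f : E.dom} {w : X →ₘ[m] ℝ} (hw : b.IsExtension p t f w) (c : A.carrier) :
    ∀ᵐ x ∂m, |w x - b.d c x| ≤ (k₁ x + k₂ x) * G.sqrtΓ (f - c) x := by
  obtain ⟨a, ha, hs⟩ := hw
  obtain ⟨n₁, hn₁, h₁⟩ := exists_seq_tendsto_ae_zero_of_sumNorm ht two_ne_zero hs
  obtain ⟨-, -, n₂, hn₂, h₂⟩ := A.exists_approx_ae H (a := fun n => a (n₁ n)) (ha.comp hn₁.tendsto_atTop)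
  have hC : ∀ᵐ x ∂m, ∀ i, |b.d (a i) x - b.d c x|
      ≤ (k₁ x + k₂ x) * (G.sqrtΓ (f - c) x + G.sqrtΓ (f - a i) x) := by
    rw [ae_all_iff]; intro i
    exact hb.abs_d_sub_le f (a i) c
  filter_upwards [h₁, h₂, hC] with x h1 h2 h3
  have l1 := (h1.comp hn₂.tendsto_atTop).abs.add
    (((tendsto_const_nhds (x := G.sqrtΓ (f - c) x)).add h2).const_mul (k₁ x + k₂ x))
  rw [abs_zero, add_zero, zero_add] at l1
  refine ge_of_tendsto' l1 fun n => ?_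
  refine (abs_sub_le _ (b.d (a (n₁ (n₂ n))) x) _).trans ?_
  exact add_le_add le_rfl (h3 _)

variable [ENNReal.HolderTriple q p t]

/-- Along a subsequence with √Γ(f - a_n) → 0 a.e. the functions da_n(b) are pointwise Cauchy. The
pointwise bound on the error then gives convergence in the sum norm by Hölder's inequality. -/
theorem exists_isExtension (hb : b.Control q k₁ k₂) (H : HeatSemigroup E)
    (hA : G.DenseInVp p A.carrier) {f : E.dom} (hf : G.MemVp p f) : ∃ w, b.IsExtension p t f w := by
  obtain ⟨a₀, ha₀⟩ := A.exists_approx hA hf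
  obtain ⟨-, -, ns, hns, hae⟩ := A.exists_approx_ae H ha₀
  set a := fun n => a₀ (ns n) with hadef
  have ha : Tendsto (fun n => G.normVp p (f - a n)) atTop (𝓝 0) := ha₀.comp hns.tendsto_atTop
  obtain ⟨lp, l2, -⟩ := A.exists_approx_ae H ha
  have hC : ∀ᵐ x ∂m, ∀ i j, |b.d (a i) x - b.d (a j) x|
      ≤ (k₁ x + k₂ x) * (G.sqrtΓ (f - a j) x + G.sqrtΓ (f - a i) x) := by
    rw [ae_all_iff]; intro i
    rw [ae_all_iff]; intro j
    exact hb.abs_d_sub_le f (a i) (a j)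
  obtain ⟨w, hw, hlim⟩ := exists_stronglyMeasurable_limit_of_tendsto_ae (μ := m)
    (f := fun n => (b.d (a n) : X → ℝ)) (fun n => (b.d (a n)).aestronglyMeasurable) (by
      filter_upwards [hC, hae] with x h1 h2
      refine cauchySeq_tendsto_of_complete (cauchySeq_iff_tendsto_dist_atTop_0.2 ?_)
      rw [← prod_atTop_atTop_eq]
      have l := ((h2.comp tendsto_snd).add (h2.comp tendsto_fst)).const_mul (k₁ x + k₂ x)
        (x := atTop ×ˢ atTop)
      rw [add_zero, mul_zero] at l
      exact squeeze_zero (fun _ => dist_nonneg) (fun n => h1 n.1 n.2) l)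
  have hwe := AEEqFun.coeFn_mk w (hw.aestronglyMeasurable (μ := m))
  refine ⟨AEEqFun.mk w hw.aestronglyMeasurable, a, ha, ?_⟩
  have hle : ∀ n, ∀ᵐ x ∂m, |(AEEqFun.mk w hw.aestronglyMeasurable : X →ₘ[m] ℝ) x - b.d (a n) x|
      ≤ (k₁ x + k₂ x) * G.sqrtΓ (f - a n) x := by
    intro n
    filter_upwards [hC, hae, hlim, hwe] with x h1 h2 h3 h4
    rw [h4]
    have l1 := (h3.sub_const (b.d (a n) x)).abs
    have l2 := ((tendsto_const_nhds (x := G.sqrtΓ (f - a n) x)).add h2).const_mul (k₁ x + k₂ x)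
    rw [add_zero] at l2
    exact le_of_tendsto_of_tendsto' l1 l2 fun i => h1 i n
  have l := (ENNReal.Tendsto.const_mul lp (Or.inr hb.memLp₁.2.ne)).add
    (ENNReal.Tendsto.const_mul l2 (Or.inr hb.memLp₂.2.ne))
  rw [mul_zero, mul_zero, add_zero] at l
  exact tendsto_of_tendsto_of_tendsto_of_le_of_le tendsto_const_nhds l (fun _ => zero_le) fun n =>
    sumNorm_le_of_abs_le ((AEEqFun.aestronglyMeasurable _).sub (AEEqFun.aestronglyMeasurable _))
      hb.memLp₁.1 hb.memLp₂.1 (G.aestronglyMeasurable_sqrtΓ _) hb.nonneg₁ hb.nonneg₂ (G.sqrtΓ_nonneg _) (hle n)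

theorem isExtension_ext (hb : b.Control q k₁ k₂) (H : HeatSemigroup E)
    (hA : G.DenseInVp p A.carrier) {f : E.dom} (hf : G.MemVp p f) : b.IsExtension p t f (b.ext p t f) := by
  have h := hb.exists_isExtension (t := t) H hA hf
  rw [ext, dif_pos h]
  exact h.choose_spec

theorem abs_ext_sub_le (hb : b.Control q k₁ k₂) (H : HeatSemigroup E) (ht : t ≠ 0)
    (hA : G.DenseInVp p A.carrier) {f : E.dom} (hf : G.MemVp p f) (c : A.carrier) :
    ∀ᵐ x ∂m, |b.ext p t f x - b.d c x| ≤ (k₁ x + k₂ x) * G.sqrtΓ (f - c) x :=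
  hb.abs_sub_le_of_isExtension H ht (hb.isExtension_ext H hA hf) c

theorem abs_ext_le (hb : b.Control q k₁ k₂) (H : HeatSemigroup E) (ht : t ≠ 0)
    (hA : G.DenseInVp p A.carrier) {f : E.dom} (hf : G.MemVp p f) :
    ∀ᵐ x ∂m, |b.ext p t f x| ≤ (k₁ x + k₂ x) * G.sqrtΓ f x := by
  filter_upwards [hb.abs_ext_sub_le H ht hA hf 0, AEEqFun.coeFn_zero (μ := m) (α := X) (β := ℝ)] with x h1 h2
  rw [map_zero, h2, Pi.zero_apply, sub_zero, Submodule.coe_zero, sub_zero] at h1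
  exact h1

theorem ext_coe (hb : b.Control q k₁ k₂) (H : HeatSemigroup E) (ht : t ≠ 0)
    (hA : G.DenseInVp p A.carrier) (c : A.carrier) : b.ext p t (c : E.dom) =ᵐ[m] b.d c := by
  filter_upwards [hb.abs_ext_sub_le H ht hA (hA.1 c c.2) c, G.sqrtΓ_zero] with x h1 h2
  rw [sub_self, h2, mul_zero] at h1
  linarith [abs_nonpos_iff.1 h1]

/-- Linearity is not immediate from a chosen value. Approximating `f` and `g` along one subsequence,
the difference of the two sides is dominated by multiples of √Γ(f - a_n) and √Γ(g - e_n), which tend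
to zero a.e. -/
theorem ext_add_smul (hb : b.Control q k₁ k₂) (H : HeatSemigroup E) (ht : t ≠ 0) (hp : 1 ≤ p)
    (hA : G.DenseInVp p A.carrier) {f g : E.dom} (hf : G.MemVp p f) (hg : G.MemVp p g) (c : ℝ) :
    ∀ᵐ x ∂m, b.ext p t (f + c • g) x = b.ext p t f x + c * b.ext p t g x := by
  obtain ⟨a₀, ha₀⟩ := A.exists_approx hA hf
  obtain ⟨e₀, he₀⟩ := A.exists_approx hA hg
  obtain ⟨-, -, n₁, hn₁, h₁⟩ := A.exists_approx_ae H ha₀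
  obtain ⟨-, -, n₂, hn₂, h₂⟩ := A.exists_approx_ae H (a := fun n => e₀ (n₁ n)) (he₀.comp hn₁.tendsto_atTop)
  set a := fun n => a₀ (n₁ (n₂ n)) with hadef
  set e := fun n => e₀ (n₁ (n₂ n)) with hedef
  have hfg : G.MemVp p (f + c • g) := CarreDuChamp.MemVp.add G hp hf (CarreDuChamp.MemVp.smul G c hg)
  have k1 := ae_all_iff.2 fun n => hb.abs_ext_sub_le H ht hA hf (a n)
  have k2 := ae_all_iff.2 fun n => hb.abs_ext_sub_le H ht hA hg (e n)
  have k3 := ae_all_iff.2 fun n => hb.abs_ext_sub_le H ht hA hfg (a n + c • e n)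
  have k4 : ∀ᵐ x ∂m, ∀ n, b.d (a n + c • e n) x = b.d (a n) x + c * b.d (e n) x := by
    rw [ae_all_iff]; intro n
    filter_upwards [AEEqFun.coeFn_add (b.d (a n)) (c • b.d (e n)), AEEqFun.coeFn_smul c (b.d (e n))] with x h1 h2
    rw [map_add, map_smul, h1, Pi.add_apply, h2, Pi.smul_apply, smul_eq_mul]
  have k5 : ∀ᵐ x ∂m, ∀ n, G.sqrtΓ (f + c • g - ((a n + c • e n : A.carrier) : E.dom)) x
      ≤ G.sqrtΓ (f - a n) x + |c| * G.sqrtΓ (g - e n) x := by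
    rw [ae_all_iff]; intro n
    filter_upwards [G.sqrtΓ_add_le (f - a n) (c • (g - e n)), G.sqrtΓ_smul c (g - e n)] with x h1 h2
    rw [h2] at h1
    refine le_trans (le_of_eq ?_) h1
    congr 1
    rw [Submodule.coe_add, Submodule.coe_smul, smul_sub]
    abel
  filter_upwards [h₁, h₂, k1, k2, k3, k4, k5] with x h1 h2 h3 h4 h5 h6 h7
  have la : Tendsto (fun n => G.sqrtΓ (f - a n) x) atTop (𝓝 0) := h1.comp hn₂.tendsto_atTop
  have l := (((la.add (h2.const_mul |c|)).const_mul (k₁ x + k₂ x)).add (la.const_mul (k₁ x + k₂ x))).add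
    ((h2.const_mul (k₁ x + k₂ x)).const_mul |c|)
  simp only [mul_zero, add_zero] at l
  have : |b.ext p t (f + c • g) x - (b.ext p t f x + c * b.ext p t g x)| ≤ 0 := by
    refine ge_of_tendsto' l fun n => ?_
    have e1 : b.ext p t (f + c • g) x - (b.ext p t f x + c * b.ext p t g x)
        = (b.ext p t (f + c • g) x - b.d (a n + c • e n) x) - (b.ext p t f x - b.d (a n) x)
          - c * (b.ext p t g x - b.d (e n) x) := by rw [h6 n]; ring
    rw [e1]
    refine (abs_sub _ _).trans (add_le_add ((abs_sub _ _).trans (add_le_add ?_ (h3 n))) ?_)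
    · exact (h5 n).trans (mul_le_mul_of_nonneg_left (h7 n) (hb.nonneg x))
    · rw [abs_mul]
      exact mul_le_mul_of_nonneg_left (h4 n) (abs_nonneg c)
  linarith [abs_nonpos_iff.1 this]

theorem ext_sub (hb : b.Control q k₁ k₂) (H : HeatSemigroup E) (ht : t ≠ 0) (hp : 1 ≤ p)
    (hA : G.DenseInVp p A.carrier) {f g : E.dom} (hf : G.MemVp p f) (hg : G.MemVp p g) :
    ∀ᵐ x ∂m, b.ext p t (f - g) x = b.ext p t f x - b.ext p t g x := by
  filter_upwards [hb.ext_add_smul H ht hp hA hf hg (-1)] with x hx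
  rw [neg_one_smul, ← sub_eq_add_neg] at hx
  rw [hx]; ring

end TestDerivation.Control

end

/-! ### The Leibniz rule and the divergence formula on 𝕍_r × 𝕍_s. -/

section

variable {X : Type*} [MeasurableSpace X] {m : Measure X} {E : DirichletForm m}
  {G : CarreDuChamp E} {A : TestAlgebra G}

theorem holderTriple_conjExponent {q r s : ℝ≥0∞} (hr : 1 ≤ r) (h : q⁻¹ + r⁻¹ + s⁻¹ = 1) :
    ENNReal.HolderTriple q s r.conjExponent := by
  have hc := (ENNReal.HolderConjugate.conjExponent hr).inv_add_inv_eq_inv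
  rw [inv_one] at hc
  refine ⟨?_⟩
  have hr' : r⁻¹ ≠ ⊤ := by
    rw [ENNReal.inv_ne_top]; exact (zero_lt_one.trans_le hr).ne'
  have : r⁻¹ + (q⁻¹ + s⁻¹) = r⁻¹ + r.conjExponent⁻¹ := by
    rw [hc, ← h]; ring
  exact (ENNReal.add_right_inj hr').1 this

theorem holderBound_le {q r s : ℝ≥0∞} {k₁ k₂ y z : X → ℝ} {Y Z : ℝ≥0∞} (h1 : eLpNorm y r m ≤ Y)
    (h2 : eLpNorm y 2 m ≤ Y) (h3 : eLpNorm z s m ≤ Z) (h4 : eLpNorm z 2 m ≤ Z) :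
    holderBound m q r s k₁ k₂ y z ≤ (eLpNorm k₁ q m + eLpNorm k₂ ⊤ m) * Y * Z := by
  rw [holderBound, add_mul, add_mul]
  gcongr

namespace TestDerivation

/-- The standing assumptions on the derivation `b`, with the bound `k₁ + k₂ ∈ L^q + L^∞` and the
decomposition `D₁ + D₂ ∈ L^q + L^∞` of its divergence. -/
structure Regular (b : TestDerivation A) (D : X →ₘ[m] ℝ) (r s q : ℝ≥0∞) (k₁ k₂ D₁ D₂ : X → ℝ) : Prop where
  one_lt_left : 1 < r
  left_ne_top : r ≠ ⊤
  one_lt_right : 1 < s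
  right_ne_top : s ≠ ⊤
  exponents : q⁻¹ + r⁻¹ + s⁻¹ = 1
  dense_left : G.DenseInVp r A.carrier
  dense_right : G.DenseInVp s A.carrier
  control : b.Control q k₁ k₂
  hasDivergence : b.HasDivergence D
  memLp₁ : MemLp D₁ q m
  memLp₂ : MemLp D₂ ⊤ m
  decomposition : D =ᵐ[m] D₁ + D₂

namespace Regular

variable {b : TestDerivation A} {D : X →ₘ[m] ℝ} {r s q : ℝ≥0∞} {k₁ k₂ D₁ D₂ : X → ℝ}

/-- The assumptions are symmetric in r and s. Each estimate is proved for one order and applied in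
both, notably on the two halves of the interpolation. -/
theorem symm (h : b.Regular D r s q k₁ k₂ D₁ D₂) : b.Regular D s r q k₁ k₂ D₁ D₂ where
  one_lt_left := h.one_lt_right
  left_ne_top := h.right_ne_top
  one_lt_right := h.one_lt_left
  right_ne_top := h.left_ne_top
  exponents := by rw [add_right_comm]; exact h.exponents
  dense_left := h.dense_right
  dense_right := h.dense_left
  control := h.control
  hasDivergence := h.hasDivergence
  memLp₁ := h.memLp₁
  memLp₂ := h.memLp₂
  decomposition := h.decomposition

theorem holderTriple (h : b.Regular D r s q k₁ k₂ D₁ D₂) : ENNReal.HolderTriple q s r.conjExponent :=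
  holderTriple_conjExponent h.one_lt_left.le h.exponents

theorem conjExponent_ne_zero (h : b.Regular D r s q k₁ k₂ D₁ D₂) : r.conjExponent ≠ 0 := by
  have := ENNReal.HolderConjugate.conjExponent h.one_lt_left.le
  exact (ENNReal.HolderConjugate.pos r.conjExponent r).ne'

theorem abs_div_mul_le (h : b.Regular D r s q k₁ k₂ D₁ D₂) (y z : X → ℝ) :
    ∀ᵐ x ∂m, |D x * (y x * z x)| ≤ |D₁ x + D₂ x| * |y x| * |z x| := by
  filter_upwards [h.decomposition] with x hx
  rw [hx, Pi.add_apply, abs_mul, abs_mul, mul_assoc]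

theorem integrable_div_mul (h : b.Regular D r s q k₁ k₂ D₁ D₂) {y z : X → ℝ}
    (hy : MemLp y r m) (hy2 : MemLp y 2 m) (hz : MemLp z s m) (hz2 : MemLp z 2 m) :
    Integrable (fun x => D x * (y x * z x)) m :=
  integrable_of_abs_le_mul h.exponents ((AEEqFun.aestronglyMeasurable _).mul (hy.1.mul hz.1)) h.memLp₁ h.memLp₂
    hy hy2 hz hz2 (h.abs_div_mul_le y z)

theorem enorm_integral_div_mul_le (h : b.Regular D r s q k₁ k₂ D₁ D₂) {y z : X → ℝ}
    (hy : AEStronglyMeasurable y m) (hz : AEStronglyMeasurable z m) :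
    ‖∫ x, D x * (y x * z x) ∂m‖ₑ ≤ holderBound m q r s D₁ D₂ y z :=
  enorm_integral_le_holderBound h.exponents h.memLp₁.1 h.memLp₂.1 hy hz (h.abs_div_mul_le y z)

variable [SigmaFinite m]

theorem abs_ext_le (h : b.Regular D r s q k₁ k₂ D₁ D₂) (H : HeatSemigroup E) {g : E.dom} (hg : G.MemVp s g) :
    ∀ᵐ x ∂m, |b.ext s r.conjExponent g x| ≤ (k₁ x + k₂ x) * G.sqrtΓ g x :=
  have := h.holderTriple
  h.control.abs_ext_le H h.conjExponent_ne_zero h.dense_right hg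

theorem ext_coe (h : b.Regular D r s q k₁ k₂ D₁ D₂) (H : HeatSemigroup E) (c : A.carrier) :
    b.ext s r.conjExponent (c : E.dom) =ᵐ[m] b.d c :=
  have := h.holderTriple
  h.control.ext_coe H h.conjExponent_ne_zero h.dense_right c

theorem ext_add_smul (h : b.Regular D r s q k₁ k₂ D₁ D₂) (H : HeatSemigroup E) {f g : E.dom}
    (hf : G.MemVp s f) (hg : G.MemVp s g) (c : ℝ) :
    ∀ᵐ x ∂m, b.ext s r.conjExponent (f + c • g) x
      = b.ext s r.conjExponent f x + c * b.ext s r.conjExponent g x :=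
  have := h.holderTriple
  h.control.ext_add_smul H h.conjExponent_ne_zero h.one_lt_right.le h.dense_right hf hg c

theorem ext_sub (h : b.Regular D r s q k₁ k₂ D₁ D₂) (H : HeatSemigroup E) {f g : E.dom}
    (hf : G.MemVp s f) (hg : G.MemVp s g) :
    ∀ᵐ x ∂m, b.ext s r.conjExponent (f - g) x
      = b.ext s r.conjExponent f x - b.ext s r.conjExponent g x :=
  have := h.holderTriple
  h.control.ext_sub H h.conjExponent_ne_zero h.one_lt_right.le h.dense_right hf hg

theorem abs_mul_ext_le (h : b.Regular D r s q k₁ k₂ D₁ D₂) (H : HeatSemigroup E) (y : X → ℝ)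
    {g : E.dom} (hg : G.MemVp s g) :
    ∀ᵐ x ∂m, |y x * b.ext s r.conjExponent g x| ≤ |k₁ x + k₂ x| * |y x| * |G.sqrtΓ g x| := by
  filter_upwards [h.abs_ext_le H hg] with x hx
  rw [abs_mul, abs_of_nonneg (h.control.nonneg x), abs_of_nonneg (G.sqrtΓ_nonneg g x)]
  calc |y x| * |b.ext s r.conjExponent g x| ≤ |y x| * ((k₁ x + k₂ x) * G.sqrtΓ g x) := by gcongr
    _ = _ := by ring

theorem integrable_mul_ext (h : b.Regular D r s q k₁ k₂ D₁ D₂) (H : HeatSemigroup E) {y : X → ℝ}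
    (hy : MemLp y r m) (hy2 : MemLp y 2 m) {g : E.dom} (hg : G.MemVp s g) :
    Integrable (fun x => y x * b.ext s r.conjExponent g x) m :=
  integrable_of_abs_le_mul h.exponents (hy.1.mul (AEEqFun.aestronglyMeasurable _)) h.control.memLp₁ h.control.memLp₂
    hy hy2 hg.2 (G.memLp_sqrtΓ_two g) (h.abs_mul_ext_le H y hg)

theorem enorm_integral_mul_ext_le (h : b.Regular D r s q k₁ k₂ D₁ D₂) (H : HeatSemigroup E) {y : X → ℝ}
    (hy : AEStronglyMeasurable y m) {g : E.dom} (hg : G.MemVp s g) :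
    ‖∫ x, y x * b.ext s r.conjExponent g x ∂m‖ₑ ≤ holderBound m q r s k₁ k₂ y (G.sqrtΓ g) :=
  enorm_integral_le_holderBound h.exponents h.control.memLp₁.1 h.control.memLp₂.1 hy hg.2.1 (h.abs_mul_ext_le H y hg)

end Regular

/-- The defect in the Leibniz rule `∫ f dg(b) + g df(b) dm = -∫ f g div b dm`. -/
def leibnizDefect (b : TestDerivation A) (D : X →ₘ[m] ℝ) (r s : ℝ≥0∞) (f g : E.dom) : ℝ :=
  ∫ x, (f : Lp ℝ 2 m) x * b.ext s r.conjExponent g x ∂m + ∫ x, (g : Lp ℝ 2 m) x * b.ext r s.conjExponent f x ∂m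
    + ∫ x, D x * ((f : Lp ℝ 2 m) x * (g : Lp ℝ 2 m) x) ∂m

theorem leibnizDefect_comm (b : TestDerivation A) (D : X →ₘ[m] ℝ) (r s : ℝ≥0∞) (f g : E.dom) :
    b.leibnizDefect D r s f g = b.leibnizDefect D s r g f := by
  rw [leibnizDefect, leibnizDefect, add_comm (∫ x, (f : Lp ℝ 2 m) x * b.ext s r.conjExponent g x ∂m)]
  congr 1
  refine integral_congr_ae (Eventually.of_forall fun x => ?_)
  ring

namespace Regular

variable {b : TestDerivation A} {D : X →ₘ[m] ℝ} {r s q : ℝ≥0∞} {k₁ k₂ D₁ D₂ : X → ℝ} [SigmaFinite m]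

theorem leibnizDefect_sub_right (h : b.Regular D r s q k₁ k₂ D₁ D₂) (H : HeatSemigroup E) {f g g' : E.dom}
    (hf : G.MemVp r f) (hg : G.MemVp s g) (hg' : G.MemVp s g') :
    b.leibnizDefect D r s f (g - g') = b.leibnizDefect D r s f g - b.leibnizDefect D r s f g' := by
  have f2 := Lp.memLp (f : Lp ℝ 2 m)
  have g2 := Lp.memLp (g : Lp ℝ 2 m)
  have g2' := Lp.memLp (g' : Lp ℝ 2 m)
  have e0 : ∀ᵐ x ∂m, ((g - g' : E.dom) : Lp ℝ 2 m) x = (g : Lp ℝ 2 m) x - (g' : Lp ℝ 2 m) x :=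
    Lp.coeFn_sub _ _
  have e1 : ∫ x, (f : Lp ℝ 2 m) x * b.ext s r.conjExponent (g - g') x ∂m
      = ∫ x, (f : Lp ℝ 2 m) x * b.ext s r.conjExponent g x ∂m
        - ∫ x, (f : Lp ℝ 2 m) x * b.ext s r.conjExponent g' x ∂m := by
    rw [← integral_sub (h.integrable_mul_ext H hf.1 f2 hg) (h.integrable_mul_ext H hf.1 f2 hg')]
    refine integral_congr_ae ?_
    filter_upwards [h.ext_sub H hg hg'] with x hx
    rw [hx]; ring
  have e2 : ∫ x, ((g - g' : E.dom) : Lp ℝ 2 m) x * b.ext r s.conjExponent f x ∂m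
      = ∫ x, (g : Lp ℝ 2 m) x * b.ext r s.conjExponent f x ∂m
        - ∫ x, (g' : Lp ℝ 2 m) x * b.ext r s.conjExponent f x ∂m := by
    rw [← integral_sub (h.symm.integrable_mul_ext H hg.1 g2 hf) (h.symm.integrable_mul_ext H hg'.1 g2' hf)]
    refine integral_congr_ae ?_
    filter_upwards [e0] with x hx
    rw [hx]; ring
  have e3 : ∫ x, D x * ((f : Lp ℝ 2 m) x * ((g - g' : E.dom) : Lp ℝ 2 m) x) ∂m
      = ∫ x, D x * ((f : Lp ℝ 2 m) x * (g : Lp ℝ 2 m) x) ∂m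
        - ∫ x, D x * ((f : Lp ℝ 2 m) x * (g' : Lp ℝ 2 m) x) ∂m := by
    rw [← integral_sub (h.integrable_div_mul hf.1 f2 hg.1 g2) (h.integrable_div_mul hf.1 f2 hg'.1 g2')]
    refine integral_congr_ae ?_
    filter_upwards [e0] with x hx
    rw [hx]; ring
  rw [leibnizDefect, leibnizDefect, leibnizDefect, e1, e2, e3]
  ring

/-- Joint continuity of the defect: each of its three integrals obeys Hölder's inequality with
exponents q, r, s, and with ∞, 2, 2 for the bounded parts. -/
theorem enorm_leibnizDefect_le (h : b.Regular D r s q k₁ k₂ D₁ D₂) (H : HeatSemigroup E) {f g : E.dom}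
    (hf : G.MemVp r f) (hg : G.MemVp s g) :
    ‖b.leibnizDefect D r s f g‖ₑ ≤ (2 * (eLpNorm k₁ q m + eLpNorm k₂ ⊤ m) + (eLpNorm D₁ q m + eLpNorm D₂ ⊤ m))
      * G.normVp r f * G.normVp s g := by
  have f1 := G.eLpNorm_le_normVp r f
  have f2 : eLpNorm (f : Lp ℝ 2 m) 2 m ≤ G.normVp r f := by
    rw [← Lp.enorm_def]; exact TestAlgebra.enorm_le_normVp r f
  have f3 := G.eLpNorm_sqrtΓ_le_normVp r f
  have f4 := A.eLpNorm_sqrtΓ_two_le_normVp H r f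
  have g1 := G.eLpNorm_le_normVp s g
  have g2 : eLpNorm (g : Lp ℝ 2 m) 2 m ≤ G.normVp s g := by
    rw [← Lp.enorm_def]; exact TestAlgebra.enorm_le_normVp s g
  have g3 := G.eLpNorm_sqrtΓ_le_normVp s g
  have g4 := A.eLpNorm_sqrtΓ_two_le_normVp H s g
  have b1 := (h.enorm_integral_mul_ext_le H (Lp.aestronglyMeasurable (f : Lp ℝ 2 m)) hg).trans
    (holderBound_le f1 f2 g3 g4)
  have b2 := (h.symm.enorm_integral_mul_ext_le H (Lp.aestronglyMeasurable (g : Lp ℝ 2 m)) hf).trans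
    (holderBound_le g1 g2 f3 f4)
  have b3 := (h.enorm_integral_div_mul_le (Lp.aestronglyMeasurable (f : Lp ℝ 2 m))
    (Lp.aestronglyMeasurable (g : Lp ℝ 2 m))).trans (holderBound_le f1 f2 g1 g2)
  refine (enorm_add_le _ _).trans ((add_le_add ((enorm_add_le _ _).trans (add_le_add b1 b2)) b3).trans (le_of_eq ?_))
  ring

theorem leibnizDefect_eq_of_forall (h : b.Regular D r s q k₁ k₂ D₁ D₂) (H : HeatSemigroup E) {f g : E.dom}
    (hf : G.MemVp r f) (hg : G.MemVp s g) (h0 : ∀ a : A.carrier, b.leibnizDefect D r s f a = 0) :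
    b.leibnizDefect D r s f g = 0 := by
  obtain ⟨a, ha⟩ := A.exists_approx h.dense_right hg
  have hfin : (2 * (eLpNorm k₁ q m + eLpNorm k₂ ⊤ m) + (eLpNorm D₁ q m + eLpNorm D₂ ⊤ m)) * G.normVp r f ≠ ⊤ := by
    refine ENNReal.mul_ne_top ?_ ?_
    · refine ENNReal.add_ne_top.2 ⟨ENNReal.mul_ne_top (by simp) (ENNReal.add_ne_top.2
        ⟨h.control.memLp₁.2.ne, h.control.memLp₂.2.ne⟩), ENNReal.add_ne_top.2 ⟨h.memLp₁.2.ne, h.memLp₂.2.ne⟩⟩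
    · exact ENNReal.add_ne_top.2 ⟨ENNReal.add_ne_top.2 ⟨by simp, hf.1.2.ne⟩, hf.2.2.ne⟩
  have l := ENNReal.Tendsto.const_mul ha (Or.inr hfin)
  rw [mul_zero] at l
  have : ‖b.leibnizDefect D r s f g‖ₑ ≤ 0 := by
    refine ge_of_tendsto' l fun n => ?_
    have han := h.dense_right.1 (a n) (a n).2
    have e := h.leibnizDefect_sub_right H hf hg han
    rw [h0, sub_zero] at e
    rw [← e]
    exact h.enorm_leibnizDefect_le H hf (CarreDuChamp.MemVp.sub G h.one_lt_right.le hg han)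
  simpa using this

/-- The Leibniz rule and the divergence formula for the extended derivation. -/
theorem leibnizDefect_eq_zero (h : b.Regular D r s q k₁ k₂ D₁ D₂) (H : HeatSemigroup E) {f g : E.dom}
    (hf : G.MemVp r f) (hg : G.MemVp s g) : b.leibnizDefect D r s f g = 0 := by
  -- Density is used in one variable at a time, the second after exchanging the variables. For two
  -- test functions the claim is the Leibniz rule for their product combined with the definition of
  -- the divergence.
  refine h.leibnizDefect_eq_of_forall H hf hg fun a => ?_
  rw [leibnizDefect_comm]
  refine h.symm.leibnizDefect_eq_of_forall H (h.dense_right.1 a a.2) hf fun c => ?_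
  obtain ⟨ca, hca⟩ := A.exists_mul a c
  have ha := h.dense_right.1 a a.2
  have hc := h.dense_left.1 c c.2
  have a2 := Lp.memLp ((a : E.dom) : Lp ℝ 2 m)
  have c2 := Lp.memLp ((c : E.dom) : Lp ℝ 2 m)
  have key := h.hasDivergence ca
  rw [leibnizDefect, ← integral_add (h.symm.integrable_mul_ext H ha.1 a2 hc) (h.integrable_mul_ext H hc.1 c2 ha)]
  have e1 : ∫ x, ((a : E.dom) : Lp ℝ 2 m) x * b.ext r s.conjExponent (c : E.dom) x
      + ((c : E.dom) : Lp ℝ 2 m) x * b.ext s r.conjExponent (a : E.dom) x ∂m = ∫ x, b.d ca x ∂m := by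
    refine integral_congr_ae ?_
    filter_upwards [b.leibniz a c ca hca, h.ext_coe H a, h.symm.ext_coe H c] with x h1 h2 h3
    rw [h1, h2, h3]
  have e2 : ∫ x, D x * (((a : E.dom) : Lp ℝ 2 m) x * ((c : E.dom) : Lp ℝ 2 m) x) ∂m
      = ∫ x, ((ca : E.dom) : Lp ℝ 2 m) x * D x ∂m := by
    refine integral_congr_ae ?_
    filter_upwards [hca] with x h1
    rw [h1]; ring
  rw [e1, e2, key]
  ring

end Regular

end TestDerivation

end

/-! ### Differentiability of the interpolation. -/

section

variable {X : Type*} [MeasurableSpace X] {m : Measure X} {E : DirichletForm m}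
  {G : CarreDuChamp E} {A : TestAlgebra G}

theorem hasDerivAt_clm_apply₂ {V W : Type*} [NormedAddCommGroup V] [NormedSpace ℝ V] [NormedAddCommGroup W]
    [NormedSpace ℝ W] (B : V →L[ℝ] W →L[ℝ] ℝ) {v : ℝ → V} {w : ℝ → W} {v' : V} {w' : W} {t : ℝ}
    (hv : HasDerivAt v v' t) (hw : HasDerivAt w w' t) :
    HasDerivAt (fun t => B (v t) (w t)) (B v' (w t) + B (v t) w') t :=
  (B.hasFDerivAt.comp_hasDerivAt t hv).clm_apply hw

namespace HeatSemigroup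

variable (H : HeatSemigroup E) {t : ℝ} {p : ℝ≥0∞} {c : ℝ}

open Classical in
/-- `P_t f` as an element of `𝕍`, for `t > 0`. -/
def flow (t : ℝ) (f : Lp ℝ 2 m) : E.dom := if h : 0 < t then ⟨H.P t f, H.mem_dom f h⟩ else 0

theorem flow_eq (ht : 0 < t) (f : Lp ℝ 2 m) : H.flow t f = ⟨H.P t f, H.mem_dom f ht⟩ := by
  rw [flow, dif_pos ht]

theorem coe_flow (ht : 0 < t) (f : Lp ℝ 2 m) : (H.flow t f : Lp ℝ 2 m) = H.P t f := by
  rw [H.flow_eq ht]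

theorem flow_add_smul (ht : 0 < t) (f g : Lp ℝ 2 m) (c : ℝ) :
    H.flow t (f + c • g) = H.flow t f + c • H.flow t g := by
  refine Subtype.ext ?_
  rw [H.coe_flow ht, map_add, map_smul, Submodule.coe_add, Submodule.coe_smul, H.coe_flow ht, H.coe_flow ht]

theorem flow_P {s : ℝ} (hs : 0 < s) (ht : 0 < t) (f : Lp ℝ 2 m) : H.flow s (H.P t f) = H.flow (s + t) f := by
  refine Subtype.ext ?_
  rw [H.coe_flow hs, H.coe_flow (by positivity), H.P_add f hs ht]

theorem flow_sub (ht : 0 < t) (f g : Lp ℝ 2 m) : H.flow t (f - g) = H.flow t f - H.flow t g := by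
  refine Subtype.ext ?_
  rw [H.coe_flow ht, map_sub, Submodule.coe_sub, H.coe_flow ht, H.coe_flow ht]

theorem eLpNorm_sqrtΓ_flow_le (hΓ : GammaInequality G H p c) (ht : 0 < t) (ht1 : t < 1) {f : Lp ℝ 2 m}
    (hf : MemLp f p m) : eLpNorm (G.sqrtΓ (H.flow t f)) p m ≤ ENNReal.ofReal (c / √t) * eLpNorm f p m := by
  obtain ⟨_, h⟩ := hΓ.2 f hf t ⟨ht, ht1⟩
  rwa [H.flow_eq ht]

theorem eLpNorm_sqrtΓ_flow_two_le [SigmaFinite m] (A : TestAlgebra G) (ht : 0 < t) (f : Lp ℝ 2 m) :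
    eLpNorm (G.sqrtΓ (H.flow t f)) 2 m ≤ ENNReal.ofReal (1 / √t) * eLpNorm f 2 m := by
  rw [H.flow_eq ht]
  exact A.eLpNorm_sqrtΓ_P_le H f ht

theorem memVp_flow (hΓ : GammaInequality G H p c) (hp1 : 1 < p) (hp : p ≠ ⊤) (ht : 0 < t) (ht1 : t < 1)
    {f : Lp ℝ 2 m} (hf : MemLp f p m) : G.MemVp p (H.flow t f) := by
  refine ⟨?_, G.aestronglyMeasurable_sqrtΓ _, (H.eLpNorm_sqrtΓ_flow_le hΓ ht ht1 hf).trans_lt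
    (ENNReal.mul_lt_top (by simp) hf.2)⟩
  rw [H.coe_flow ht]
  exact H.memLp_P hp1 hp ht hf

/-- `Δ P_t f` as an element of `𝕍`, for `t > 0`. -/
def lapFlow (t : ℝ) (f : Lp ℝ 2 m) : E.dom := H.flow (t / 2) (H.lap (t / 2) f)

theorem lapFlow_eq {s : ℝ} (hs : 0 < s) (ht : 0 < t) (f : Lp ℝ 2 m) : H.flow s (H.lap t f) = H.lapFlow (s + t) f := by
  refine Subtype.ext ?_
  have : 0 < (s + t) / 2 := by positivity
  rw [lapFlow, H.coe_flow hs, H.coe_flow this, ← H.lap_add f hs ht, ← H.lap_add f this this, add_halves]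

theorem coe_lapFlow (ht : 0 < t) (f : Lp ℝ 2 m) : (H.lapFlow t f : Lp ℝ 2 m) = H.lap t f := by
  rw [lapFlow, H.coe_flow (by positivity), ← H.lap_add f (by positivity) (by positivity), add_halves]

theorem memVp_lapFlow (hΓ : GammaInequality G H p c) (hp1 : 1 < p) (hp : p ≠ ⊤) (ht : 0 < t) (ht1 : t < 1)
    {f : Lp ℝ 2 m} (hf : MemLp f p m) : G.MemVp p (H.lapFlow t f) :=
  H.memVp_flow hΓ hp1 hp (by positivity) (by linarith) (H.memLp_lap hp1 hp (by positivity) hf)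

end HeatSemigroup

theorem interLp.eLpNorm_le {p : ℝ≥0∞} [Fact (1 ≤ p)] (z : interLp m p) : eLpNorm z.1.2 p m ≤ ‖z‖ₑ := by
  rw [interLp.enorm_eq]; exact le_max_left _ _

theorem interLp.eLpNorm_two_le {p : ℝ≥0∞} [Fact (1 ≤ p)] (z : interLp m p) : eLpNorm z.1.2 2 m ≤ ‖z‖ₑ := by
  rw [interLp.enorm_eq]; exact le_max_right _ _

namespace TestDerivation

/-- The interpolation `t ↦ ∫ P_t u d(P_{α - t} f)(b) dm` between the two terms of the commutator. -/
def interpolation (b : TestDerivation A) (H : HeatSemigroup E) (r s : ℝ≥0∞) (α : ℝ)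
    (u f : Lp ℝ 2 m) (t : ℝ) : ℝ :=
  ∫ x, H.P t u x * b.ext s r.conjExponent (H.flow (α - t) f) x ∂m

namespace Regular

variable {b : TestDerivation A} {D : X →ₘ[m] ℝ} {r s q : ℝ≥0∞} {k₁ k₂ D₁ D₂ : X → ℝ} [SigmaFinite m]

/-- The continuous bilinear form `(u, f) ↦ ∫ u d(P_δ f)(b) dm` on `(L^r ∩ L²) × (L^s ∩ L²)`. -/
theorem exists_pairing (h : b.Regular D r s q k₁ k₂ D₁ D₂) (H : HeatSemigroup E) [Fact (1 ≤ r)] [Fact (1 ≤ s)]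
    {c δ : ℝ} (hΓ : GammaInequality G H s c) (hδ : 0 < δ) (hδ1 : δ < 1) :
    ∃ B : interLp m r →L[ℝ] interLp m s →L[ℝ] ℝ, ∀ z w,
      B z w = ∫ x, z.1.2 x * b.ext s r.conjExponent (H.flow δ w.1.2) x ∂m := by
  have mw : ∀ w : interLp m s, G.MemVp s (H.flow δ w.1.2) := fun w =>
    H.memVp_flow hΓ h.one_lt_right h.right_ne_top hδ hδ1 (interLp.memLp w)
  have int : ∀ (z : interLp m r) (w : interLp m s),
      Integrable (fun x => z.1.2 x * b.ext s r.conjExponent (H.flow δ w.1.2) x) m := fun z w =>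
    h.integrable_mul_ext H (interLp.memLp z) (Lp.memLp _) (mw w)
  have left : ∀ (z z' : interLp m r) (c : ℝ) (w : interLp m s),
      ∫ x, (z + c • z').1.2 x * b.ext s r.conjExponent (H.flow δ w.1.2) x ∂m
        = ∫ x, z.1.2 x * b.ext s r.conjExponent (H.flow δ w.1.2) x ∂m
          + c * ∫ x, z'.1.2 x * b.ext s r.conjExponent (H.flow δ w.1.2) x ∂m := by
    intro z z' c w
    rw [← integral_const_mul, ← integral_add (int z w) ((int z' w).const_mul c)]
    refine integral_congr_ae ?_
    filter_upwards [Lp.coeFn_add z.1.2 (c • z'.1.2), Lp.coeFn_smul c z'.1.2] with x h1 h2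
    have : (z + c • z').1.2 = z.1.2 + c • z'.1.2 := rfl
    rw [this, h1, Pi.add_apply, h2, Pi.smul_apply, smul_eq_mul]; ring
  have right : ∀ (z : interLp m r) (c : ℝ) (w w' : interLp m s),
      ∫ x, z.1.2 x * b.ext s r.conjExponent (H.flow δ (w + c • w').1.2) x ∂m
        = ∫ x, z.1.2 x * b.ext s r.conjExponent (H.flow δ w.1.2) x ∂m
          + c * ∫ x, z.1.2 x * b.ext s r.conjExponent (H.flow δ w'.1.2) x ∂m := by
    intro z c w w'
    rw [← integral_const_mul, ← integral_add (int z w) ((int z w').const_mul c)]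
    refine integral_congr_ae ?_
    filter_upwards [h.ext_add_smul H (mw w) (mw w') c] with x h1
    have : (w + c • w').1.2 = w.1.2 + c • w'.1.2 := rfl
    rw [this, H.flow_add_smul hδ, h1]; ring
  let L : interLp m r →ₗ[ℝ] interLp m s →ₗ[ℝ] ℝ := LinearMap.mk₂ ℝ
    (fun z w => ∫ x, z.1.2 x * b.ext s r.conjExponent (H.flow δ w.1.2) x ∂m)
    (fun z z' w => by simpa using left z z' 1 w)
    (fun c z w => by
      have h0 := left 0 0 1 w
      have h1 := left 0 z c w
      simp only [add_zero, smul_zero, zero_add, one_mul, smul_eq_mul] at h0 h1 ⊢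
      rw [h1]; linarith)
    (fun z w w' => by simpa using right z 1 w w')
    (fun c z w => by
      have h0 := right z 1 0 0
      have h1 := right z c 0 w
      simp only [add_zero, smul_zero, zero_add, one_mul, smul_eq_mul] at h0 h1 ⊢
      rw [h1]; linarith)
  have hfin : (eLpNorm k₁ q m + eLpNorm k₂ ⊤ m) * (ENNReal.ofReal (c / √δ) + ENNReal.ofReal (1 / √δ)) ≠ ⊤ :=
    ENNReal.mul_ne_top (ENNReal.add_ne_top.2 ⟨h.control.memLp₁.2.ne, h.control.memLp₂.2.ne⟩) (by simp)
  refine ⟨L.mkContinuous₂ ((eLpNorm k₁ q m + eLpNorm k₂ ⊤ m)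
    * (ENNReal.ofReal (c / √δ) + ENNReal.ofReal (1 / √δ))).toReal fun z w => ?_, fun z w => rfl⟩
  rw [← toReal_enorm, ← toReal_enorm z, ← toReal_enorm w, ← ENNReal.toReal_mul, ← ENNReal.toReal_mul]
  refine ENNReal.toReal_mono (ENNReal.mul_ne_top (ENNReal.mul_ne_top hfin enorm_ne_top) enorm_ne_top) ?_
  refine (h.enorm_integral_mul_ext_le H (Lp.aestronglyMeasurable z.1.2) (mw w)).trans ?_
  refine (holderBound_le (interLp.eLpNorm_le z) (interLp.eLpNorm_two_le z)
    (Z := (ENNReal.ofReal (c / √δ) + ENNReal.ofReal (1 / √δ)) * ‖w‖ₑ) ?_ ?_).trans (le_of_eq (by ring))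
  · refine (H.eLpNorm_sqrtΓ_flow_le hΓ hδ hδ1 (interLp.memLp w)).trans ?_
    gcongr
    · exact le_self_add
    · exact interLp.eLpNorm_le w
  · refine (H.eLpNorm_sqrtΓ_flow_two_le A hδ _).trans ?_
    gcongr
    · exact le_add_self
    · exact interLp.eLpNorm_two_le w

variable {H : HeatSemigroup E} {c α t : ℝ} {u f : Lp ℝ 2 m}

/-- The map g ↦ dg(b) needs a gradient. Keeping δ = (α - t)/2 of the flow aside makes (u, g) ↦ ∫ u
d(P_δ g)(b) continuous on (L^r ∩ L²) × (L^s ∩ L²). Near t the interpolation is this bilinear form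
evaluated on two curves that are differentiable in those spaces. -/
theorem hasDerivAt_interpolation (h : b.Regular D r s q k₁ k₂ D₁ D₂) (hΓ : GammaInequality G H s c)
    (hu : MemLp u r m) (hf : MemLp f s m) (ht : 0 < t) (htα : t < α) (hα : α < 1) :
    HasDerivAt (b.interpolation H r s α u f)
      (∫ x, H.lap t u x * b.ext s r.conjExponent (H.flow (α - t) f) x ∂m
        - ∫ x, H.P t u x * b.ext s r.conjExponent (H.lapFlow (α - t) f) x ∂m) t := by
  have : Fact (1 ≤ r) := ⟨h.one_lt_left.le⟩
  have : Fact (1 ≤ s) := ⟨h.one_lt_right.le⟩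
  set δ := (α - t) / 2 with hδdef
  have hδ : 0 < δ := by rw [hδdef]; linarith
  obtain ⟨B, hB⟩ := h.exists_pairing H hΓ hδ (by rw [hδdef]; linarith)
  have hpos : 0 < α - δ - t := by rw [hδdef]; linarith
  have d1 := H.hasDerivAt_toInterLp h.one_lt_left h.left_ne_top ht hu
  have d2 : HasDerivAt (fun t => toInterLp s (H.P (α - δ - t) f)) (-toInterLp s (H.lap (α - δ - t) f)) t :=
    HasDerivAt.comp_const_sub (α - δ) _ (H.hasDerivAt_toInterLp h.one_lt_right h.right_ne_top hpos hf)
  have key := hasDerivAt_clm_apply₂ B d1 d2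
  have e : ∀ t' ∈ Ioo 0 (α - δ), B (toInterLp r (H.P t' u)) (toInterLp s (H.P (α - δ - t') f))
      = b.interpolation H r s α u f t' := by
    intro t' ht'
    have h2 : 0 < α - δ - t' := by linarith [ht'.2]
    rw [hB, toInterLp_snd (H.memLp_P h.one_lt_left h.left_ne_top ht'.1 hu),
      toInterLp_snd (H.memLp_P h.one_lt_right h.right_ne_top h2 hf), H.flow_P hδ h2, interpolation,
      show δ + (α - δ - t') = α - t' by ring]
  have key2 := key.congr_of_eventuallyEq (f₁ := b.interpolation H r s α u f) (by
    filter_upwards [Ioo_mem_nhds ht (show t < α - δ by linarith)] with t' ht'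
    exact (e t' ht').symm)
  refine key2.congr_deriv ?_
  rw [map_neg, hB, hB, toInterLp_snd (H.memLp_P h.one_lt_left h.left_ne_top ht hu),
      toInterLp_snd (H.memLp_P h.one_lt_right h.right_ne_top hpos hf),
      toInterLp_snd (H.memLp_lap h.one_lt_left h.left_ne_top ht hu),
      toInterLp_snd (H.memLp_lap h.one_lt_right h.right_ne_top hpos hf), H.flow_P hδ hpos, H.lapFlow_eq hδ hpos,
      show δ + (α - δ - t) = α - t by ring]
  ring

/-- The same factorization with δ = α/2, now using strong continuity of the flow of `u` at time 0,
where it need not be differentiable. -/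
theorem tendsto_interpolation (h : b.Regular D r s q k₁ k₂ D₁ D₂) (hΓ : GammaInequality G H s c)
    (hu : MemLp u r m) (hf : MemLp f s m) (hα0 : 0 < α) (hα : α < 1) :
    Tendsto (b.interpolation H r s α u f) (𝓝[>] 0)
      (𝓝 (∫ x, u x * b.ext s r.conjExponent (H.flow α f) x ∂m)) := by
  have : Fact (1 ≤ r) := ⟨h.one_lt_left.le⟩
  have : Fact (1 ≤ s) := ⟨h.one_lt_right.le⟩
  set δ := α / 2 with hδdef
  have hδ : 0 < δ := by rw [hδdef]; linarith
  obtain ⟨B, hB⟩ := h.exists_pairing H hΓ hδ (by rw [hδdef]; linarith)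
  have hpos : 0 < α - δ - 0 := by rw [hδdef]; linarith
  have l1 := H.tendsto_toInterLp h.one_lt_left h.left_ne_top hu
  have l2 : Tendsto (fun t => toInterLp s (H.P (α - δ - t) f)) (𝓝[>] 0) (𝓝 (toInterLp s (H.P (α - δ - 0) f))) :=
    (HasDerivAt.comp_const_sub (α - δ) _ (H.hasDerivAt_toInterLp h.one_lt_right h.right_ne_top hpos hf)).continuousAt.tendsto.mono_left
      nhdsWithin_le_nhds
  have key := (B.continuous₂.tendsto (toInterLp r u, toInterLp s (H.P (α - δ - 0) f))).comp (l1.prodMk_nhds l2)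
  rw [Function.uncurry_apply_pair] at key
  have e0 : B (toInterLp r u) (toInterLp s (H.P (α - δ - 0) f))
      = ∫ x, u x * b.ext s r.conjExponent (H.flow α f) x ∂m := by
    rw [hB, toInterLp_snd hu, toInterLp_snd (H.memLp_P h.one_lt_right h.right_ne_top hpos hf), H.flow_P hδ hpos,
      show δ + (α - δ - 0) = α by ring]
  rw [e0] at key
  refine key.congr' ?_
  filter_upwards [Ioo_mem_nhdsGT (show 0 < α - δ by linarith)] with t ht
  have h2 : 0 < α - δ - t := by linarith [ht.2]
  rw [Function.comp_apply, Function.uncurry_apply_pair, hB, toInterLp_snd (H.memLp_P h.one_lt_left h.left_ne_top ht.1 hu),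
    toInterLp_snd (H.memLp_P h.one_lt_right h.right_ne_top h2 hf), H.flow_P hδ h2, interpolation,
    show δ + (α - δ - t) = α - t by ring]

end Regular

end TestDerivation

end

/-! ### The commutator estimate on test functions. -/

section

variable {X : Type*} [MeasurableSpace X] {m : Measure X} {E : DirichletForm m}
  {G : CarreDuChamp E} {A : TestAlgebra G}

/-- Integration of a derivative bound with an integrable singularity at the origin. -/
theorem abs_sub_le_of_hasDerivAt_of_sqrt {Φ Φ' : ℝ → ℝ} {α K K' Φ₀ : ℝ} (hα : 0 < α) (hK : 0 ≤ K) (hK' : 0 ≤ K')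
    (hd : ∀ t ∈ Ioc 0 (α / 2), HasDerivAt Φ (Φ' t) t)
    (hb : ∀ t ∈ Ioc 0 (α / 2), |Φ' t| ≤ K / (√t * √(α - t)) + K' / (α - t))
    (hlim : Tendsto Φ (𝓝[>] 0) (𝓝 Φ₀)) : |Φ₀ - Φ (α / 2)| ≤ 2 * K + K' := by
  -- On (0, α/2] one has α - t ≥ α/2, so the derivative bound is at most K√(2/α)/√t + 2K'/α, of
  -- which `g` is the primitive vanishing at 0. Its value 2K + K' at α/2 does not depend on α.
  set g : ℝ → ℝ := fun t => 2 * K * √(2 / α) * √t + K' * (2 / α) * t with hg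
  have hg' : ∀ t ∈ Ioc 0 (α / 2), HasDerivAt g (2 * K * √(2 / α) * (1 / (2 * √t)) + K' * (2 / α)) t := by
    intro t ht
    have h1 := (Real.hasDerivAt_sqrt ht.1.ne').const_mul (2 * K * √(2 / α))
    have h2 := (hasDerivAt_id t).const_mul (K' * (2 / α))
    rw [mul_one] at h2
    exact h1.add h2
  have hle : ∀ t ∈ Ioc 0 (α / 2), |Φ' t| ≤ 2 * K * √(2 / α) * (1 / (2 * √t)) + K' * (2 / α) := by
    intro t ht
    have h0 := Real.sqrt_pos.2 ht.1
    have hαt : α / 2 ≤ α - t := by linarith [ht.2]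
    have h1 : 1 / (α - t) ≤ 2 / α := by
      rw [show 2 / α = 1 / (α / 2) by field_simp]
      exact one_div_le_one_div_of_le (by positivity) hαt
    have h2 : 1 / √(α - t) ≤ √(2 / α) := by
      have h3 : 1 / √(α - t) = √(1 / (α - t)) := by rw [Real.sqrt_div zero_le_one, Real.sqrt_one]
      rw [h3]
      exact Real.sqrt_le_sqrt h1
    refine (hb t ht).trans ?_
    calc K / (√t * √(α - t)) + K' / (α - t) = K * (1 / √(α - t)) * (1 / √t) + K' * (1 / (α - t)) := by
          rw [div_mul_eq_div_div]; ring
      _ ≤ K * √(2 / α) * (1 / √t) + K' * (2 / α) := by gcongr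
      _ = _ := by field_simp
  have hcv : Convex ℝ (Ioc 0 (α / 2)) := convex_Ioc _ _
  -- Monotonicity of g ± Φ replaces integration of the derivative, so no integrability of `Φ'` has
  -- to be checked.
  have mono : ∀ σ : ℝ, |σ| = 1 → MonotoneOn (fun t => g t + σ * Φ t) (Ioc 0 (α / 2)) := by
    intro σ hσ
    have hh : ∀ t ∈ Ioc 0 (α / 2), HasDerivAt (fun t => g t + σ * Φ t)
        (2 * K * √(2 / α) * (1 / (2 * √t)) + K' * (2 / α) + σ * Φ' t) t := fun t ht =>
      (hg' t ht).add ((hd t ht).const_mul σ)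
    refine monotoneOn_of_deriv_nonneg hcv (fun t ht => (hh t ht).continuousAt.continuousWithinAt)
      (fun t ht => (hh t (interior_subset ht)).differentiableAt.differentiableWithinAt) fun t ht => ?_
    rw [(hh t (interior_subset ht)).deriv]
    have h1 := hle t (interior_subset ht)
    have h2 : |σ * Φ' t| = |Φ' t| := by rw [abs_mul, hσ, one_mul]
    have h3 := neg_abs_le (σ * Φ' t)
    linarith
  have hα2 : α / 2 ∈ Ioc 0 (α / 2) := ⟨by positivity, le_rfl⟩
  have lg : Tendsto g (𝓝[>] 0) (𝓝 0) := by
    have : Continuous g := by rw [hg]; fun_prop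
    have h0 : g 0 = 0 := by simp [hg]
    simpa [h0] using (this.tendsto 0).mono_left nhdsWithin_le_nhds
  have hend : g (α / 2) = 2 * K + K' := by
    have h1 : √(2 / α) * √(α / 2) = 1 := by
      rw [← Real.sqrt_mul (by positivity), show 2 / α * (α / 2) = 1 by field_simp, Real.sqrt_one]
    have h2 : g (α / 2) = 2 * K * (√(2 / α) * √(α / 2)) + K' * (2 / α * (α / 2)) := by rw [hg]; ring
    rw [h2, h1, show 2 / α * (α / 2) = 1 by field_simp]; ring
  have key : ∀ σ : ℝ, |σ| = 1 → σ * Φ₀ ≤ g (α / 2) + σ * Φ (α / 2) := by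
    intro σ hσ
    have l := lg.add (hlim.const_mul σ)
    rw [zero_add] at l
    refine le_of_tendsto l ?_
    filter_upwards [Ioc_mem_nhdsGT (show 0 < α / 2 by positivity)] with t ht
    exact mono σ hσ ht hα2 ht.2
  have k1 := key 1 (by simp)
  have k2 := key (-1) (by simp)
  rw [hend] at k1 k2
  rw [abs_le]
  constructor <;> linarith

theorem holderBound_le_ofReal {q r s : ℝ≥0∞} {k₁ k₂ y z : X → ℝ} {κ₁ κ₂ Y₁ Y₂ Z₁ Z₂ : ℝ} (hκ₁ : 0 ≤ κ₁) (hκ₂ : 0 ≤ κ₂)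
    (hY₁ : 0 ≤ Y₁) (hY₂ : 0 ≤ Y₂)
    (hZ₁ : 0 ≤ Z₁) (hZ₂ : 0 ≤ Z₂)
    (hk₁ : eLpNorm k₁ q m ≤ ENNReal.ofReal κ₁) (hk₂ : eLpNorm k₂ ⊤ m ≤ ENNReal.ofReal κ₂)
    (h1 : eLpNorm y r m ≤ ENNReal.ofReal Y₁) (h2 : eLpNorm y 2 m ≤ ENNReal.ofReal Y₂)
    (h3 : eLpNorm z s m ≤ ENNReal.ofReal Z₁) (h4 : eLpNorm z 2 m ≤ ENNReal.ofReal Z₂) :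
    holderBound m q r s k₁ k₂ y z ≤ ENNReal.ofReal (κ₁ * Y₁ * Z₁ + κ₂ * Y₂ * Z₂) := by
  rw [ENNReal.ofReal_add (by positivity) (by positivity), ENNReal.ofReal_mul (by positivity),
    ENNReal.ofReal_mul hκ₁, ENNReal.ofReal_mul (by positivity), ENNReal.ofReal_mul hκ₂, holderBound]
  gcongr

theorem abs_le_of_enorm_le {x y : ℝ} (hy : 0 ≤ y) (h : ‖x‖ₑ ≤ ENNReal.ofReal y) : |x| ≤ y := by
  rw [← ofReal_norm, Real.norm_eq_abs] at h
  exact (ENNReal.ofReal_le_ofReal_iff hy).1 h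

/-- `f` is bounded by `a` in `L^p` and in `L²`. -/
structure InterBound (f : Lp ℝ 2 m) (p : ℝ≥0∞) (a : ℝ) : Prop where
  nonneg : 0 ≤ a
  le : eLpNorm f p m ≤ ENNReal.ofReal a
  le_two : eLpNorm f 2 m ≤ ENNReal.ofReal a

namespace InterBound

variable {f : Lp ℝ 2 m} {p : ℝ≥0∞} {a : ℝ} {H : HeatSemigroup E} {c t : ℝ}

theorem memLp (h : InterBound f p a) : MemLp f p m := ⟨Lp.aestronglyMeasurable _, h.le.trans_lt ENNReal.ofReal_lt_top⟩

theorem P (h : InterBound f p a) (hp1 : 1 < p) (hp : p ≠ ⊤) (ht : 0 < t) : InterBound (H.P t f) p a :=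
  ⟨h.nonneg, (H.eLpNorm_P_le hp1 hp ht h.memLp).trans h.le,
    (H.eLpNorm_P_le (by simp) (by simp) ht (Lp.memLp f)).trans h.le_two⟩

theorem sqrtΓ_le (h : InterBound f p a) (hΓ : GammaInequality G H p c) (ht : 0 < t) (ht1 : t < 1) :
    eLpNorm (G.sqrtΓ (H.flow t f)) p m ≤ ENNReal.ofReal (c / √t * a) := by
  have := hΓ.1
  rw [ENNReal.ofReal_mul (by positivity)]
  exact (H.eLpNorm_sqrtΓ_flow_le hΓ ht ht1 h.memLp).trans (by gcongr; exact h.le)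

theorem sqrtΓ_two_le [SigmaFinite m] (h : InterBound f p a) (A : TestAlgebra G) (ht : 0 < t) :
    eLpNorm (G.sqrtΓ (H.flow t f)) 2 m ≤ ENNReal.ofReal (1 / √t * a) := by
  rw [ENNReal.ofReal_mul (by positivity)]
  exact (H.eLpNorm_sqrtΓ_flow_two_le A ht f).trans (by gcongr; exact h.le_two)

theorem lap_le (h : InterBound f p a) (hΔ : DeltaInequality H p c) (ht : 0 < t) (ht1 : t < 1) :
    eLpNorm (H.lap t f) p m ≤ ENNReal.ofReal (c / t * a) := by
  have := hΔ.1
  obtain ⟨l, hl, hle⟩ := hΔ.2 f h.memLp t ⟨ht, ht1⟩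
  rw [hl.unique (H.isLaplacian f ht)] at hle
  rw [ENNReal.ofReal_mul (by positivity)]
  exact hle.trans (by gcongr; exact h.le)

theorem lap_two_le (h : InterBound f p a) (ht : 0 < t) :
    eLpNorm (H.lap t f) 2 m ≤ ENNReal.ofReal (2 / t * a) := by
  rw [← Lp.enorm_def, ← ofReal_norm]
  refine ENNReal.ofReal_le_ofReal ((H.norm_lap_le f ht).trans ?_)
  have := h.le_two
  rw [← Lp.enorm_def, ← ofReal_norm, ENNReal.ofReal_le_ofReal_iff h.nonneg] at this
  gcongr

end InterBound

namespace TestDerivation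

theorem mem_deformationBounds_symm {b : TestDerivation A} {D : X →ₘ[m] ℝ} {r s : ℝ≥0∞} {c : ℝ}
    (h : c ∈ b.deformationBounds D r s) : c ∈ b.deformationBounds D s r := by
  refine ⟨h.1, fun f g Lf Lg hf hLf hLfs hg hLg hLgr => ?_⟩
  have := h.2 g f Lg Lf hg hLg hLgr hf hLf hLfs
  have e : b.symDeformation D s r f g Lf Lg = b.symDeformation D r s g f Lg Lf := by
    rw [symDeformation, symDeformation]
    congr 2
    ext x
    rw [G.symm f g]
    ring
  rw [e]
  refine this.trans (le_of_eq (by ring))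

namespace Regular

variable {b : TestDerivation A} {D : X →ₘ[m] ℝ} {r s q : ℝ≥0∞} {k₁ k₂ D₁ D₂ : X → ℝ}

theorem abs_div_Γ_le (h : b.Regular D r s q k₁ k₂ D₁ D₂) (v g : E.dom) :
    ∀ᵐ x ∂m, |D x * G.Γ v g x| ≤ |D₁ x + D₂ x| * |G.sqrtΓ v x| * |G.sqrtΓ g x| := by
  filter_upwards [h.decomposition, G.abs_Γ_le v g] with x h1 h2
  rw [h1, Pi.add_apply, abs_mul, mul_assoc, abs_of_nonneg (G.sqrtΓ_nonneg v x), abs_of_nonneg (G.sqrtΓ_nonneg g x)]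
  gcongr

variable [SigmaFinite m] {H : HeatSemigroup E} {α t : ℝ} {u f : Lp ℝ 2 m} {c cr cs dr ds a β δ₁ δ₂ : ℝ}

/-- The derivative of the interpolation in terms of the deformation. -/
theorem interpolation_deriv_eq (h : b.Regular D r s q k₁ k₂ D₁ D₂) (hΓr : GammaInequality G H r cr)
    (hΓs : GammaInequality G H s cs)
    (hu : MemLp u r m) (hf : MemLp f s m) (ht : 0 < t) (htα : t < α) (hα : α < 1) :
    ∫ x, H.lap t u x * b.ext s r.conjExponent (H.flow (α - t) f) x ∂m
        - ∫ x, H.P t u x * b.ext s r.conjExponent (H.lapFlow (α - t) f) x ∂m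
      = -2 * b.symDeformation D r s (H.flow t u) (H.flow (α - t) f) (H.lap t u) (H.lap (α - t) f)
        + ∫ x, D x * G.Γ (H.flow t u) (H.flow (α - t) f) x ∂m
        + ∫ x, D x * (H.P t u x * H.lap (α - t) f x) ∂m := by
  have hαt : 0 < α - t := by linarith
  have mv := H.memVp_flow hΓr h.one_lt_left h.left_ne_top ht (htα.trans hα) hu
  have mg := H.memVp_flow hΓs h.one_lt_right h.right_ne_top hαt (by linarith) hf
  have ml := H.memVp_lapFlow hΓs h.one_lt_right h.right_ne_top hαt (by linarith) hf
  -- The Leibniz rule for P_t u and ΔP_{α-t} f trades the derivative of the Laplacian for ΔP_{α-t} f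
  -- d(P_t u)(b). This completes the symmetric expression defining the deformation.
  have key := h.leibnizDefect_eq_zero H mv ml
  rw [leibnizDefect, H.coe_flow ht, H.coe_lapFlow hαt] at key
  have i1 := h.symm.integrable_mul_ext H (H.memLp_lap h.one_lt_right h.right_ne_top hαt hf) (Lp.memLp _) mv
  have i2 := h.integrable_mul_ext H (H.memLp_lap h.one_lt_left h.left_ne_top ht hu) (Lp.memLp _) mg
  have i3 : Integrable (fun x => D x * G.Γ (H.flow t u) (H.flow (α - t) f) x) m :=
    integrable_of_abs_le_mul h.exponents ((AEEqFun.aestronglyMeasurable _).mul (Lp.aestronglyMeasurable _))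
      h.memLp₁ h.memLp₂ mv.2 (G.memLp_sqrtΓ_two _) mg.2 (G.memLp_sqrtΓ_two _) (h.abs_div_Γ_le _ _)
  have e : b.symDeformation D r s (H.flow t u) (H.flow (α - t) f) (H.lap t u) (H.lap (α - t) f)
      = -(1 / 2) * (∫ x, H.lap (α - t) f x * b.ext r s.conjExponent (H.flow t u) x ∂m
        + ∫ x, H.lap t u x * b.ext s r.conjExponent (H.flow (α - t) f) x ∂m
        - ∫ x, D x * G.Γ (H.flow t u) (H.flow (α - t) f) x ∂m) := by
    have i12 : Integrable (fun x => H.lap (α - t) f x * b.ext r s.conjExponent (H.flow t u) x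
      + H.lap t u x * b.ext s r.conjExponent (H.flow (α - t) f) x) m := i1.add i2
    rw [symDeformation, ← integral_add i1 i2, ← integral_sub i12 i3]
    congr 2
    ext x
    ring
  rw [e]
  linarith

/-- The deformation and the Γ term carry a gradient at time t and one at time α - t, hence the
factor 1/(√t √(α-t)). The remaining term carries a full Laplacian at time α - t, hence 1/(α-t). The
bounded part of the divergence is paired in L², with constants 1 and 2 in place of the Γ and Δ
constants. -/
theorem abs_interpolation_deriv_le (h : b.Regular D r s q k₁ k₂ D₁ D₂) (hΓr : GammaInequality G H r cr)
    (hΓs : GammaInequality G H s cs) (hΔs : DeltaInequality H s ds) (hc : c ∈ b.deformationBounds D r s)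
    (hδ₁ : 0 ≤ δ₁) (hδ₂ : 0 ≤ δ₂) (hD₁ : eLpNorm D₁ q m ≤ ENNReal.ofReal δ₁) (hD₂ : eLpNorm D₂ ⊤ m ≤ ENNReal.ofReal δ₂)
    (hu : InterBound u r a) (hf : InterBound f s β) (ht : 0 < t) (htα : t < α) (hα : α < 1) :
    |∫ x, H.lap t u x * b.ext s r.conjExponent (H.flow (α - t) f) x ∂m
        - ∫ x, H.P t u x * b.ext s r.conjExponent (H.lapFlow (α - t) f) x ∂m|
      ≤ (2 * c * cr * cs + δ₁ * cr * cs + δ₂) * (a * β) / (√t * √(α - t))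
        + (δ₁ * ds + 2 * δ₂) * (a * β) / (α - t) := by
  have hαt : 0 < α - t := by linarith
  have h0 := Real.sqrt_pos.2 ht
  have h1 := Real.sqrt_pos.2 hαt
  have hcr := hΓr.1
  have hcs := hΓs.1
  have hds := hΔs.1
  have ha := hu.nonneg
  have hβ := hf.nonneg
  have hc0 := hc.1
  have mv := H.memVp_flow hΓr h.one_lt_left h.left_ne_top ht (htα.trans hα) hu.memLp
  have mg := H.memVp_flow hΓs h.one_lt_right h.right_ne_top hαt (by linarith) hf.memLp
  rw [h.interpolation_deriv_eq hΓr hΓs hu.memLp hf.memLp ht htα hα]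
  have b1 : |b.symDeformation D r s (H.flow t u) (H.flow (α - t) f) (H.lap t u) (H.lap (α - t) f)|
      ≤ c * (cr / √t * a) * (cs / √(α - t) * β) := by
    have l1 : E.IsLaplacian (H.flow t u) (H.lap t u) := by rw [H.coe_flow ht]; exact H.isLaplacian u ht
    have l2 : E.IsLaplacian (H.flow (α - t) f) (H.lap (α - t) f) := by rw [H.coe_flow hαt]; exact H.isLaplacian f hαt
    refine (hc.2 _ _ _ _ mv l1 (H.memLp_lap h.one_lt_left h.left_ne_top ht hu.memLp) mg l2
      (H.memLp_lap h.one_lt_right h.right_ne_top hαt hf.memLp)).trans ?_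
    have n1 := ENNReal.toReal_le_of_le_ofReal (by positivity) (hu.sqrtΓ_le hΓr ht (htα.trans hα))
    have n2 := ENNReal.toReal_le_of_le_ofReal (by positivity) (hf.sqrtΓ_le hΓs hαt (by linarith))
    gcongr
  have b2 : |∫ x, D x * G.Γ (H.flow t u) (H.flow (α - t) f) x ∂m|
      ≤ δ₁ * (cr / √t * a) * (cs / √(α - t) * β) + δ₂ * (1 / √t * a) * (1 / √(α - t) * β) := by
    refine abs_le_of_enorm_le (by positivity) ((enorm_integral_le_holderBound h.exponents h.memLp₁.1 h.memLp₂.1 mv.2.1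
      mg.2.1 (h.abs_div_Γ_le _ _)).trans (holderBound_le_ofReal hδ₁ hδ₂ (by positivity) (by positivity)
        (by positivity) (by positivity) hD₁ hD₂ (hu.sqrtΓ_le hΓr ht (htα.trans hα)) (hu.sqrtΓ_two_le A ht)
        (hf.sqrtΓ_le hΓs hαt (by linarith)) (hf.sqrtΓ_two_le A hαt)))
  have hPu := hu.P (H := H) h.one_lt_left h.left_ne_top ht
  have b3 : |∫ x, D x * (H.P t u x * H.lap (α - t) f x) ∂m|
      ≤ δ₁ * a * (ds / (α - t) * β) + δ₂ * a * (2 / (α - t) * β) := by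
    refine abs_le_of_enorm_le (by positivity) ((h.enorm_integral_div_mul_le (Lp.aestronglyMeasurable _)
      (Lp.aestronglyMeasurable _)).trans (holderBound_le_ofReal hδ₁ hδ₂ ha ha
        (by positivity) (by positivity) hD₁ hD₂ hPu.le hPu.le_two
        (hf.lap_le hΔs hαt (by linarith)) (hf.lap_two_le hαt)))
  refine (abs_add_three _ _ _).trans ?_
  rw [abs_mul, abs_neg, abs_two]
  calc _ ≤ 2 * (c * (cr / √t * a) * (cs / √(α - t) * β))
        + (δ₁ * (cr / √t * a) * (cs / √(α - t) * β) + δ₂ * (1 / √t * a) * (1 / √(α - t) * β))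
        + (δ₁ * a * (ds / (α - t) * β) + δ₂ * a * (2 / (α - t) * β)) := by gcongr
    _ = _ := by field_simp; ring

theorem abs_interpolation_sub_le (h : b.Regular D r s q k₁ k₂ D₁ D₂) (hΓr : GammaInequality G H r cr)
    (hΓs : GammaInequality G H s cs) (hΔs : DeltaInequality H s ds) (hc : c ∈ b.deformationBounds D r s)
    (hδ₁ : 0 ≤ δ₁) (hδ₂ : 0 ≤ δ₂) (hD₁ : eLpNorm D₁ q m ≤ ENNReal.ofReal δ₁) (hD₂ : eLpNorm D₂ ⊤ m ≤ ENNReal.ofReal δ₂)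
    (hu : InterBound u r a) (hf : InterBound f s β) (hα0 : 0 < α) (hα : α < 1) :
    |∫ x, u x * b.ext s r.conjExponent (H.flow α f) x ∂m - b.interpolation H r s α u f (α / 2)|
      ≤ (2 * (2 * c * cr * cs + δ₁ * cr * cs + δ₂) + (δ₁ * ds + 2 * δ₂)) * (a * β) := by
  have hcr := hΓr.1
  have hcs := hΓs.1
  have hds := hΔs.1
  have ha := hu.nonneg
  have hβ := hf.nonneg
  have hc0 := hc.1
  refine (abs_sub_le_of_hasDerivAt_of_sqrt (K := (2 * c * cr * cs + δ₁ * cr * cs + δ₂) * (a * β))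
    (K' := (δ₁ * ds + 2 * δ₂) * (a * β)) hα0 (by positivity) (by positivity)
    (fun t ht => h.hasDerivAt_interpolation hΓs hu.memLp hf.memLp ht.1 (by linarith [ht.2]) hα)
    (fun t ht => h.abs_interpolation_deriv_le hΓr hΓs hΔs hc hδ₁ hδ₂ hD₁ hD₂ hu hf ht.1 (by linarith [ht.2]) hα)
    (h.tendsto_interpolation hΓs hu.memLp hf.memLp hα0 hα)).trans (le_of_eq (by ring))

/-- Rewriting the term with df(b) by the Leibniz rule for P_α u and `f` makes the commutator the sum
of the initial values of the two interpolations, plus a divergence term. -/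
theorem commutator_eq (h : b.Regular D r s q k₁ k₂ D₁ D₂) (hΓr : GammaInequality G H r cr) (hu : MemLp u r m)
    (hα0 : 0 < α) (hα : α < 1) (f : A.carrier) :
    b.commutator H r s α u f = ∫ x, u x * b.ext s r.conjExponent (H.flow α (f : E.dom)) x ∂m
      + ∫ x, ((f : E.dom) : Lp ℝ 2 m) x * b.ext r s.conjExponent (H.flow α u) x ∂m
      + ∫ x, D x * (H.P α u x * ((f : E.dom) : Lp ℝ 2 m) x) ∂m := by
  have mu := H.memVp_flow hΓr h.one_lt_left h.left_ne_top hα0 hα hu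
  have key := h.leibnizDefect_eq_zero H mu (h.dense_right.1 f f.2)
  rw [leibnizDefect, H.coe_flow hα0] at key
  have e : ∫ x, H.P α u x * b.ext s r.conjExponent (f : E.dom) x ∂m = ∫ x, H.P α u x * b.d f x ∂m := by
    refine integral_congr_ae ?_
    filter_upwards [h.ext_coe H f] with x hx
    rw [hx]
  rw [e] at key
  rw [commutator, divMul, semigroupDivMul, dif_pos (H.mem_dom _ hα0), divMulExt, H.flow_eq hα0 ((f : E.dom) : Lp ℝ 2 m)]
  linarith

/-- The commutator estimate, tested on `f ∈ 𝒜`. -/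
theorem abs_commutator_le (h : b.Regular D r s q k₁ k₂ D₁ D₂) (hΓr : GammaInequality G H r cr)
    (hΓs : GammaInequality G H s cs) (hΔr : DeltaInequality H r dr) (hΔs : DeltaInequality H s ds)
    (hc : c ∈ b.deformationBounds D r s)
    (hδ₁ : 0 ≤ δ₁) (hδ₂ : 0 ≤ δ₂) (hD₁ : eLpNorm D₁ q m ≤ ENNReal.ofReal δ₁) (hD₂ : eLpNorm D₂ ⊤ m ≤ ENNReal.ofReal δ₂)
    (hu : InterBound u r a) (f : A.carrier) (hf : InterBound ((f : E.dom) : Lp ℝ 2 m) s β) (hα0 : 0 < α) (hα : α < 1) :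
    |b.commutator H r s α u f| ≤ (8 * cr * cs + dr + ds + 10) * a * (c + (δ₁ + δ₂)) * β := by
  have hcr := hΓr.1
  have hcs := hΓs.1
  have hdr := hΔr.1
  have hds := hΔs.1
  have ha := hu.nonneg
  have hβ := hf.nonneg
  have hc0 := hc.1
  have hα2 : 0 < α / 2 := by positivity
  set f' : Lp ℝ 2 m := ((f : E.dom) : Lp ℝ 2 m) with hf'
  have b1 := h.abs_interpolation_sub_le hΓr hΓs hΔs hc hδ₁ hδ₂ hD₁ hD₂ hu hf hα0 hα
  have b2 := h.symm.abs_interpolation_sub_le hΓs hΓr hΔr (mem_deformationBounds_symm hc) hδ₁ hδ₂ hD₁ hD₂ hf hu hα0 hα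
  have mu := H.memVp_flow hΓr h.one_lt_left h.left_ne_top hα2 (by linarith) hu.memLp
  have mf := H.memVp_flow hΓs h.one_lt_right h.right_ne_top hα2 (by linarith) hf.memLp
  -- At the midpoint α/2 the values of the two interpolations add up to minus an integral against
  -- the divergence, so the two halves fit together.
  have key := h.leibnizDefect_eq_zero H mu mf
  rw [leibnizDefect, H.coe_flow hα2, H.coe_flow hα2] at key
  rw [interpolation, show α - α / 2 = α / 2 by ring] at b1 b2
  have hD : ∀ v w : Lp ℝ 2 m, InterBound v r a → InterBound w s β →
      |∫ x, D x * (v x * w x) ∂m| ≤ (δ₁ + δ₂) * (a * β) := by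
    intro v w hv hw
    refine (abs_le_of_enorm_le (by positivity) ((h.enorm_integral_div_mul_le (Lp.aestronglyMeasurable _)
      (Lp.aestronglyMeasurable _)).trans (holderBound_le_ofReal hδ₁ hδ₂ ha ha hβ hβ hD₁ hD₂ hv.le hv.le_two
        hw.le hw.le_two))).trans (le_of_eq (by ring))
  have b3 := hD (H.P α u) f' (hu.P h.one_lt_left h.left_ne_top hα0) hf
  have b4 := hD (H.P (α / 2) u) (H.P (α / 2) f') (hu.P h.one_lt_left h.left_ne_top hα2)
    (hf.P h.one_lt_right h.right_ne_top hα2)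
  rw [h.commutator_eq hΓr hu.memLp hα0 hα]
  have hab : 0 ≤ a * β := mul_nonneg ha hβ
  have total : |∫ x, u x * b.ext s r.conjExponent (H.flow α f') x ∂m
      + ∫ x, f' x * b.ext r s.conjExponent (H.flow α u) x ∂m + ∫ x, D x * (H.P α u x * f' x) ∂m|
      ≤ (2 * (2 * c * cr * cs + δ₁ * cr * cs + δ₂) + (δ₁ * ds + 2 * δ₂)) * (a * β)
        + (2 * (2 * c * cs * cr + δ₁ * cs * cr + δ₂) + (δ₁ * dr + 2 * δ₂)) * (β * a)
        + (δ₁ + δ₂) * (a * β) + (δ₁ + δ₂) * (a * β) := by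
    rw [abs_le] at *
    constructor <;> linarith
  refine total.trans ?_
  -- This is what the common factor 8 c_r c_s + d_r + d_s + 10 adds to the actual coefficients 8 c_r
  -- c_s of c, 4 c_r c_s + d_r + d_s + 2 of δ₁, and 10 of δ₂.
  have : 0 ≤ ((4 * cr * cs + 8) * δ₁ + (8 * cr * cs + dr + ds) * δ₂ + (dr + ds + 10) * c) * (a * β) := by positivity
  nlinarith

end Regular

end TestDerivation

end

section

variable {X : Type*} [MeasurableSpace X] {m : Measure X} {E : DirichletForm m}
  {G : CarreDuChamp E} {A : TestAlgebra G}

/-! ### Representation of functionals on `L^s ∩ L²` -/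

/-- A functional on the product is the sum of its restrictions to the two factors, each represented
by Riesz. On the diagonal L^p ∩ L² the two representing functions act on the same function and may
be added. -/
theorem exists_representative_of_clm [SigmaFinite m] {p p' : ℝ≥0∞} [Fact (1 ≤ p)] [p.HolderConjugate p'] (hp1 : 1 < p) (hp : p ≠ ⊤)
    (Λ : Lp ℝ p m × Lp ℝ 2 m →L[ℝ] ℝ) :
    ∃ w₁ w₂ : X → ℝ, MemLp w₁ p' m ∧ MemLp w₂ 2 m ∧ eLpNorm w₁ p' m ≤ ‖Λ‖ₑ ∧ eLpNorm w₂ 2 m ≤ ‖Λ‖ₑ ∧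
      ∀ z : interLp m p, Λ z = ∫ x, (w₁ x + w₂ x) * z.1.2 x ∂m := by
  obtain ⟨w₁, h1, n1, e1⟩ := exists_dual_representative (p' := p') hp1 hp (Λ.comp (ContinuousLinearMap.inl ℝ _ _))
  have : (2 : ℝ≥0∞).HolderConjugate 2 := inferInstance
  obtain ⟨w₂, h2, n2, e2⟩ := exists_dual_representative (p' := 2) (by simp) (by simp)
    (Λ.comp (ContinuousLinearMap.inr ℝ (Lp ℝ p m) (Lp ℝ 2 m)))
  have b1 : ‖Λ.comp (ContinuousLinearMap.inl ℝ (Lp ℝ p m) (Lp ℝ 2 m))‖ₑ ≤ ‖Λ‖ₑ := by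
    rw [enorm_le_iff_norm_le]
    refine (Λ.opNorm_comp_le _).trans (mul_le_of_le_one_right (norm_nonneg _) ?_)
    exact ContinuousLinearMap.norm_inl_le_one ℝ _ _
  have b2 : ‖Λ.comp (ContinuousLinearMap.inr ℝ (Lp ℝ p m) (Lp ℝ 2 m))‖ₑ ≤ ‖Λ‖ₑ := by
    rw [enorm_le_iff_norm_le]
    refine (Λ.opNorm_comp_le _).trans (mul_le_of_le_one_right (norm_nonneg _) ?_)
    exact ContinuousLinearMap.norm_inr_le_one ℝ _ _
  refine ⟨w₁, w₂, h1, h2, n1.trans b1, n2.trans b2, fun z => ?_⟩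
  have e : Λ z = Λ (z.1.1, 0) + Λ (0, z.1.2) := by
    rw [← map_add]; simp
  have e1' := e1 z.1.1
  have e2' := e2 z.1.2
  rw [ContinuousLinearMap.comp_apply, ContinuousLinearMap.inl_apply] at e1'
  rw [ContinuousLinearMap.comp_apply, ContinuousLinearMap.inr_apply] at e2'
  have hc := ENNReal.HolderConjugate.symm (p := p) (q := p')
  rw [e, e1', e2', ← integral_add (integrable_mul_of_conj (p := p') (p' := p) h1 (Lp.memLp _))
    (integrable_mul_of_conj (p := 2) (p' := 2) h2 (Lp.memLp _))]
  refine integral_congr_ae ?_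
  filter_upwards [interLp.ae_eq z] with x hx
  rw [hx]; ring

/-- A linear functional on test functions that is bounded for the norm of `L^p ∩ L²` is induced by
a function in `L^p' + L²`. -/
theorem exists_representative [SigmaFinite m] {p p' : ℝ≥0∞} [p.HolderConjugate p'] (hp1 : 1 < p) (hp : p ≠ ⊤)
    {V : Type*} [AddCommGroup V] [Module ℝ V] (j : V →ₗ[ℝ] Lp ℝ 2 m) (hj : Function.Injective j)
    (hjp : ∀ v, MemLp (j v) p m) (ℓ : V →ₗ[ℝ] ℝ) {K : ℝ}
    (hℓ : ∀ v, |ℓ v| ≤ K * (interNorm (j v) p 2 m).toReal) :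
    ∃ w : X →ₘ[m] ℝ, MemSum w p' 2 m ∧ (∀ v, ℓ v = ∫ x, w x * j v x ∂m) ∧
      ∀ K : ℝ, 0 ≤ K → (∀ v, |ℓ v| ≤ K * (interNorm (j v) p 2 m).toReal) →
        sumNorm w p' 2 m ≤ ENNReal.ofReal (2 * K) := by
  have : Fact (1 ≤ p) := ⟨hp1.le⟩
  let ι : V →ₗ[ℝ] interLp m p :=
    { toFun := fun v => toInterLp p (j v)
      map_add' := fun v w => by
        apply interLp.ext
        change (toInterLp p (j (v + w))).1.2 = (toInterLp p (j v)).1.2 + (toInterLp p (j w)).1.2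
        rw [toInterLp_snd (hjp _), toInterLp_snd (hjp _), toInterLp_snd (hjp _), map_add]
      map_smul' := fun c v => by rw [map_smul, toInterLp_smul c (hjp v), RingHom.id_apply] }
  have hιsnd : ∀ v, (ι v).1.2 = j v := fun v => toInterLp_snd (hjp v)
  have hιn : ∀ v, ‖ι v‖ = (interNorm (j v) p 2 m).toReal := fun v => by
    rw [← toReal_enorm, interLp.enorm_eq, hιsnd]
  let κ : V →ₗ[ℝ] Lp ℝ p m × Lp ℝ 2 m := (interLp m p).subtype ∘ₗ ι
  have hκ : Function.Injective κ := fun v w hvw => hj (by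
    have := congrArg Prod.snd hvw
    rwa [show (κ v).2 = j v from hιsnd v, show (κ w).2 = j w from hιsnd w] at this)
  let e := LinearEquiv.ofInjective κ hκ
  let φ : LinearMap.range κ →ₗ[ℝ] ℝ := ℓ ∘ₗ e.symm.toLinearMap
  have hφ : ∀ K : ℝ, (∀ v, |ℓ v| ≤ K * (interNorm (j v) p 2 m).toReal) → ∀ z, ‖φ z‖ ≤ K * ‖z‖ := by
    intro K h z
    obtain ⟨v, rfl⟩ := e.surjective z
    have : φ (e v) = ℓ v := by
      change ℓ (e.symm (e v)) = ℓ v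
      rw [e.symm_apply_apply]
    rw [this, Real.norm_eq_abs]
    refine (h v).trans (le_of_eq ?_)
    rw [← hιn]; rfl
  let φc : LinearMap.range κ →L[ℝ] ℝ := φ.mkContinuous K (hφ K hℓ)
  -- The extension has exactly the norm of the functional, so any admissible constant bounds it. A
  -- single representative thus serves all constants; the factor 2 comes from bounding its two
  -- summands separately.
  obtain ⟨Λ, hΛ, hn⟩ := exists_extension_norm_eq (LinearMap.range κ) φc
  obtain ⟨w₁, w₂, h1, h2, n1, n2, hw⟩ := exists_representative_of_clm (p' := p') hp1 hp Λ
  have hwe := AEEqFun.coeFn_mk (w₁ + w₂) (h1.1.add h2.1)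
  refine ⟨AEEqFun.mk (w₁ + w₂) (h1.1.add h2.1), ⟨w₁, w₂, h1, h2, hwe⟩, fun v => ?_, fun K' hK' h => ?_⟩
  · have e1 : ℓ v = Λ (e v : Lp ℝ p m × Lp ℝ 2 m) := by
      rw [hΛ]
      change ℓ v = ℓ (e.symm (e v))
      rw [e.symm_apply_apply]
    rw [e1, show ((e v : LinearMap.range κ) : Lp ℝ p m × Lp ℝ 2 m) = (ι v : Lp ℝ p m × Lp ℝ 2 m) from rfl, hw, hιsnd]
    refine integral_congr_ae ?_
    filter_upwards [hwe] with x hx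
    rw [hx]; rfl
  · have hb : ‖Λ‖ₑ ≤ ENNReal.ofReal K' := by
      rw [← ofReal_norm, hn]
      exact ENNReal.ofReal_le_ofReal (φc.opNorm_le_bound hK' (hφ K' h))
    refine (sumNorm_le h1.1 h2.1 hwe).trans ?_
    rw [two_mul, ENNReal.ofReal_add hK' hK']
    exact add_le_add (n1.trans hb) (n2.trans hb)

/-- Functions in `L^p' + L²` are close to functions in `L²` as functionals on `L^p ∩ L²`. -/
theorem exists_pairing_approx {p p' : ℝ≥0∞} [p.HolderConjugate p'] (hp1 : 1 < p)
    {w₁ w₂ : X → ℝ} (h1 : MemLp w₁ p' m) (h2 : MemLp w₂ 2 m) {ε : ℝ} (hε : 0 < ε) :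
    ∃ ψ : Lp ℝ 2 m, ∀ (g : Lp ℝ 2 m) (β : ℝ), InterBound g p β →
      |∫ x, g x * (w₁ x + w₂ x) ∂m - inner ℝ g ψ| ≤ ε * β := by
  have hp' : p' ≠ ⊤ := ((ENNReal.HolderConjugate.lt_top_iff_one_lt p' p).2 hp1).ne
  have hp'0 : p' ≠ 0 := (ENNReal.HolderConjugate.pos p' p).ne'
  -- Only the L^{p'} summand must be approximated. As p' is finite and nonzero, an approximating
  -- simple function in L^{p'} also lies in L².
  obtain ⟨φ, hφ, hφm⟩ := h1.exists_simpleFunc_eLpNorm_sub_lt hp' (ε := ENNReal.ofReal ε) (by simpa using hε)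
  have hφ2 : MemLp φ 2 m := by
    rw [SimpleFunc.memLp_iff (by simp) (by simp)]
    exact (SimpleFunc.memLp_iff hp'0 hp').1 hφm
  have hsum : MemLp (fun x => φ x + w₂ x) 2 m := hφ2.add h2
  refine ⟨hsum.toLp _, fun g β hg => ?_⟩
  have i1 : Integrable (fun x => g x * w₁ x) m := integrable_mul_of_conj (p := p) (p' := p') hg.memLp h1
  have i2 : Integrable (fun x => g x * w₂ x) m := integrable_mul_of_conj (p := 2) (p' := 2) (Lp.memLp g) h2
  have i3 : Integrable (fun x => g x * φ x) m := integrable_mul_of_conj (p := 2) (p' := 2) (Lp.memLp g) hφ2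
  have e : ∫ x, g x * (w₁ x + w₂ x) ∂m - inner ℝ g (hsum.toLp _) = ∫ x, g x * (w₁ x - φ x) ∂m := by
    have i4 : Integrable (fun x => g x * (w₁ x + w₂ x)) m := by
      simp only [mul_add]; exact i1.add i2
    have i5 : Integrable (fun x => g x * (φ x + w₂ x)) m := by
      simp only [mul_add]; exact i3.add i2
    have e1 : inner ℝ g (hsum.toLp _) = ∫ x, g x * (φ x + w₂ x) ∂m := by
      rw [← integral_mul_eq_inner]
      refine integral_congr_ae ?_
      filter_upwards [hsum.coeFn_toLp] with x hx
      rw [hx]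
    rw [e1, ← integral_sub i4 i5]
    congr 1
    ext x; ring
  rw [e]
  refine abs_le_of_enorm_le (mul_nonneg hε.le hg.nonneg) ?_
  refine (enorm_integral_mul_le (p := p) (p' := p') hg.memLp.1 (h1.1.sub hφm.1)).trans ?_
  rw [mul_comm, ENNReal.ofReal_mul hε.le]
  exact mul_le_mul' hφ.le hg.le

theorem interNorm_lt_top {f : Lp ℝ 2 m} {p : ℝ≥0∞} (hf : MemLp f p m) : interNorm f p 2 m < ⊤ :=
  max_lt hf.2 (Lp.memLp f).2

theorem interBound_toReal {f : Lp ℝ 2 m} {p : ℝ≥0∞} (hf : MemLp f p m) :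
    InterBound f p (interNorm f p 2 m).toReal := by
  refine ⟨ENNReal.toReal_nonneg, ?_, ?_⟩ <;> rw [ENNReal.ofReal_toReal (interNorm_lt_top hf).ne]
  exacts [le_max_left _ _, le_max_right _ _]

theorem tendsto_interNorm_P_sub (H : HeatSemigroup E) {p : ℝ≥0∞} (hp1 : 1 < p) (hp : p ≠ ⊤) {f : Lp ℝ 2 m}
    (hf : MemLp f p m) : Tendsto (fun t => (interNorm (H.P t f - f : Lp ℝ 2 m) p 2 m).toReal) (𝓝[>] 0) (𝓝 0) := by
  have := (H.tendsto_eLpNorm_P_sub hp1 hp hf).max (H.tendsto_eLpNorm_P_sub (p := 2) (by simp) (by simp) (Lp.memLp f))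
  rw [max_self] at this
  exact (ENNReal.tendsto_toReal ENNReal.zero_ne_top).comp this

end

/-! ### Linearity of the commutator and its convergence for regularized functions. -/

section

variable {X : Type*} [MeasurableSpace X] {m : Measure X} {E : DirichletForm m}
  {G : CarreDuChamp E} {A : TestAlgebra G}

namespace TestDerivation

/-- The infimum defining `‖D^sym b‖_{r,s}` is attained. -/
theorem deformationNorm_mem {b : TestDerivation A} {D : X →ₘ[m] ℝ} {r s : ℝ≥0∞} (h : b.HasDeformation D r s) :
    b.deformationNorm D r s ∈ b.deformationBounds D r s := by
  have h0 : 0 ≤ b.deformationNorm D r s := Real.sInf_nonneg fun c hc => hc.1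
  refine ⟨h0, fun f g Lf Lg hf hLf hLfs hg hLg hLgr => ?_⟩
  have hall : ∀ c ∈ b.deformationBounds D r s, |b.symDeformation D r s f g Lf Lg|
      ≤ c * (eLpNorm (G.sqrtΓ f) r m).toReal * (eLpNorm (G.sqrtΓ g) s m).toReal :=
    fun c hc => hc.2 f g Lf Lg hf hLf hLfs hg hLg hLgr
  simp only [mul_assoc] at hall ⊢
  set y := (eLpNorm (G.sqrtΓ f) r m).toReal * (eLpNorm (G.sqrtΓ g) s m).toReal with hy
  rcases (show 0 ≤ y by positivity).eq_or_lt with h1 | h1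
  · obtain ⟨c, hc⟩ := h
    have := hall c hc
    rw [← h1, mul_zero] at this ⊢
    exact this
  · rw [← div_le_iff₀ h1]
    exact le_csInf h fun c hc => (div_le_iff₀ h1).2 (hall c hc)

namespace Regular

variable {b : TestDerivation A} {D : X →ₘ[m] ℝ} {r s q : ℝ≥0∞} {k₁ k₂ D₁ D₂ : X → ℝ} [SigmaFinite m]
  {H : HeatSemigroup E} {α t : ℝ} {u v f : Lp ℝ 2 m} {c cr cs dr ds a β δ₁ δ₂ : ℝ}

theorem commutator_eq_sub (h : b.Regular D r s q k₁ k₂ D₁ D₂) (hα0 : 0 < α) (u : Lp ℝ 2 m) (f : A.carrier) :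
    b.commutator H r s α u f = ∫ x, u x * b.ext s r.conjExponent (H.flow α (f : E.dom)) x ∂m
      - ∫ x, H.P α u x * b.ext s r.conjExponent (f : E.dom) x ∂m := by
  have e : ∫ x, H.P α u x * b.ext s r.conjExponent (f : E.dom) x ∂m = ∫ x, H.P α u x * b.d f x ∂m := by
    refine integral_congr_ae ?_
    filter_upwards [h.ext_coe H f] with x hx
    rw [hx]
  rw [e, commutator, divMul, semigroupDivMul, dif_pos (H.mem_dom _ hα0), divMulExt,
    H.flow_eq hα0 ((f : E.dom) : Lp ℝ 2 m)]
  ring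

theorem integral_sub_mul_ext (h : b.Regular D r s q k₁ k₂ D₁ D₂) (H : HeatSemigroup E) (hu : MemLp u r m) (hv : MemLp v r m) {g : E.dom}
    (hg : G.MemVp s g) : ∫ x, (u - v : Lp ℝ 2 m) x * b.ext s r.conjExponent g x ∂m
      = ∫ x, u x * b.ext s r.conjExponent g x ∂m - ∫ x, v x * b.ext s r.conjExponent g x ∂m := by
  rw [← integral_sub (h.integrable_mul_ext H hu (Lp.memLp u) hg) (h.integrable_mul_ext H hv (Lp.memLp v) hg)]
  refine integral_congr_ae ?_
  filter_upwards [Lp.coeFn_sub u v] with x hx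
  rw [hx, Pi.sub_apply, sub_mul]

theorem integral_mul_ext_add_smul (h : b.Regular D r s q k₁ k₂ D₁ D₂) (H : HeatSemigroup E) (hu : MemLp u r m) {g g' : E.dom}
    (hg : G.MemVp s g) (hg' : G.MemVp s g') (c : ℝ) : ∫ x, u x * b.ext s r.conjExponent (g + c • g') x ∂m
      = ∫ x, u x * b.ext s r.conjExponent g x ∂m + c * ∫ x, u x * b.ext s r.conjExponent g' x ∂m := by
  rw [← integral_const_mul, ← integral_add (h.integrable_mul_ext H hu (Lp.memLp u) hg)
    ((h.integrable_mul_ext H hu (Lp.memLp u) hg').const_mul c)]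
  refine integral_congr_ae ?_
  filter_upwards [h.ext_add_smul H hg hg' c] with x hx
  rw [hx]; ring

theorem commutator_sub (h : b.Regular D r s q k₁ k₂ D₁ D₂) (hΓs : GammaInequality G H s cs) (hu : MemLp u r m)
    (hv : MemLp v r m) (hα0 : 0 < α) (hα : α < 1) (f : A.carrier) :
    b.commutator H r s α (u - v) f = b.commutator H r s α u f - b.commutator H r s α v f := by
  have mf := H.memVp_flow hΓs h.one_lt_right h.right_ne_top hα0 hα (h.dense_right.1 f f.2).1
  rw [h.commutator_eq_sub hα0, h.commutator_eq_sub hα0, h.commutator_eq_sub hα0, map_sub,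
    h.integral_sub_mul_ext H hu hv mf, h.integral_sub_mul_ext H (H.memLp_P h.one_lt_left h.left_ne_top hα0 hu)
      (H.memLp_P h.one_lt_left h.left_ne_top hα0 hv) (h.dense_right.1 f f.2)]
  ring

theorem commutator_add_smul (h : b.Regular D r s q k₁ k₂ D₁ D₂) (hΓs : GammaInequality G H s cs) (hu : MemLp u r m)
    (hα0 : 0 < α) (hα : α < 1) (f g : A.carrier) (c : ℝ) :
    b.commutator H r s α u (f + c • g) = b.commutator H r s α u f + c * b.commutator H r s α u g := by
  have mf := h.dense_right.1 f f.2
  have mg := h.dense_right.1 g g.2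
  have mPf := H.memVp_flow hΓs h.one_lt_right h.right_ne_top hα0 hα mf.1
  have mPg := H.memVp_flow hΓs h.one_lt_right h.right_ne_top hα0 hα mg.1
  have e1 : ((f + c • g : A.carrier) : E.dom) = (f : E.dom) + c • (g : E.dom) := rfl
  have e2 : (((f : E.dom) + c • (g : E.dom) : E.dom) : Lp ℝ 2 m)
      = ((f : E.dom) : Lp ℝ 2 m) + c • ((g : E.dom) : Lp ℝ 2 m) := rfl
  rw [h.commutator_eq_sub hα0, h.commutator_eq_sub hα0, h.commutator_eq_sub hα0, e1, e2, H.flow_add_smul hα0,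
    h.integral_mul_ext_add_smul H hu mPf mPg,
    h.integral_mul_ext_add_smul H (H.memLp_P h.one_lt_left h.left_ne_top hα0 hu) mf mg]
  ring

/-- The commutator as a linear functional on test functions. -/
theorem exists_commutator_linearMap (h : b.Regular D r s q k₁ k₂ D₁ D₂) (hΓs : GammaInequality G H s cs)
    (hu : MemLp u r m) (hα0 : 0 < α) (hα : α < 1) :
    ∃ ℓ : A.carrier →ₗ[ℝ] ℝ, ∀ f, ℓ f = b.commutator H r s α u f :=
  ⟨{  toFun := b.commutator H r s α u
      map_add' := fun f g => by simpa using h.commutator_add_smul hΓs hu hα0 hα f g 1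
      map_smul' := fun c f => by
        have h0 := h.commutator_add_smul hΓs hu hα0 hα 0 0 1
        have h1 := h.commutator_add_smul hΓs hu hα0 hα 0 f c
        simp only [add_zero, smul_zero, zero_add, one_mul, smul_eq_mul, RingHom.id_apply] at h0 h1 ⊢
        rw [h1]; linarith }, fun _ => rfl⟩

/-- The functional `g ↦ ∫ g dv(b) + g v div b dm` is close to an `L²` functional. -/
theorem exists_pairing_approx (h : b.Regular D r s q k₁ k₂ D₁ D₂) (H : HeatSemigroup E) {v : E.dom}
    (hv : G.MemVp r v) {ε : ℝ} (hε : 0 < ε) :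
    ∃ ψ : Lp ℝ 2 m, ∀ (g : Lp ℝ 2 m) (β : ℝ), InterBound g s β →
      |∫ x, g x * b.ext r s.conjExponent v x ∂m + ∫ x, D x * ((v : Lp ℝ 2 m) x * g x) ∂m - inner ℝ g ψ| ≤ ε * β := by
  have ht := h.symm.holderTriple
  have hc : s.HolderConjugate s.conjExponent := ENNReal.HolderConjugate.conjExponent h.one_lt_right.le
  have hk := h.control
  obtain ⟨e₁, e₂, m1, m2, e, b1, b2⟩ := exists_decomposition_eLpNorm_le (q := q) (p := r) (t := s.conjExponent)
    (AEEqFun.aestronglyMeasurable (b.ext r s.conjExponent v)) hk.memLp₁.1 hk.memLp₂.1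
    (G.aestronglyMeasurable_sqrtΓ v) hk.nonneg₁ hk.nonneg₂ (G.sqrtΓ_nonneg v) (h.symm.abs_ext_le H hv)
  have l1 : MemLp e₁ s.conjExponent m := ⟨m1, b1.trans_lt (ENNReal.mul_lt_top hk.memLp₁.2 hv.2.2)⟩
  have l2 : MemLp e₂ 2 m := ⟨m2, b2.trans_lt (ENNReal.mul_lt_top hk.memLp₂.2 (G.memLp_sqrtΓ_two v).2)⟩
  have l3 : MemLp (fun x => D₁ x * (v : Lp ℝ 2 m) x) s.conjExponent m := MemLp.mul' hv.1 h.memLp₁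
  have l4 : MemLp (fun x => D₂ x * (v : Lp ℝ 2 m) x) 2 m := MemLp.mul' (Lp.memLp _) h.memLp₂
  obtain ⟨ψ, hψ⟩ := DirichletCalculus.exists_pairing_approx (p := s) h.one_lt_right (l1.add l3) (l2.add l4) hε
  refine ⟨ψ, fun g β hg => ?_⟩
  refine le_trans (le_of_eq ?_) (hψ g β hg)
  congr 2
  rw [← integral_add (h.symm.integrable_mul_ext H hg.memLp (Lp.memLp g) hv)
    (h.integrable_div_mul hv.1 (Lp.memLp _) hg.memLp (Lp.memLp g))]
  refine integral_congr_ae ?_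
  filter_upwards [h.decomposition] with x hx
  rw [hx, e]
  simp only [Pi.add_apply]
  ring

/-- Convergence of the commutator for regularized functions. -/
theorem eventually_abs_commutator_P_le (h : b.Regular D r s q k₁ k₂ D₁ D₂) (hΓr : GammaInequality G H r cr)
    (hΓs : GammaInequality G H s cs) (hu : MemLp u r m) {δ : ℝ} (hδ : 0 < δ) (hδ1 : δ < 1) {ε : ℝ} (hε : 0 < ε) :
    ∀ᶠ α in 𝓝[>] (0 : ℝ), ∀ (f : A.carrier) (β : ℝ), InterBound ((f : E.dom) : Lp ℝ 2 m) s β →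
      |b.commutator H r s α (H.P δ u) f| ≤ ε * β := by
  have hcr := hΓr.1
  have mV := H.memVp_flow hΓr h.one_lt_left h.left_ne_top hδ hδ1 hu
  have hPu := H.memLp_P h.one_lt_left h.left_ne_top hδ hu
  obtain ⟨ψ, hψ⟩ := h.exists_pairing_approx H mV (show 0 < ε / 4 by positivity)
  rw [H.coe_flow hδ] at hψ
  set κ₁ := (eLpNorm k₁ q m).toReal with hκ₁
  set κ₂ := (eLpNorm k₂ ⊤ m).toReal with hκ₂
  set δ₁ := (eLpNorm D₁ q m).toReal with hδ₁
  set δ₂ := (eLpNorm D₂ ⊤ m).toReal with hδ₂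
  have fk1 : eLpNorm k₁ q m ≤ ENNReal.ofReal κ₁ := (ENNReal.ofReal_toReal h.control.memLp₁.2.ne).ge
  have fk2 : eLpNorm k₂ ⊤ m ≤ ENNReal.ofReal κ₂ := (ENNReal.ofReal_toReal h.control.memLp₂.2.ne).ge
  have fd1 : eLpNorm D₁ q m ≤ ENNReal.ofReal δ₁ := (ENNReal.ofReal_toReal h.memLp₁.2.ne).ge
  have fd2 : eLpNorm D₂ ⊤ m ≤ ENNReal.ofReal δ₂ := (ENNReal.ofReal_toReal h.memLp₂.2.ne).ge
  set n : ℝ → ℝ := fun α => (interNorm (H.P α u - u : Lp ℝ 2 m) r 2 m).toReal with hn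
  have ln : Tendsto n (𝓝[>] 0) (𝓝 0) := tendsto_interNorm_P_sub H h.one_lt_left h.left_ne_top hu
  have lψ : Tendsto (fun α => ‖ψ - H.P α ψ‖) (𝓝[>] 0) (𝓝 0) := by
    simpa only [norm_sub_rev] using tendsto_iff_norm_sub_tendsto_zero.1 (H.tendsto_zero ψ)
  have lim := (ln.const_mul (κ₁ * (cr / √δ) + κ₂ * (1 / √δ) + (δ₁ + δ₂))).add lψ
  rw [mul_zero, add_zero] at lim
  filter_upwards [lim.eventually_lt_const (show 0 < ε / 2 by positivity), Ioo_mem_nhdsGT zero_lt_one] with α hα hα01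
  intro f β hf
  obtain ⟨hα0, hα1⟩ := hα01
  have hβ := hf.nonneg
  have mα := H.memVp_flow hΓr h.one_lt_left h.left_ne_top hα0 hα1 hPu
  have mf := H.memVp_flow hΓs h.one_lt_right h.right_ne_top hα0 hα1 hf.memLp
  have hd : MemLp (H.P α u - u : Lp ℝ 2 m) r m := memLp_sub (H.memLp_P h.one_lt_left h.left_ne_top hα0 hu) hu
  have hnb : InterBound (H.P α u - u) r (n α) := interBound_toReal hd
  have hn0 : 0 ≤ n α := hnb.nonneg
  have hPd := hnb.P (H := H) h.one_lt_left h.left_ne_top hδ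
  set f' : Lp ℝ 2 m := ((f : E.dom) : Lp ℝ 2 m) with hf'
  -- With v = P_δ u, the term ∫ v d(P_α f)(b) becomes minus the functional ∫ g dv(b) + ∫ g v div b
  -- at g = P_α f. The other terms of the commutator are close to the same functional at g = f.
  have key := h.leibnizDefect_eq_zero H mV mf
  rw [leibnizDefect, H.coe_flow hδ, H.coe_flow hα0] at key
  rw [h.commutator_eq hΓr hPu hα0 hα1]
  -- Since P_α v - v = P_δ(P_α u - u), the Γ inequality is used at the fixed time δ and the error is
  -- controlled by the norm of P_α u - u in L^r ∩ L².
  have t1 : |∫ x, f' x * b.ext r s.conjExponent (H.flow α (H.P δ u)) x ∂m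
      - ∫ x, f' x * b.ext r s.conjExponent (H.flow δ u) x ∂m|
      ≤ κ₁ * β * (cr / √δ * n α) + κ₂ * β * (1 / √δ * n α) := by
    have e : H.flow α (H.P δ u) = H.flow δ u + (1 : ℝ) • H.flow δ (H.P α u - u) := by
      rw [one_smul, H.flow_sub hδ, H.flow_P hα0 hδ, H.flow_P hδ hα0, add_comm α δ]; abel
    have md := H.memVp_flow hΓr h.one_lt_left h.left_ne_top hδ hδ1 hd
    rw [e, h.symm.integral_mul_ext_add_smul H hf.memLp mV md, one_mul, add_sub_cancel_left]
    refine abs_le_of_enorm_le (by positivity) ((h.symm.enorm_integral_mul_ext_le H hf.memLp.1 md).trans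
      (holderBound_le_ofReal (by positivity) (by positivity) hβ hβ (by positivity) (by positivity) fk1 fk2
        hf.le hf.le_two (hnb.sqrtΓ_le hΓr hδ hδ1) (hnb.sqrtΓ_two_le A hδ)))
  have t2 : |∫ x, D x * (H.P α (H.P δ u) x * f' x) ∂m - ∫ x, D x * (H.P δ u x * f' x) ∂m|
      ≤ δ₁ * n α * β + δ₂ * n α * β := by
    have e : ∫ x, D x * (H.P α (H.P δ u) x * f' x) ∂m - ∫ x, D x * (H.P δ u x * f' x) ∂m
        = ∫ x, D x * (H.P δ (H.P α u - u) x * f' x) ∂m := by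
      rw [← integral_sub (h.integrable_div_mul (H.memLp_P h.one_lt_left h.left_ne_top hα0 hPu) (Lp.memLp _)
        hf.memLp (Lp.memLp _)) (h.integrable_div_mul hPu (Lp.memLp _) hf.memLp (Lp.memLp _))]
      refine integral_congr_ae ?_
      rw [map_sub, H.P_comm u hδ hα0]
      filter_upwards [Lp.coeFn_sub (H.P α (H.P δ u)) (H.P δ u)] with x hx
      rw [hx, Pi.sub_apply]; ring
    rw [e]
    exact abs_le_of_enorm_le (by positivity) ((h.enorm_integral_div_mul_le (Lp.aestronglyMeasurable _)
      (Lp.aestronglyMeasurable _)).trans (holderBound_le_ofReal (by positivity) (by positivity) hn0 hn0 hβ hβ fd1 fd2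
        hPd.le hPd.le_two hf.le hf.le_two))
  have p1 := hψ f' β hf
  have p2 := hψ (H.P α f') β (hf.P h.one_lt_right h.right_ne_top hα0)
  -- Symmetry moves 1 - P_α from `f`, over which the estimate must be uniform, to the fixed function
  -- ψ.
  have p3 : |inner ℝ f' ψ - inner ℝ (H.P α f') ψ| ≤ β * ‖ψ - H.P α ψ‖ := by
    rw [H.P_symm f' ψ hα0, ← inner_sub_right]
    refine (abs_real_inner_le_norm _ _).trans ?_
    have := hf.le_two
    rw [← Lp.enorm_def, ← ofReal_norm, ENNReal.ofReal_le_ofReal_iff hβ] at this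
    gcongr
  have fin := mul_le_mul_of_nonneg_right hα.le hβ
  have total : |∫ x, H.P δ u x * b.ext s r.conjExponent (H.flow α f') x ∂m
      + ∫ x, f' x * b.ext r s.conjExponent (H.flow α (H.P δ u)) x ∂m
      + ∫ x, D x * (H.P α (H.P δ u) x * f' x) ∂m|
      ≤ (κ₁ * β * (cr / √δ * n α) + κ₂ * β * (1 / √δ * n α)) + (δ₁ * n α * β + δ₂ * n α * β)
        + ε / 4 * β + ε / 4 * β + β * ‖ψ - H.P α ψ‖ := by
    rw [abs_le] at *
    constructor <;> linarith
  refine total.trans ?_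
  nlinarith

end Regular

end TestDerivation

end

/-! ### Choice of representatives, the final constant, and convergence. -/

section

variable {X : Type*} [MeasurableSpace X] {m : Measure X} {E : DirichletForm m}
  {G : CarreDuChamp E} {A : TestAlgebra G}

theorem sumNorm_lt_top {f : X → ℝ} {p q : ℝ≥0∞} (hf : MemSum f p q m) : sumNorm f p q m < ⊤ := by
  obtain ⟨g, h, hg, hh, e⟩ := hf
  exact (sumNorm_le hg.1 hh.1 e).trans_lt (ENNReal.add_lt_top.2 ⟨hg.2, hh.2⟩)

/-- Almost optimal decompositions. -/
theorem MemSum.exists_decomposition {f : X → ℝ} {p q : ℝ≥0∞} (hf : MemSum f p q m) {ε : ℝ≥0∞} (hε : ε ≠ 0) :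
    ∃ g h : X → ℝ, MemLp g p m ∧ MemLp h q m ∧ f =ᵐ[m] g + h ∧
      eLpNorm g p m + eLpNorm h q m ≤ sumNorm f p q m + ε := by
  by_cases hε' : ε = ⊤
  · obtain ⟨g, h, hg, hh, e⟩ := hf
    exact ⟨g, h, hg, hh, e, by simp [hε']⟩
  have hlt : sumNorm f p q m < sumNorm f p q m + ε := ENNReal.lt_add_right (sumNorm_lt_top hf).ne hε
  have hfin := ENNReal.add_lt_top.2 ⟨sumNorm_lt_top hf, lt_top_iff_ne_top.2 hε'⟩
  conv_lhs at hlt => rw [sumNorm]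
  simp only [iInf_lt_iff] at hlt
  obtain ⟨g, h, hg, hh, e, hlt⟩ := hlt
  have := ENNReal.add_lt_top.1 (hlt.trans hfin)
  exact ⟨g, h, ⟨hg, this.1⟩, ⟨hh, this.2⟩, e, hlt.le⟩

namespace TestDerivation

variable {b : TestDerivation A} {D : X →ₘ[m] ℝ} {r s q : ℝ≥0∞} {k₁ k₂ D₁ D₂ : X → ℝ}
  {H : HeatSemigroup E} {α : ℝ} {u : Lp ℝ 2 m} {cr cs dr ds : ℝ}

namespace Regular

theorem commutator_constant_nonneg (hΓr : GammaInequality G H r cr)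
    (hΓs : GammaInequality G H s cs) (hΔr : DeltaInequality H r dr) (hΔs : DeltaInequality H s ds)
    (hdef : b.HasDeformation D r s) :
    0 ≤ (8 * cr * cs + dr + ds + 10) * (interNorm u r 2 m).toReal *
      (b.deformationNorm D r s + ((eLpNorm D₁ q m).toReal + (eLpNorm D₂ ⊤ m).toReal)) := by
  have h1 := hΓr.1
  have h2 := hΓs.1
  have h3 := hΔr.1
  have h4 := hΔs.1
  have h5 := (deformationNorm_mem hdef).1
  positivity

variable [SigmaFinite m]

theorem abs_commutator_le_interNorm (h : b.Regular D r s q k₁ k₂ D₁ D₂) (hΓr : GammaInequality G H r cr)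
    (hΓs : GammaInequality G H s cs) (hΔr : DeltaInequality H r dr) (hΔs : DeltaInequality H s ds)
    (hdef : b.HasDeformation D r s) (hu : MemLp u r m) (f : A.carrier) {β : ℝ}
    (hf : InterBound ((f : E.dom) : Lp ℝ 2 m) s β) (hα0 : 0 < α) (hα : α < 1) :
    |b.commutator H r s α u f| ≤ (8 * cr * cs + dr + ds + 10) * (interNorm u r 2 m).toReal *
      (b.deformationNorm D r s + ((eLpNorm D₁ q m).toReal + (eLpNorm D₂ ⊤ m).toReal)) * β :=
  h.abs_commutator_le hΓr hΓs hΔr hΔs (deformationNorm_mem hdef) ENNReal.toReal_nonneg ENNReal.toReal_nonneg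
    (ENNReal.ofReal_toReal h.memLp₁.2.ne).ge (ENNReal.ofReal_toReal h.memLp₂.2.ne).ge (interBound_toReal hu) f hf hα0 hα

/-- The commutator is induced by a function of `L^{s'} + L²`, whose norm is controlled by every bound of the
functional. -/
theorem exists_commutator_representative (h : b.Regular D r s q k₁ k₂ D₁ D₂) (hΓr : GammaInequality G H r cr)
    (hΓs : GammaInequality G H s cs) (hΔr : DeltaInequality H r dr) (hΔs : DeltaInequality H s ds)
    (hdef : b.HasDeformation D r s) (hu : MemLp u r m) (hα0 : 0 < α) (hα : α < 1) :
    ∃ w : X →ₘ[m] ℝ, MemSum w s.conjExponent 2 m ∧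
      (∀ f : A.carrier, b.commutator H r s α u f = ∫ x, w x * ((f : E.dom) : Lp ℝ 2 m) x ∂m) ∧
      ∀ K : ℝ, 0 ≤ K →
        (∀ (f : A.carrier) (β : ℝ), InterBound ((f : E.dom) : Lp ℝ 2 m) s β → |b.commutator H r s α u f| ≤ K * β) →
        sumNorm w s.conjExponent 2 m ≤ ENNReal.ofReal (2 * K) := by
  obtain ⟨ℓ, hℓ⟩ := h.exists_commutator_linearMap hΓs hu hα0 hα
  have := ENNReal.HolderConjugate.conjExponent h.one_lt_right.le
  have hm : ∀ f : A.carrier, MemLp ((f : E.dom) : Lp ℝ 2 m) s m := fun f => (h.dense_right.1 f f.2).1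
  obtain ⟨w, hw, he, hb⟩ := exists_representative (p' := s.conjExponent) h.one_lt_right h.right_ne_top
    (E.dom.subtype ∘ₗ A.carrier.subtype) (Subtype.val_injective.comp Subtype.val_injective) hm ℓ
    (fun f => by
      rw [hℓ]
      exact h.abs_commutator_le_interNorm hΓr hΓs hΔr hΔs hdef hu f (interBound_toReal (hm f)) hα0 hα)
  exact ⟨w, hw, fun f => (hℓ f).symm.trans (he f), fun K hK hbd => hb K hK fun f => by
    rw [hℓ]; exact hbd f _ (interBound_toReal (hm f))⟩

/-- The commutator is linear in `u` and its bound is uniform in α. So δ is chosen first, making the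
contribution of P_δ u - u small for all α, and only then is α sent to 0 for P_δ u. -/
theorem eventually_abs_commutator_le (h : b.Regular D r s q k₁ k₂ D₁ D₂) (hΓr : GammaInequality G H r cr)
    (hΓs : GammaInequality G H s cs) (hΔr : DeltaInequality H r dr) (hΔs : DeltaInequality H s ds)
    (hdef : b.HasDeformation D r s) (hu : MemLp u r m) {ε : ℝ} (hε : 0 < ε) :
    ∀ᶠ α in 𝓝[>] (0 : ℝ), ∀ (f : A.carrier) (β : ℝ), InterBound ((f : E.dom) : Lp ℝ 2 m) s β →
      |b.commutator H r s α u f| ≤ ε * β := by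
  have hlim := ((tendsto_interNorm_P_sub H h.one_lt_left h.left_ne_top hu).const_mul
    (8 * cr * cs + dr + ds + 10)).mul_const
    (b.deformationNorm D r s + ((eLpNorm D₁ q m).toReal + (eLpNorm D₂ ⊤ m).toReal))
  rw [mul_zero, zero_mul] at hlim
  obtain ⟨δ, hδb, hδ0, hδ1⟩ := ((hlim.eventually_lt_const (half_pos hε)).and
    (Ioo_mem_nhdsGT (zero_lt_one' ℝ))).exists
  have hP := H.memLp_P h.one_lt_left h.left_ne_top hδ0 hu
  filter_upwards [h.eventually_abs_commutator_P_le hΓr hΓs hu hδ0 hδ1 (half_pos hε),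
    Ioo_mem_nhdsGT (zero_lt_one' ℝ)] with α h1 hα f β hf
  have h2 := h.commutator_sub hΓs hP hu hα.1 hα.2 f
  have h3 := h.abs_commutator_le_interNorm hΓr hΓs hΔr hΔs hdef (memLp_sub hP hu) f hf hα.1 hα.2
  have h4 := h1 f β hf
  have h5 := mul_le_mul_of_nonneg_right hδb.le hf.nonneg
  rw [h2] at h3
  rw [abs_le] at h3 h4 ⊢
  constructor <;> linarith [h3.1, h3.2, h4.1, h4.2]

end Regular

variable [SigmaFinite m]

/-- The commutator estimate and the convergence of the commutators. -/
theorem exists_commutator_family (hr1 : 1 < r) (hr : r < ⊤) (hs1 : 1 < s) (hs : s < ⊤)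
    (hqrs : q⁻¹ + r⁻¹ + s⁻¹ = 1) (hAr : G.DenseInVp r A.carrier) (hAs : G.DenseInVp s A.carrier)
    (hΓr : ∃ c, GammaInequality G H r c) (hΓs : ∃ c, GammaInequality G H s c)
    (hb : b.InSum q ⊤) (hdiv : b.HasDivergence D) (hD : MemSum D q ⊤ m) (hdef : b.HasDeformation D r s)
    (hu : MemLp u r m) :
    ∃ w : ℝ → (X →ₘ[m] ℝ),
      (∀ α ∈ Ioo (0 : ℝ) 1, MemSum (w α) s.conjExponent 2 m ∧
        ∀ f : A.carrier, b.commutator H r s α u f = ∫ x, w α x * ((f : E.dom) : Lp ℝ 2 m) x ∂m) ∧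
      (∀ cr cs dr ds : ℝ, GammaInequality G H r cr → GammaInequality G H s cs →
        DeltaInequality H r dr → DeltaInequality H s ds → ∀ α ∈ Ioo (0 : ℝ) 1,
          sumNorm (w α) s.conjExponent 2 m
            ≤ ENNReal.ofReal (2 * (8 * cr * cs + dr + ds + 10)) * interNorm u r 2 m
              * (ENNReal.ofReal (b.deformationNorm D r s) + sumNorm D q ⊤ m)) ∧
      Tendsto (fun α => sumNorm (w α) s.conjExponent 2 m) (𝓝[>] 0) (𝓝 0) := by
  classical
  obtain ⟨k₁, k₂, hk⟩ := hb.exists_control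
  have hreg : ∀ D₁ D₂, MemLp D₁ q m → MemLp D₂ ⊤ m → D =ᵐ[m] D₁ + D₂ → b.Regular D r s q k₁ k₂ D₁ D₂ :=
    fun D₁ D₂ h1 h2 e => ⟨hr1, hr.ne, hs1, hs.ne, hqrs, hAr, hAs, hk, hdiv, h1, h2, e⟩
  obtain ⟨D₁, D₂, hD₁, hD₂, eD⟩ := id hD
  have h := hreg D₁ D₂ hD₁ hD₂ eD
  obtain ⟨cr₀, hcr₀⟩ := hΓr
  obtain ⟨cs₀, hcs₀⟩ := hΓs
  obtain ⟨dr₀, hdr₀⟩ := H.exists_deltaInequality hr1 hr.ne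
  obtain ⟨ds₀, hds₀⟩ := H.exists_deltaInequality hs1 hs.ne
  -- The representatives are fixed before any constants or any other decomposition of the divergence
  -- are considered; their norm bound is available for every constant that bounds the functional.
  choose w hw hwe hwb using fun α : Ioo (0 : ℝ) 1 =>
    h.exists_commutator_representative hcr₀ hcs₀ hdr₀ hds₀ hdef hu α.2.1 α.2.2
  refine ⟨fun α => if hα : α ∈ Ioo (0 : ℝ) 1 then w ⟨α, hα⟩ else 0, ?_, ?_, ?_⟩
  · intro α hα
    simp only [dif_pos hα]
    exact ⟨hw _, hwe ⟨α, hα⟩⟩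
  · intro cr cs dr ds hcr hcs hdr hds α hα
    simp only [dif_pos hα]
    have hdn := (deformationNorm_mem hdef).1
    have hB : ENNReal.ofReal (2 * (8 * cr * cs + dr + ds + 10)) * interNorm u r 2 m ≠ ⊤ :=
      ENNReal.mul_ne_top ENNReal.ofReal_ne_top (interNorm_lt_top hu).ne
    -- The estimate involves a particular decomposition of the divergence. Applying it to
    -- decompositions within ε of the infimum and letting ε ↓ 0 produces the sum norm.
    refine ge_of_tendsto (f := fun ε : ℝ≥0∞ => ENNReal.ofReal (2 * (8 * cr * cs + dr + ds + 10)) * interNorm u r 2 m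
      * (ENNReal.ofReal (b.deformationNorm D r s) + (sumNorm D q ⊤ m + ε))) (x := 𝓝[>] 0) ?_ ?_
    · refine (ENNReal.Tendsto.const_mul ?_ (Or.inr hB)).mono_left nhdsWithin_le_nhds
      have : Tendsto (fun ε : ℝ≥0∞ => ENNReal.ofReal (b.deformationNorm D r s) + (sumNorm D q ⊤ m + ε)) (𝓝 0)
          (𝓝 (ENNReal.ofReal (b.deformationNorm D r s) + (sumNorm D q ⊤ m + 0))) := by
        refine Continuous.tendsto ?_ _
        fun_prop
      simpa using this
    · filter_upwards [self_mem_nhdsWithin] with ε hε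
      obtain ⟨F₁, F₂, hF₁, hF₂, eF, hle⟩ := hD.exists_decomposition (ne_of_gt hε)
      have h' := hreg F₁ F₂ hF₁ hF₂ eF
      refine (hwb ⟨α, hα⟩ _ (Regular.commutator_constant_nonneg (D₁ := F₁) (D₂ := F₂) (q := q) hcr hcs hdr hds hdef)
        fun f β hf => h'.abs_commutator_le_interNorm hcr hcs hdr hds hdef hu f hf hα.1 hα.2).trans ?_
      have e1 : 0 < 8 * cr * cs + dr + ds + 10 := by
        have h1 := hcr.1
        have h2 := hcs.1
        have h3 := hdr.1
        have h4 := hds.1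
        positivity
      rw [← mul_assoc, ← mul_assoc, ENNReal.ofReal_mul (by positivity), ENNReal.ofReal_mul (by positivity),
        ENNReal.ofReal_toReal (interNorm_lt_top hu).ne, ENNReal.ofReal_add hdn (by positivity),
        ENNReal.ofReal_add (by positivity) (by positivity), ENNReal.ofReal_toReal hF₁.2.ne,
        ENNReal.ofReal_toReal hF₂.2.ne]
      gcongr
  · rw [ENNReal.tendsto_nhds_zero]
    intro ε hε
    obtain ⟨ε', hε', hle⟩ : ∃ ε' : ℝ, 0 < ε' ∧ ENNReal.ofReal (2 * ε') ≤ ε := by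
      obtain ⟨c, hc0, hc⟩ := ENNReal.lt_iff_exists_nnreal_btwn.1 hε
      refine ⟨c / 2, half_pos (by exact_mod_cast hc0), ?_⟩
      rw [mul_div_cancel₀ _ two_ne_zero, ENNReal.ofReal_coe_nnreal]
      exact hc.le
    filter_upwards [h.eventually_abs_commutator_le hcr₀ hcs₀ hdr₀ hds₀ hdef hu hε', Ioo_mem_nhdsGT (zero_lt_one' ℝ)]
      with α hα hα1
    simp only [dif_pos hα1]
    exact (hwb ⟨α, hα1⟩ ε' hε'.le hα).trans hle

end TestDerivation

end

end DirichletCalculus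

end

theorem lemma5p7 :
    ∃ C : ℝ → ℝ → ℝ → ℝ → ℝ,
      ∀ (X : Type*) [TopologicalSpace X] [PolishSpace X] [MeasurableSpace X] [BorelSpace X]
        (m : Measure X) [SigmaFinite m] [m.IsOpenPosMeasure]
        (E : DirichletCalculus.DirichletForm m) (G : DirichletCalculus.CarreDuChamp E)
        (H : DirichletCalculus.HeatSemigroup E) (A : DirichletCalculus.TestAlgebra G)
        (r s q : ℝ≥0∞) (_ : 1 < r) (_ : r < ⊤) (_ : 1 < s) (_ : s < ⊤) (_ : 1 < q)
        (_ : q⁻¹ + r⁻¹ + s⁻¹ = 1)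
        (_ : G.DenseInVp r A.carrier) (_ : G.DenseInVp s A.carrier)
        (_ : ∃ c, DirichletCalculus.GammaInequality G H r c)
        (_ : ∃ c, DirichletCalculus.GammaInequality G H s c)
        (b : DirichletCalculus.TestDerivation A) (_ : b.InSum q ⊤)
        (D : X →ₘ[m] ℝ) (_ : b.HasDivergence D) (_ : DirichletCalculus.MemSum D q ⊤ m)
        (_ : b.HasDeformation D r s),
        (∃ c, DirichletCalculus.DeltaInequality H r c) ∧
        (∃ c, DirichletCalculus.DeltaInequality H s c) ∧
        ∀ u : Lp ℝ 2 m, MemLp u r m →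
          ∃ w : ℝ → (X →ₘ[m] ℝ),
            (∀ α ∈ Ioo (0 : ℝ) 1,
              DirichletCalculus.MemSum (w α) s.conjExponent 2 m ∧
              ∀ f : A.carrier, b.commutator H r s α u f
                = ∫ x, w α x * ((f : E.dom) : Lp ℝ 2 m) x ∂m) ∧
            (∀ cr cs dr ds : ℝ,
              DirichletCalculus.GammaInequality G H r cr →
              DirichletCalculus.GammaInequality G H s cs →
              DirichletCalculus.DeltaInequality H r dr →
              DirichletCalculus.DeltaInequality H s ds →
              ∀ α ∈ Ioo (0 : ℝ) 1,
                DirichletCalculus.sumNorm (w α) s.conjExponent 2 m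
                  ≤ ENNReal.ofReal (C cr cs dr ds) * DirichletCalculus.interNorm u r 2 m
                    * (ENNReal.ofReal (b.deformationNorm D r s)
                        + DirichletCalculus.sumNorm D q ⊤ m)) ∧
            Tendsto (fun α => DirichletCalculus.sumNorm (w α) s.conjExponent 2 m)
              (𝓝[>] 0) (𝓝 0) := by
  -- The constant of the tested estimate, doubled by the passage to a representative in L^{s'} + L².
  refine ⟨fun cr cs dr ds => 2 * (8 * cr * cs + dr + ds + 10), ?_⟩
  intro X _ _ _ _ m _ _ E G H A r s q hr1 hr hs1 hs _ hqrs hAr hAs hΓr hΓs b hb D hdiv hD hdef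
  exact ⟨H.exists_deltaInequality hr1 hr.ne, H.exists_deltaInequality hs1 hs.ne, fun u hu =>
    b.exists_commutator_family hr1 hr hs1 hs hqrs hAr hAs hΓr hΓs hb hdiv hD hdef hu⟩
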